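/- In the (randomized, word-size $O(\log(n+W))$, unit-cost, concurrent-read concurrent-write) PRAM model, where the work of a run is the total number of operations over all processors and its depth is the number of parallel steps, exact single-source shortest paths in directed graphs with non-negative integer weights can be solved with the following guarantees. Throughout, $\tilde O(\cdot)$ suppresses factors polylogarithmic in $n$, and $\log W$ is read as $\log(W+2)$ (so that it is positive also for $W\in\{0,1\}$). For every constant $c$ there is a randomized PRAM algorithm (one program, independent of the input) that takes as input a directed graph $G=(V,E,w)$ with $n=|V|$ nodes, $m=|E|\ge n-1$ edges, and weights $w:E\to\{0,1,\dots,W\}$, a source $s\in V$, and an integer $1\le h\le n$, and that, for every outcome of its coin tosses, halts with the distance $\mathrm{dist}_G(s,v)\in\{0,1,2,\dots\}\cup\{\infty\}$ for every $v\in V$, such that - its work is $$\tilde O\!\left(\Big(\frac{n^3}{h^3}+m\,h+\frac{m\,n}{h}\Big)\log W\right)$$ with probability at least $1-n^{-c}$, and also in expectation; - its depth is always $\tilde O(h)$ if $W$ is polynomially bounded in $n$ (the hidden constant may depend on the degree of the polynomial), and always $\tilde O(h\log W)$ for arbitrary $W$. -/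

import Mathlib

open MeasureTheory

/-! ### Weighted directed graphs and distances -/

/-- A directed graph on the node set `Fin n` with exactly `m` edges `E ⊆ V × V` (listed in an
arbitrary order, without repetition; loops are allowed) and non-negative integer edge weights. -/
structure WDigraph (n m : ℕ) where
  edge : Fin m → Fin n × Fin n
  edge_injective : Function.Injective edge
  weight : Fin m → ℕ

namespace WDigraph

variable {n m : ℕ}

/-- `G.IsWalkWeight u v ℓ`: some walk from `u` to `v` in `G` has total weight `ℓ`. -/
inductive IsWalkWeight (G : WDigraph n m) : Fin n → Fin n → ℕ → Prop
  | nil (u : Fin n) : IsWalkWeight G u u 0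
  | cons (j : Fin m) {v : Fin n} {l : ℕ} (h : IsWalkWeight G (G.edge j).2 v l) :
      IsWalkWeight G (G.edge j).1 v (G.weight j + l)

/-- The distance from `u` to `v`, i.e. the least weight of a walk from `u` to `v` (as weights are
non-negative, this is the weight of a shortest path); `⊤` if `v` is not reachable from `u`. -/
noncomputable def dist (G : WDigraph n m) (u v : Fin n) : ℕ∞ :=
  ⨅ (l : ℕ) (_ : G.IsWalkWeight u v l), (l : ℕ∞)

end WDigraph

/-! ### The PRAM

A synchronous parallel random access machine with words of `w` bits, in the usual work-time
presentation: a fixed program text, whose parallel statement lets any number `N` of processors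
`0, …, N - 1` simultaneously evaluate expressions over the shared memory and then write to it.
Reads may be concurrent; concurrent writes to one cell are resolved in favour of the processor of
least index (priority CRCW). The program does not depend on the input or on the word size. -/

namespace PRAM

/-- The unit-cost operations on words. -/
inductive Op
  | add | sub | mul | div | mod | lt | eq

/-- Value of an operation before reduction to a word; `sub` is truncated at `0`, `div` and `mod`
are division with remainder, and comparisons return `1` (true) or `0` (false). -/
def Op.eval : Op → ℕ → ℕ → ℕ
  | .add, x, y => x + y
  | .sub, x, y => x - y
  | .mul, x, y => x * y
  | .div, x, y => x / y
  | .mod, x, y => x % y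
  | .lt, x, y => if x < y then 1 else 0
  | .eq, x, y => if x = y then 1 else 0

/-- What one processor can compute within one statement: literals, its own index, its coin of the
current time step, reads of shared memory and operations on words. -/
inductive Expr
  | lit (k : ℕ)
  | pid
  | coin
  | read (addr : Expr)
  | op (o : Op) (a b : Expr)

/-- Contents of the shared memory. -/
abbrev Mem := ℕ → ℕ

/-- Outcomes of the coin tosses: `ω (t, i)` is the coin of processor `i` at time `t`. -/
abbrev Coins := ℕ × ℕ → Bool

/-- The coins are independent and fair. -/
noncomputable def coinMeasure : Measure Coins :=
  Measure.infinitePi fun _ : ℕ × ℕ => (PMF.uniformOfFintype Bool).toMeasure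

/-- Value, as a word of `w` bits, of an expression for processor `i` at time `t`. -/
def Expr.eval (w : ℕ) (ω : Coins) (t i : ℕ) (M : Mem) : Expr → ℕ
  | .lit k => k % 2 ^ w
  | .pid => i % 2 ^ w
  | .coin => (ω (t, i)).toNat % 2 ^ w
  | .read a => M (a.eval w ω t i M) % 2 ^ w
  | .op o a b => o.eval (a.eval w ω t i M) (b.eval w ω t i M) % 2 ^ w

/-- Number of elementary operations needed to evaluate an expression. -/
def Expr.cost : Expr → ℕ
  | .lit _ => 1
  | .pid => 1
  | .coin => 1
  | .read a => a.cost + 1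
  | .op _ a b => a.cost + b.cost + 1

/-- Programs. The statement `par N g a v` stands for
`for all i < N in parallel: if g then M[a] := v`; with `N = 1` it is a sequential assignment. -/
inductive Prog
  | skip
  | par (N guard addr val : Expr)
  | seq (p q : Prog)
  | ite (cond : Expr) (p q : Prog)
  | while (cond : Expr) (p : Prog)

open Classical in
/-- Effect of `par N g a v` on the memory, where `k` is the value of `N`: every processor `i < k`
evaluates its expressions in the old memory, then all writes take place; of several processors that
write to the same cell, the one of least index succeeds. -/
noncomputable def parWrite (w : ℕ) (ω : Coins) (t k : ℕ) (g a v : Expr) (M : Mem) : Mem := fun x =>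
  if H : ∃ i, i < k ∧ g.eval w ω t i M ≠ 0 ∧ a.eval w ω t i M = x then
    v.eval w ω t (Nat.find H) M
  else M x

/-- `Exec w ω p t M M' work depth`: with words of `w` bits and coins `ω`, program `p`, started at
time `t` on memory `M`, halts with memory `M'` after performing `work` operations in total over all
processors, in `depth` parallel steps. -/
inductive Exec (w : ℕ) (ω : Coins) : Prog → ℕ → Mem → Mem → ℕ → ℕ → Prop
  | skip (t : ℕ) (M : Mem) : Exec w ω .skip t M M 0 0
  | par (N g a v : Expr) (t : ℕ) (M : Mem) :
      Exec w ω (.par N g a v) t M (parWrite w ω t (N.eval w ω t 0 M) g a v M)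
        (N.cost + N.eval w ω t 0 M * (g.cost + a.cost + v.cost + 1))
        (N.cost + (g.cost + a.cost + v.cost + 1))
  | seq {p q : Prog} {t : ℕ} {M M₁ M₂ : Mem} {k₁ d₁ k₂ d₂ : ℕ}
      (hp : Exec w ω p t M M₁ k₁ d₁) (hq : Exec w ω q (t + d₁) M₁ M₂ k₂ d₂) :
      Exec w ω (.seq p q) t M M₂ (k₁ + k₂) (d₁ + d₂)
  | ite_true {e : Expr} {p q : Prog} {t : ℕ} {M M₁ : Mem} {k d : ℕ}
      (he : e.eval w ω t 0 M ≠ 0) (hp : Exec w ω p (t + e.cost) M M₁ k d) :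
      Exec w ω (.ite e p q) t M M₁ (e.cost + k) (e.cost + d)
  | ite_false {e : Expr} {p q : Prog} {t : ℕ} {M M₁ : Mem} {k d : ℕ}
      (he : e.eval w ω t 0 M = 0) (hq : Exec w ω q (t + e.cost) M M₁ k d) :
      Exec w ω (.ite e p q) t M M₁ (e.cost + k) (e.cost + d)
  | while_true {e : Expr} {p : Prog} {t : ℕ} {M M₁ M₂ : Mem} {k₁ d₁ k₂ d₂ : ℕ}
      (he : e.eval w ω t 0 M ≠ 0) (hp : Exec w ω p (t + e.cost) M M₁ k₁ d₁)
      (hr : Exec w ω (.while e p) (t + e.cost + d₁) M₁ M₂ k₂ d₂) :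
      Exec w ω (.while e p) t M M₂ (e.cost + k₁ + k₂) (e.cost + d₁ + d₂)
  | while_false {e : Expr} {p : Prog} {t : ℕ} {M : Mem} (he : e.eval w ω t 0 M = 0) :
      Exec w ω (.while e p) t M M e.cost e.cost

/-- The machine is deterministic once the coins are fixed: final memory, work and depth of a
halting run are determined. -/
theorem Exec.unique {w : ℕ} {ω : Coins} {p : Prog} {t : ℕ} {M M₁ M₂ : Mem} {k₁ d₁ k₂ d₂ : ℕ}
    (h₁ : Exec w ω p t M M₁ k₁ d₁) (h₂ : Exec w ω p t M M₂ k₂ d₂) :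
    M₁ = M₂ ∧ k₁ = k₂ ∧ d₁ = d₂ := by
  induction h₁ generalizing M₂ k₂ d₂ with
  | skip => cases h₂; simp
  | par => cases h₂; simp
  | seq _ _ ih ih' =>
    cases h₂ with
    | seq hp hq =>
      obtain ⟨rfl, rfl, rfl⟩ := ih hp
      obtain ⟨rfl, rfl, rfl⟩ := ih' hq
      simp
  | ite_true he _ ih =>
    cases h₂ with
    | ite_true _ hp => obtain ⟨rfl, rfl, rfl⟩ := ih hp; simp
    | ite_false he' _ => exact absurd he' he
  | ite_false he _ ih =>
    cases h₂ with
    | ite_true he' _ => exact absurd he he'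
    | ite_false _ hp => obtain ⟨rfl, rfl, rfl⟩ := ih hp; simp
  | while_true he _ _ ih ih' =>
    cases h₂ with
    | while_true _ hp hr =>
      obtain ⟨rfl, rfl, rfl⟩ := ih hp
      obtain ⟨rfl, rfl, rfl⟩ := ih' hr
      simp
    | while_false he' => exact absurd he' he
  | while_false he =>
    cases h₂ with
    | while_true he' _ _ => exact absurd he he'
    | while_false _ => simp

/-- Initial memory on input `(G, s, h)`: cells `0, 1, 2, 3` hold `n, m, s, h`; for `j < m` the
cells `4 + 3 j`, `5 + 3 j`, `6 + 3 j` hold tail, head and weight of the `j`-th edge; all other cells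
hold `0`. -/
def inputMem {n m : ℕ} (G : WDigraph n m) (s : Fin n) (h : ℕ) : Mem
  | 0 => n
  | 1 => m
  | 2 => s
  | 3 => h
  | x + 4 =>
    if hx : x / 3 < m then
      match x % 3 with
      | 0 => (G.edge ⟨x / 3, hx⟩).1
      | 1 => (G.edge ⟨x / 3, hx⟩).2
      | _ => G.weight ⟨x / 3, hx⟩
    else 0

/-- How an output cell encodes a distance: `0` stands for `∞`, and `d + 1` for the number `d`. -/
def decodeDist : ℕ → ℕ∞
  | 0 => ⊤
  | d + 1 => (d : ℕ∞)

end PRAM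

/-! The algorithm combines random hubs with scaling by potentials. Take about `n log n / h` random
vertices as hubs, with the source as hub `0`. For every pair of vertices fix a lightest walk with
fewest edges; if it has more than `h` edges, the `h` vertices just before its end form a set, and
with high probability the hubs meet all of these at most `n²` sets (`exists_hitting_sets`,
`coinMeasure_not_goodHubs`). Then every walk can be replaced, at no extra weight, by a chain of
walks of at most `h` edges that start and end at hubs (`GoodHubs`), apart from the two ends of the
chain.

Distances are approached from below by a potential. The invariant `PotInv` says that the reduced
weights `w + pot(tail) - pot(head)` are non-negative and that `pot` falls short of the distance by
at most `D`. One phase (`phaseP_ok`) produces estimates `X ≤ D` for the reduced weights, which are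
themselves a feasible potential and satisfy `4 dist ≤ 8 lam X + D` wherever `X < D`, with `lam` of
order `log n`. Adding `X` to `pot` lowers `D` by `D / (8 lam)`, rounded up (`PotInv.step`), so
`O(lam log (n W))` phases bring `D` to `0` (`nextBound_iterate`).

For a phase, the graph is first made sparse locally: the incoming edges of a vertex are arranged in
a binary tree, each node has three links, and links run from heads to tails (`LinkSpec`). Thus `h`
edges become `O(h log n)` links. At scale `i`, weights are measured in units of `2^i D / (h cap)`
and rounded up to powers of two that are at least `1`. A breadth-first search with these delays,
from all `T` hubs and up to time `h lam`, sees every short walk between hubs of weight at most `2^i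
D / cap`, and whatever it sees is at most a factor `lam` heavier (`LinkWalk.exists_linkReach`,
`LinkReach.exists_linkWalk`). Half of the least successful scale is therefore a lower estimate for
short walks. A min-plus closure over the hubs followed by relaxation along links yields `X`. The
closed estimates obey the triangle inequality along every short walk between hubs, so hub chains
make `X` feasible (`PhaseSpec.feasible`). Searches, closure and relaxation cost, up to logarithms,
`T (n + m)`, `T³` and `h (n + m)`: the three terms of the work bound.

Coins influence only the work. Once `D = 0`, a last phase with `D = 1` marks the vertices at reduced
distance `0`, and a check of every edge certifies the result whatever the hubs were
(`exact_of_check`). If the check fails, the run is repeated with all vertices as hubs, which always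
succeeds. The failure probability `n^{-(c+3)}` outweighs the `n³` cost of the repetition, which
settles the expectation.

The program is written over named arrays of natural numbers (`AProg`, `Run`) and then translated to
the machine (`Run.exec`). The translation is faithful as soon as all values stay below some `B` with
`B ^ deg < 2 ^ w`; since `B` is polynomial in `n + W`, words of `O(log (n + W))` bits suffice. -/

namespace PRAM

/-! ### Expressions without overflow -/

/-- Value of an expression over the natural numbers, without reduction to words. -/
def Expr.evalN (ω : Coins) (t i : ℕ) (M : Mem) : Expr → ℕ
  | .lit k => k
  | .pid => i
  | .coin => (ω (t, i)).toNat
  | .read a => M (a.evalN ω t i M)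
  | .op o a b => o.eval (a.evalN ω t i M) (b.evalN ω t i M)

/-- If all memory cells are at most `B`, then values of `e` are at most `B ^ e.deg`. -/
def Expr.deg : Expr → ℕ
  | .lit k => k + 1
  | .pid => 1
  | .coin => 1
  | .read a => max 1 a.deg
  | .op .add a b => max a.deg b.deg + 1
  | .op .mul a b => a.deg + b.deg
  | .op _ a b => max a.deg b.deg

/-- The degree bounds every intermediate value by a power of `B` below `2 ^ w`, so no reduction
modulo `2 ^ w` ever takes effect. The size bound is proved together with the equality because each
operation needs it for its operands. A literal `k` is covered by `k < 2 ^ (k + 1) ≤ B ^ (k + 1)`. -/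
theorem Expr.eval_eq_evalN {B w : ℕ} (hB : 2 ≤ B) {ω : Coins} {t i : ℕ} {M : Mem}
    (hM : ∀ x, M x ≤ B) (hi : i ≤ B) (e : Expr) (he : B ^ e.deg < 2 ^ w) :
    e.eval w ω t i M = e.evalN ω t i M ∧ e.evalN ω t i M ≤ B ^ e.deg := by
  have hB1 : ∀ {a b : ℕ}, a ≤ b → B ^ a ≤ B ^ b := fun h => Nat.pow_le_pow_right (by omega) h
  induction e with
  | lit k =>
    have h : k ≤ B ^ (k + 1) := by
      calc k ≤ 2 ^ (k + 1) := (Nat.lt_two_pow_self.le).trans (Nat.pow_le_pow_right (by omega) (by omega))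
        _ ≤ B ^ (k + 1) := Nat.pow_le_pow_left hB _
    simp only [deg] at he
    exact ⟨Nat.mod_eq_of_lt (h.trans_lt he), h⟩
  | pid =>
    simp only [deg, pow_one] at he
    exact ⟨Nat.mod_eq_of_lt (hi.trans_lt he), by simpa [evalN, deg] using hi⟩
  | coin =>
    simp only [deg, pow_one] at he
    have h : (ω (t, i)).toNat ≤ B := (Bool.toNat_le _).trans (by omega)
    exact ⟨Nat.mod_eq_of_lt (h.trans_lt he), by simpa [evalN, deg] using h⟩
  | read a ih =>
    obtain ⟨h1, -⟩ := ih ((hB1 (le_max_right _ _)).trans_lt he)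
    have h2 : M (a.evalN ω t i M) ≤ B ^ (Expr.read a).deg :=
      (hM _).trans ((pow_one B).symm.le.trans (hB1 (le_max_left _ _)))
    simp only [eval, evalN, h1]
    exact ⟨Nat.mod_eq_of_lt (h2.trans_lt he), h2⟩
  | op o a b iha ihb =>
    have hda : a.deg ≤ (Expr.op o a b).deg := by cases o <;> simp only [deg] <;> omega
    have hdb : b.deg ≤ (Expr.op o a b).deg := by cases o <;> simp only [deg] <;> omega
    obtain ⟨ha, ha'⟩ := iha ((hB1 hda).trans_lt he)
    obtain ⟨hb, hb'⟩ := ihb ((hB1 hdb).trans_lt he)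
    have ha2 := ha'.trans (hB1 hda)
    have h1 : 1 ≤ B ^ (Expr.op o a b).deg := Nat.one_le_pow _ _ (by omega)
    have key : o.eval (a.evalN ω t i M) (b.evalN ω t i M) ≤ B ^ (Expr.op o a b).deg := by
      cases o with
      | add =>
        have e1 := ha'.trans (hB1 (le_max_left a.deg b.deg))
        have e2 := hb'.trans (hB1 (le_max_right a.deg b.deg))
        simp only [Op.eval, deg, pow_succ]
        nlinarith
      | sub => exact (Nat.sub_le _ _).trans ha2
      | mul => simpa only [Op.eval, deg, pow_add] using Nat.mul_le_mul ha' hb'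
      | div => exact (Nat.div_le_self _ _).trans ha2
      | mod => exact (Nat.mod_le _ _).trans ha2
      | lt => simp only [Op.eval]; split_ifs <;> omega
      | eq => simp only [Op.eval]; split_ifs <;> omega
    simp only [eval, evalN, ha, hb]
    exact ⟨Nat.mod_eq_of_lt (key.trans_lt he), key⟩

/-! ### Programs over named arrays -/

/-- Names of the arrays used by the program. -/
inductive Arr
  | lg | pw | tt | bits | hub | acc | j1 | j2 | nn | lk | loc | wl | kl | pot | dd | d0 | cap | ll
  | sc | si | mat | big | x | vis | own | q | st | len | tm | pj | aa | kk | tg | e | f | bad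
  deriving DecidableEq

/-- The number of arrays. -/
def numArr : ℕ := 36

theorem Arr.ctorIdx_lt (a : Arr) : a.ctorIdx < numArr := by
  cases a <;> decide

theorem Arr.ctorIdx_ofNat {r : ℕ} (h : r < numArr) : (Arr.ofNat r).ctorIdx = r := by
  unfold numArr at h
  interval_cases r <;> rfl

/-- Expressions over named arrays and the input. -/
inductive AE
  | lit (k : ℕ)
  | pid
  | inp (e : AE)
  | rd (a : Arr) (e : AE)
  | op (o : Op) (a b : AE)

/-- Contents of the named arrays. -/
abbrev St := Arr → ℕ → ℕ

namespace AE

/-- Value of an expression for processor `i`. -/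
def eval (I : ℕ → ℕ) (σ : St) (i : ℕ) : AE → ℕ
  | .lit k => k
  | .pid => i
  | .inp e => I (e.eval I σ i)
  | .rd a e => σ a (e.eval I σ i)
  | .op o x y => o.eval (x.eval I σ i) (y.eval I σ i)

instance (k : ℕ) : OfNat AE k := ⟨.lit k⟩
instance : Add AE := ⟨.op .add⟩
instance : Sub AE := ⟨.op .sub⟩
instance : Mul AE := ⟨.op .mul⟩
instance : Div AE := ⟨.op .div⟩
instance : Mod AE := ⟨.op .mod⟩

/-- Comparison `<`. -/
def lt (a b : AE) : AE := .op .lt a b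
/-- Comparison `=`. -/
def eq (a b : AE) : AE := .op .eq a b
/-- Negation of a truth value. -/
def not (a : AE) : AE := .op .eq a 0
/-- The first cell of an array, used as a scalar variable. -/
def sc (a : Arr) : AE := .rd a 0

variable (I : ℕ → ℕ) (σ : St) (i : ℕ) (a b : AE)

@[simp] theorem eval_lit (k : ℕ) : (AE.lit k).eval I σ i = k := rfl
@[simp] theorem eval_ofNat (k : ℕ) : (ofNat(k) : AE).eval I σ i = ofNat(k) := rfl
@[simp] theorem eval_pid : AE.pid.eval I σ i = i := rfl
@[simp] theorem eval_inp : (AE.inp a).eval I σ i = I (a.eval I σ i) := rfl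
@[simp] theorem eval_rd (r : Arr) : (AE.rd r a).eval I σ i = σ r (a.eval I σ i) := rfl
@[simp] theorem eval_sc (r : Arr) : (AE.sc r).eval I σ i = σ r 0 := rfl
@[simp] theorem eval_add : (a + b).eval I σ i = a.eval I σ i + b.eval I σ i := rfl
@[simp] theorem eval_sub : (a - b).eval I σ i = a.eval I σ i - b.eval I σ i := rfl
@[simp] theorem eval_mul : (a * b).eval I σ i = a.eval I σ i * b.eval I σ i := rfl
@[simp] theorem eval_div : (a / b).eval I σ i = a.eval I σ i / b.eval I σ i := rfl
@[simp] theorem eval_mod : (a % b).eval I σ i = a.eval I σ i % b.eval I σ i := rfl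
@[simp] theorem eval_lt :
    (lt a b).eval I σ i = if a.eval I σ i < b.eval I σ i then 1 else 0 := rfl
@[simp] theorem eval_eq :
    (eq a b).eval I σ i = if a.eval I σ i = b.eval I σ i then 1 else 0 := rfl
@[simp] theorem eval_not : (not a).eval I σ i = if a.eval I σ i = 0 then 1 else 0 := rfl

/-- Address of a cell of a named array; the arrays are interleaved behind the input. -/
def addr (a : Arr) (x : Expr) : Expr :=
  .op .add (.op .add (.op .add (.lit 4) (.op .mul (.lit 3) (.read (.lit 1))))
    (.op .mul (.lit numArr) x)) (.lit a.ctorIdx)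

/-- Translation to expressions of the machine. -/
def compile : AE → Expr
  | .lit k => .lit k
  | .pid => .pid
  | .inp e => .op .mul (.read e.compile)
      (.op .lt e.compile (.op .add (.lit 4) (.op .mul (.lit 3) (.read (.lit 1)))))
  | .rd a e => .read (addr a e.compile)
  | .op o x y => .op o x.compile y.compile

end AE

/-- The memory that holds the input `I` with `m` edges, followed by the arrays `σ`. -/
def toMem (I : ℕ → ℕ) (m : ℕ) (σ : St) : Mem := fun x =>
  if x < 4 + 3 * m then I x
  else σ (Arr.ofNat ((x - (4 + 3 * m)) % numArr)) ((x - (4 + 3 * m)) / numArr)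

section
variable {I : ℕ → ℕ} {m : ℕ} (σ : St)

theorem toMem_arr (a : Arr) (x : ℕ) :
    toMem I m σ (4 + 3 * m + numArr * x + a.ctorIdx) = σ a x := by
  have h := a.ctorIdx_lt
  have h2 : 4 + 3 * m + numArr * x + a.ctorIdx - (4 + 3 * m) = a.ctorIdx + numArr * x := by omega
  rw [toMem, if_neg (by omega), h2, Nat.add_mul_mod_self_left, Nat.mod_eq_of_lt h,
    Nat.add_mul_div_left _ _ (by omega), Nat.div_eq_of_lt h, Arr.ofNat_ctorIdx, zero_add]

theorem toMem_le {B : ℕ} (hI : ∀ x, I x ≤ B) (hσ : ∀ a x, σ a x ≤ B) (x : ℕ) :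
    toMem I m σ x ≤ B := by
  unfold toMem; split_ifs
  · exact hI x
  · exact hσ _ _

theorem AE.evalN_addr (h1 : I 1 = m) (ω : Coins) (t i : ℕ) (a : Arr) (x : Expr) :
    (AE.addr a x).evalN ω t i (toMem I m σ) =
      4 + 3 * m + numArr * x.evalN ω t i (toMem I m σ) + a.ctorIdx := by
  simp [AE.addr, Expr.evalN, Op.eval, toMem, h1]
  omega

/-- Beyond the input the machine memory holds the arrays, whereas the abstract input is `0` there.
The comparison factor in the translation of `inp` restores that zero, so reads past the last edge
are legitimate. -/
theorem AE.evalN_compile (h1 : I 1 = m) (h0 : ∀ x, 4 + 3 * m ≤ x → I x = 0)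
    (ω : Coins) (t i : ℕ) (e : AE) :
    e.compile.evalN ω t i (toMem I m σ) = e.eval I σ i := by
  induction e with
  | lit k => rfl
  | pid => rfl
  | inp e ih =>
    have : toMem I m σ 1 = m := by rw [toMem, if_pos (by omega), h1]
    simp only [compile, Expr.evalN, Op.eval, ih, eval, this]
    split_ifs with h
    · rw [toMem, if_pos h, mul_one]
    · rw [h0 _ (by omega), mul_zero]
  | rd a e ih => simp only [compile, Expr.evalN, AE.evalN_addr σ h1, ih, toMem_arr, eval]
  | op o x y ihx ihy => simp only [compile, Expr.evalN, eval, ihx, ihy]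

end

/-- Effect of a parallel write of `N` processors on one array. -/
noncomputable def scatter (N : ℕ) (g : ℕ → Prop) (idx v old : ℕ → ℕ) : ℕ → ℕ := fun x =>
  open Classical in
  if H : ∃ i, i < N ∧ g i ∧ idx i = x then v (Nat.find H) else old x

theorem scatter_cases (N : ℕ) (g : ℕ → Prop) (idx v old : ℕ → ℕ) (x : ℕ) :
    scatter N g idx v old x = old x ∨
      ∃ i < N, g i ∧ idx i = x ∧ scatter N g idx v old x = v i := by
  classical
  unfold scatter
  split_ifs with H
  · exact .inr ⟨_, (Nat.find_spec H).1, (Nat.find_spec H).2.1, (Nat.find_spec H).2.2, rfl⟩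
  · exact .inl rfl

/-- Behind the input, addresses correspond bijectively to pairs of an array and an index, by
quotient and remainder modulo `numArr`. Hence writes aimed at one array touch neither the input nor
another array, and the priority rule on addresses becomes the priority rule of `scatter`. -/
theorem parWrite_toMem {I : ℕ → ℕ} {m : ℕ} {σ : St} {w : ℕ} {ω : Coins} {t N : ℕ}
    {g a v : Expr} {arr : Arr} {g' : ℕ → Prop} {idx v' : ℕ → ℕ}
    (hg : ∀ i < N, g.eval w ω t i (toMem I m σ) ≠ 0 ↔ g' i)
    (ha : ∀ i < N, a.eval w ω t i (toMem I m σ) = 4 + 3 * m + numArr * idx i + arr.ctorIdx)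
    (hv : ∀ i < N, v.eval w ω t i (toMem I m σ) = v' i) :
    parWrite w ω t N g a v (toMem I m σ) =
      toMem I m (Function.update σ arr (scatter N g' idx v' (σ arr))) := by
  classical
  have hc := arr.ctorIdx_lt
  funext x
  by_cases hx : x < 4 + 3 * m
  · have hne : ¬ ∃ i, i < N ∧ g.eval w ω t i (toMem I m σ) ≠ 0 ∧
        a.eval w ω t i (toMem I m σ) = x := by
      rintro ⟨i, hi, -, h⟩
      rw [ha i hi] at h; omega
    rw [parWrite, dif_neg hne, toMem, toMem, if_pos hx, if_pos hx]
  · obtain ⟨y, b, rfl⟩ : ∃ y b, x = 4 + 3 * m + numArr * y + Arr.ctorIdx b := by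
      refine ⟨(x - (4 + 3 * m)) / numArr, Arr.ofNat ((x - (4 + 3 * m)) % numArr), ?_⟩
      rw [Arr.ctorIdx_ofNat (Nat.mod_lt _ (by decide))]
      have := Nat.div_add_mod (x - (4 + 3 * m)) numArr
      omega
    have hb := b.ctorIdx_lt
    have key : ∀ i < N, (a.eval w ω t i (toMem I m σ) = 4 + 3 * m + numArr * y + b.ctorIdx ↔
        arr = b ∧ idx i = y) := by
      intro i hi
      rw [ha i hi]
      constructor
      · intro h
        have e1 : (arr.ctorIdx + numArr * idx i) = (b.ctorIdx + numArr * y) := by omega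
        have e2 := congrArg (· % numArr) e1
        have e3 := congrArg (· / numArr) e1
        simp only [Nat.add_mul_mod_self_left, Nat.mod_eq_of_lt hb, Nat.mod_eq_of_lt hc] at e2
        rw [Nat.add_mul_div_left _ _ (by decide), Nat.add_mul_div_left _ _ (by decide),
          Nat.div_eq_of_lt hb, Nat.div_eq_of_lt hc, zero_add, zero_add] at e3
        exact ⟨by rw [← Arr.ofNat_ctorIdx arr, e2, Arr.ofNat_ctorIdx], e3⟩
      · rintro ⟨rfl, rfl⟩; rfl
    rw [toMem_arr]
    by_cases hab : arr = b
    · subst hab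
      rw [Function.update_self]
      have hiff : ∀ i, (i < N ∧ g.eval w ω t i (toMem I m σ) ≠ 0 ∧
          a.eval w ω t i (toMem I m σ) = 4 + 3 * m + numArr * y + arr.ctorIdx) ↔
          (i < N ∧ g' i ∧ idx i = y) := by
        intro i
        constructor
        · rintro ⟨h1, h2, h3⟩; exact ⟨h1, (hg i h1).1 h2, ((key i h1).1 h3).2⟩
        · rintro ⟨h1, h2, h3⟩; exact ⟨h1, (hg i h1).2 h2, (key i h1).2 ⟨rfl, h3⟩⟩
      unfold parWrite scatter
      by_cases H : ∃ i, i < N ∧ g' i ∧ idx i = y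
      · have H' : ∃ i, i < N ∧ g.eval w ω t i (toMem I m σ) ≠ 0 ∧
          a.eval w ω t i (toMem I m σ) = 4 + 3 * m + numArr * y + arr.ctorIdx := by
          obtain ⟨i, hi⟩ := H; exact ⟨i, (hiff i).2 hi⟩
        rw [dif_pos H', dif_pos H]
        have hf : Nat.find H' = Nat.find H := Nat.find_congr' (hiff _)
        rw [hf]
        exact hv _ (Nat.find_spec H).1
      · have H' : ¬ ∃ i, i < N ∧ g.eval w ω t i (toMem I m σ) ≠ 0 ∧
          a.eval w ω t i (toMem I m σ) = 4 + 3 * m + numArr * y + arr.ctorIdx := by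
          rintro ⟨i, hi⟩; exact H ⟨i, (hiff i).1 hi⟩
        rw [dif_neg H', dif_neg H, toMem_arr]
    · have H' : ¬ ∃ i, i < N ∧ g.eval w ω t i (toMem I m σ) ≠ 0 ∧
          a.eval w ω t i (toMem I m σ) = 4 + 3 * m + numArr * y + b.ctorIdx := by
        rintro ⟨i, hi, -, h⟩; exact hab ((key i hi).1 h).1
      rw [parWrite, dif_neg H', toMem_arr, Function.update_of_ne (Ne.symm hab)]

/-- Programs over named arrays: `par N g a idx v` stands for
`for all i < N in parallel: if g then a[idx] := v`. -/
inductive AProg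
  | skip
  | par (N g : AE) (a : Arr) (idx v : AE)
  | seq (p q : AProg)
  | ite (e : AE) (p q : AProg)
  | loop (e : AE) (p : AProg)

namespace AProg

/-- Translation to programs of the machine. -/
def compile : AProg → Prog
  | skip => .skip
  | par N g a idx v => .par N.compile g.compile (AE.addr a idx.compile) v.compile
  | seq p q => .seq p.compile q.compile
  | ite e p q => .ite e.compile p.compile q.compile
  | loop e p => .while e.compile p.compile

end AProg

/-- The largest degree of an expression in a program. -/
def Prog.deg : Prog → ℕ
  | .skip => 0
  | .par N g a v => max (max N.deg g.deg) (max a.deg v.deg)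
  | .seq p q => max p.deg q.deg
  | .ite e p q => max e.deg (max p.deg q.deg)
  | .while e p => max e.deg p.deg

/-- The largest cost of a statement in a program. -/
def Prog.cst : Prog → ℕ
  | .skip => 0
  | .par N g a v => N.cost + g.cost + a.cost + v.cost + 1
  | .seq p q => max p.cst q.cst
  | .ite e p q => max e.cost (max p.cst q.cst)
  | .while e p => max e.cost p.cst

/-- Runs of programs over named arrays, with all values that are written bounded by `B`. The work
of a parallel statement for `N` processors counts as `N + 1`, its depth as `1`. -/
inductive Run (I : ℕ → ℕ) (B : ℕ) : AProg → St → St → ℕ → ℕ → Prop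
  | skip (σ : St) : Run I B .skip σ σ 0 0
  | par (N g : AE) (a : Arr) (idx v : AE) (σ : St) (hN : N.eval I σ 0 ≤ B)
      (hv : ∀ i < N.eval I σ 0, g.eval I σ i ≠ 0 → v.eval I σ i ≤ B) :
      Run I B (.par N g a idx v) σ
        (Function.update σ a (scatter (N.eval I σ 0) (fun i => g.eval I σ i ≠ 0)
          (idx.eval I σ ·) (v.eval I σ ·) (σ a))) (N.eval I σ 0 + 1) 1
  | seq {p q : AProg} {σ σ₁ σ₂ : St} {k₁ d₁ k₂ d₂ : ℕ} (hp : Run I B p σ σ₁ k₁ d₁)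
      (hq : Run I B q σ₁ σ₂ k₂ d₂) : Run I B (.seq p q) σ σ₂ (k₁ + k₂) (d₁ + d₂)
  | ite_true {e : AE} {p q : AProg} {σ σ₁ : St} {k d : ℕ} (he : e.eval I σ 0 ≠ 0)
      (hp : Run I B p σ σ₁ k d) : Run I B (.ite e p q) σ σ₁ (1 + k) (1 + d)
  | ite_false {e : AE} {p q : AProg} {σ σ₁ : St} {k d : ℕ} (he : e.eval I σ 0 = 0)
      (hp : Run I B q σ σ₁ k d) : Run I B (.ite e p q) σ σ₁ (1 + k) (1 + d)
  | loop_true {e : AE} {p : AProg} {σ σ₁ σ₂ : St} {k₁ d₁ k₂ d₂ : ℕ} (he : e.eval I σ 0 ≠ 0)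
      (hp : Run I B p σ σ₁ k₁ d₁) (hr : Run I B (.loop e p) σ₁ σ₂ k₂ d₂) :
      Run I B (.loop e p) σ σ₂ (1 + k₁ + k₂) (1 + d₁ + d₂)
  | loop_false {e : AE} {p : AProg} {σ : St} (he : e.eval I σ 0 = 0) :
      Run I B (.loop e p) σ σ 1 1

theorem Run.bounded {I : ℕ → ℕ} {B : ℕ} {p : AProg} {σ σ' : St} {k d : ℕ}
    (h : Run I B p σ σ' k d) (hσ : ∀ a x, σ a x ≤ B) : ∀ a x, σ' a x ≤ B := by
  classical
  induction h with
  | skip => exact hσ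
  | par N g a idx v σ hN hv =>
    intro b x
    by_cases hb : b = a
    · subst hb
      rw [Function.update_self]
      rcases scatter_cases (N.eval I σ 0) (fun i => g.eval I σ i ≠ 0) (idx.eval I σ ·)
        (v.eval I σ ·) (σ b) x with h | ⟨i, hi, hg, -, h⟩
      · rw [h]; exact hσ _ _
      · rw [h]; exact hv i hi hg
    · rw [Function.update_of_ne hb]; exact hσ _ _
  | seq _ _ ih ih' => exact ih' (ih hσ)
  | ite_true _ _ ih => exact ih hσ
  | ite_false _ _ ih => exact ih hσ
  | loop_true _ _ _ ih ih' => exact ih' (ih hσ)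
  | loop_false _ => exact hσ

/-- The translation of a program over named arrays runs on the machine with the same effect and,
up to a constant factor, the same work and depth. -/
theorem Run.exec {I : ℕ → ℕ} {B m : ℕ} (hB : 2 ≤ B) (h1 : I 1 = m)
    (h0 : ∀ x, 4 + 3 * m ≤ x → I x = 0) (hI : ∀ x, I x ≤ B) {p : AProg} {σ σ' : St} {k d : ℕ}
    (h : Run I B p σ σ' k d) (hσ : ∀ a x, σ a x ≤ B) {w : ℕ} (hw : B ^ p.compile.deg < 2 ^ w) :
    ∃ k' d', k' ≤ p.compile.cst * k ∧ d' ≤ p.compile.cst * d ∧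
      ∀ ω t, Exec w ω p.compile t (toMem I m σ) (toMem I m σ') k' d' := by
  have hmono : ∀ {a b : ℕ}, a ≤ b → B ^ b < 2 ^ w → B ^ a < 2 ^ w :=
    fun h h' => (Nat.pow_le_pow_right (by omega) h).trans_lt h'
  have hev : ∀ (σ : St), (∀ a x, σ a x ≤ B) → ∀ (e : AE), B ^ e.compile.deg < 2 ^ w → ∀ i ≤ B,
      ∀ ω t, e.compile.eval w ω t i (toMem I m σ) = e.eval I σ i := by
    intro σ hσ e he i hi ω t
    rw [(Expr.eval_eq_evalN hB (toMem_le σ hI hσ) hi _ he).1, AE.evalN_compile σ h1 h0]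
  induction h with
  | skip σ => exact ⟨0, 0, by simp, by simp, fun ω t => Exec.skip t _⟩
  | par N g a idx v σ hN hv =>
    simp only [AProg.compile, Prog.deg] at hw
    have hwN := hmono (show N.compile.deg ≤ _ by omega) hw
    have hwg := hmono (show g.compile.deg ≤ _ by omega) hw
    have hwa := hmono (show (AE.addr a idx.compile).deg ≤ _ by omega) hw
    have hwv := hmono (show v.compile.deg ≤ _ by omega) hw
    have eN : ∀ ω t, N.compile.eval w ω t 0 (toMem I m σ) = N.eval I σ 0 :=
      fun ω t => hev σ hσ N hwN 0 (by omega) ω t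
    refine ⟨N.compile.cost + N.eval I σ 0 * (g.compile.cost + (AE.addr a idx.compile).cost +
      v.compile.cost + 1), N.compile.cost + (g.compile.cost + (AE.addr a idx.compile).cost +
      v.compile.cost + 1), ?_, ?_, fun ω t => ?_⟩
    rotate_left 2
    · have := Exec.par (w := w) (ω := ω) N.compile g.compile (AE.addr a idx.compile) v.compile t
        (toMem I m σ)
      rw [eN, parWrite_toMem (arr := a) (g' := fun i => g.eval I σ i ≠ 0)
        (idx := (idx.eval I σ ·)) (v' := (v.eval I σ ·))] at this
      · exact this
      · intro i hi; rw [hev σ hσ g hwg i (by omega)]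
      · intro i hi
        rw [(Expr.eval_eq_evalN hB (toMem_le σ hI hσ) (by omega) _ hwa).1, AE.evalN_addr σ h1,
          AE.evalN_compile σ h1 h0]
      · intro i hi; exact hev σ hσ v hwv i (by omega) ω t
    · simp only [AProg.compile, Prog.cst]
      have hc : g.compile.cost + (AE.addr a idx.compile).cost + v.compile.cost + 1 ≤
        N.compile.cost + g.compile.cost + (AE.addr a idx.compile).cost + v.compile.cost + 1 := by
        omega
      nlinarith [Nat.mul_le_mul_left (N.eval I σ 0) hc]
    · simp only [AProg.compile, Prog.cst]; omega
  | seq hp hq ih ih' =>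
    simp only [AProg.compile, Prog.deg] at hw
    obtain ⟨k1, d1, hk1, hd1, e1⟩ := ih hσ (hmono (le_max_left _ _) hw)
    obtain ⟨k2, d2, hk2, hd2, e2⟩ := ih' (hp.bounded hσ) (hmono (le_max_right _ _) hw)
    refine ⟨_, _, ?_, ?_, fun ω t => Exec.seq (e1 ω t) (e2 ω _)⟩
    · simp only [AProg.compile, Prog.cst, mul_add]
      exact Nat.add_le_add (hk1.trans (Nat.mul_le_mul_right _ (le_max_left _ _)))
        (hk2.trans (Nat.mul_le_mul_right _ (le_max_right _ _)))
    · simp only [AProg.compile, Prog.cst, mul_add]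
      exact Nat.add_le_add (hd1.trans (Nat.mul_le_mul_right _ (le_max_left _ _)))
        (hd2.trans (Nat.mul_le_mul_right _ (le_max_right _ _)))
  | @ite_true e p q σ σ₁ k d he hp ih =>
    simp only [AProg.compile, Prog.deg] at hw
    obtain ⟨k1, d1, hk1, hd1, e1⟩ := ih hσ (hmono (by omega) hw)
    refine ⟨_, _, ?_, ?_, fun ω t => Exec.ite_true ?_ (e1 ω _)⟩
    · simp only [AProg.compile, Prog.cst, mul_add, mul_one]
      exact Nat.add_le_add (by omega) (hk1.trans (Nat.mul_le_mul_right _ (by omega)))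
    · simp only [AProg.compile, Prog.cst, mul_add, mul_one]
      exact Nat.add_le_add (by omega) (hd1.trans (Nat.mul_le_mul_right _ (by omega)))
    · rw [hev σ hσ e (hmono (by omega) hw) 0 (by omega)]; exact he
  | @ite_false e p q σ σ₁ k d he hp ih =>
    simp only [AProg.compile, Prog.deg] at hw
    obtain ⟨k1, d1, hk1, hd1, e1⟩ := ih hσ (hmono (by omega) hw)
    refine ⟨_, _, ?_, ?_, fun ω t => Exec.ite_false ?_ (e1 ω _)⟩
    · simp only [AProg.compile, Prog.cst, mul_add, mul_one]
      exact Nat.add_le_add (by omega) (hk1.trans (Nat.mul_le_mul_right _ (by omega)))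
    · simp only [AProg.compile, Prog.cst, mul_add, mul_one]
      exact Nat.add_le_add (by omega) (hd1.trans (Nat.mul_le_mul_right _ (by omega)))
    · rw [hev σ hσ e (hmono (by omega) hw) 0 (by omega)]; exact he
  | @loop_true e p σ σ₁ σ₂ k₁ d₁ k₂ d₂ he hp hr ih ih' =>
    obtain ⟨k2, d2, hk2, hd2, e2⟩ := ih' (hp.bounded hσ) hw
    simp only [AProg.compile, Prog.deg] at hw
    obtain ⟨k1, d1, hk1, hd1, e1⟩ := ih hσ (hmono (le_max_right _ _) hw)
    refine ⟨_, _, ?_, ?_, fun ω t => Exec.while_true ?_ (e1 ω _) (e2 ω _)⟩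
    · simp only [AProg.compile, Prog.cst, mul_add, mul_one] at hk2 ⊢
      exact Nat.add_le_add (Nat.add_le_add (by omega)
        (hk1.trans (Nat.mul_le_mul_right _ (by omega)))) hk2
    · simp only [AProg.compile, Prog.cst, mul_add, mul_one] at hd2 ⊢
      exact Nat.add_le_add (Nat.add_le_add (by omega)
        (hd1.trans (Nat.mul_le_mul_right _ (by omega)))) hd2
    · rw [hev σ hσ e (hmono (by omega) hw) 0 (by omega)]; exact he
  | @loop_false e p σ he =>
    simp only [AProg.compile, Prog.deg] at hw
    refine ⟨_, _, ?_, ?_, fun ω t => Exec.while_false ?_⟩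
    · simp only [AProg.compile, Prog.cst]; omega
    · simp only [AProg.compile, Prog.cst]; omega
    · rw [hev σ hσ e (hmono (by omega) hw) 0 (by omega)]; exact he

/-! ### Rules for total correctness -/

/-- Program `p` halts on `σ`, with final arrays, work and depth that satisfy `Q`. -/
def Ok (I : ℕ → ℕ) (B : ℕ) (p : AProg) (σ : St) (Q : St → ℕ → ℕ → Prop) : Prop :=
  ∃ σ' k d, Run I B p σ σ' k d ∧ Q σ' k d

section
variable {I : ℕ → ℕ} {B : ℕ} {σ : St} {Q : St → ℕ → ℕ → Prop}

theorem Ok.imp {p : AProg} {Q' : St → ℕ → ℕ → Prop} (h : Ok I B p σ Q)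
    (hQ : ∀ σ' k d, Q σ' k d → Q' σ' k d) : Ok I B p σ Q' := by
  obtain ⟨σ', k, d, hr, hq⟩ := h
  exact ⟨σ', k, d, hr, hQ _ _ _ hq⟩

theorem Ok.skip (h : Q σ 0 0) : Ok I B .skip σ Q := ⟨σ, 0, 0, .skip σ, h⟩

theorem Ok.par {N g : AE} {a : Arr} {idx v : AE} (hN : N.eval I σ 0 ≤ B)
    (hv : ∀ i < N.eval I σ 0, g.eval I σ i ≠ 0 → v.eval I σ i ≤ B)
    (h : Q (Function.update σ a (scatter (N.eval I σ 0) (fun i => g.eval I σ i ≠ 0)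
          (idx.eval I σ ·) (v.eval I σ ·) (σ a))) (N.eval I σ 0 + 1) 1) :
    Ok I B (.par N g a idx v) σ Q := ⟨_, _, _, .par N g a idx v σ hN hv, h⟩

theorem Ok.seq {p q : AProg} (h : Ok I B p σ fun σ₁ k₁ d₁ => Ok I B q σ₁ fun σ₂ k₂ d₂ =>
    Q σ₂ (k₁ + k₂) (d₁ + d₂)) : Ok I B (.seq p q) σ Q := by
  obtain ⟨σ₁, k₁, d₁, hr₁, σ₂, k₂, d₂, hr₂, hq⟩ := h
  exact ⟨_, _, _, .seq hr₁ hr₂, hq⟩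

theorem Ok.ite {e : AE} {p q : AProg}
    (ht : e.eval I σ 0 ≠ 0 → Ok I B p σ fun σ' k d => Q σ' (1 + k) (1 + d))
    (hf : e.eval I σ 0 = 0 → Ok I B q σ fun σ' k d => Q σ' (1 + k) (1 + d)) :
    Ok I B (.ite e p q) σ Q := by
  by_cases he : e.eval I σ 0 = 0
  · obtain ⟨_, _, _, hr, hq⟩ := hf he; exact ⟨_, _, _, .ite_false he hr, hq⟩
  · obtain ⟨_, _, _, hr, hq⟩ := ht he; exact ⟨_, _, _, .ite_true he hr, hq⟩

/-- Loop rule whose invariant also tracks the work and depth so far. -/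
theorem Ok.loop_acc {e : AE} {p : AProg} (n : ℕ) (J : ℕ → St → ℕ → ℕ → Prop)
    (h0 : J 0 σ 0 0)
    (hbody : ∀ i < n, ∀ σ k₀ d₀, J i σ k₀ d₀ → e.eval I σ 0 ≠ 0 ∧
      Ok I B p σ fun σ' k d => J (i + 1) σ' (k₀ + (1 + k)) (d₀ + (1 + d)))
    (hend : ∀ σ k d, J n σ k d → e.eval I σ 0 = 0 ∧ Q σ (k + 1) (d + 1)) :
    Ok I B (.loop e p) σ Q := by
  suffices H : ∀ r i, i + r = n → ∀ σ k₀ d₀, J i σ k₀ d₀ →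
      Ok I B (.loop e p) σ fun σ' k d => Q σ' (k₀ + k) (d₀ + d) by
    refine (H n 0 (by omega) σ 0 0 h0).imp fun σ' k d h => ?_
    simpa using h
  intro r
  induction r with
  | zero =>
    intro i hi σ k₀ d₀ hJ
    obtain rfl : i = n := by omega
    obtain ⟨he, hq⟩ := hend _ _ _ hJ
    exact ⟨_, _, _, .loop_false he, hq⟩
  | succ r ih =>
    intro i hi σ k₀ d₀ hJ
    obtain ⟨he, σ₁, k₁, d₁, hr₁, hJ₁⟩ := hbody i (by omega) _ _ _ hJ
    obtain ⟨σ₂, k₂, d₂, hr₂, hq⟩ := ih (i + 1) (by omega) _ _ _ hJ₁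
    refine ⟨_, _, _, .loop_true he hr₁ hr₂, ?_⟩
    simpa only [add_assoc] using hq

/-- Loop rule for `n` iterations of work at most `kb` and depth at most `db`. -/
theorem Ok.loop {e : AE} {p : AProg} (n kb db : ℕ) (J : ℕ → St → Prop) (h0 : J 0 σ)
    (hbody : ∀ i < n, ∀ σ, J i σ → e.eval I σ 0 ≠ 0 ∧
      Ok I B p σ fun σ' k d => J (i + 1) σ' ∧ k ≤ kb ∧ d ≤ db)
    (hend : ∀ σ, J n σ → e.eval I σ 0 = 0)
    (hQ : ∀ σ k d, J n σ → k ≤ n * (kb + 1) + 1 → d ≤ n * (db + 1) + 1 → Q σ k d) :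
    Ok I B (.loop e p) σ Q := by
  refine Ok.loop_acc n (fun i σ k d => J i σ ∧ k ≤ i * (kb + 1) ∧ d ≤ i * (db + 1))
    ⟨h0, by simp, by simp⟩ ?_ ?_
  · rintro i hi σ k₀ d₀ ⟨hJ, hk, hd⟩
    obtain ⟨he, hp⟩ := hbody i hi σ hJ
    refine ⟨he, hp.imp fun σ' k d ⟨h1, h2, h3⟩ => ⟨h1, ?_, ?_⟩⟩ <;> rw [add_mul] <;> omega
  · rintro σ k d ⟨hJ, hk, hd⟩
    exact ⟨hend _ hJ, hQ _ _ _ hJ (by omega) (by omega)⟩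

end

/-! ### Parallel writes -/

section
variable {N : ℕ} {g : ℕ → Prop} {idx v old : ℕ → ℕ}

open Classical in
theorem scatter_id (N : ℕ) (g : ℕ → Prop) (v old : ℕ → ℕ) (x : ℕ) :
    scatter N g (fun i => i) v old x = if x < N ∧ g x then v x else old x := by
  unfold scatter
  split_ifs with H h h
  · exact congrArg v (Nat.find_spec H).2.2
  · exact absurd ⟨(Nat.find_spec H).2.2 ▸ (Nat.find_spec H).1,
      (Nat.find_spec H).2.2 ▸ (Nat.find_spec H).2.1⟩ h
  · exact absurd ⟨x, h.1, h.2, rfl⟩ H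
  · rfl

theorem scatter_of_forall {x : ℕ} (h : ∀ i < N, g i → idx i ≠ x) :
    scatter N g idx v old x = old x := by
  unfold scatter
  rw [dif_neg]
  rintro ⟨i, h1, h2, h3⟩; exact h i h1 h2 h3

/-- Some processor that writes to a cell succeeds, and it is the one of least index. -/
theorem scatter_spec {i : ℕ} (hi : i < N) (hg : g i) :
    ∃ j ≤ i, g j ∧ idx j = idx i ∧ scatter N g idx v old (idx i) = v j ∧
      ∀ l < j, g l → idx l ≠ idx i := by
  classical
  have H : ∃ j, j < N ∧ g j ∧ idx j = idx i := ⟨i, hi, hg, rfl⟩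
  have hs := Nat.find_spec H
  refine ⟨Nat.find H, Nat.find_min' H ⟨hi, hg, rfl⟩, hs.2.1, hs.2.2, ?_, ?_⟩
  · rw [scatter, dif_pos H]
  · intro l hl hgl he
    exact Nat.find_min H hl ⟨hl.trans hs.1, hgl, he⟩

theorem scatter_inj {i : ℕ} (hi : i < N) (hg : g i)
    (h : ∀ j < N, g j → idx j = idx i → j = i) : scatter N g idx v old (idx i) = v i := by
  obtain ⟨j, hji, hgj, he, hs, -⟩ := scatter_spec (v := v) (old := old) hi hg (idx := idx)
  rw [hs, h j (by omega) hgj he]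

theorem scatter_one (g : ℕ → Prop) [Decidable (g 0)] (idx v old : ℕ → ℕ) :
    scatter 1 g idx v old = if g 0 then Function.update old (idx 0) (v 0) else old := by
  classical
  funext x
  unfold scatter
  by_cases hg : g 0
  · rw [if_pos hg]
    by_cases hx : idx 0 = x
    · subst hx
      have H : ∃ i, i < 1 ∧ g i ∧ idx i = idx 0 := ⟨0, by omega, hg, rfl⟩
      rw [dif_pos H, Function.update_self]
      have := (Nat.find_spec H).1
      congr 1; omega
    · rw [dif_neg, Function.update_of_ne (Ne.symm hx)]
      rintro ⟨i, h1, h2, h3⟩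
      obtain rfl : i = 0 := by omega
      exact hx h3
  · rw [if_neg hg, dif_neg]
    rintro ⟨i, h1, h2, h3⟩
    obtain rfl : i = 0 := by omega
    exact hg h2

end


/-- `σ'` agrees with `σ` except on the arrays in `l`. -/
def Same (l : List Arr) (σ σ' : St) : Prop := ∀ a, a ∉ l → σ' a = σ a

theorem Same.refl (l : List Arr) (σ : St) : Same l σ σ := fun _ _ => rfl

theorem Same.trans {l : List Arr} {σ σ' σ'' : St} (h : Same l σ σ') (h' : Same l σ' σ'') :
    Same l σ σ'' := fun a ha => (h' a ha).trans (h a ha)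

theorem Same.mono {l l' : List Arr} {σ σ' : St} (h : Same l σ σ') (hl : l ⊆ l') :
    Same l' σ σ' := fun a ha => h a fun h => ha (hl h)

theorem Same.of_ne {a : Arr} {l : List Arr} {σ σ' : St} (h : ∀ b, b ≠ a → σ' b = σ b)
    (ha : a ∈ l) : Same l σ σ' := fun b hb => h b fun e => hb (e ▸ ha)

namespace AProg

/-- Assignment to a scalar. -/
def set (a : Arr) (v : AE) : AProg := .par 1 1 a 0 v

/-- Parallel assignment to the first `N` cells of an array. -/
def map (N g : AE) (a : Arr) (v : AE) : AProg := .par N g a .pid v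

end AProg

/-! ### Rules for single parallel statements. -/

section
variable {I : ℕ → ℕ} {B : ℕ} {σ : St} {Q : St → ℕ → ℕ → Prop}

theorem Ok.set {a : Arr} {v : AE} (hB : 1 ≤ B) (hv : v.eval I σ 0 ≤ B)
    (h : ∀ σ' : St, σ' a 0 = v.eval I σ 0 → (∀ b, b ≠ a → σ' b = σ b) → Q σ' 2 1) :
    Ok I B (.set a v) σ Q := by
  refine Ok.par (by simpa using hB) ?_ (h _ ?_ ?_)
  · intro i hi _
    obtain rfl : i = 0 := by simpa using hi
    exact hv
  · simp [scatter_one]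
  · intro b hb; rw [Function.update_of_ne hb]

theorem Ok.setIf {a : Arr} {g v : AE} (hB : 1 ≤ B) (hv : g.eval I σ 0 ≠ 0 → v.eval I σ 0 ≤ B)
    (h : ∀ σ' : St, (g.eval I σ 0 ≠ 0 → σ' a 0 = v.eval I σ 0) →
      (g.eval I σ 0 = 0 → σ' a 0 = σ a 0) → (∀ b, b ≠ a → σ' b = σ b) → Q σ' 2 1) :
    Ok I B (.par 1 g a 0 v) σ Q := by
  refine Ok.par (by simpa using hB) ?_ (h _ ?_ ?_ ?_)
  · intro i hi hg
    obtain rfl : i = 0 := by simpa using hi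
    exact hv hg
  · intro hg; simp [scatter_one, hg]
  · intro hg; simp [scatter_one, hg]
  · intro b hb; rw [Function.update_of_ne hb]

open Classical in
theorem Ok.map {N g : AE} {a : Arr} {v : AE} (hN : N.eval I σ 0 ≤ B)
    (hv : ∀ i < N.eval I σ 0, g.eval I σ i ≠ 0 → v.eval I σ i ≤ B)
    (h : ∀ σ' : St, (∀ x, σ' a x =
        if x < N.eval I σ 0 ∧ g.eval I σ x ≠ 0 then v.eval I σ x else σ a x) →
      (∀ b, b ≠ a → σ' b = σ b) → Q σ' (N.eval I σ 0 + 1) 1) :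
    Ok I B (.map N g a v) σ Q := by
  refine Ok.par hN hv (h _ ?_ ?_)
  · intro x
    rw [Function.update_self]
    convert scatter_id _ _ _ _ x
    rfl
  · intro b hb; rw [Function.update_of_ne hb]

theorem Ok.scat {N g : AE} {a : Arr} {idx v : AE} (hN : N.eval I σ 0 ≤ B)
    (hv : ∀ i < N.eval I σ 0, g.eval I σ i ≠ 0 → v.eval I σ i ≤ B)
    (h : ∀ σ' : St, (σ' a = scatter (N.eval I σ 0) (fun i => g.eval I σ i ≠ 0)
          (idx.eval I σ ·) (v.eval I σ ·) (σ a)) →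
      (∀ b, b ≠ a → σ' b = σ b) → Q σ' (N.eval I σ 0 + 1) 1) :
    Ok I B (.par N g a idx v) σ Q := by
  refine Ok.par hN hv (h _ ?_ ?_)
  · rw [Function.update_self]
  · intro b hb; rw [Function.update_of_ne hb]

end

/-! ### Suffix sums and block minima by doubling. -/

open AE

@[simp high] theorem ind_mul_ind (p q : Prop) [Decidable p] [Decidable q] :
    ((if p then 1 else 0) * (if q then 1 else 0) : ℕ) = if p ∧ q then 1 else 0 := by
  by_cases p <;> by_cases q <;> simp [*]

/-- Suffix sums of the first `kk` cells of `f`. -/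
def scanP : AProg :=
  .seq (.set .j1 1) <| .loop (lt (sc .j1) (sc .kk)) <|
    .seq (.map (sc .kk) (lt (pid + sc .j1) (sc .kk)) .f (rd .f pid + rd .f (pid + sc .j1)))
      (.set .j1 (sc .j1 * 2))

/-- Doubling: after `i` rounds cell `r` holds the sum of the window of length `2 ^ i` that starts at
`r`, cut off at `K`. Sums run towards the end so that the total lands in cell `0`, whose address
does not depend on `K`. Every window sum is at most the total, which is why `hf` alone prevents
overflow. -/
theorem scanP_ok {I : ℕ → ℕ} {B K Λ : ℕ} {σ : St} (hB : 2 * K + 1 ≤ B) (hK : σ .kk 0 = K)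
    (hf : ∑ r ∈ Finset.range K, σ .f r ≤ B) (hΛ : K ≤ 2 ^ Λ) :
    Ok I B scanP σ fun σ' k d => (∀ r < K, σ' .f r = ∑ q ∈ Finset.Ico r K, σ .f q) ∧
      Same [.f, .j1] σ σ' ∧ k ≤ (K + 7) * (Λ + 1) ∧ d ≤ 5 * (Λ + 1) := by
  have hsub : ∀ a b : ℕ, b ≤ K → ∑ q ∈ Finset.Ico a b, σ .f q ≤ B := fun a b hb =>
    (Finset.sum_le_sum_of_subset (fun x hx => by simp at hx ⊢; omega)).trans hf
  refine Ok.seq (Ok.set (by omega) (by simp; omega) fun σ₁ h1 h1' => ?_)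
  simp only [eval_ofNat] at h1
  refine Ok.loop (Nat.clog 2 K) (K + 3) 2 (fun i σ' => σ' .j1 0 = 2 ^ i ∧
    (∀ r < K, σ' .f r = ∑ q ∈ Finset.Ico r (min K (r + 2 ^ i)), σ .f q) ∧
      Same [.f, .j1] σ σ') ?_ ?_ ?_ ?_
  · refine ⟨by simpa using h1, fun r hr => ?_, Same.of_ne h1' (by simp)⟩
    rw [h1' _ (by simp), min_eq_right (by simpa using hr)]
    simp
  · rintro i hi σ₂ ⟨hj, hF, hS⟩
    have hlt := Nat.pow_lt_of_lt_clog hi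
    have hkk : σ₂ .kk 0 = K := by rw [hS _ (by simp), hK]
    have key : ∀ r, r + 2 ^ i < K → σ₂ .f r + σ₂ .f (r + 2 ^ i) =
        ∑ q ∈ Finset.Ico r (min K (r + 2 ^ (i + 1))), σ .f q := by
      intro r hr
      rw [hF r (by omega), hF _ hr, min_eq_right hr.le, Finset.sum_Ico_consecutive _ (by omega)]
      · congr 2; rw [pow_succ]; congr 1; omega
      · rw [le_min_iff]; omega
    refine ⟨by simp [hj, hkk, hlt], Ok.seq (Ok.map (by simp [hkk]; omega) ?_ ?_)⟩
    · intro r hr hg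
      simp [hkk, hj] at hr hg ⊢
      rw [key r hg]
      exact hsub _ _ (min_le_left _ _)
    · intro σ₃ h3 h3'
      refine Ok.set (by omega) (by simp [h3', hj]; omega) fun σ₄ h4 h4' => ?_
      simp only [eval_mul, eval_sc, eval_ofNat] at h4
      refine ⟨⟨?_, ?_, ?_⟩, ?_, by omega⟩
      · rw [h4, h3' _ (by simp), hj, pow_succ]
      · intro r hr
        rw [h4' _ (by simp), h3]
        simp only [eval_sc, hkk, hr, eval_lt, eval_pid, eval_add, eval_rd, hj, true_and]
        by_cases hg : r + 2 ^ i < K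
        · simp [hg, key r hg]
        · have h2 : 2 ^ i ≤ 2 ^ (i + 1) := Nat.pow_le_pow_right (by omega) (by omega)
          simp only [hg, if_false, ne_eq, not_true_eq_false]
          rw [hF r hr, min_eq_left (by omega), min_eq_left (by omega)]
      · exact (hS.trans (Same.of_ne h3' (by simp))).trans (Same.of_ne h4' (by simp))
      · simp [hkk]
  · rintro σ₂ ⟨hj, hF, hS⟩
    have hkk : σ₂ .kk 0 = K := by rw [hS _ (by simp), hK]
    have := Nat.le_pow_clog one_lt_two K
    simp [hj, hkk, this]
  · rintro σ₂ k d ⟨hj, hF, hS⟩ hk hd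
    have hc : Nat.clog 2 K ≤ Λ := (Nat.clog_le_iff_le_pow (by omega)).2 hΛ
    refine ⟨fun r hr => ?_, hS, ?_, ?_⟩
    · have := Nat.le_pow_clog one_lt_two K
      rw [hF r hr, min_eq_left (by omega)]
    · nlinarith
    · nlinarith

/-- Minima of the blocks of length `tt` of `big`, to the first cell of each block. -/
def minP : AProg :=
  .seq (.set .j1 1) <| .loop (lt (sc .j1) (sc .tt)) <|
    .seq (.map (sc .tt * sc .tt * sc .tt)
        (lt (pid % sc .tt + sc .j1) (sc .tt) * lt (rd .big (pid + sc .j1)) (rd .big pid)) .big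
        (rd .big (pid + sc .j1)))
      (.set .j1 (sc .j1 * 2))

/-- Doubling again, with windows of length `2 ^ i` inside each block. The guard on `pid % tt` keeps
a window from running into the next block, so a cell near the end of its block simply keeps its
value. Tracking a witness cell shows that the minimum is attained, not merely bounded. -/
theorem minP_ok {I : ℕ → ℕ} {B T Λ : ℕ} {σ : St} (hB : 2 * T * T * T + 1 ≤ B)
    (hT : σ .tt 0 = T) (hb : ∀ r < T * T * T, σ .big r ≤ B) (hΛ : T ≤ 2 ^ Λ) :
    Ok I B minP σ fun σ' k d => (∀ x < T * T, (∀ z < T, σ' .big (x * T) ≤ σ .big (x * T + z)) ∧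
        ∃ z < T, σ' .big (x * T) = σ .big (x * T + z)) ∧
      Same [.big, .j1] σ σ' ∧ k ≤ (T * T * T + 7) * (Λ + 1) ∧ d ≤ 5 * (Λ + 1) := by
  have hTB : 2 * T + 1 ≤ B := by
    rcases Nat.eq_zero_or_pos T with rfl | h
    · simpa using hB
    · have : T ≤ T * T * T := by nlinarith [Nat.mul_le_mul h h]
      linarith
  have hTB' : T * T * T ≤ B := by
    have : 2 * T * T * T = T * T * T + T * T * T := by ring
    omega
  have hidx : ∀ x z, x < T * T → z < T → x * T + z < T * T * T := by
    intro x z hx hz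
    have : (x + 1) * T ≤ T * T * T := Nat.mul_le_mul_right _ hx
    rw [add_mul] at this; omega
  refine Ok.seq (Ok.set (by omega) (by simp; omega) fun σ₁ h1 h1' => ?_)
  simp only [eval_ofNat] at h1
  refine Ok.loop (Nat.clog 2 T) (T * T * T + 3) 2 (fun i σ' => σ' .j1 0 = 2 ^ i ∧
    (∀ x < T * T, ∀ z < T,
      (∀ y < T, z ≤ y → y < z + 2 ^ i → σ' .big (x * T + z) ≤ σ .big (x * T + y)) ∧
      ∃ y < T, σ' .big (x * T + z) = σ .big (x * T + y)) ∧
      Same [.big, .j1] σ σ') ?_ ?_ ?_ ?_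
  · refine ⟨by simpa using h1, fun x hx z hz => ⟨fun y hy h2 h3 => ?_, z, hz, ?_⟩,
      Same.of_ne h1' (by simp)⟩
    · obtain rfl : y = z := by simp at h3; omega
      rw [h1' _ (by simp)]
    · rw [h1' _ (by simp)]
  · rintro i hi σ₂ ⟨hj, hF, hS⟩
    have hlt := Nat.pow_lt_of_lt_clog hi
    have hkk : σ₂ .tt 0 = T := by rw [hS _ (by simp), hT]
    refine ⟨by simp [hj, hkk, hlt], Ok.seq (Ok.map (by simpa [hkk] using hTB') ?_ ?_)⟩
    · intro r hr hg
      simp [hkk, hj] at hr hg ⊢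
      have hg1 := hg.1
      have hx : r / T < T * T := Nat.div_lt_of_lt_mul (by rwa [mul_comm])
      have hr' : r = r / T * T + r % T := (Nat.div_add_mod' r T).symm
      obtain ⟨y, hy, he⟩ := (hF _ hx _ hg1).2
      rw [hr', add_assoc, he]
      exact hb _ (hidx _ _ hx hy)
    · intro σ₃ h3 h3'
      refine Ok.set (by omega) (by simp [h3', hj]; omega) fun σ₄ h4 h4' => ?_
      simp only [eval_mul, eval_sc, eval_ofNat] at h4
      refine ⟨⟨?_, ?_, ?_⟩, ?_, by omega⟩
      · rw [h4, h3' _ (by simp), hj, pow_succ]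
      · intro x hx z hz
        have e1 : (x * T + z) % T = z := by rw [Nat.mul_add_mod', Nat.mod_eq_of_lt hz]
        have e2 : σ₄ .big (x * T + z) = if z + 2 ^ i < T ∧
            σ₂ .big (x * T + (z + 2 ^ i)) < σ₂ .big (x * T + z) then
            σ₂ .big (x * T + (z + 2 ^ i)) else σ₂ .big (x * T + z) := by
          rw [h4' _ (by simp), h3]
          simp [hkk, hj, e1, hidx x z hx hz, add_assoc]
        rw [e2]
        obtain ⟨ha, y, hy, hye⟩ := hF x hx z hz
        split_ifs with hg
        · obtain ⟨hb', y', hy', hye'⟩ := hF x hx _ hg.1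
          refine ⟨fun w hw h5 h6 => ?_, y', hy', hye'⟩
          by_cases h7 : w < z + 2 ^ i
          · exact hg.2.le.trans (ha w hw h5 h7)
          · exact hb' w hw (by omega) (by rw [pow_succ] at h6; omega)
        · refine ⟨fun w hw h5 h6 => ?_, y, hy, hye⟩
          by_cases h7 : w < z + 2 ^ i
          · exact ha w hw h5 h7
          · have hg1 : z + 2 ^ i < T := by omega
            have := (hF x hx _ hg1).1 w hw (by omega) (by rw [pow_succ] at h6; omega)
            refine le_trans ?_ this
            by_contra h8
            exact hg ⟨hg1, by omega⟩
      · exact (hS.trans (Same.of_ne h3' (by simp))).trans (Same.of_ne h4' (by simp))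
      · simp [hkk]
  · rintro σ₂ ⟨hj, hF, hS⟩
    have hkk : σ₂ .tt 0 = T := by rw [hS _ (by simp), hT]
    have := Nat.le_pow_clog one_lt_two T
    simp [hj, hkk, this]
  · rintro σ₂ k d ⟨hj, hF, hS⟩ hk hd
    have hc : Nat.clog 2 T ≤ Λ := (Nat.clog_le_iff_le_pow (by omega)).2 hΛ
    refine ⟨fun x hx => ?_, hS, ?_, ?_⟩
    · have h0 : 0 < T := by
        rcases Nat.eq_zero_or_pos T with rfl | h
        · simp at hx
        · exact h
      obtain ⟨ha, y, hy, hye⟩ := hF x hx 0 h0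
      have := Nat.le_pow_clog one_lt_two T
      exact ⟨fun z hz => ha z hz (by omega) (by omega), y, hy, hye⟩
    · have := Nat.mul_le_mul_right (T * T * T + 3 + 1) hc
      linarith [Nat.zero_le (Λ * 3), Nat.zero_le (T * T * T)]
    · linarith


open AE

/-! ### Breadth-first search with delays -/

/-- The queue `q` of length `len` lists the marked keys below `U` without repetition. -/
structure QueueInv (U len : ℕ) (q vis : ℕ → ℕ) : Prop where
  lt : ∀ i < len, q i < U
  inj : ∀ i < len, ∀ j < len, q i = q j → i = j
  marked : ∀ i < len, vis (q i) ≠ 0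
  mem : ∀ y < U, vis y ≠ 0 → ∃ i < len, q i = y

theorem QueueInv.len_le {U len : ℕ} {q vis : ℕ → ℕ} (h : QueueInv U len q vis) : len ≤ U := by
  have := Finset.card_le_card_of_injOn (s := Finset.range len) (t := Finset.range U) q
    (fun i hi => by simpa using h.lt i (by simpa using hi))
    (fun i hi j hj he => h.inj i (by simpa using hi) j (by simpa using hj) he)
  simpa using this

/-- Appending the targets with indices in `R`, sorted by the number of later elements of `R`. -/
theorem QueueInv.append {U len K : ℕ} {q vis : ℕ → ℕ} (h : QueueInv U len q vis)
    {f tg q' vis' : ℕ → ℕ} (hf : ∀ r < K, f r ≤ 1) (htg : ∀ r < K, tg r < U)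
    (hfresh : ∀ r < K, f r ≠ 0 → vis (tg r) = 0)
    (hinj : ∀ r < K, ∀ r' < K, f r ≠ 0 → f r' ≠ 0 → tg r = tg r' → r = r')
    (hq' : q' = scatter K (fun r => f r ≠ 0) (fun r => len + ∑ i ∈ Finset.Ico r K, f i - 1) tg q)
    (hvis' : vis' = scatter K (fun r => f r ≠ 0) tg (fun _ => 1) vis) :
    QueueInv U (len + ∑ i ∈ Finset.Ico 0 K, f i) q' vis' ∧ (∀ i < len, q' i = q i) ∧
      (∀ i, len ≤ i → i < len + ∑ i ∈ Finset.Ico 0 K, f i →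
        ∃ r < K, f r ≠ 0 ∧ q' i = tg r) ∧ (∀ r < K, f r ≠ 0 → vis' (tg r) ≠ 0) ∧
      (∀ y, vis y ≠ 0 → vis' y ≠ 0) := by
  have hS : ∀ r < K, ∑ i ∈ Finset.Ico r K, f i = f r + ∑ i ∈ Finset.Ico (r + 1) K, f i :=
    fun r hr => Finset.sum_eq_sum_Ico_succ_bot hr f
  have hanti : ∀ r r', r ≤ r' → ∑ i ∈ Finset.Ico r' K, f i ≤ ∑ i ∈ Finset.Ico r K, f i :=
    fun r r' hr => Finset.sum_le_sum_of_subset (Finset.Ico_subset_Ico_left hr)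
  have hpos : ∀ r < K, f r ≠ 0 → 1 ≤ ∑ i ∈ Finset.Ico r K, f i := fun r hr h0 => by
    rw [hS r hr]; omega
  have hstrict : ∀ r r', r < r' → r < K → f r ≠ 0 →
      ∑ i ∈ Finset.Ico r' K, f i < ∑ i ∈ Finset.Ico r K, f i := fun r r' hr hK h0 => by
    rw [hS r hK]; have := hanti (r + 1) r' hr; omega
  have hposn : ∀ r < K, ∀ r' < K, f r ≠ 0 → f r' ≠ 0 →
      len + ∑ i ∈ Finset.Ico r K, f i - 1 = len + ∑ i ∈ Finset.Ico r' K, f i - 1 → r = r' := by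
    intro r hr r' hr' h0 h0' he
    have h1 := hpos r hr h0
    have h2 := hpos r' hr' h0'
    rcases lt_trichotomy r r' with h | h | h
    · have := hstrict r r' h hr h0; omega
    · exact h
    · have := hstrict r' r h hr' h0'; omega
  have hold : ∀ i < len, q' i = q i := by
    intro i hi
    rw [hq']
    refine scatter_of_forall fun r hr h0 => ?_
    have := hpos r hr h0
    omega
  have hnew : ∀ r < K, f r ≠ 0 → q' (len + ∑ i ∈ Finset.Ico r K, f i - 1) = tg r := by
    intro r hr h0
    rw [hq']
    exact scatter_inj (g := fun r => f r ≠ 0)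
      (idx := fun r => len + ∑ i ∈ Finset.Ico r K, f i - 1) hr h0
      fun r' hr' h0' he => hposn r' hr' r hr h0' h0 he
  -- Going from `r` to `r + 1` a suffix sum drops by the flag `f r`, which is `0` or `1`; hence
  -- between the total and `0` no value is skipped and the new queue positions are filled without
  -- gaps.
  have hsurj : ∀ p < ∑ i ∈ Finset.Ico 0 K, f i, ∃ r < K, f r ≠ 0 ∧
      ∑ i ∈ Finset.Ico r K, f i = p + 1 := by
    intro p hp
    have h1 : ∃ r, ∑ i ∈ Finset.Ico r K, f i ≤ p := ⟨K, by simp⟩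
    classical
    have h2 := Nat.find_spec h1
    have h3 : Nat.find h1 ≠ 0 := fun h => by rw [h] at h2; omega
    obtain ⟨r, hr⟩ := Nat.exists_eq_succ_of_ne_zero h3
    have h4 := Nat.find_min h1 (m := r) (by omega)
    rw [hr] at h2
    replace h2 : ∑ i ∈ Finset.Ico (r + 1) K, f i ≤ p := h2
    have hrK : r < K := by
      by_contra hrK
      rw [Finset.Ico_eq_empty (by omega)] at h4
      simp at h4
    have h5 := hf r hrK
    have h6 := hS r hrK
    exact ⟨r, hrK, by omega, by omega⟩
  have hnew' : ∀ i, len ≤ i → i < len + ∑ i ∈ Finset.Ico 0 K, f i →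
      ∃ r < K, f r ≠ 0 ∧ q' i = tg r ∧ i = len + ∑ i ∈ Finset.Ico r K, f i - 1 := by
    intro i hi hi'
    obtain ⟨r, hr, h0, he⟩ := hsurj (i - len) (by omega)
    have hi2 : i = len + ∑ i ∈ Finset.Ico r K, f i - 1 := by omega
    exact ⟨r, hr, h0, by rw [hi2]; exact hnew r hr h0, hi2⟩
  have hv1 : ∀ r < K, f r ≠ 0 → vis' (tg r) ≠ 0 := by
    intro r hr h0
    obtain ⟨j, -, -, -, hj, -⟩ := scatter_spec (g := fun r => f r ≠ 0) (idx := tg)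
      (v := fun _ => 1) (old := vis) hr h0
    rw [hvis', hj]; simp
  have hv2 : ∀ y, vis y ≠ 0 → vis' y ≠ 0 := by
    intro y hy
    rw [hvis']
    rcases scatter_cases K (fun r => f r ≠ 0) tg (fun _ => 1) vis y with e | ⟨-, -, -, -, e⟩
    · rwa [e]
    · rw [e]; simp
  have hqnew : ∀ r < K, f r ≠ 0 → ∃ i < len + ∑ i ∈ Finset.Ico 0 K, f i, q' i = tg r := by
    intro r hr h0
    have h1 := hpos r hr h0
    have h2 := hanti 0 r (by omega)
    exact ⟨_, by omega, hnew r hr h0⟩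
  refine ⟨⟨?_, ?_, ?_, ?_⟩, hold, fun i hi hi' => ?_, hv1, hv2⟩
  · intro i hi
    by_cases hl : i < len
    · rw [hold i hl]; exact h.lt i hl
    · obtain ⟨r, hr, h0, he, -⟩ := hnew' i (by omega) hi
      rw [he]; exact htg r hr
  · intro i hi j hj he
    by_cases hl : i < len <;> by_cases hl' : j < len
    · rw [hold i hl, hold j hl'] at he; exact h.inj i hl j hl' he
    · obtain ⟨r, hr, h0, he', -⟩ := hnew' j (by omega) hj
      rw [hold i hl, he'] at he
      exact absurd (hfresh r hr h0) (he ▸ h.marked i hl)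
    · obtain ⟨r, hr, h0, he', -⟩ := hnew' i (by omega) hi
      rw [hold j hl', he'] at he
      exact absurd (hfresh r hr h0) (he ▸ h.marked j hl')
    · obtain ⟨r, hr, h0, he1, e1⟩ := hnew' i (by omega) hi
      obtain ⟨r', hr', h0', he2, e2⟩ := hnew' j (by omega) hj
      rw [he1, he2] at he
      rw [e1, e2, hinj r hr r' hr' h0 h0' he]
  · intro i hi
    by_cases hl : i < len
    · rw [hold i hl]; exact hv2 _ (h.marked i hl)
    · obtain ⟨r, hr, h0, he, -⟩ := hnew' i (by omega) hi
      rw [he]; exact hv1 r hr h0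
  · intro y hy hv
    rw [hvis'] at hv
    rcases scatter_cases K (fun r => f r ≠ 0) tg (fun _ => 1) vis y with e | ⟨r, hr, h0, rfl, -⟩
    · rw [e] at hv
      obtain ⟨i, hi, rfl⟩ := h.mem y hy hv
      exact ⟨i, by omega, hold i hi⟩
    · exact hqnew r hr h0
  · obtain ⟨r, hr, h0, he, -⟩ := hnew' i hi hi'
    exact ⟨r, hr, h0, he⟩

/-- The key that processor `pid` expands: a third of the processors for each kind of link. -/
def keyE : AE := rd .q (sc .aa + pid / 3)
/-- The index of the link that processor `pid` follows. -/
def linkE : AE := 3 * (keyE % sc .nn) + pid % 3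

/-- Follow the links of delay exponent `j2` from the `kk / 3` keys in the queue from position `aa`
on, and append the new keys to the queue. -/
def stepP : AProg :=
  .seq (.map (sc .kk) 1 .tg (keyE / sc .nn * sc .nn + rd .lk linkE)) <|
  .seq (.map (sc .kk) 1 .e (eq (rd .kl linkE - sc .si) (sc .j2) * not (rd .vis (rd .tg pid)))) <|
  .seq (.par (sc .kk) (rd .e pid) .own (rd .tg pid) pid) <|
  .seq (.map (sc .kk) 1 .f (rd .e pid * eq (rd .own (rd .tg pid)) pid)) <|
  .seq (.map (sc .kk) 1 .e (rd .f pid)) <|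
  .seq scanP <|
  .seq (.par (sc .kk) (rd .e pid) .q (sc .len + rd .f pid - 1) (rd .tg pid)) <|
  .seq (.par (sc .kk) (rd .e pid) .vis (rd .tg pid) 1) <|
  .par 1 (lt 0 (sc .kk)) .len 0 (sc .len + rd .f 0)

/-- The key reached by link `c` from key `y`. -/
def keyTgt (N : ℕ) (lk : ℕ → ℕ) (y c : ℕ) : ℕ := y / N * N + lk (3 * (y % N) + c)

/-- The delay exponent of link `c` from key `y`. -/
def keyCls (N : ℕ) (kl : ℕ → ℕ) (si y c : ℕ) : ℕ := kl (3 * (y % N) + c) - si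

/-- Several processors may reach the same unmarked key. They all write their index to `own` at that
key, and only the one that finds itself there sets its flag, so fresh keys are appended once. The
flags are copied to `e` because the scan overwrites `f`; the suffix sums then serve as queue
positions. For `K = 0` the scan leaves `f 0` meaningless, hence the guarded update of `len`. -/
theorem stepP_ok {I : ℕ → ℕ} {B U K Λ A N L j : ℕ} {σ : St} (hB : 2 * K + 1 ≤ B) (hUB : U ≤ B)
    (hK : σ .kk 0 = K) (hN : σ .nn 0 = N) (hA : σ .aa 0 = A) (hL : σ .len 0 = L)
    (hj : σ .j2 0 = j) (hΛ : K ≤ 2 ^ Λ) (hQ : QueueInv U L (σ .q) (σ .vis))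
    (hU : ∀ r < K, keyTgt N (σ .lk) (σ .q (A + r / 3)) (r % 3) < U) :
    Ok I B stepP σ fun σ' k d => QueueInv U (σ' .len 0) (σ' .q) (σ' .vis) ∧ L ≤ σ' .len 0 ∧
      (∀ i < L, σ' .q i = σ .q i) ∧
      (∀ i, L ≤ i → i < σ' .len 0 → ∃ r < K,
        keyCls N (σ .kl) (σ .si 0) (σ .q (A + r / 3)) (r % 3) = j ∧
        σ' .q i = keyTgt N (σ .lk) (σ .q (A + r / 3)) (r % 3)) ∧
      (∀ r < K, keyCls N (σ .kl) (σ .si 0) (σ .q (A + r / 3)) (r % 3) = j →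
        σ' .vis (keyTgt N (σ .lk) (σ .q (A + r / 3)) (r % 3)) ≠ 0) ∧
      Same [.tg, .e, .own, .f, .j1, .q, .vis, .len] σ σ' ∧
      k ≤ (8 * K + 16) * (Λ + 1) ∧ d ≤ 13 * (Λ + 1) := by
  classical
  set tg : ℕ → ℕ := fun r => keyTgt N (σ .lk) (σ .q (A + r / 3)) (r % 3) with htg
  set cl : ℕ → ℕ := fun r => keyCls N (σ .kl) (σ .si 0) (σ .q (A + r / 3)) (r % 3) with hcl
  have hKB : K ≤ B := by omega
  refine Ok.seq (Ok.map (by simpa [hK] using hKB) ?_ fun σ₁ h1 f1 => ?_)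
  · intro r hr _
    simp only [eval_sc, hK] at hr
    simp [keyE, linkE, hN, hA]
    exact (hU r hr).le.trans hUB
  have t1 : ∀ r < K, σ₁ .tg r = tg r := by
    intro r hr
    rw [h1]; simp [hK, hr, keyE, linkE, hN, hA, htg, keyTgt]
  have nd : ([Arr.tg, .e, .own, .f, .j1, .q, .vis, .len] : List Arr).Nodup := by decide
  refine Ok.seq (Ok.map (by simpa [f1, hK] using hKB) ?_ fun σ₂ h2 f2 => ?_)
  · intro r hr _
    simp only [eval_mul, eval_eq, eval_not, ind_mul_ind]
    split_ifs <;> omega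
  have t2 : ∀ r < K, σ₂ .e r = if cl r = j ∧ σ .vis (tg r) = 0 then 1 else 0 := by
    intro r hr
    rw [h2]
    simp [f1, hK, hr, keyE, linkE, hN, hA, hj, hcl, keyCls, t1]
  refine Ok.seq (Ok.scat (by simpa [f1, f2, hK] using hKB) ?_ fun σ₃ h3 f3 => ?_)
  · intro r hr _
    simp [f1, f2, hK] at hr ⊢
    omega
  have eN3 : AE.eval I σ₂ 0 (sc .kk) = K := by simp [f2, f1, hK]
  rw [eN3] at h3
  have t3 : ∀ r < K, cl r = j → σ .vis (tg r) = 0 → ∃ r' < K, cl r' = j ∧ tg r' = tg r ∧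
      σ₃ .own (tg r) = r' := by
    intro r hr hc hv
    obtain ⟨r', hr', hg, he, hs, -⟩ := scatter_spec (N := K)
      (g := fun i => AE.eval I σ₂ i (rd .e pid) ≠ 0) (idx := fun i => AE.eval I σ₂ i (rd .tg pid))
      (v := fun i => AE.eval I σ₂ i pid) (old := σ₂ .own) hr (by simp [t2, hr, hc, hv])
    have hrK : r' < K := by omega
    simp only [eval_rd, eval_pid, f2 .tg (by simp), t1, hr, hrK, t2] at he hg
    refine ⟨r', hrK, ?_, he, ?_⟩
    · by_contra hne
      simp [hne] at hg
    · have e : tg r = AE.eval I σ₂ r (rd .tg pid) := by simp [f2, t1 r hr]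
      rw [h3, e]; exact hs
  refine Ok.seq (Ok.map (by simpa [f1, f2, f3, hK] using hKB) ?_ fun σ₄ h4 f4 => ?_)
  · intro r hr _
    simp [f1, f2, f3, hK] at hr
    simp [f3, t2, hr]
    split_ifs <;> omega
  have t4 : ∀ r < K, σ₄ .f r =
      if (cl r = j ∧ σ .vis (tg r) = 0) ∧ σ₃ .own (tg r) = r then 1 else 0 := by
    intro r hr
    rw [h4]
    simp only [f3 .kk (by simp), eval_sc, eval_ofNat, hr, ne_eq, one_ne_zero,
      not_false_eq_true, eval_mul, eval_rd, eval_eq, eval_pid,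
      f3 .e (by simp), t2, f3 .tg (by simp), f2 .tg (by simp), t1, ind_mul_ind]
    simp [f2, f1, hK, hr]
  refine Ok.seq (Ok.map (by simpa [f1, f2, f3, f4, hK] using hKB) ?_ fun σ₅ h5 f5 => ?_)
  · intro r hr _
    simp [f1, f2, f3, f4, hK] at hr
    simp [t4, hr]
    split_ifs <;> omega
  have t5 : ∀ r < K, σ₅ .e r = σ₄ .f r := by
    intro r hr
    rw [h5]; simp [f1, f2, f3, f4, hK, hr]
  have f4le : ∀ r < K, σ₄ .f r ≤ 1 := fun r hr => by rw [t4 r hr]; split_ifs <;> simp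
  refine Ok.seq ((scanP_ok (K := K) (Λ := Λ) hB (by simp [f1, f2, f3, f4, f5, hK]) ?_ hΛ).imp ?_)
  · rw [f5 _ (by simp)]
    refine (Finset.sum_le_card_nsmul _ _ 1 fun r hr => f4le r (by simpa using hr)).trans ?_
    simpa using hKB
  rintro σ₆ k6 d6 ⟨h6, S6, hk6, hd6⟩
  rw [f5 .f (by simp)] at h6
  have e6 : ∀ r < K, σ₆ .e r = σ₄ .f r := fun r hr => by rw [S6 _ (by simp), t5 r hr]
  have tg6 : ∀ r < K, σ₆ .tg r = tg r := fun r hr => by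
    rw [S6 _ (by simp)]; simp [f5, f4, f3, f2, t1, hr]
  have kk6 : σ₆ .kk 0 = K := by rw [S6 _ (by simp)]; simp [f5, f4, f3, f2, f1, hK]
  have len6 : σ₆ .len 0 = L := by rw [S6 _ (by simp)]; simp [f5, f4, f3, f2, f1, hL]
  have q6 : σ₆ .q = σ .q := by rw [S6 _ (by simp)]; simp [f5, f4, f3, f2, f1]
  have vis6 : σ₆ .vis = σ .vis := by rw [S6 _ (by simp)]; simp [f5, f4, f3, f2, f1]
  have ex : ∀ {N : ℕ} {g g' : ℕ → Prop} {i i' v v' o o' : ℕ → ℕ}, (∀ r < N, g r ↔ g' r) →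
      (∀ r < N, i r = i' r) → (∀ r < N, v r = v' r) → o = o' →
      scatter N g i v o = scatter N g' i' v' o' := by
    intro N g g' i i' v v' o o' hg hi hv ho
    subst ho
    funext x
    have hiff : ∀ r, (r < N ∧ g r ∧ i r = x) ↔ (r < N ∧ g' r ∧ i' r = x) := fun r =>
      and_congr_right fun hr => by rw [hg r hr, hi r hr]
    unfold scatter
    by_cases H : ∃ r, r < N ∧ g r ∧ i r = x
    · have H' : ∃ r, r < N ∧ g' r ∧ i' r = x := by obtain ⟨r, h⟩ := H; exact ⟨r, (hiff r).1 h⟩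
      have hf : Nat.find H = Nat.find H' := Nat.find_congr' (hiff _)
      rw [dif_pos H, dif_pos H', hf]
      exact hv _ (Nat.find_spec H').1
    · have H' : ¬ ∃ r, r < N ∧ g' r ∧ i' r = x := by
        rintro ⟨r, h⟩; exact H ⟨r, (hiff r).2 h⟩
      rw [dif_neg H, dif_neg H']
  refine Ok.seq (Ok.scat (by simpa [kk6] using hKB) ?_ fun σ₇ h7 f7 => ?_)
  · intro r hr _
    simp only [eval_sc, kk6] at hr
    simp only [eval_rd, eval_pid, tg6 r hr]
    exact (hU r hr).le.trans hUB
  refine Ok.seq (Ok.scat (by simpa [f7, kk6] using hKB) ?_ fun σ₈ h8 f8 => ?_)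
  · intro r hr _
    simp; omega
  have q7 : σ₇ .q = scatter K (fun r => σ₄ .f r ≠ 0)
      (fun r => L + ∑ i ∈ Finset.Ico r K, σ₄ .f i - 1) tg (σ .q) := by
    rw [h7]
    simp only [eval_sc, kk6]
    refine ex ?_ ?_ ?_ q6
    · intro r hr; simp [e6 r hr]
    · intro r hr; simp [len6, h6 r hr]
    · intro r hr; simp [tg6 r hr]
  have vis8 : σ₈ .vis = scatter K (fun r => σ₄ .f r ≠ 0) tg (fun _ => 1) (σ .vis) := by
    rw [h8]
    simp only [eval_sc, f7 .kk (by simp), kk6]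
    refine ex ?_ ?_ ?_ ?_
    · intro r hr; simp [f7, e6 r hr]
    · intro r hr; simp [f7, tg6 r hr]
    · intro r hr; simp
    · rw [f7 _ (by simp), vis6]
  have hfr : ∀ r < K, σ₄ .f r ≠ 0 →
      (cl r = j ∧ σ .vis (tg r) = 0) ∧ σ₃ .own (tg r) = r := fun r hr h0 => by
    rw [t4 r hr] at h0
    by_contra hne
    simp [hne] at h0
  obtain ⟨hQ', hold, hnew, hmark, hvmono⟩ := hQ.append f4le hU (fun r hr h0 => (hfr r hr h0).1.2)
    (fun r hr r' hr' h0 h0' he => by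
      have := (hfr r hr h0).2; have h' := (hfr r' hr' h0').2
      have he' : tg r = tg r' := he
      rw [← this, ← h', he']) q7 vis8
  have hlenU := hQ'.len_le
  have f08 : 0 < K → σ₈ .f 0 = ∑ i ∈ Finset.Ico 0 K, σ₄ .f i := fun h0 => by
    rw [f8 _ (by simp), f7 _ (by simp), h6 0 h0]
  have S8 : Same [.tg, .e, .own, .f, .j1, .q, .vis, .len] σ σ₈ := by
    have a1 := Same.of_ne (l := [.tg, .e, .own, .f, .j1, .q, .vis, .len]) f1 (by simp)
    have a2 := Same.of_ne (l := [.tg, .e, .own, .f, .j1, .q, .vis, .len]) f2 (by simp)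
    have a3 := Same.of_ne (l := [.tg, .e, .own, .f, .j1, .q, .vis, .len]) f3 (by simp)
    have a4 := Same.of_ne (l := [.tg, .e, .own, .f, .j1, .q, .vis, .len]) f4 (by simp)
    have a5 := Same.of_ne (l := [.tg, .e, .own, .f, .j1, .q, .vis, .len]) f5 (by simp)
    have a6 := S6.mono (l' := [.tg, .e, .own, .f, .j1, .q, .vis, .len]) (by decide)
    have a7 := Same.of_ne (l := [.tg, .e, .own, .f, .j1, .q, .vis, .len]) f7 (by simp)
    have a8 := Same.of_ne (l := [.tg, .e, .own, .f, .j1, .q, .vis, .len]) f8 (by simp)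
    exact ((((((a1.trans a2).trans a3).trans a4).trans a5).trans a6).trans a7).trans a8
  refine Ok.setIf (by omega) ?_ fun σ₉ h9 h9' f9 => ?_
  · intro hg
    have h0 : 0 < K := Nat.pos_of_ne_zero (by simpa [f8, f7, kk6] using hg)
    simp only [eval_add, eval_sc, eval_rd, eval_ofNat, f08 h0, f8 .len (by simp),
      f7 .len (by simp), len6]
    exact hlenU.trans hUB
  have len9 : σ₉ .len 0 = L + ∑ i ∈ Finset.Ico 0 K, σ₄ .f i := by
    rcases Nat.eq_zero_or_pos K with h0 | h0
    · rw [h9' (by simp [f8, f7, kk6, h0]), f8 _ (by simp), f7 _ (by simp), len6]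
      simp [h0]
    · rw [h9 (by simp [f8, f7, kk6, h0])]
      simp [f08 h0, f8, f7, len6]
  have q9 : σ₉ .q = σ₇ .q := by rw [f9 _ (by simp), f8 _ (by simp)]
  have vis9 : σ₉ .vis = σ₈ .vis := by rw [f9 _ (by simp)]
  refine ⟨?_, by omega, ?_, ?_, ?_, S8.trans (Same.of_ne f9 (by simp)), ?_, ?_⟩
  · rw [len9, q9, vis9]; exact hQ'
  · rw [q9]; exact hold
  · intro i hi hi'
    rw [len9] at hi'
    obtain ⟨r, hr, h0, he⟩ := hnew i hi hi'
    exact ⟨r, hr, (hfr r hr h0).1.1, by rw [q9]; exact he⟩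
  · intro r hr hc
    rw [vis9]
    by_cases hv : σ .vis (tg r) = 0
    · obtain ⟨r', hr', hc', he, ho⟩ := t3 r hr hc hv
      have hf' : σ₄ .f r' ≠ 0 := by
        rw [t4 r' hr', he]; simp [hc', hv, ho]
      have := hmark r' hr' hf'
      change σ₈ .vis (tg r) ≠ 0
      rw [← he]; exact this
    · exact hvmono _ hv
  · simp only [eval_sc, hK, f1 .kk (by simp), f2 .kk (by simp), f3 .kk (by simp),
      f4 .kk (by simp), f7 .kk (by simp), kk6]
    nlinarith
  · linarith


/-! ### Rounds of the delayed search. -/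

open AE

/-- `KeyReach S tgt cls y δ`: key `y` is reached from `S` along links of total delay `δ`. -/
inductive KeyReach (S : ℕ → Prop) (tgt cls : ℕ → ℕ → ℕ) : ℕ → ℕ → Prop
  | init {y : ℕ} (h : S y) : KeyReach S tgt cls y 0
  | step {y δ : ℕ} (h : KeyReach S tgt cls y δ) (c : ℕ) (hc : c < 3) :
      KeyReach S tgt cls (tgt y c) (δ + 2 ^ cls y c)

/-- The state of the search before time `t`: the keys settled at time `τ` occupy the positions
from `st τ` to `st (τ + 1)` of the queue. -/
structure BfsInv (S : ℕ → Prop) (tgt cls : ℕ → ℕ → ℕ) (U t len : ℕ) (st q vis : ℕ → ℕ) :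
    Prop where
  queue : QueueInv U len q vis
  zero : st 0 = 0
  mono : ∀ a b, a ≤ b → b ≤ t → st a ≤ st b
  last : st t = len
  sound : ∀ τ < t, ∀ i, st τ ≤ i → i < st (τ + 1) → KeyReach S tgt cls (q i) τ
  init : ∀ y, S y → ∃ i < st 1, q i = y
  complete : ∀ τ < t, ∀ i, st τ ≤ i → i < st (τ + 1) → ∀ c < 3, τ + 2 ^ cls (q i) c < t →
    ∃ i' < st (τ + 2 ^ cls (q i) c + 1), q i' = tgt (q i) c

theorem BfsInv.exists_segment {S : ℕ → Prop} {tgt cls : ℕ → ℕ → ℕ} {U t len : ℕ}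
    {st q vis : ℕ → ℕ} (h : BfsInv S tgt cls U t len st q vis) {s i : ℕ} (hs : s ≤ t)
    (hi : i < st s) : ∃ τ < s, st τ ≤ i ∧ i < st (τ + 1) := by
  induction s with
  | zero => rw [h.zero] at hi; omega
  | succ s ih =>
    by_cases h' : i < st s
    · obtain ⟨τ, h1, h2⟩ := ih (by omega) h'
      exact ⟨τ, by omega, h2⟩
    · exact ⟨s, by omega, by omega, hi⟩

/-- Marked keys lie in some queue segment, and segments are sound. Conversely, follow a chain of
links: a key reached with delay `δ` may have been settled at an earlier time, but then completeness
delivers the next key no later than the chain does, and monotonicity of `st` finishes the step. -/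
theorem BfsInv.vis_iff {S : ℕ → Prop} {tgt cls : ℕ → ℕ → ℕ} {U t len : ℕ}
    {st q vis : ℕ → ℕ} (h : BfsInv S tgt cls U t len st q vis) {y : ℕ} (hy : y < U) :
    vis y ≠ 0 ↔ ∃ δ < t, KeyReach S tgt cls y δ := by
  constructor
  · intro hv
    obtain ⟨i, hi, rfl⟩ := h.queue.mem y hy hv
    rw [← h.last] at hi
    obtain ⟨τ, h1, h2, h3⟩ := h.exists_segment le_rfl hi
    exact ⟨τ, h1, h.sound τ h1 i h2 h3⟩
  · rintro ⟨δ, hδ, hr⟩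
    have key : ∀ {y δ}, KeyReach S tgt cls y δ → δ < t → ∃ i < st (δ + 1), q i = y := by
      intro y δ hr
      induction hr with
      | init hS => intro _; exact h.init _ hS
      | @step y δ _ c hc ih =>
        intro hlt
        have h2 : 0 < 2 ^ cls y c := by positivity
        obtain ⟨i, hi, rfl⟩ := ih (by omega)
        obtain ⟨τ, h1, h3, h4⟩ := h.exists_segment (by omega) hi
        obtain ⟨i', hi', he⟩ := h.complete τ (by omega) i h3 h4 c hc (by omega)
        exact ⟨i', hi'.trans_le (h.mono _ _ (by omega) (by omega)), he⟩
    obtain ⟨i, hi, rfl⟩ := key hr hδ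
    exact h.queue.marked i (hi.trans_le (h.last ▸ h.mono _ _ (by omega) le_rfl))

/-- One round of the search: all links that arrive at time `tm`. -/
def bfsRoundP : AProg :=
  .seq (.set .j2 0) <| .seq (.set .pj 1) <|
  .seq (.loop (not (lt (sc .tm) (sc .pj))) <|
    .seq (.set .aa (rd .st (sc .tm - sc .pj))) <|
    .seq (.set .kk (3 * (rd .st (sc .tm - sc .pj + 1) - sc .aa))) <|
    .seq stepP <|
    .seq (.set .j2 (sc .j2 + 1)) (.set .pj (sc .pj * 2))) <|
  .seq (.par 1 1 .st (sc .tm + 1) (sc .len)) (.set .tm (sc .tm + 1))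

/-- The arrays changed by the search. -/
abbrev bfsArr : List Arr :=
  [.tg, .e, .own, .f, .j1, .q, .vis, .len, .j2, .pj, .aa, .kk, .st, .tm]

theorem stepP_same_bfsArr {σ σ' : St} (h : Same [.tg, .e, .own, .f, .j1, .q, .vis, .len] σ σ') :
    Same bfsArr σ σ' := h.mono (by decide)

/-- A link of exponent `j` arrives at time `t` exactly if its key was settled at time `t - 2 ^ j`.
So only `log₂ t + 1` segments of the queue need to be scanned, one per exponent. Keys appended in
this round lie behind all of these segments and do not disturb the scans. The work is left as the
sum of the segment lengths, to be summed over all rounds later. -/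
theorem bfsRoundP_ok {I : ℕ → ℕ} {B U Λ N t : ℕ} {S : ℕ → Prop} {σ : St}
    (hB : 6 * U + 2 * t + 3 ≤ B) (hN : σ .nn 0 = N) (ht : σ .tm 0 = t) (ht1 : 1 ≤ t)
    (hΛ : 3 * U ≤ 2 ^ Λ) (hU : ∀ y < U, ∀ c < 3, keyTgt N (σ .lk) y c < U)
    (hinv : BfsInv S (keyTgt N (σ .lk)) (keyCls N (σ .kl) (σ .si 0)) U t (σ .len 0) (σ .st)
      (σ .q) (σ .vis)) :
    Ok I B bfsRoundP σ fun σ' k d => σ' .tm 0 = t + 1 ∧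
      BfsInv S (keyTgt N (σ .lk)) (keyCls N (σ .kl) (σ .si 0)) U (t + 1) (σ' .len 0) (σ' .st)
        (σ' .q) (σ' .vis) ∧ (∀ a ≤ t, σ' .st a = σ .st a) ∧ Same bfsArr σ σ' ∧
      k ≤ 24 * (Λ + 1) * (∑ j ∈ Finset.range (Nat.log 2 t + 1),
          (σ .st (t - 2 ^ j + 1) - σ .st (t - 2 ^ j))) +
        (Nat.log 2 t + 1) * (16 * (Λ + 1) + 9) + 9 ∧
      d ≤ (Nat.log 2 t + 1) * (13 * (Λ + 1) + 5) + 5 := by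
  set st := σ .st with hst
  set tgt := keyTgt N (σ .lk) with htgt
  set cls := keyCls N (σ .kl) (σ .si 0) with hcls
  have hstU : ∀ a ≤ t, st a ≤ U := fun a ha =>
    (hinv.mono a t ha le_rfl).trans (hinv.last ▸ hinv.queue.len_le)
  have hlog : Nat.log 2 t < t := Nat.log_lt_self 2 (by omega)
  refine Ok.seq (Ok.set (by omega) (by simp) fun σ₁ h1 f1 => ?_)
  refine Ok.seq (Ok.set (by omega) (by simp; omega) fun σ₂ h2 f2 => ?_)
  simp only [eval_ofNat] at h1 h2
  have S2 : Same bfsArr σ σ₂ := (Same.of_ne f1 (by decide)).trans (Same.of_ne f2 (by decide))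
  refine Ok.seq (Ok.loop_acc (Nat.log 2 t + 1) (fun j σ' k d => σ' .j2 0 = j ∧ σ' .pj 0 = 2 ^ j ∧
    σ' .tm 0 = t ∧ σ' .st = st ∧ QueueInv U (σ' .len 0) (σ' .q) (σ' .vis) ∧
    st t ≤ σ' .len 0 ∧ (∀ i < st t, σ' .q i = σ .q i) ∧
    (∀ i, st t ≤ i → i < σ' .len 0 → KeyReach S tgt cls (σ' .q i) t) ∧
    (∀ τ < t, ∀ i, st τ ≤ i → i < st (τ + 1) → ∀ c < 3, τ + 2 ^ cls (σ .q i) c = t →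
      cls (σ .q i) c < j → ∃ i' < σ' .len 0, σ' .q i' = tgt (σ .q i) c) ∧
    Same bfsArr σ σ' ∧
    k ≤ 24 * (Λ + 1) * (∑ j ∈ Finset.range j, (st (t - 2 ^ j + 1) - st (t - 2 ^ j))) +
        j * (16 * (Λ + 1) + 9) ∧ d ≤ j * (13 * (Λ + 1) + 5)) ?_ ?_ ?_)
  · have e1 : ∀ a, a ≠ .j2 → a ≠ .pj → σ₂ a = σ a := fun a ha hb => by rw [f2 a hb, f1 a ha]
    refine ⟨by rw [f2 _ (by simp), h1], by rw [h2, pow_zero], ?_, ?_, ?_, ?_, ?_, ?_, ?_, S2, ?_, ?_⟩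
    · rw [e1 _ (by simp) (by simp), ht]
    · rw [e1 _ (by simp) (by simp)]
    · rw [e1 _ (by simp) (by simp), e1 _ (by simp) (by simp), e1 _ (by simp) (by simp)]
      exact hinv.queue
    · rw [e1 _ (by simp) (by simp), hinv.last]
    · intro i _; rw [e1 _ (by simp) (by simp)]
    · intro i hi hi'
      rw [e1 _ (by simp) (by simp), ← hinv.last] at hi'; omega
    · intro τ _ i _ _ c _ _ h0; omega
    · simp
    · simp
  · rintro j hj σ₃ k₀ d₀ ⟨a1, a2, a3, a4, hQ, hlen, hpre, hsnd, hcmp, S3, hk, hd⟩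
    have h2j : 2 ^ j ≤ t := Nat.pow_le_of_le_log (by omega) (by omega)
    have h2j1 : 0 < 2 ^ j := by positivity
    set s := t - 2 ^ j with hs
    have hst1 := hstU (s + 1) (by omega)
    have hstm := hinv.mono s (s + 1) (by omega) (by omega)
    have hstt := hinv.mono (s + 1) t (by omega) (by omega)
    refine ⟨by simp [a2, a3, h2j], ?_⟩
    refine Ok.seq (Ok.set (by omega) ?_ fun σ₄ h4 f4 => ?_)
    · simp only [eval_rd, eval_sub, eval_sc, a4, a3, a2]; exact (hstU _ (by omega)).trans (by omega)
    simp only [eval_rd, eval_sub, eval_sc, a4, a3, a2, ← hs] at h4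
    refine Ok.seq (Ok.set (by omega) ?_ fun σ₅ h5 f5 => ?_)
    · simp only [eval_rd, eval_sub, eval_mul, eval_ofNat, eval_add, eval_sc, f4 .st (by simp), a4,
        f4 .tm (by simp), f4 .pj (by simp), a3, a2, ← hs, h4]
      omega
    simp only [eval_rd, eval_sub, eval_mul, eval_ofNat, eval_add, eval_sc, f4 .st (by simp), a4,
        f4 .tm (by simp), f4 .pj (by simp), a3, a2, ← hs, h4] at h5
    have e5 : ∀ a, a ≠ .aa → a ≠ .kk → σ₅ a = σ₃ a := fun a ha hb => by rw [f5 a hb, f4 a ha]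
    have lk5 : σ₅ .lk = σ .lk := by
      rw [e5 _ (by simp) (by simp), S3 _ (by decide)]
    have kl5 : σ₅ .kl = σ .kl := by
      rw [e5 _ (by simp) (by simp), S3 _ (by decide)]
    have si5 : σ₅ .si = σ .si := by
      rw [e5 _ (by simp) (by simp), S3 _ (by decide)]
    have q5 : σ₅ .q = σ₃ .q := e5 _ (by simp) (by simp)
    have hqi : ∀ r < 3 * (st (s + 1) - st s), σ₅ .q (st s + r / 3) = σ .q (st s + r / 3) := by
      intro r hr
      rw [q5]; exact hpre _ (by omega)
    refine Ok.seq ((stepP_ok (U := U) (Λ := Λ) (by omega) (by omega) h5 (N := N) ?_ (A := st s) ?_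
      (L := σ₃ .len 0) ?_ (j := j) ?_ (by omega) ?_ ?_).imp ?_)
    · rw [e5 _ (by simp) (by simp), S3 _ (by decide), hN]
    · rw [f5 _ (by simp), h4]
    · rw [e5 _ (by simp) (by simp)]
    · rw [e5 _ (by simp) (by simp), a1]
    · rw [e5 _ (by simp) (by simp), e5 _ (by simp) (by simp)]; exact hQ
    · intro r hr
      rw [lk5, hqi r hr]
      exact hU _ (hinv.queue.lt _ (by rw [← hinv.last]; omega)) _ (Nat.mod_lt _ (by omega))
    rintro σ₆ k6 d6 ⟨b1, b2, b3, b4, b5, S6, hk6, hd6⟩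
    rw [lk5, kl5, si5, q5] at b4
    rw [lk5, kl5, si5, q5] at b5
    rw [q5] at b3
    have S6' := stepP_same_bfsArr S6
    have tm6 : σ₆ .tm 0 = t := by rw [S6 _ (by simp), e5 _ (by simp) (by simp), a3]
    have j6 : σ₆ .j2 0 = j := by rw [S6 _ (by simp), e5 _ (by simp) (by simp), a1]
    have pj6 : σ₆ .pj 0 = 2 ^ j := by rw [S6 _ (by simp), e5 _ (by simp) (by simp), a2]
    have st6 : σ₆ .st = st := by rw [S6 _ (by simp), e5 _ (by simp) (by simp), a4]
    refine Ok.seq (Ok.set (by omega) (by simp [j6]; omega) fun σ₇ h7 f7 => ?_)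
    refine Ok.set (by omega) (by simp [f7, pj6]; omega) fun σ₈ h8 f8 => ?_
    have e8 : ∀ a, a ≠ .j2 → a ≠ .pj → σ₈ a = σ₆ a := fun a ha hb => by rw [f8 a hb, f7 a ha]
    have q8 : σ₈ .q = σ₆ .q := e8 _ (by simp) (by simp)
    have len8 : σ₈ .len = σ₆ .len := e8 _ (by simp) (by simp)
    refine ⟨?_, ?_, ?_, ?_, ?_, ?_, ?_, ?_, ?_, ?_, ?_, ?_⟩
    · rw [f8 _ (by simp), h7]; simp [j6]
    · rw [h8]; simp [f7, pj6, pow_succ]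
    · rw [e8 _ (by simp) (by simp), tm6]
    · rw [e8 _ (by simp) (by simp), st6]
    · rw [len8, q8, e8 _ (by simp) (by simp)]; exact b1
    · rw [len8]; omega
    · intro i hi
      rw [q8, b3 i (by omega), hpre i hi]
    · intro i hi hi'
      rw [q8]
      rw [len8] at hi'
      by_cases hl : i < σ₃ .len 0
      · rw [b3 i hl]; exact hsnd i hi hl
      · obtain ⟨r, hr, hc, he⟩ := b4 i (by omega) hi'
        have hq := hqi r hr
        rw [q5] at hq
        rw [hq] at hc he
        have := (hinv.sound s (by omega) (st s + r / 3) (by omega) (by omega)).step (r % 3)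
          (Nat.mod_lt _ (by omega))
        rw [he]
        have hc' : cls (σ .q (st s + r / 3)) (r % 3) = j := hc
        rw [hc', show s + 2 ^ j = t by omega] at this
        exact this
    · intro τ hτ i hi hi' c hc he hlt
      rw [len8, q8]
      by_cases hcj : cls (σ .q i) c < j
      · obtain ⟨i', h1', h2'⟩ := hcmp τ hτ i hi hi' c hc he hcj
        exact ⟨i', by omega, by rw [b3 i' h1', h2']⟩
      · have hcj' : cls (σ .q i) c = j := by omega
        rw [hcj'] at he
        have hτs : τ = s := by omega
        subst hτs
        have hr : 3 * (i - st s) + c < 3 * (st (s + 1) - st s) := by omega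
        have hdiv : (3 * (i - st s) + c) / 3 = i - st s := by omega
        have hmod : (3 * (i - st s) + c) % 3 = c := by omega
        have hq := hqi _ hr
        rw [q5] at hq
        have := b5 _ hr
        rw [hq, hdiv, hmod, show st s + (i - st s) = i by omega] at this
        have hqU : σ .q i < U := hinv.queue.lt _ (by rw [← hinv.last]; omega)
        obtain ⟨i', h1', h2'⟩ := b1.mem _ (hU _ hqU c hc) (this hcj')
        exact ⟨i', h1', h2'⟩
    · exact (((S3.trans ((Same.of_ne f4 (by decide)).trans (Same.of_ne f5 (by decide)))).trans
        S6').trans (Same.of_ne f7 (by decide))).trans (Same.of_ne f8 (by decide))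
    · rw [Finset.sum_range_succ, mul_add, add_mul]
      have : (8 * (3 * (st (s + 1) - st s)) + 16) * (Λ + 1) =
        24 * (Λ + 1) * (st (s + 1) - st s) + 16 * (Λ + 1) := by ring
      rw [this] at hk6
      linarith
    · rw [add_mul]; linarith
  rintro σ₃ k d ⟨a1, a2, a3, a4, hQ, hlen, hpre, hsnd, hcmp, S3, hk, hd⟩
  have h2l : t < 2 ^ (Nat.log 2 t + 1) := Nat.lt_pow_succ_log_self (by omega) t
  refine ⟨by simp [a2, a3, h2l], ?_⟩
  have hlenU := hQ.len_le
  refine Ok.seq (Ok.scat (by simp; omega) ?_ fun σ₄ h4 f4 => ?_)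
  · intro i hi _
    simp; omega
  have st4 : σ₄ .st = Function.update st (t + 1) (σ₃ .len 0) := by
    rw [h4]
    simp [scatter_one, a3, a4]
  refine Ok.set (by omega) (by simp [f4, a3]; omega) fun σ₅ h5 f5 => ?_
  have st5 : σ₅ .st = Function.update st (t + 1) (σ₃ .len 0) := by rw [f5 _ (by simp), st4]
  have stle : ∀ a ≤ t, σ₅ .st a = st a := fun a ha => by
    rw [st5, Function.update_of_ne (by omega)]
  have stlast : σ₅ .st (t + 1) = σ₃ .len 0 := by rw [st5, Function.update_self]
  have q5 : σ₅ .q = σ₃ .q := by rw [f5 _ (by simp), f4 _ (by simp)]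
  have len5 : σ₅ .len = σ₃ .len := by rw [f5 _ (by simp), f4 _ (by simp)]
  have vis5 : σ₅ .vis = σ₃ .vis := by rw [f5 _ (by simp), f4 _ (by simp)]
  refine ⟨by rw [h5]; simp [f4, a3], ⟨?_, ?_, ?_, ?_, ?_, ?_, ?_⟩, stle, ?_, ?_, ?_⟩
  · rw [q5, len5, vis5]; exact hQ
  · rw [stle _ (by omega), hinv.zero]
  · intro a b hab hb
    by_cases hbt : b ≤ t
    · rw [stle _ hbt, stle _ (by omega)]; exact hinv.mono a b hab hbt
    · obtain rfl : b = t + 1 := by omega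
      rw [stlast]
      by_cases hat : a ≤ t
      · rw [stle _ hat]; exact (hinv.mono a t hat le_rfl).trans hlen
      · obtain rfl : a = t + 1 := by omega
        rw [stlast]
  · rw [stlast, len5]
  · intro τ hτ i hi hi'
    rw [q5]
    by_cases hτt : τ < t
    · rw [stle _ (by omega)] at hi hi'
      have := hinv.mono (τ + 1) t (by omega) le_rfl
      rw [hpre i (by omega)]
      exact hinv.sound τ hτt i hi hi'
    · obtain rfl : τ = t := by omega
      rw [stlast] at hi'
      rw [stle _ le_rfl] at hi
      exact hsnd i hi hi'
  · intro y hy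
    obtain ⟨i, hi, he⟩ := hinv.init y hy
    have := hinv.mono 1 t ht1 le_rfl
    exact ⟨i, by rwa [stle _ ht1], by rw [q5, hpre i (by omega), he]⟩
  · intro τ hτ i hi hi' c hc hlt
    have h2c : 0 < 2 ^ cls (σ₅ .q i) c := by positivity
    have hτt : τ < t := by omega
    rw [stle _ (by omega)] at hi hi'
    have hm := hinv.mono (τ + 1) t (by omega) le_rfl
    rw [q5, hpre i (by omega)] at hlt ⊢
    by_cases hlt' : τ + 2 ^ cls (σ .q i) c < t
    · obtain ⟨i', h1', h2'⟩ := hinv.complete τ hτt i hi hi' c hc hlt'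
      have hm' := hinv.mono (τ + 2 ^ cls (σ .q i) c + 1) t (by omega) le_rfl
      exact ⟨i', by rwa [stle _ (by omega)], by rw [hpre i' (by omega), h2']⟩
    · have he : τ + 2 ^ cls (σ .q i) c = t := by omega
      have hcl : cls (σ .q i) c < Nat.log 2 t + 1 :=
        Nat.lt_succ_of_le (Nat.le_log_of_pow_le (by omega) (by omega))
      rw [he, stlast]
      exact hcmp τ hτt i hi hi' c hc he hcl
  · exact (S3.trans (Same.of_ne f4 (by decide))).trans (Same.of_ne f5 (by decide))
  · simp only [eval_ofNat]; linarith
  · linarith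


/-! ### Simultaneous search from all hubs, on pairs of a hub and a node. -/

open AE

/-- `LinkReach lk cls x z δ`: node `z` is reached from `x` along links of total delay `δ`. -/
inductive LinkReach (lk cls : ℕ → ℕ) (x : ℕ) : ℕ → ℕ → Prop
  | nil : LinkReach lk cls x x 0
  | step {z δ : ℕ} (h : LinkReach lk cls x z δ) (c : ℕ) (hc : c < 3) :
      LinkReach lk cls x (lk (3 * z + c)) (δ + 2 ^ cls (3 * z + c))

/-- Following a link changes only the remainder of a key modulo `N`; the quotient, which names the
hub, is preserved. Thus one search over the keys `x * N + z` consists of `T` independent searches,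
and no key that starts at another hub can reach hub index `x`. -/
theorem keyReach_iff {T N si : ℕ} {lk kl hub : ℕ → ℕ} (hlk : ∀ r < 3 * N, lk r < N)
    (hhub : ∀ x < T, hub x < N) {x z δ : ℕ} (hx : x < T) (hz : z < N) :
    KeyReach (fun y => ∃ x < T, y = x * N + hub x) (keyTgt N lk) (keyCls N kl si) (x * N + z) δ ↔
      LinkReach lk (fun r => kl r - si) (hub x) z δ := by
  have hmod : ∀ x z, z < N → (x * N + z) % N = z := fun x z hz => by
    rw [Nat.mul_add_mod', Nat.mod_eq_of_lt hz]
  have hdiv : ∀ x z, z < N → (x * N + z) / N = x := fun x z hz => by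
    rw [mul_comm, Nat.mul_add_div (by omega), Nat.div_eq_of_lt hz, add_zero]
  constructor
  · intro h
    have key : ∀ {y δ}, KeyReach (fun y => ∃ x < T, y = x * N + hub x) (keyTgt N lk)
        (keyCls N kl si) y δ →
        LinkReach lk (fun r => kl r - si) (hub (y / N)) (y % N) δ ∧ y / N < T := by
      intro y δ h
      induction h with
      | init hS =>
        obtain ⟨x, hx, rfl⟩ := hS
        rw [hmod _ _ (hhub x hx), hdiv _ _ (hhub x hx)]
        exact ⟨.nil, hx⟩
      | @step y δ _ c hc ih =>
        have hl : lk (3 * (y % N) + c) < N := hlk _ (by have := Nat.mod_lt y (show N > 0 by omega); omega)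
        simp only [keyTgt]
        rw [hmod _ _ hl, hdiv _ _ hl]
        exact ⟨ih.1.step c hc, ih.2⟩
    have := (key h).1
    rwa [hmod _ _ hz, hdiv _ _ hz] at this
  · intro h
    have key : ∀ {z δ}, LinkReach lk (fun r => kl r - si) (hub x) z δ → z < N ∧
        KeyReach (fun y => ∃ x < T, y = x * N + hub x) (keyTgt N lk) (keyCls N kl si)
          (x * N + z) δ := by
      intro z δ h
      induction h with
      | nil => exact ⟨hhub x hx, .init ⟨x, hx, rfl⟩⟩
      | @step z δ _ c hc ih =>
        have := ih.2.step c hc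
        simp only [keyTgt, keyCls, hmod x z ih.1, hdiv x z ih.1] at this
        exact ⟨hlk _ (by omega), this⟩
    exact (key h).2

/-- Search from all hubs up to time `ll`, with delay exponents `kl - si`. -/
def bfsP : AProg :=
  .seq (.map (sc .tt * sc .nn) 1 .vis 0) <|
  .seq (.map (sc .tt) 1 .q (pid * sc .nn + rd .hub pid)) <|
  .seq (.par (sc .tt) 1 .vis (rd .q pid) 1) <|
  .seq (.set .len (sc .tt)) <|
  .seq (.set .st 0) <|
  .seq (.par 1 1 .st 1 (sc .tt)) <|
  .seq (.set .tm 1) <|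
  .loop (not (lt (sc .ll) (sc .tm))) bfsRoundP

theorem bfsP_ok {I : ℕ → ℕ} {B T N L Λ : ℕ} {σ : St} (hB : 6 * (T * N) + 2 * L + 3 ≤ B)
    (hT : σ .tt 0 = T) (hN : σ .nn 0 = N) (hL : σ .ll 0 = L) (hT1 : 1 ≤ T)
    (hΛ : 3 * (T * N) ≤ 2 ^ Λ) (hlk : ∀ r < 3 * N, σ .lk r < N)
    (hhub : ∀ x < T, σ .hub x < N) :
    Ok I B bfsP σ fun σ' k d => (∀ x < T, ∀ z < N, σ' .vis (x * N + z) ≠ 0 ↔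
        ∃ δ ≤ L, LinkReach (σ .lk) (fun r => σ .kl r - σ .si 0) (σ .hub x) z δ) ∧
      Same bfsArr σ σ' ∧ k ≤ 60 * (Λ + 1) * (Nat.log 2 L + 1) * (T * N + L + 1) ∧
      d ≤ 30 * (Λ + 1) * (Nat.log 2 L + 1) * (L + 1) := by
  set U := T * N with hUdef
  have hN1 : 0 < N := (Nat.zero_le _).trans_lt (hhub 0 (by omega))
  have hTU : T ≤ U := Nat.le_mul_of_pos_right T hN1
  set S : ℕ → Prop := fun y => ∃ x < T, y = x * N + σ .hub x with hS
  have hkey : ∀ x < T, ∀ z < N, x * N + z < U := fun x hx z hz => by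
    have : (x + 1) * N ≤ T * N := Nat.mul_le_mul_right _ hx
    rw [add_mul] at this; omega
  have hkeyinj : ∀ x z x' z', z < N → z' < N → x * N + z = x' * N + z' → x = x' := by
    intro x z x' z' hz hz' he
    have := congrArg (· / N) he
    simpa [mul_comm, Nat.mul_add_div hN1, Nat.div_eq_of_lt hz, Nat.div_eq_of_lt hz'] using this
  have hU : ∀ y < U, ∀ c < 3, keyTgt N (σ .lk) y c < U := by
    intro y hy c hc
    refine hkey _ (Nat.div_lt_of_lt_mul (by rwa [mul_comm])) _ (hlk _ ?_)
    have := Nat.mod_lt y hN1; omega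
  refine Ok.seq (Ok.map (by simp [hT, hN, ← hUdef]; omega) (by simp) fun σ₁ h1 f1 => ?_)
  refine Ok.seq (Ok.map (by simp [f1, hT]; omega) ?_ fun σ₂ h2 f2 => ?_)
  · intro i hi _
    simp [f1, hT, hN] at hi ⊢
    exact (hkey i hi _ (hhub i hi)).le.trans (by omega)
  have q2 : ∀ i < T, σ₂ .q i = i * N + σ .hub i := by
    intro i hi
    rw [h2]; simp [f1, hT, hN, hi]
  refine Ok.seq (Ok.scat (by simp [f1, f2, hT]; omega) (by simp; omega) fun σ₃ h3 f3 => ?_)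
  have eT : AE.eval I σ₂ 0 (sc .tt) = T := by simp [f1, f2, hT]
  refine Ok.seq (Ok.set (by omega) (by simp [f1, f2, f3, hT]; omega) fun σ₄ h4 f4 => ?_)
  refine Ok.seq (Ok.set (by omega) (by simp) fun σ₅ h5 f5 => ?_)
  refine Ok.seq (Ok.scat (by simp; omega) (by simp [f1, f2, f3, f4, f5, hT]; omega) fun σ₆ h6 f6 => ?_)
  refine Ok.seq (Ok.set (by omega) (by simp; omega) fun σ₇ h7 f7 => ?_)
  have S7 : Same bfsArr σ σ₇ := ((((((Same.of_ne f1 (by decide)).trans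
    (Same.of_ne f2 (by decide))).trans (Same.of_ne f3 (by decide))).trans
    (Same.of_ne f4 (by decide))).trans (Same.of_ne f5 (by decide))).trans
    (Same.of_ne f6 (by decide))).trans (Same.of_ne f7 (by decide))
  have len7 : σ₇ .len 0 = T := by
    rw [f7 _ (by simp), f6 _ (by simp), f5 _ (by simp), h4]; simp [f3, f2, f1, hT]
  have st6 : σ₆ .st = Function.update (σ₅ .st) 1 T := by
    rw [h6]
    have : AE.eval I σ₅ 0 (1 : AE) = 1 := rfl
    rw [this, scatter_one]
    simp [f5, f4, f3, f2, f1, hT]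
  have st70 : σ₇ .st 0 = 0 := by
    rw [f7 _ (by simp), st6]; simpa using h5
  have st71 : σ₇ .st 1 = T := by
    rw [f7 _ (by simp), st6]; simp
  have q7 : σ₇ .q = σ₂ .q := by
    rw [f7 _ (by simp), f6 _ (by simp), f5 _ (by simp), f4 _ (by simp), f3 _ (by simp)]
  have vis7 : σ₇ .vis = σ₃ .vis := by
    rw [f7 _ (by simp), f6 _ (by simp), f5 _ (by simp), f4 _ (by simp)]
  have vis2 : ∀ y < U, σ₂ .vis y = 0 := by
    intro y hy
    rw [f2 _ (by simp), h1]; simp [hT, hN, ← hUdef, hy]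
  rw [eT] at h3
  have hq0 : QueueInv U T (σ₂ .q) (σ₃ .vis) := by
    refine ⟨?_, ?_, ?_, ?_⟩
    · intro i hi; rw [q2 i hi]; exact hkey i hi _ (hhub i hi)
    · intro i hi j hj he
      rw [q2 i hi, q2 j hj] at he
      exact hkeyinj _ _ _ _ (hhub i hi) (hhub j hj) he
    · intro i hi
      obtain ⟨j, -, -, -, hj, -⟩ := scatter_spec (N := T) (g := fun i => eval I σ₂ i 1 ≠ 0)
        (idx := fun i => eval I σ₂ i (rd .q pid)) (v := fun i => eval I σ₂ i 1)
        (old := σ₂ .vis) hi (by simp)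
      rw [h3]
      have e : σ₂ .q i = eval I σ₂ i (rd .q pid) := rfl
      rw [e, hj]; simp
    · intro y hy hv
      rw [h3] at hv
      rcases scatter_cases T (fun i => eval I σ₂ i 1 ≠ 0) (fun i => eval I σ₂ i (rd .q pid))
        (fun i => eval I σ₂ i 1) (σ₂ .vis) y with e | ⟨i, hi, -, he, -⟩
      · rw [e, vis2 y hy] at hv; exact absurd rfl hv
      · exact ⟨i, hi, he⟩
  have inv0 : BfsInv S (keyTgt N (σ .lk)) (keyCls N (σ .kl) (σ .si 0)) U 1 (σ₇ .len 0)
      (σ₇ .st) (σ₇ .q) (σ₇ .vis) := by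
    refine ⟨by rw [len7, q7, vis7]; exact hq0, st70, ?_, by rw [st71, len7], ?_, ?_, ?_⟩
    · intro a b hab hb
      interval_cases b
      · obtain rfl : a = 0 := by omega
        rfl
      · interval_cases a
        · rw [st70]; omega
        · rfl
    · intro τ hτ i _ hi
      obtain rfl : τ = 0 := by omega
      rw [zero_add, st71] at hi
      rw [q7, q2 i hi]
      exact .init ⟨i, hi, rfl⟩
    · rintro y ⟨x, hx, rfl⟩
      exact ⟨x, by rwa [st71], by rw [q7, q2 x hx]⟩
    · intro τ _ i _ _ c _ h
      have : 0 < 2 ^ keyCls N (σ .kl) (σ .si 0) (σ₇ .q i) c := by positivity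
      omega
  set J := Nat.log 2 L + 1 with hJ
  -- Amortization: before round `i + 1`, exponent `j` has scanned precisely the queue positions
  -- below `st (i + 1 - 2 ^ j)`, each once. Truncated subtraction together with `st 0 = 0` covers
  -- exponents that are still too large. At the end each summand is at most the number `U` of keys,
  -- so the scans cost about `U` per exponent.
  refine Ok.loop_acc L (fun i σ' k d => σ' .tm 0 = i + 1 ∧
    BfsInv S (keyTgt N (σ .lk)) (keyCls N (σ .kl) (σ .si 0)) U (i + 1) (σ' .len 0)
      (σ' .st) (σ' .q) (σ' .vis) ∧ Same bfsArr σ σ' ∧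
    k ≤ 24 * (Λ + 1) * (∑ j ∈ Finset.range J, σ' .st (i + 1 - 2 ^ j)) +
      i * (J * (16 * (Λ + 1) + 9) + 10) ∧ d ≤ i * (J * (13 * (Λ + 1) + 5) + 6)) ?_ ?_ ?_
  · exact ⟨by simpa using h7, inv0, S7, by simp, by simp⟩
  · rintro i hi σ₈ k₀ d₀ ⟨a1, a2, S8, hk, hd⟩
    have lk8 : σ₈ .lk = σ .lk := S8 _ (by decide)
    have kl8 : σ₈ .kl = σ .kl := S8 _ (by decide)
    have si8 : σ₈ .si = σ .si := S8 _ (by decide)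
    refine ⟨by simp [S8 .ll (by decide), hL, a1]; omega, ?_⟩
    refine (bfsRoundP_ok (U := U) (Λ := Λ) (N := N) (t := i + 1) (S := S) (by omega)
      (by rw [S8 _ (by decide), hN]) a1 (by omega) hΛ (by rwa [lk8])
      (by rwa [lk8, kl8, si8])).imp ?_
    rintro σ₉ k d ⟨b1, b2, b3, S9, hk9, hd9⟩
    rw [lk8, kl8, si8] at b2
    have hlog : Nat.log 2 (i + 1) + 1 ≤ J := by
      rw [hJ]; exact Nat.succ_le_succ (Nat.log_mono_right (by omega))
    refine ⟨b1, b2, S8.trans S9, ?_, ?_⟩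
    · have hsum : (∑ j ∈ Finset.range (Nat.log 2 (i + 1) + 1),
            (σ₈ .st (i + 1 - 2 ^ j + 1) - σ₈ .st (i + 1 - 2 ^ j))) +
          ∑ j ∈ Finset.range J, σ₈ .st (i + 1 - 2 ^ j) ≤
          ∑ j ∈ Finset.range J, σ₉ .st (i + 1 + 1 - 2 ^ j) := by
        set g : ℕ → ℕ := fun j => if j < Nat.log 2 (i + 1) + 1 then
          (σ₈ .st (i + 1 - 2 ^ j + 1) - σ₈ .st (i + 1 - 2 ^ j)) else 0 with hg
        have e1 : (∑ j ∈ Finset.range (Nat.log 2 (i + 1) + 1),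
            (σ₈ .st (i + 1 - 2 ^ j + 1) - σ₈ .st (i + 1 - 2 ^ j))) ≤
            ∑ j ∈ Finset.range J, g j := by
          rw [Finset.sum_congr rfl fun j hj => (if_pos (Finset.mem_range.1 hj)).symm]
          exact Finset.sum_le_sum_of_subset (Finset.range_subset_range.2 hlog)
        refine (Nat.add_le_add_right e1 _).trans ?_
        rw [← Finset.sum_add_distrib]
        refine Finset.sum_le_sum fun j _ => ?_
        have h2j : 0 < 2 ^ j := by positivity
        simp only [hg]
        split_ifs with hj
        · have h2 : 2 ^ j ≤ i + 1 := Nat.pow_le_of_le_log (by omega) (by omega)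
          rw [b3 _ (by omega), show i + 1 + 1 - 2 ^ j = i + 1 - 2 ^ j + 1 by omega]
          have := a2.mono (i + 1 - 2 ^ j) (i + 1 - 2 ^ j + 1) (by omega) (by omega)
          omega
        · have h2 : i + 1 < 2 ^ j :=
            Nat.lt_pow_of_log_lt (by omega) (by omega)
          rw [show i + 1 - 2 ^ j = 0 by omega, a2.zero]; omega
      have h1' := Nat.mul_le_mul_left (24 * (Λ + 1)) hsum
      have h2' := Nat.mul_le_mul_right (16 * (Λ + 1) + 9) hlog
      rw [mul_add] at h1'
      rw [add_mul]
      linarith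
    · have h2' := Nat.mul_le_mul_right (13 * (Λ + 1) + 5) hlog
      rw [add_mul]
      linarith
  · rintro σ₈ k d ⟨a1, a2, S8, hk, hd⟩
    refine ⟨by simp [S8 .ll (by decide), hL, a1], ?_, S8, ?_, ?_⟩
    · intro x hx z hz
      rw [a2.vis_iff (hkey x hx z hz)]
      simp_rw [Nat.lt_succ_iff]
      refine exists_congr fun δ => and_congr_right fun _ => keyReach_iff hlk hhub hx hz
    · have hs : ∑ j ∈ Finset.range J, σ₈ .st (L + 1 - 2 ^ j) ≤ J * U := by
        refine (Finset.sum_le_card_nsmul _ _ U fun j _ => ?_).trans (by simp)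
        exact (a2.mono _ _ (Nat.sub_le _ _) le_rfl).trans (a2.last ▸ a2.queue.len_le)
      have h1' := Nat.mul_le_mul_left (24 * (Λ + 1)) hs
      simp only [eval_mul, eval_sc, hT, hN, ← hUdef, eval_ofNat, f1 .tt (by simp),
        f2 .tt (by simp)]
      have hJ1 : 1 ≤ J := by omega
      have hLJ : 1 ≤ (Λ + 1) * J := Nat.mul_pos (by omega) hJ1
      have e1 : L * 1 ≤ L * ((Λ + 1) * J) := Nat.mul_le_mul_left _ hLJ
      have e2 : L * (J * 1) ≤ L * (J * (Λ + 1)) := Nat.mul_le_mul_left _ (Nat.mul_le_mul_left _ (by omega))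
      have e3 : U * 1 ≤ U * ((Λ + 1) * J) := Nat.mul_le_mul_left _ hLJ
      nlinarith
    · have hJ1 : 1 ≤ J := by omega
      have hLJ : 1 ≤ (Λ + 1) * J := Nat.mul_pos (by omega) hJ1
      have e1 : L * 1 ≤ L * ((Λ + 1) * J) := Nat.mul_le_mul_left _ hLJ
      have e2 : L * (J * 1) ≤ L * (J * (Λ + 1)) := Nat.mul_le_mul_left _ (Nat.mul_le_mul_left _ (by omega))
      nlinarith


open AE

/-! ### The matrix of distance estimates between hubs -/

/-- Hub `y` is found by the search from hub `x` at scale `i`. -/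
def HubSees (lk kl hub : ℕ → ℕ) (L i x y : ℕ) : Prop :=
  ∃ δ ≤ L, LinkReach lk (fun r => kl r - i) (hub x) (hub y) δ

/-- Search at all scales; the entry for a pair of hubs is half of the least scale that succeeds,
or `cap`. -/
def scalesP : AProg :=
  .seq (.map (sc .tt * sc .tt) 1 .mat (sc .cap)) <|
  .seq (.set .sc 1) <| .seq (.set .si 0) <|
  .loop (lt (sc .sc) (2 * sc .cap)) <|
    .seq bfsP <|
    .seq (.map (sc .tt * sc .tt)
      (not (not (rd .vis (pid / sc .tt * sc .nn + rd .hub (pid % sc .tt)))) *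
        lt (sc .sc / 2) (rd .mat pid)) .mat (sc .sc / 2)) <|
    .seq (.set .sc (sc .sc * 2)) (.set .si (sc .si + 1))

/-- The arrays changed by the search at all scales. -/
abbrev scalesArr : List Arr := [.mat, .sc, .si] ++ bfsArr

/-- An entry is half of the least scale `2 ^ i` that succeeds because failure at scale `i - 1` is
what bounds short walks from below; scale `0` yields the entry `0`. Scales with `2 ^ i ≥ 2 * CAP`
are omitted since their halves could not improve on the initial value `CAP`. -/
theorem scalesP_ok {I : ℕ → ℕ} {B T N L Λ CAP : ℕ} {σ : St}
    (hB : 6 * (T * N) + T * T + 2 * L + 4 * CAP + 4 ≤ B)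
    (hT : σ .tt 0 = T) (hN : σ .nn 0 = N) (hL : σ .ll 0 = L) (hT1 : 1 ≤ T)
    (hC : σ .cap 0 = CAP) (hΛ : 3 * (T * N) ≤ 2 ^ Λ) (hΛC : 2 * CAP ≤ 2 ^ Λ)
    (hlk : ∀ r < 3 * N, σ .lk r < N) (hhub : ∀ x < T, σ .hub x < N) :
    Ok I B scalesP σ fun σ' k d => (∀ x < T, ∀ y < T, σ' .mat (x * T + y) ≤ CAP ∧
        (σ' .mat (x * T + y) = CAP ∨ ∃ i, σ' .mat (x * T + y) = 2 ^ i / 2 ∧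
          HubSees (σ .lk) (σ .kl) (σ .hub) L i x y) ∧
        ∀ i, 2 ^ i < 2 * CAP → HubSees (σ .lk) (σ .kl) (σ .hub) L i x y →
          σ' .mat (x * T + y) ≤ 2 ^ i / 2) ∧ Same scalesArr σ σ' ∧
      k ≤ (Λ + 1) * (60 * (Λ + 1) * (Nat.log 2 L + 1) * (T * N + L + 1) + 2 * (T * T) + 10) ∧
      d ≤ (Λ + 1) * (30 * (Λ + 1) * (Nat.log 2 L + 1) * (L + 1) + 10) := by
  have hTT : T * T < T * T * T + 1 := by nlinarith [Nat.mul_le_mul_left (T * T) hT1]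
  have hidx : ∀ x y, x < T → y < T → x * T + y < T * T := fun x y hx hy => by
    have : (x + 1) * T ≤ T * T := Nat.mul_le_mul_right _ hx
    rw [add_mul] at this; omega
  have hdiv : ∀ x y, y < T → (x * T + y) / T = x := fun x y hy => by
    rw [mul_comm, Nat.mul_add_div (by omega), Nat.div_eq_of_lt hy, add_zero]
  have hmod : ∀ x y, y < T → (x * T + y) % T = y := fun x y hy => by
    rw [Nat.mul_add_mod', Nat.mod_eq_of_lt hy]
  refine Ok.seq (Ok.map (by simp [hT]; omega) (by simp [hC]; omega) fun σ₁ h1 f1 => ?_)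
  refine Ok.seq (Ok.set (by omega) (by simp; omega) fun σ₂ h2 f2 => ?_)
  refine Ok.seq (Ok.set (by omega) (by simp) fun σ₃ h3 f3 => ?_)
  simp only [eval_ofNat] at h2 h3
  refine Ok.loop (Nat.clog 2 (2 * CAP))
    (60 * (Λ + 1) * (Nat.log 2 L + 1) * (T * N + L + 1) + T * T + 5)
    (30 * (Λ + 1) * (Nat.log 2 L + 1) * (L + 1) + 3)
    (fun i σ' => σ' .sc 0 = 2 ^ i ∧ σ' .si 0 = i ∧ (∀ x < T, ∀ y < T,
        σ' .mat (x * T + y) ≤ CAP ∧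
        (σ' .mat (x * T + y) = CAP ∨ ∃ i, σ' .mat (x * T + y) = 2 ^ i / 2 ∧
          HubSees (σ .lk) (σ .kl) (σ .hub) L i x y) ∧
        ∀ i' < i, HubSees (σ .lk) (σ .kl) (σ .hub) L i' x y →
          σ' .mat (x * T + y) ≤ 2 ^ i' / 2) ∧ Same scalesArr σ σ') ?_ ?_ ?_ ?_
  · refine ⟨?_, by simpa using h3, fun x hx y hy => ?_, ?_⟩
    · rw [f3 _ (by simp)]; simpa using h2
    · have : σ₃ .mat (x * T + y) = CAP := by
        rw [f3 _ (by simp), f2 _ (by simp), h1]; simp [hT, hC, hidx x y hx hy]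
      exact ⟨this.le, .inl this, fun i h => by omega⟩
    · exact ((Same.of_ne f1 (by decide)).trans (Same.of_ne f2 (by decide))).trans
        (Same.of_ne f3 (by decide))
  · rintro i hi σ₄ ⟨a1, a2, a3, S4⟩
    have hlt := Nat.pow_lt_of_lt_clog hi
    have hiC : i < 2 * CAP := Nat.lt_two_pow_self.trans hlt
    refine ⟨by simp [a1, S4 .cap (by decide), hC, hlt], ?_⟩
    refine Ok.seq ((bfsP_ok (B := B) (T := T) (N := N) (L := L) (Λ := Λ) (by omega)
      (by rw [S4 _ (by decide), hT]) (by rw [S4 _ (by decide), hN])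
      (by rw [S4 _ (by decide), hL]) hT1 hΛ (by rwa [S4 _ (by decide)])
      (by rwa [S4 _ (by decide)])).imp ?_)
    rintro σ₅ k5 d5 ⟨h5, S5, hk5, hd5⟩
    rw [S4 .lk (by decide), S4 .kl (by decide), S4 .hub (by decide), a2] at h5
    have tt5 : σ₅ .tt 0 = T := by rw [S5 _ (by decide), S4 _ (by decide), hT]
    have nn5 : σ₅ .nn 0 = N := by rw [S5 _ (by decide), S4 _ (by decide), hN]
    have hub5 : σ₅ .hub = σ .hub := by rw [S5 _ (by decide), S4 _ (by decide)]
    have sc5 : σ₅ .sc 0 = 2 ^ i := by rw [S5 _ (by decide), a1]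
    have mat5 : σ₅ .mat = σ₄ .mat := by rw [S5 _ (by decide)]
    refine Ok.seq (Ok.map (by simp [tt5]; omega) (by simp [sc5]; omega) fun σ₆ h6 f6 => ?_)
    refine Ok.seq (Ok.set (by omega) (by simp [f6, sc5]; omega) fun σ₇ h7 f7 => ?_)
    refine Ok.set (by omega) (by simp [f7, f6, S5 .si (by decide), a2]; omega) fun σ₈ h8 f8 => ?_
    refine ⟨⟨?_, ?_, ?_, ?_⟩, ?_, by omega⟩
    · rw [f8 _ (by simp), h7]; simp [f6, sc5, pow_succ]
    · rw [h8]; simp [f7, f6, S5 .si (by decide), a2]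
    · intro x hx y hy
      obtain ⟨b1, b2, b3⟩ := a3 x hx y hy
      have e : σ₈ .mat (x * T + y) = if σ₅ .vis (x * N + σ .hub y) ≠ 0 ∧
          2 ^ i / 2 < σ₄ .mat (x * T + y) then 2 ^ i / 2 else σ₄ .mat (x * T + y) := by
        rw [f8 _ (by simp), f7 _ (by simp), h6]
        simp [tt5, nn5, hub5, sc5, mat5, hidx x y hx hy, hdiv x y hy, hmod x y hy, and_comm]
      have hv := h5 x hx _ (hhub y hy)
      rw [e]
      split_ifs with hg
      · refine ⟨by omega, .inr ⟨i, rfl, hv.1 hg.1⟩, fun i' hi' hs => ?_⟩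
        have := b3
        rcases Nat.lt_succ_iff_lt_or_eq.1 hi' with h | rfl
        · exact hg.2.le.trans (b3 i' h hs)
        · exact le_rfl
      · refine ⟨b1, b2, fun i' hi' hs => ?_⟩
        rcases Nat.lt_succ_iff_lt_or_eq.1 hi' with h | rfl
        · exact b3 i' h hs
        · by_contra hlt'
          exact hg ⟨hv.2 hs, not_le.1 hlt'⟩
    · exact (((S4.trans (S5.mono (by decide))).trans (Same.of_ne f6 (by decide))).trans
        (Same.of_ne f7 (by decide))).trans (Same.of_ne f8 (by decide))
    · simp [tt5]; omega
  · rintro σ₄ ⟨a1, a2, a3, S4⟩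
    have := Nat.le_pow_clog one_lt_two (2 * CAP)
    simp [a1, S4 .cap (by decide), hC, this]
  · rintro σ₄ k d ⟨a1, a2, a3, S4⟩ hk hd
    have hc : Nat.clog 2 (2 * CAP) ≤ Λ := (Nat.clog_le_iff_le_pow (by omega)).2 hΛC
    refine ⟨fun x hx y hy => ?_, S4, ?_, ?_⟩
    · obtain ⟨b1, b2, b3⟩ := a3 x hx y hy
      exact ⟨b1, b2, fun i hi => b3 i ((Nat.lt_clog_iff_pow_lt (by omega)).2 hi)⟩
    · simp only [eval_mul, eval_sc, hT]
      set X := 60 * (Λ + 1) * (Nat.log 2 L + 1) * (T * N + L + 1)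
      have h1 := hk.trans (Nat.add_le_add_right (Nat.mul_le_mul_right _ hc) 1)
      have h2 : Λ * (X + T * T + 5 + 1) ≤ Λ * (X + 2 * (T * T) + 10) :=
        Nat.mul_le_mul_left _ (by omega)
      rw [add_mul]; omega
    · set X := 30 * (Λ + 1) * (Nat.log 2 L + 1) * (L + 1)
      have h1 := hd.trans (Nat.add_le_add_right (Nat.mul_le_mul_right _ hc) 1)
      have h2 : Λ * (X + 3 + 1) ≤ Λ * (X + 10) := Nat.mul_le_mul_left _ (by omega)
      rw [add_mul]; omega

/-- Length of the path `p 0, …, p k` for the length matrix `a`. -/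
def pathSum (a : ℕ → ℕ → ℕ) (p : ℕ → ℕ) (k : ℕ) : ℕ :=
  ∑ t ∈ Finset.range k, a (p t) (p (t + 1))

theorem exists_path_concat {a : ℕ → ℕ → ℕ} {T k k' : ℕ} {p p' : ℕ → ℕ} (hp : ∀ t ≤ k, p t < T)
    (hp' : ∀ t ≤ k', p' t < T) (h : p k = p' 0) :
    ∃ q : ℕ → ℕ, q 0 = p 0 ∧ q (k + k') = p' k' ∧ (∀ t ≤ k + k', q t < T) ∧
      pathSum a q (k + k') = pathSum a p k + pathSum a p' k' := by
  set q : ℕ → ℕ := fun t => if t ≤ k then p t else p' (t - k) with hq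
  have h1 : ∀ t ≤ k, q t = p t := fun t ht => if_pos ht
  have h2 : ∀ t, q (k + t) = p' t := by
    intro t
    rcases Nat.eq_zero_or_pos t with rfl | ht
    · rw [add_zero, h1 k le_rfl, h]
    · simp only [hq]; rw [if_neg (by omega), Nat.add_sub_cancel_left]
  refine ⟨q, h1 0 (Nat.zero_le _), h2 k', fun t ht => ?_, ?_⟩
  · by_cases htk : t ≤ k
    · rw [h1 t htk]; exact hp t htk
    · rw [show t = k + (t - k) by omega, h2]; exact hp' _ (by omega)
  · unfold pathSum
    rw [Finset.sum_range_add]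
    congr 1
    · refine Finset.sum_congr rfl fun t ht => ?_
      rw [Finset.mem_range] at ht
      rw [h1 t ht.le, h1 (t + 1) ht]
    · refine Finset.sum_congr rfl fun t _ => ?_
      rw [h2, add_assoc, h2]

/-- A path on `T` nodes can be shortened to fewer than `T` steps. -/
theorem exists_path_lt {a : ℕ → ℕ → ℕ} {T : ℕ} (k : ℕ) (p : ℕ → ℕ) (hp : ∀ t ≤ k, p t < T) :
    ∃ k' < T, ∃ q : ℕ → ℕ, q 0 = p 0 ∧ q k' = p k ∧ (∀ t ≤ k', q t < T) ∧
      pathSum a q k' ≤ pathSum a p k := by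
  induction k using Nat.strong_induction_on generalizing p with
  | _ k ih =>
    by_cases hk : k < T
    · exact ⟨k, hk, p, rfl, rfl, hp, le_rfl⟩
    · obtain ⟨i, hi, j, hj, hne, he⟩ := Finset.exists_ne_map_eq_of_card_lt_of_maps_to
        (s := Finset.range (k + 1)) (t := Finset.range T) (f := p) (by simp; omega)
        (fun t ht => by simpa using hp t (by simpa [Nat.lt_succ_iff] using ht))
      wlog hij : i < j generalizing i j
      · exact this j hj i hi hne.symm he.symm (by omega)
      simp only [Finset.mem_range, Nat.lt_succ_iff] at hi hj
      obtain ⟨q, hq0, hqk, hqT, hqs⟩ := exists_path_concat (a := a) (T := T) (k := i) (k' := k - j)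
        (p := p) (p' := fun t => p (j + t)) (fun t ht => hp t (by omega))
        (fun t ht => hp _ (by omega)) (by simpa using he)
      obtain ⟨k', hk', r, hr0, hrk, hrT, hrs⟩ := ih (i + (k - j)) (by omega) q hqT
      refine ⟨k', hk', r, hr0.trans hq0, ?_, hrT, hrs.trans ?_⟩
      · rw [hrk, hqk]; congr 1; omega
      · rw [hqs]
        have e : k = j + (k - j) := by omega
        unfold pathSum
        conv_rhs => rw [e, Finset.sum_range_add]
        refine Nat.add_le_add (Finset.sum_le_sum_of_subset (Finset.range_subset_range.2 hij.le)) ?_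
        exact Finset.sum_le_sum fun t _ => by rw [add_assoc]

/-- Min-plus closure of `mat` by repeated squaring. -/
def closureP : AProg :=
  .seq (.set .pw 1) <|
  .loop (lt (sc .pw) (sc .tt)) <|
    .seq (.map (sc .tt * sc .tt * sc .tt) 1 .big
      (rd .mat (pid / sc .tt / sc .tt * sc .tt + pid % sc .tt) +
        rd .mat (pid % sc .tt * sc .tt + pid / sc .tt % sc .tt))) <|
    .seq minP <|
    .seq (.map (sc .tt * sc .tt) (lt (rd .big (pid * sc .tt)) (rd .mat pid)) .mat
      (rd .big (pid * sc .tt))) <|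
    .set .pw (sc .pw * 2)

/-- The arrays changed by the closure. -/
abbrev closureArr : List Arr := [.pw, .big, .j1, .mat]

/-- After `i` squarings an entry is at most the length of every path of at most `2 ^ i` steps, and
is the length of some such path. Both halves are needed: the first gives the triangle inequality,
the second controls the rounding error, which grows with the number of steps. That number is at most
`2 * T` because the loop stops at the first power of two that is at least `T`. Zero diagonal entries
account for paths of no steps. -/
theorem closureP_ok {I : ℕ → ℕ} {B T Λ CAP : ℕ} {σ : St}
    (hB : 2 * T * T * T + 2 * CAP + 2 ≤ B) (hT : σ .tt 0 = T) (hT1 : 1 ≤ T) (hΛ : T ≤ 2 ^ Λ)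
    (hle : ∀ x < T, ∀ y < T, σ .mat (x * T + y) ≤ CAP)
    (hrefl : ∀ x < T, σ .mat (x * T + x) = 0) :
    Ok I B closureP σ fun σ' k d =>
      (∀ p k, k ≤ T → (∀ t ≤ k, p t < T) → σ' .mat (p 0 * T + p k) ≤
        pathSum (fun x y => σ .mat (x * T + y)) p k) ∧
      (∀ x < T, ∀ y < T, σ' .mat (x * T + y) ≤ CAP ∧
        ∃ k ≤ 2 * T, ∃ p, p 0 = x ∧ p k = y ∧ (∀ t ≤ k, p t < T) ∧
        σ' .mat (x * T + y) = pathSum (fun x y => σ .mat (x * T + y)) p k) ∧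
      Same closureArr σ σ' ∧ k ≤ (Λ + 1) * ((Λ + 1) * (3 * (T * T * T) + 20)) ∧
      d ≤ (Λ + 1) * ((Λ + 1) * 20) := by
  set a : ℕ → ℕ → ℕ := fun x y => σ .mat (x * T + y) with ha
  have hTT : T * T ≤ T * T * T := Nat.le_mul_of_pos_right _ hT1
  have hTT' : T ≤ T * T := Nat.le_mul_of_pos_right _ hT1
  have hT3 : 2 * T * T * T = 2 * (T * T * T) := by ring
  have hidx : ∀ x y, x < T → y < T → x * T + y < T * T := fun x y hx hy => by
    have : (x + 1) * T ≤ T * T := Nat.mul_le_mul_right _ hx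
    rw [add_mul] at this; omega
  have hidx3 : ∀ x z, x < T * T → z < T → x * T + z < T * T * T := fun x z hx hz => by
    have : (x + 1) * T ≤ T * T * T := Nat.mul_le_mul_right _ hx
    rw [add_mul] at this; omega
  have hdiv : ∀ x y, y < T → (x * T + y) / T = x := fun x y hy => by
    rw [mul_comm, Nat.mul_add_div (by omega), Nat.div_eq_of_lt hy, add_zero]
  have hmod : ∀ x y, y < T → (x * T + y) % T = y := fun x y hy => by
    rw [Nat.mul_add_mod', Nat.mod_eq_of_lt hy]
  refine Ok.seq (Ok.set (by omega) (by simp; omega) fun σ₁ h1 f1 => ?_)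
  simp only [eval_ofNat] at h1
  refine Ok.loop (Nat.clog 2 T)
    (T * T * T + T * T + 4 + (T * T * T + 7) * (Λ + 1)) (3 + 5 * (Λ + 1))
    (fun i σ' => σ' .pw 0 = 2 ^ i ∧
      (∀ p k, k ≤ 2 ^ i → (∀ t ≤ k, p t < T) → σ' .mat (p 0 * T + p k) ≤ pathSum a p k) ∧
      (∀ x < T, ∀ y < T, σ' .mat (x * T + y) ≤ CAP ∧
        ∃ k ≤ 2 ^ i, ∃ p, p 0 = x ∧ p k = y ∧ (∀ t ≤ k, p t < T) ∧
        σ' .mat (x * T + y) = pathSum a p k) ∧ Same closureArr σ σ') ?_ ?_ ?_ ?_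
  · have m1 : σ₁ .mat = σ .mat := f1 _ (by simp)
    refine ⟨by simpa using h1, ?_, ?_, Same.of_ne f1 (by decide)⟩
    · intro p k hk hp
      rw [m1]
      rcases Nat.le_one_iff_eq_zero_or_eq_one.1 (by simpa using hk) with rfl | rfl
      · simp [hrefl _ (hp 0 le_rfl)]
      · simp [pathSum, ha]
    · intro x hx y hy
      rw [m1]
      refine ⟨hle x hx y hy, 1, by simp, fun t => if t = 0 then x else y, by simp, by simp, ?_, ?_⟩
      · intro t _; dsimp only; split_ifs <;> assumption
      · simp [pathSum, ha]
  · rintro i hi σ₂ ⟨a1, a2, a3, S2⟩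
    have hlt := Nat.pow_lt_of_lt_clog hi
    have tt2 : σ₂ .tt 0 = T := by rw [S2 _ (by decide), hT]
    have hr1 : ∀ r < T * T * T, r / T / T < T := fun r hr =>
      Nat.div_lt_of_lt_mul (Nat.div_lt_of_lt_mul (by linarith [mul_assoc T T T]))
    have hr2 : ∀ r, r % T < T := fun r => Nat.mod_lt _ hT1
    refine ⟨by simp [a1, tt2, hlt], ?_⟩
    refine Ok.seq (Ok.map (by simp [tt2]; omega) ?_ fun σ₃ h3 f3 => ?_)
    · intro r hr _
      simp [tt2] at hr ⊢
      have := (a3 _ (hr1 r hr) _ (hr2 r)).1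
      have := (a3 _ (hr2 r) _ (hr2 (r / T))).1
      omega
    have b3 : ∀ x < T, ∀ y < T, ∀ z < T, σ₃ .big ((x * T + y) * T + z) =
        σ₂ .mat (x * T + z) + σ₂ .mat (z * T + y) := by
      intro x hx y hy z hz
      rw [h3]
      simp [tt2, hidx3 _ _ (hidx x y hx hy) hz, hdiv _ _ hz, hdiv _ _ hy, hmod _ _ hz,
        hmod _ _ hy]
    refine Ok.seq ((minP_ok (T := T) (Λ := Λ) (by omega) (by rw [f3 _ (by simp), tt2]) ?_
      hΛ).imp ?_)
    · intro r hr
      rw [h3]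
      simp [tt2, hr]
      have := (a3 _ (hr1 r hr) _ (hr2 r)).1
      have := (a3 _ (hr2 r) _ (hr2 (r / T))).1
      omega
    rintro σ₄ k4 d4 ⟨b4, S4, hk4, hd4⟩
    have tt4 : σ₄ .tt 0 = T := by rw [S4 _ (by decide), f3 _ (by simp), tt2]
    have mat4 : σ₄ .mat = σ₂ .mat := by rw [S4 _ (by decide), f3 _ (by simp)]
    refine Ok.seq (Ok.map (by simp [tt4]; omega) ?_ fun σ₅ h5 f5 => ?_)
    · intro r hr _
      simp [tt4] at hr ⊢
      obtain ⟨z, hz, he⟩ := (b4 r hr).2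
      have hrx : r / T < T := Nat.div_lt_of_lt_mul hr
      have hr' : r = r / T * T + r % T := (Nat.div_add_mod' r T).symm
      rw [he]
      conv_lhs => rw [hr']
      rw [b3 _ hrx _ (hr2 r) _ hz]
      have := (a3 _ hrx _ hz).1
      have := (a3 _ hz _ (hr2 r)).1
      omega
    refine Ok.set (by omega) (by simp [f5, S4 .pw (by decide), f3, a1]; omega) fun σ₆ h6 f6 => ?_
    have e6 : ∀ x < T, ∀ y < T, σ₆ .mat (x * T + y) =
        if σ₄ .big ((x * T + y) * T) < σ₂ .mat (x * T + y) then σ₄ .big ((x * T + y) * T)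
        else σ₂ .mat (x * T + y) := by
      intro x hx y hy
      rw [f6 _ (by simp), h5]
      simp [tt4, mat4, hidx x y hx hy]
    refine ⟨⟨?_, ?_, ?_, ?_⟩, ?_, by omega⟩
    · rw [h6]; simp [f5, S4 .pw (by decide), f3, a1, pow_succ]
    · intro p k hk hp
      -- The path is cut after `min k (2 ^ i)` steps, so that both pieces have at most `2 ^ i`
      -- steps; the second piece may be empty.
      have hk1 : min k (2 ^ i) ≤ k := min_le_left _ _
      set k1 := min k (2 ^ i) with hk1def
      have hsplit : pathSum a p k = pathSum a p k1 + pathSum a (fun t => p (k1 + t)) (k - k1) := by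
        unfold pathSum
        conv_lhs => rw [show k = k1 + (k - k1) by omega, Finset.sum_range_add]
        rfl
      have l1 := a2 p k1 (min_le_right _ _) (fun t ht => hp t (by omega))
      have l2 := a2 (fun t => p (k1 + t)) (k - k1) (by rw [pow_succ] at hk; omega)
        (fun t ht => hp _ (by omega))
      simp only [add_zero, show k1 + (k - k1) = k by omega] at l2
      have hb := (b4 _ (hidx _ _ (hp 0 (by omega)) (hp k le_rfl))).1 _ (hp k1 hk1)
      rw [b3 _ (hp 0 (by omega)) _ (hp k le_rfl) _ (hp k1 hk1)] at hb
      rw [e6 _ (hp 0 (by omega)) _ (hp k le_rfl), hsplit]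
      split_ifs with hg <;> omega
    · intro x hx y hy
      obtain ⟨c1, k, hk, p, p0, pk, pT, ps⟩ := a3 x hx y hy
      rw [e6 x hx y hy]
      split_ifs with hg
      · refine ⟨hg.le.trans c1, ?_⟩
        obtain ⟨z, hz, he⟩ := (b4 _ (hidx x y hx hy)).2
        rw [b3 x hx y hy z hz] at he
        obtain ⟨-, k1, hk1, p1, p10, p1k, p1T, p1s⟩ := a3 x hx z hz
        obtain ⟨-, k2, hk2, p2, p20, p2k, p2T, p2s⟩ := a3 z hz y hy
        obtain ⟨q, q0, qk, qT, qs⟩ := exists_path_concat (a := a) p1T p2T (p1k.trans p20.symm)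
        exact ⟨k1 + k2, by rw [pow_succ]; omega, q, q0.trans p10, qk.trans p2k, qT, by
          rw [he, p1s, p2s, qs]⟩
      · exact ⟨c1, k, by rw [pow_succ]; omega, p, p0, pk, pT, ps⟩
    · exact (((S2.trans (Same.of_ne f3 (by decide))).trans (S4.mono (by decide))).trans
        (Same.of_ne f5 (by decide))).trans (Same.of_ne f6 (by decide))
    · simp [tt2, tt4]; omega
  · rintro σ₂ ⟨a1, a2, a3, S2⟩
    have := Nat.le_pow_clog one_lt_two T
    simp [a1, S2 .tt (by decide), hT, this]
  · rintro σ₂ k d ⟨a1, a2, a3, S2⟩ hk hd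
    have hc : Nat.clog 2 T ≤ Λ := (Nat.clog_le_iff_le_pow (by omega)).2 hΛ
    have hcT := Nat.le_pow_clog one_lt_two T
    have hc2 : 2 ^ Nat.clog 2 T ≤ 2 * T := by
      rcases Nat.lt_or_ge 1 T with h | h
      · have := Nat.pow_pred_clog_lt_self one_lt_two h
        have h0 := Nat.clog_pos one_lt_two h
        rw [show Nat.clog 2 T = (Nat.clog 2 T).pred + 1 by rw [Nat.pred_eq_sub_one]; omega,
          pow_succ]
        omega
      · rw [Nat.clog_of_right_le_one h]; omega
    refine ⟨fun p k hk hp => a2 p k (hk.trans hcT) hp, fun x hx y hy => ?_, S2, ?_, ?_⟩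
    · obtain ⟨c1, k, hk, p, h⟩ := a3 x hx y hy
      exact ⟨c1, k, hk.trans hc2, p, h⟩
    · set X := T * T * T
      have h1 := hk.trans (Nat.add_le_add_right (Nat.mul_le_mul_right _ hc) 1)
      have h2 : X + T * T + 4 + (X + 7) * (Λ + 1) + 1 ≤ (Λ + 1) * (3 * X + 20) - 3 := by
        have : X * 1 ≤ X * (Λ + 1) := Nat.mul_le_mul_left _ (by omega)
        have : (Λ + 1) * (3 * X + 20) = 3 * (X * (Λ + 1)) + 20 * (Λ + 1) := by ring
        have : (X + 7) * (Λ + 1) = X * (Λ + 1) + 7 * (Λ + 1) := by ring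
        omega
      have h3 := Nat.mul_le_mul_left Λ h2
      have h4 : 20 ≤ (Λ + 1) * (3 * X + 20) := by nlinarith
      have h5 := h3.trans (Nat.mul_le_mul_left Λ (Nat.sub_le _ 3))
      simp only [add_mul (a := Λ) (b := 1) (c := (Λ + 1) * (3 * X + 20)), one_mul]
      omega
    · have h1 := hd.trans (Nat.add_le_add_right (Nat.mul_le_mul_right _ hc) 1)
      nlinarith

/-- Prefixing one step to a path that realizes `a' y z` may exceed the `T` steps covered by `h1`.
Removing cycles brings the path below `T` steps without increasing its length, since lengths are
non-negative. -/
theorem closure_triangle {T : ℕ} {a a' : ℕ → ℕ → ℕ}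
    (h1 : ∀ p k, k ≤ T → (∀ t ≤ k, p t < T) → a' (p 0) (p k) ≤ pathSum a p k)
    (h2 : ∀ x < T, ∀ y < T, ∃ k, ∃ p : ℕ → ℕ, p 0 = x ∧ p k = y ∧ (∀ t ≤ k, p t < T) ∧
        a' x y = pathSum a p k) {x y z : ℕ} (hx : x < T) (hy : y < T) (hz : z < T) :
    a' x z ≤ a x y + a' y z := by
  obtain ⟨k, p, p0, pk, pT, ps⟩ := h2 y hy z hz
  obtain ⟨q, q0, qk, qT, qs⟩ := exists_path_concat (a := a) (T := T) (k := 1) (k' := k)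
    (p := fun t => if t = 0 then x else y) (p' := p)
    (fun t _ => by split_ifs <;> assumption) pT (by simp [p0])
  obtain ⟨k', hk', r, r0, rk, rT, rs⟩ := exists_path_lt (a := a) _ q qT
  have := h1 r k' hk'.le rT
  rw [r0, rk, q0, qk, pk] at this
  have e : pathSum a (fun t => if t = 0 then x else y) 1 = a x y := by simp [pathSum]
  simp only [if_pos] at this
  rw [ps, ← e, ← qs]
  exact this.trans rs


open AE

/-! ### Relaxation along links -/

/-- `LinkWalk lk wl z k l y`: a walk along `k` links from `z` to `y` of total weight `l`. -/
inductive LinkWalk (lk wl : ℕ → ℕ) : ℕ → ℕ → ℕ → ℕ → Prop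
  | nil (z : ℕ) : LinkWalk lk wl z 0 0 z
  | cons {z k l y : ℕ} (c : ℕ) (hc : c < 3) (h : LinkWalk lk wl (lk (3 * z + c)) k l y) :
      LinkWalk lk wl z (k + 1) (wl (3 * z + c) + l) y

theorem LinkWalk.append {lk wl : ℕ → ℕ} {z k l y k' l' y' : ℕ} (h : LinkWalk lk wl z k l y)
    (h' : LinkWalk lk wl y k' l' y') : LinkWalk lk wl z (k + k') (l + l') y' := by
  induction h with
  | nil z => simpa using h'
  | cons c hc _ ih =>
    have := (ih h').cons c hc
    rwa [← add_assoc, add_right_comm] at this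

theorem LinkWalk.snoc {lk wl : ℕ → ℕ} {z k l y : ℕ} (h : LinkWalk lk wl z k l y) (c : ℕ)
    (hc : c < 3) : LinkWalk lk wl z (k + 1) (l + wl (3 * y + c)) (lk (3 * y + c)) := by
  simpa using h.append ((LinkWalk.nil _).cons c hc)

/-- Improve the estimates `x` along the links of kind `c`. -/
def pullP (c : AE) : AProg :=
  .map (sc .nn) (lt (rd .x (rd .lk (3 * pid + c)) + rd .wl (3 * pid + c)) (rd .x pid)) .x
    (rd .x (rd .lk (3 * pid + c)) + rd .wl (3 * pid + c))

theorem pullP_ok {I : ℕ → ℕ} {B N : ℕ} {σ : St} {c : AE} {c' : ℕ} (hc : ∀ i, c.eval I σ i = c')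
    (hN : σ .nn 0 = N) (hNB : N ≤ B) (hx : ∀ z < N, σ .x z ≤ B) :
    Ok I B (pullP c) σ fun σ' k d => (∀ z < N, σ' .x z =
        min (σ .x z) (σ .x (σ .lk (3 * z + c')) + σ .wl (3 * z + c'))) ∧
      (∀ b, b ≠ .x → σ' b = σ b) ∧ k ≤ N + 1 ∧ d ≤ 1 := by
  refine Ok.map (by simpa [hN] using hNB) ?_ fun σ' h f => ⟨fun z hz => ?_, f, by simp [hN], le_rfl⟩
  · intro z hz hg
    simp [hN, hc] at hz hg ⊢
    exact hg.le.trans (hx z hz)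
  · rw [h]
    simp only [eval_sc, hN, hz, eval_lt, eval_add, eval_rd, eval_mul, eval_ofNat, eval_pid, hc,
      true_and]
    by_cases h2 : σ .x (σ .lk (3 * z + c')) + σ .wl (3 * z + c') < σ .x z
    · simp [h2, min_eq_right h2.le]
    · simp [h2, min_eq_left (not_lt.1 h2)]

/-- `h * (lg + 2)` rounds of relaxation. -/
def relaxP : AProg :=
  .seq (.set .pw 0) <|
  .loop (lt (sc .pw) (inp 3 * (sc .lg + 2))) <|
    .seq (pullP 0) <| .seq (pullP 1) <| .seq (pullP 2) <| .set .pw (sc .pw + 1)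

/-- Bellman–Ford along links. The three kinds of links are treated one after the other within a
round; a later pull may already see improved values, which can only help, so after `i` rounds all
walks of at most `i` links are accounted for. Since each value remains an initial value plus the
weight of an actual walk, nothing drops too low. -/
theorem relaxP_ok {I : ℕ → ℕ} {B N R D : ℕ} {σ : St} (hB : N + R + D + 1 ≤ B)
    (hN : σ .nn 0 = N) (hR : I 3 * (σ .lg 0 + 2) = R) (hx : ∀ z < N, σ .x z ≤ D)
    (hlk : ∀ r < 3 * N, σ .lk r < N) :
    Ok I B relaxP σ fun σ' k d => (∀ z < N, σ' .x z ≤ σ .x z) ∧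
      (∀ z < N, ∀ k ≤ R, ∀ l y, LinkWalk (σ .lk) (σ .wl) z k l y → σ' .x z ≤ σ .x y + l) ∧
      (∀ z < N, ∃ k l y, y < N ∧ LinkWalk (σ .lk) (σ .wl) z k l y ∧ σ' .x z = σ .x y + l) ∧
      Same [.pw, .x] σ σ' ∧ k ≤ R * (3 * N + 6) + 3 ∧ d ≤ R * 5 + 2 := by
  refine Ok.seq (Ok.set (by omega) (by simp) fun σ₁ h1 f1 => ?_)
  simp only [eval_ofNat] at h1
  refine Ok.loop R (3 * N + 5) 4 (fun i σ' => σ' .pw 0 = i ∧ (∀ z < N, σ' .x z ≤ σ .x z) ∧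
      (∀ z < N, ∀ k ≤ i, ∀ l y, LinkWalk (σ .lk) (σ .wl) z k l y → σ' .x z ≤ σ .x y + l) ∧
      (∀ z < N, ∃ k l y, y < N ∧ LinkWalk (σ .lk) (σ .wl) z k l y ∧ σ' .x z = σ .x y + l) ∧
      Same [.pw, .x] σ σ') ?_ ?_ ?_ ?_
  · have x1 : σ₁ .x = σ .x := f1 _ (by simp)
    refine ⟨by simpa using h1, fun z _ => by rw [x1], ?_, ?_, Same.of_ne f1 (by decide)⟩
    · intro z hz k hk l y hw
      obtain rfl : k = 0 := by omega
      cases hw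
      rw [x1]; exact le_rfl
    · intro z hz
      exact ⟨0, 0, z, hz, .nil z, by rw [x1, add_zero]⟩
  · rintro i hi σ₂ ⟨a1, a2, a3, a4, S2⟩
    have one : ∀ (c : AE) (c' : ℕ), c' < 3 → (∀ σ i, c.eval I σ i = c') → ∀ σ₂ : St,
        (∀ z < N, σ₂ .x z ≤ σ .x z) →
        (∀ z < N, ∃ k l y, y < N ∧ LinkWalk (σ .lk) (σ .wl) z k l y ∧ σ₂ .x z = σ .x y + l) →
        Same [.pw, .x] σ σ₂ → Ok I B (pullP c) σ₂ fun σ' k d =>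
          (∀ z < N, σ' .x z ≤ σ₂ .x z) ∧
          (∀ z < N, σ' .x z ≤ σ₂ .x (σ .lk (3 * z + c')) + σ .wl (3 * z + c')) ∧
          (∀ z < N, ∃ k l y, y < N ∧ LinkWalk (σ .lk) (σ .wl) z k l y ∧
            σ' .x z = σ .x y + l) ∧ Same [.pw, .x] σ σ' ∧ σ' .pw = σ₂ .pw ∧ k ≤ N + 1 ∧ d ≤ 1 := by
      intro c c' hc' hc σ₂ a2 a4 S2
      refine (pullP_ok (N := N) (hc σ₂) (by rw [S2 _ (by decide), hN]) (by omega)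
        fun z hz => ((a2 z hz).trans (hx z hz)).trans (by omega)).imp ?_
      rintro σ' k d ⟨h, f, hk, hd⟩
      rw [S2 .lk (by decide), S2 .wl (by decide)] at h
      refine ⟨fun z hz => (h z hz).le.trans (min_le_left _ _),
        fun z hz => (h z hz).le.trans (min_le_right _ _), fun z hz => ?_,
        S2.trans (Same.of_ne f (by decide)), f _ (by simp), hk, hd⟩
      rw [h z hz]
      rcases min_choice (σ₂ .x z) (σ₂ .x (σ .lk (3 * z + c')) + σ .wl (3 * z + c')) with e | e
      · rw [e]; exact a4 z hz
      · rw [e]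
        obtain ⟨k, l, y, hy, hw, he⟩ := a4 (σ .lk (3 * z + c')) (hlk _ (by omega))
        exact ⟨k + 1, _, y, hy, hw.cons c' hc', by rw [he]; ring⟩
    refine ⟨by simp [a1, S2 .lg (by decide), hR, hi], ?_⟩
    refine Ok.seq ((one 0 0 (by omega) (by simp) σ₂ a2 a4 S2).imp ?_)
    rintro σ₃ k3 d3 ⟨b1, b2, b3, S3, p3, hk3, hd3⟩
    refine Ok.seq ((one 1 1 (by omega) (by simp) σ₃ (fun z hz => (b1 z hz).trans (a2 z hz))
      b3 S3).imp ?_)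
    rintro σ₄ k4 d4 ⟨c1, c2, c3, S4, p4, hk4, hd4⟩
    refine Ok.seq ((one 2 2 (by omega) (by simp) σ₄
      (fun z hz => ((c1 z hz).trans (b1 z hz)).trans (a2 z hz)) c3 S4).imp ?_)
    rintro σ₅ k5 d5 ⟨e1, e2, e3, S5, p5, hk5, hd5⟩
    have pw5 : σ₅ .pw 0 = i := by rw [p5, p4, p3, a1]
    refine Ok.set (by omega) (by simp [pw5]; omega) fun σ₆ h6 f6 => ?_
    have x6 : σ₆ .x = σ₅ .x := f6 _ (by simp)
    refine ⟨⟨by rw [h6]; simp [pw5], ?_, ?_, ?_, S5.trans (Same.of_ne f6 (by decide))⟩, by omega,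
      by omega⟩
    · intro z hz
      rw [x6]
      exact (((e1 z hz).trans (c1 z hz)).trans (b1 z hz)).trans (a2 z hz)
    · intro z hz k hk l y hw
      rw [x6]
      cases hw with
      | nil => exact (((e1 z hz).trans (c1 z hz)).trans (b1 z hz)).trans (a2 z hz)
      | @cons _ k l _ c hc hw =>
        have hz' := hlk (3 * z + c) (by omega)
        have ih := a3 _ hz' k (by omega) l y hw
        have g3 := b1 _ hz'
        have g4 := c1 _ hz'
        interval_cases c
        · have := b2 z hz; have := c1 z hz; have := e1 z hz; omega
        · have := c2 z hz; have := e1 z hz; omega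
        · have := e2 z hz; omega
    · intro z hz
      rw [x6]; exact e3 z hz
  · rintro σ₂ ⟨a1, -, -, -, S2⟩
    simp [a1, S2 .lg (by decide), hR]
  · rintro σ₂ k d ⟨a1, a2, a3, a4, S2⟩ hk hd
    have e : R * (3 * N + 5 + 1) = R * (3 * N + 6) := rfl
    exact ⟨a2, a3, a4, S2, by omega, by omega⟩

/-! ### Rounding of weights -/

/-- Delay exponents: the least `j` with `wl * h * cap ≤ 2 ^ j * dd`. -/
def classP : AProg :=
  .seq (.map (3 * sc .nn) 1 .kl 0) <| .seq (.set .pw 1) <| .seq (.set .tm 0) <|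
  .loop (lt (sc .pw) (4 * sc .cap * sc .ll)) <|
    .seq (.map (3 * sc .nn) (lt (sc .pw * sc .dd) (rd .wl pid * inp 3 * sc .cap)) .kl
      (sc .tm + 1)) <|
    .seq (.set .tm (sc .tm + 1)) (.set .pw (sc .pw * 2))

/-- The condition `2 ^ j * D < wl * h * CAP` is antitone in `j`, so overwriting with `j + 1`
whenever it holds leaves the least exponent at which it fails. Exponents are capped where `2 ^ j`
reaches `4 * CAP * L`: with scales below `2 * CAP`, such a link has a delay beyond the horizon `L`
anyway. -/
theorem classP_ok {I : ℕ → ℕ} {B N L h D CAP Λ : ℕ} {σ : St} (hB : 3 * N + 8 * CAP * L + 2 ≤ B)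
    (hN : σ .nn 0 = N) (hL : σ .ll 0 = L) (hC : σ .cap 0 = CAP) (hD : σ .dd 0 = D)
    (hh : I 3 = h) (hΛ : 4 * CAP * L ≤ 2 ^ Λ) :
    Ok I B classP σ fun σ' k d => (∀ r < 3 * N, σ' .kl r ≤ Nat.clog 2 (4 * CAP * L) ∧
        ∀ j < Nat.clog 2 (4 * CAP * L), j < σ' .kl r ↔ 2 ^ j * D < σ .wl r * h * CAP) ∧
      Same [.kl, .pw, .tm] σ σ' ∧ k ≤ (Λ + 1) * (3 * N + 6) ∧ d ≤ (Λ + 1) * 4 := by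
  have h8 : 8 * CAP * L = 2 * (4 * CAP * L) := by ring
  refine Ok.seq (Ok.map (by simp [hN]; omega) (by simp) fun σ₁ h1 f1 => ?_)
  refine Ok.seq (Ok.set (by omega) (by simp; omega) fun σ₂ h2 f2 => ?_)
  refine Ok.seq (Ok.set (by omega) (by simp) fun σ₃ h3 f3 => ?_)
  simp only [eval_ofNat] at h2 h3
  refine Ok.loop (Nat.clog 2 (4 * CAP * L)) (3 * N + 5) 3
    (fun i σ' => σ' .tm 0 = i ∧ σ' .pw 0 = 2 ^ i ∧ (∀ r < 3 * N, σ' .kl r ≤ i ∧ ∀ j < i,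
        j < σ' .kl r ↔ 2 ^ j * D < σ .wl r * h * CAP) ∧
      Same [.kl, .pw, .tm] σ σ') ?_ ?_ ?_ ?_
  · refine ⟨by simpa using h3, by rw [f3 _ (by simp), h2]; simp, fun r hr => ?_, ?_⟩
    · have : σ₃ .kl r = 0 := by
        rw [f3 _ (by simp), f2 _ (by simp), h1]; simp [hN, hr]
      rw [this]; exact ⟨le_rfl, fun j hj => by omega⟩
    · exact ((Same.of_ne f1 (by decide)).trans (Same.of_ne f2 (by decide))).trans
        (Same.of_ne f3 (by decide))
  · rintro i hi σ₄ ⟨a1, a2, a3, S4⟩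
    have hlt := Nat.pow_lt_of_lt_clog hi
    have hi2 : i < 2 ^ i := Nat.lt_two_pow_self
    have hiB : i + 1 ≤ B := by omega
    have hpB : 2 ^ i * 2 ≤ B := by omega
    have S4' : ∀ a, a ∉ ([.kl, .pw, .tm] : List Arr) → σ₄ a = σ a := S4
    refine ⟨by simp [a2, S4' .cap (by decide), S4' .ll (by decide), hC, hL, hlt], ?_⟩
    refine Ok.seq (Ok.map (by simp [S4' .nn (by decide), hN]; omega)
      (by intro r _ _; simpa [a1] using hiB) fun σ₅ h5 f5 => ?_)
    refine Ok.seq (Ok.set (by omega) (by simpa [f5, a1] using hiB) fun σ₆ h6 f6 => ?_)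
    refine Ok.set (by omega) (by simpa [f6, f5, a2] using hpB) fun σ₇ h7 f7 => ?_
    refine ⟨⟨?_, ?_, ?_, ?_⟩, ?_, by omega⟩
    · rw [f7 _ (by simp), h6]; simp [f5, a1]
    · rw [h7]; simp [f6, f5, a2, pow_succ]
    · intro r hr
      have e : σ₇ .kl r = if 2 ^ i * D < σ .wl r * h * CAP then i + 1 else σ₄ .kl r := by
        rw [f7 _ (by simp), f6 _ (by simp), h5]
        simp [S4' .nn (by decide), hN, hr, S4' .dd (by decide), hD, S4' .wl (by decide), hh,
          S4' .cap (by decide), hC, a1, a2]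
      obtain ⟨b1, b2⟩ := a3 r hr
      rw [e]
      split_ifs with hg
      · refine ⟨le_rfl, fun j hj => ⟨fun _ => ?_, fun _ => hj⟩⟩
        exact (Nat.mul_le_mul_right _ (Nat.pow_le_pow_right (by omega) (by omega))).trans_lt hg
      · refine ⟨by omega, fun j hj => ?_⟩
        rcases Nat.lt_succ_iff_lt_or_eq.1 hj with hj' | rfl
        · exact b2 j hj'
        · exact ⟨fun h => by omega, fun h => absurd h hg⟩
    · exact ((S4.trans (Same.of_ne f5 (by decide))).trans (Same.of_ne f6 (by decide))).trans
        (Same.of_ne f7 (by decide))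
    · simp [S4' .nn (by decide), hN]
  · rintro σ₄ ⟨a1, a2, a3, S4⟩
    have := Nat.le_pow_clog one_lt_two (4 * CAP * L)
    simp [a2, S4 .cap (by decide), S4 .ll (by decide), hC, hL, this]
  · rintro σ₄ k d ⟨a1, a2, a3, S4⟩ hk hd
    have hc : Nat.clog 2 (4 * CAP * L) ≤ Λ := (Nat.clog_le_iff_le_pow (by omega)).2 hΛ
    have h1 := hk.trans (Nat.add_le_add_right (Nat.mul_le_mul_right _ hc) 1)
    have h2 := hd.trans (Nat.add_le_add_right (Nat.mul_le_mul_right _ hc) 1)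
    refine ⟨a3, S4, ?_, ?_⟩
    · simp only [eval_mul, eval_sc, eval_ofNat, hN]
      linarith
    · linarith


/-! ### Comparison of rounded delays with true weights. -/

open AE

section
variable {lk wl kl : ℕ → ℕ} {N J D h CAP i : ℕ}

theorem LinkReach.lt {cls : ℕ → ℕ} {x z δ : ℕ} (h : LinkReach lk cls x z δ) (hx : x < N)
    (hlk : ∀ r < 3 * N, lk r < N) : z < N := by
  induction h with
  | nil => exact hx
  | step _ c hc ih => exact hlk _ (by omega)

/-- A node that is reached early is close. -/
theorem LinkReach.exists_linkWalk {L : ℕ} (hlk : ∀ r < 3 * N, lk r < N)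
    (hkl : ∀ r < 3 * N, ∀ j < Nat.clog 2 (4 * CAP * L), j < kl r ↔ 2 ^ j * D < wl r * h * CAP)
    {x z δ : ℕ} (hr : LinkReach lk (fun r => kl r - i) x z δ) (hx : x < N) (hi : 2 ^ i < 2 * CAP)
    (hδ : δ ≤ L) : ∃ k l, LinkWalk lk wl x k l z ∧ l * h * CAP ≤ δ * 2 ^ i * D := by
  induction hr with
  | nil => exact ⟨0, 0, .nil _, by simp⟩
  | @step z δ hr c hc ih =>
    have hz := hr.lt hx hlk
    obtain ⟨k, l, hw, hl⟩ := ih ((Nat.le_add_right _ _).trans hδ)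
    refine ⟨_, _, hw.snoc c hc, ?_⟩
    set r := 3 * z + c with hrr
    have hpos := Nat.one_le_two_pow (n := kl r - i)
    have e1 : 2 ^ kl r ≤ 2 ^ (kl r - i) * 2 ^ i := by
      rw [← pow_add]; exact Nat.pow_le_pow_right (by omega) (by omega)
    -- The cap on exponents is not active on this link: its delay is at most `L` and `2 ^ i < 2 *
    -- CAP`. Hence `kl r` is the true exponent and the rounded weight is not below `wl r`.
    have e2 : 2 ^ kl r < 4 * CAP * L := by
      have hL : 2 ^ (kl r - i) ≤ L := by omega
      by_cases hk : kl r ≤ i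
      · have : 2 ^ kl r ≤ 2 ^ i := Nat.pow_le_pow_right (by omega) hk
        nlinarith
      · have e3 : 2 ^ kl r = 2 ^ (kl r - i) * 2 ^ i := by rw [← pow_add]; congr 1; omega
        nlinarith [Nat.mul_le_mul_right (2 ^ i) hL]
    have e3 : ¬ 2 ^ kl r * D < wl r * h * CAP := fun h =>
      lt_irrefl _ ((hkl r (by omega) (kl r) ((Nat.lt_clog_iff_pow_lt (by omega)).2 e2)).2 h)
    have e4 := Nat.mul_le_mul_right D e1
    calc (l + wl r) * h * CAP = l * h * CAP + wl r * h * CAP := by ring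
      _ ≤ δ * 2 ^ i * D + 2 ^ (kl r - i) * 2 ^ i * D := by omega
      _ = _ := by ring

/-- A node at the end of a short walk with few links is reached early. -/
theorem LinkWalk.exists_linkReach (hlk : ∀ r < 3 * N, lk r < N)
    (hkl : ∀ r < 3 * N, kl r ≤ J ∧ ∀ j < J, j < kl r ↔ 2 ^ j * D < wl r * h * CAP) {x y k l z : ℕ}
    (hw : LinkWalk lk wl y k l z) (hy : y < N) :
    ∀ {δ}, LinkReach lk (fun r => kl r - i) x y δ →
      ∃ e, LinkReach lk (fun r => kl r - i) x z (δ + k + e) ∧ e * 2 ^ i * D ≤ 2 * h * CAP * l := by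
  induction hw with
  | nil => intro δ hr; exact ⟨0, by simpa using hr, by simp⟩
  | @cons y k l z c hc hw ih =>
    intro δ hr
    obtain ⟨e, he, he'⟩ := ih (hlk _ (by omega)) (hr.step c hc)
    set r := 3 * y + c with hrr
    -- Each link is charged one time unit, counted in `k`, and the excess of its delay over one unit
    -- is collected in `e`. There is an excess only if `kl r > i`; then minimality of `kl r` shows
    -- that rounding to a power of two less than doubled the weight.
    refine ⟨2 ^ (kl r - i) - 1 + e, ?_, ?_⟩
    · have := Nat.one_le_two_pow (n := kl r - i)
      convert he using 1; omega
    · have key : (2 ^ (kl r - i) - 1) * 2 ^ i * D ≤ 2 * h * CAP * wl r := by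
        by_cases hk : kl r ≤ i
        · simp [Nat.sub_eq_zero_of_le hk]
        · obtain ⟨hJ, hj⟩ := hkl r (by omega)
          have h1 := (hj (kl r - 1) (by omega)).1 (by omega)
          have h2 : 2 ^ kl r = 2 * 2 ^ (kl r - 1) := by rw [← pow_succ']; congr 1; omega
          have h3 : 2 ^ (kl r - i) * 2 ^ i = 2 ^ kl r := by rw [← pow_add]; congr 1; omega
          calc (2 ^ (kl r - i) - 1) * 2 ^ i * D ≤ 2 ^ (kl r - i) * 2 ^ i * D :=
                Nat.mul_le_mul_right _ (Nat.mul_le_mul_right _ (Nat.sub_le _ _))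
            _ = 2 * (2 ^ (kl r - 1) * D) := by rw [h3, h2]; ring
            _ ≤ 2 * (wl r * h * CAP) := by omega
            _ = _ := by ring
      calc _ = (2 ^ (kl r - i) - 1) * 2 ^ i * D + e * 2 ^ i * D := by ring
        _ ≤ 2 * h * CAP * wl r + 2 * h * CAP * l := Nat.add_le_add key he'
        _ = _ := by ring

end

/-! ### One phase -/

/-- What one phase achieves for the estimates `X`, where `f` are the estimates at the hubs. -/
structure PhaseSpec (lk wl hub : ℕ → ℕ) (N T R D lam : ℕ) (f X : ℕ → ℕ) : Prop where
  le : ∀ z < N, X z ≤ D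
  zero : X (hub 0) = 0
  hub_le : ∀ i < T, ∀ j < T, ∀ k ≤ R, ∀ l, LinkWalk lk wl (hub i) k l (hub j) → f i ≤ f j + l
  le_add : ∀ z < N, ∀ j < T, ∀ k ≤ R, ∀ l, LinkWalk lk wl z k l (hub j) → X z ≤ f j + l
  eq_add : ∀ z < N, X z = D ∨ ∃ j < T, ∃ k l, LinkWalk lk wl z k l (hub j) ∧ X z = f j + l
  sound : ∀ z < N, X z < D → ∃ k l, LinkWalk lk wl z k l (hub 0) ∧ 4 * l ≤ 8 * lam * X z + D

/-- One phase: estimate the distances up to `dd`. -/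
def phaseP : AProg :=
  .seq classP <| .seq scalesP <| .seq closureP <|
  .seq (.map (sc .nn) 1 .x (sc .dd)) <|
  .seq (.par (sc .tt) 1 .x (rd .hub pid)
    ((rd .mat (pid * sc .tt) * sc .dd + sc .cap - 1) / sc .cap)) relaxP

/-- The arrays changed by a phase. -/
abbrev phaseArr : List Arr := [.kl, .pw, .tm, .x] ++ scalesArr ++ closureArr

/-- Every step of a path between hubs contributes its own additive error `lam * D`, from the `+ 1`
in `hsound`; therefore the number of steps enters the bound. Entries below `CAP` are the only ones
backed by walks, and a path of length below `CAP` has no others. -/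
theorem pathSum_linkWalk {lk wl hub : ℕ → ℕ} {a : ℕ → ℕ → ℕ} {CAP T lam D : ℕ}
    (hsound : ∀ x < T, ∀ y < T, a x y < CAP →
      ∃ k l, LinkWalk lk wl (hub x) k l (hub y) ∧ l * CAP ≤ lam * D * (2 * a x y + 1))
    (k : ℕ) (p : ℕ → ℕ) (hp : ∀ t ≤ k, p t < T) (hlt : pathSum a p k < CAP) :
    ∃ q l, LinkWalk lk wl (hub (p 0)) q l (hub (p k)) ∧
      l * CAP ≤ lam * D * (2 * pathSum a p k + k) := by
  induction k with
  | zero => exact ⟨0, 0, .nil _, by simp⟩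
  | succ k ih =>
    have e : pathSum a p (k + 1) = pathSum a p k + a (p k) (p (k + 1)) := by
      simp [pathSum, Finset.sum_range_succ]
    obtain ⟨q, l, hw, hl⟩ := ih (fun t ht => hp t (by omega)) (by omega)
    obtain ⟨q', l', hw', hl'⟩ := hsound (p k) (hp k (by omega)) (p (k + 1)) (hp _ le_rfl) (by omega)
    refine ⟨_, _, hw.append hw', ?_⟩
    rw [e]
    calc (l + l') * CAP = l * CAP + l' * CAP := by ring
      _ ≤ _ := Nat.add_le_add hl hl'
      _ = _ := by ring

-- Matrix entries are lower estimates for short walks, in units of `D / CAP`, and are at most a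
-- factor of order `lam` too small up to rounding. Both properties survive the closure. Estimates at
-- hubs are obtained by rounding up to integers, relaxation extends them to all nodes, and the
-- initial value `D` handles everything farther away. Links run against the edges, so column `0` of
-- the matrix describes distances from the source.
set_option maxHeartbeats 1000000 in
theorem phaseP_ok {I : ℕ → ℕ} {B T N h lam D Λ : ℕ} {σ : St}
    (hB : 6 * (T * N) + 2 * (T * T * T) + 8 * (8 * T * lam) * (h * lam) + 4 * (8 * T * lam) +
      3 * (h * lam) + 3 * N + D + 10 ≤ B)
    (hT : σ .tt 0 = T) (hN : σ .nn 0 = N) (hlam : σ .lg 0 + 4 = lam) (hL : σ .ll 0 = h * lam)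
    (hC : σ .cap 0 = 8 * T * lam) (hD : σ .dd 0 = D) (hh : I 3 = h) (h1 : 1 ≤ h) (hT1 : 1 ≤ T)
    (hD1 : 1 ≤ D) (hΛ : 3 * (T * N) ≤ 2 ^ Λ) (hΛC : 4 * (8 * T * lam) * (h * lam) ≤ 2 ^ Λ)
    (hlk : ∀ r < 3 * N, σ .lk r < N) (hhub : ∀ x < T, σ .hub x < N) :
    Ok I B phaseP σ fun σ' k d =>
      (∃ f, PhaseSpec (σ .lk) (σ .wl) (σ .hub) N T (h * (σ .lg 0 + 2)) D lam f (σ' .x)) ∧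
      Same phaseArr σ σ' ∧ k ≤ 300 * (Λ + 1) ^ 3 * (T * N + T * T * T + h * lam * N) ∧
      d ≤ 150 * (Λ + 1) ^ 3 * (h * lam) := by
  set CAP := 8 * T * lam with hCAP
  set L := h * lam with hLdef
  set R := h * (σ .lg 0 + 2) with hRdef
  have hN1 : 0 < N := (Nat.zero_le _).trans_lt (hhub 0 (by omega))
  -- The horizon `L` exceeds the number `R` of links of a short walk by `2 * h`, which is exactly
  -- the room for the rounding excess of a walk of weight at most `2 ^ i * D / CAP`.
  have hRL : R + 2 * h = L := by rw [hRdef, hLdef, ← hlam]; ring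
  have hC1 : 1 ≤ CAP := by rw [hCAP]; nlinarith [Nat.mul_le_mul hT1 (show 1 ≤ lam by omega)]
  have hL1 : 1 ≤ L := by omega
  have hTN : T ≤ T * N := Nat.le_mul_of_pos_right _ hN1
  have hTT : T * T ≤ T * T * T := Nat.le_mul_of_pos_right _ hT1
  have hT2 : T ≤ T * T := Nat.le_mul_of_pos_right _ hT1
  have hT3 : 2 * T * T * T = 2 * (T * T * T) := by ring
  have hCL : 4 * CAP ≤ 4 * CAP * L := Nat.le_mul_of_pos_right _ hL1
  have hLC : L ≤ 4 * CAP * L := Nat.le_mul_of_pos_left _ (by omega)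
  refine Ok.seq ((classP_ok (N := N) (L := L) (CAP := CAP) (D := D) (h := h) (Λ := Λ) (by omega)
    hN hL hC hD hh hΛC).imp ?_)
  rintro σ₁ k1 d1 ⟨c1, S1, hk1, hd1⟩
  refine Ok.seq ((scalesP_ok (T := T) (N := N) (L := L) (CAP := CAP) (Λ := Λ) (by omega)
    (by rw [S1 _ (by decide), hT]) (by rw [S1 _ (by decide), hN]) (by rw [S1 _ (by decide), hL])
    hT1 (by rw [S1 _ (by decide), hC]) hΛ (by omega) (by rwa [S1 _ (by decide)])
    (by rwa [S1 _ (by decide)])).imp ?_)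
  rintro σ₂ k2 d2 ⟨c2, S2, hk2, hd2⟩
  rw [S1 .lk (by decide), S1 .hub (by decide)] at c2
  -- entries of the matrix
  have hfeas : ∀ x < T, ∀ y < T, ∀ k ≤ R, ∀ l, LinkWalk (σ .lk) (σ .wl) (σ .hub x) k l (σ .hub y) →
      σ₂ .mat (x * T + y) * D ≤ l * CAP := by
    intro x hx y hy k hk l hw
    obtain ⟨m1, -, m3⟩ := c2 x hx y hy
    by_cases hl : D ≤ l
    · calc _ ≤ CAP * D := Nat.mul_le_mul_right _ m1
        _ ≤ l * CAP := by rw [mul_comm]; exact Nat.mul_le_mul_right _ hl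
    · have hex : ∃ i, l * CAP ≤ 2 ^ i * D := ⟨l * CAP,
        (Nat.lt_two_pow_self.le).trans (Nat.le_mul_of_pos_right _ hD1)⟩
      classical
      -- At the least scale that accommodates `l` the search must succeed, while the next smaller
      -- scale lies strictly below `l`; so the entry, half of the scale, does not overestimate.
      obtain ⟨i, hi, hmin⟩ : ∃ i, l * CAP ≤ 2 ^ i * D ∧ ∀ j < i, 2 ^ j * D < l * CAP :=
        ⟨Nat.find hex, Nat.find_spec hex, fun j hj => not_le.1 (Nat.find_min hex hj)⟩
      have hsee : HubSees (σ .lk) (σ₁ .kl) (σ .hub) L i x y := by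
        obtain ⟨e, he, he'⟩ := hw.exists_linkReach (i := i) hlk c1 (hhub x hx) .nil
        refine ⟨_, ?_, he⟩
        have h5 : e * (2 ^ i * D) ≤ 2 * h * (2 ^ i * D) := by
          calc e * (2 ^ i * D) = e * 2 ^ i * D := by ring
            _ ≤ 2 * h * CAP * l := he'
            _ = 2 * h * (l * CAP) := by ring
            _ ≤ _ := Nat.mul_le_mul_left _ hi
        have h6 : e ≤ 2 * h := Nat.le_of_mul_le_mul_right h5 (by positivity)
        omega
      have hi2 : 2 ^ i < 2 * CAP := by
        rcases i with _ | i
        · omega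
        · have h5 := hmin i (by omega)
          have h6 : 2 ^ i * D < CAP * D := by
            rw [mul_comm CAP]; exact h5.trans_le (Nat.mul_le_mul_right _ (by omega))
          have := Nat.lt_of_mul_lt_mul_right h6
          rw [pow_succ]; omega
      have h7 := m3 i hi2 hsee
      rcases i with _ | i
      · have : σ₂ .mat (x * T + y) = 0 := by simpa using h7
        rw [this]; omega
      · rw [pow_succ, Nat.mul_div_cancel _ (by omega)] at h7
        exact (Nat.mul_le_mul_right _ h7).trans (hmin i (by omega)).le
  have hsound : ∀ x < T, ∀ y < T, σ₂ .mat (x * T + y) < CAP →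
      ∃ k l, LinkWalk (σ .lk) (σ .wl) (σ .hub x) k l (σ .hub y) ∧
        l * CAP ≤ lam * D * (2 * σ₂ .mat (x * T + y) + 1) := by
    intro x hx y hy hlt
    obtain ⟨-, m2, -⟩ := c2 x hx y hy
    rcases m2 with m2 | ⟨i, hi, δ, hδ, hr⟩
    · omega
    · obtain ⟨k, l, hw, hl⟩ := hr.exists_linkWalk hlk (fun r hr => (c1 r hr).2) (hhub x hx)
        (by omega) hδ
      refine ⟨k, l, hw, ?_⟩
      have h5 : h * (l * CAP) ≤ h * (lam * D * (2 * σ₂ .mat (x * T + y) + 1)) := by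
        calc h * (l * CAP) = l * h * CAP := by ring
          _ ≤ δ * 2 ^ i * D := hl
          _ ≤ L * (2 * σ₂ .mat (x * T + y) + 1) * D := by
            refine Nat.mul_le_mul_right _ (Nat.mul_le_mul hδ ?_); omega
          _ = _ := by rw [hLdef]; ring
      exact Nat.le_of_mul_le_mul_left h5 h1
  have hT0 : σ₂ .tt 0 = T := by rw [S2 _ (by decide), S1 _ (by decide), hT]
  refine Ok.seq ((closureP_ok (T := T) (CAP := CAP) (Λ := Λ) (by omega) hT0 hT1 (by omega)
    (fun x hx y hy => (c2 x hx y hy).1) ?_).imp ?_)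
  · intro x hx
    have := (c2 x hx x hx).2.2 0 (by omega) ⟨0, by omega, .nil⟩
    simpa using this
  rintro σ₃ k3 d3 ⟨e1, e2, S3, hk3, hd3⟩
  have S13 : Same phaseArr σ σ₃ := ((S1.mono (by decide)).trans (S2.mono (by decide))).trans
    (S3.mono (by decide))
  have nn3 : σ₃ .nn 0 = N := by rw [S13 _ (by decide), hN]
  have dd3 : σ₃ .dd 0 = D := by rw [S13 _ (by decide), hD]
  have tt3 : σ₃ .tt 0 = T := by rw [S13 _ (by decide), hT]
  have cap3 : σ₃ .cap 0 = CAP := by rw [S13 _ (by decide), hC]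
  have hub3 : σ₃ .hub = σ .hub := S13 _ (by decide)
  set f : ℕ → ℕ := fun i => (σ₃ .mat (i * T) * D + CAP - 1) / CAP with hf
  have hceil : ∀ a b : ℕ, (a + CAP - 1) / CAP ≤ b ↔ a ≤ b * CAP := by
    intro a b
    rw [← Nat.lt_succ_iff, Nat.div_lt_iff_lt_mul (by omega), Nat.succ_mul]; omega
  have hF0 : ∀ i < T, σ₃ .mat (i * T) ≤ CAP := fun i hi => by simpa using (e2 i hi 0 (by omega)).1
  have hfD : ∀ i < T, f i ≤ D := fun i hi => by
    rw [hf]; dsimp only; rw [hceil, mul_comm D]; exact Nat.mul_le_mul_right _ (hF0 i hi)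
  have hfF : ∀ i, σ₃ .mat (i * T) * D ≤ f i * CAP := fun i => (hceil _ _).1 le_rfl
  -- The closure satisfies the triangle inequality, and an entry times `D` is at most the walk
  -- weight times `CAP`. Rounding up is compatible with this because the added weight `l` is an
  -- integer.
  have hfa : ∀ i < T, ∀ j < T, ∀ k ≤ R, ∀ l, LinkWalk (σ .lk) (σ .wl) (σ .hub i) k l (σ .hub j) →
      f i ≤ f j + l := by
    intro i hi j hj k hk l hw
    rw [hf]; dsimp only; rw [hceil]
    have h5 := closure_triangle (a := fun x y => σ₂ .mat (x * T + y))
      (a' := fun x y => σ₃ .mat (x * T + y)) e1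
      (fun x hx y hy => by
        obtain ⟨-, k, -, p, hp⟩ := e2 x hx y hy; exact ⟨k, p, hp⟩) hi hj
      (show 0 < T by omega)
    simp only [add_zero] at h5
    have h6 := hfeas i hi j hj k hk l hw
    have h7 := hfF j
    calc σ₃ .mat (i * T) * D ≤ (σ₂ .mat (i * T + j) + σ₃ .mat (j * T)) * D :=
          Nat.mul_le_mul_right _ h5
      _ = σ₂ .mat (i * T + j) * D + σ₃ .mat (j * T) * D := by ring
      _ ≤ l * CAP + f j * CAP := Nat.add_le_add h6 h7
      _ = (f j + l) * CAP := by ring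
  have hfs : ∀ i < T, f i < D → ∃ k l, LinkWalk (σ .lk) (σ .wl) (σ .hub i) k l (σ .hub 0) ∧
      4 * l ≤ 8 * lam * f i + D := by
    intro i hi hlt
    obtain ⟨k, hk, p, hp0, hpk, hpT, hps⟩ := (e2 i hi 0 (by omega)).2
    rw [add_zero] at hps
    have hFC : σ₃ .mat (i * T) < CAP := by
      by_contra hge
      have h5 := hfF i
      have h6 : CAP * D ≤ f i * CAP := (Nat.mul_le_mul_right _ (not_lt.1 hge)).trans h5
      rw [mul_comm] at h6
      have := Nat.le_of_mul_le_mul_right h6 hC1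
      omega
    obtain ⟨q, l, hw, hl⟩ := pathSum_linkWalk hsound k p hpT (by rw [← hps]; exact hFC)
    rw [hp0, hpk] at hw
    refine ⟨q, l, hw, ?_⟩
    rw [← hps] at hl
    -- The realizing path has at most `2 * T` steps, each with error `lam * D`. The choice `CAP = 8
    -- * T * lam` makes the total error `D / 4` after division by `CAP`.
    refine Nat.le_of_mul_le_mul_right ?_ hC1
    calc 4 * l * CAP = 4 * (l * CAP) := by ring
      _ ≤ 4 * (lam * D * (2 * σ₃ .mat (i * T) + 2 * T)) := by
        refine Nat.mul_le_mul_left _ (hl.trans (Nat.mul_le_mul_left _ (by omega)))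
      _ = 8 * lam * (σ₃ .mat (i * T) * D) + D * CAP := by rw [hCAP]; ring
      _ ≤ 8 * lam * (f i * CAP) + D * CAP :=
        Nat.add_le_add_right (Nat.mul_le_mul_left _ (hfF i)) _
      _ = _ := by ring
  refine Ok.seq (Ok.map (by simp [nn3]; omega) (by simp [dd3]; omega) fun σ₄ h4 f4 => ?_)
  have dd4 : σ₄ .dd 0 = D := by rw [f4 _ (by simp), dd3]
  have tt4 : σ₄ .tt 0 = T := by rw [f4 _ (by simp), tt3]
  have cap4 : σ₄ .cap 0 = CAP := by rw [f4 _ (by simp), cap3]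
  have hub4 : σ₄ .hub = σ .hub := by rw [f4 _ (by simp), hub3]
  have mat4 : σ₄ .mat = σ₃ .mat := f4 _ (by simp)
  refine Ok.seq (Ok.scat (by simp [tt4]; omega) ?_ fun σ₅ h5 f5 => ?_)
  · intro i hi _
    simp only [eval_sc, tt4] at hi
    have := hfD i hi
    simp only [hf] at this
    simp [tt4, cap4, mat4, dd4]; omega
  simp only [eval_sc, tt4, eval_ofNat, eval_rd, eval_pid, hub4, eval_div, eval_sub, eval_add,
    eval_mul, mat4, dd4, cap4] at h5
  change σ₅ .x = scatter T (fun _ => 1 ≠ 0) (σ .hub) f (σ₄ .x) at h5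
  have hx4 : ∀ z < N, σ₄ .x z = D := fun z hz => by rw [h4]; simp [nn3, hz, dd3]
  have x5 : ∀ z < N, σ₅ .x z = D ∨ ∃ j < T, σ .hub j = z ∧ σ₅ .x z = f j := by
    intro z hz
    rw [h5]
    rcases scatter_cases T (fun _ => 1 ≠ 0) (σ .hub) f (σ₄ .x) z with h | ⟨j, hj, -, he, h⟩
    · exact .inl (h.trans (hx4 z hz))
    · exact .inr ⟨j, hj, he, h⟩
  -- Different hub indices may name the same vertex, and the least index wins the write. A walk
  -- without links joins them, so `hfa` shows that the written value is no larger than any of the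
  -- competing ones.
  have x5' : ∀ j < T, σ₅ .x (σ .hub j) ≤ f j := by
    intro j hj
    obtain ⟨i, hij, -, he, hs, -⟩ := scatter_spec (N := T) (g := fun _ => 1 ≠ 0) (idx := σ .hub)
      (v := f) (old := σ₄ .x) hj (by simp)
    rw [h5, hs]
    have := hfa i (by omega) j hj 0 (by omega) 0 (by rw [he]; exact .nil _)
    simpa using this
  have S35 : Same phaseArr σ σ₅ := (S13.trans (Same.of_ne f4 (by decide))).trans
    (Same.of_ne f5 (by decide))
  have x5D : ∀ z < N, σ₅ .x z ≤ D := by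
    intro z hz
    rcases x5 z hz with h | ⟨j, hj, -, h⟩
    · omega
    · rw [h]; exact hfD j hj
  refine (relaxP_ok (N := N) (R := R) (D := D) (by omega) (by rw [S35 _ (by decide), hN])
    (by rw [S35 _ (by decide), hh]) x5D (by rwa [S35 _ (by decide)])).imp ?_
  rintro σ₆ k6 d6 ⟨r1, r2, r3, S6, hk6, hd6⟩
  rw [S35 .lk (by decide), S35 .wl (by decide)] at r2 r3
  have r3' : ∀ z < N, σ₆ .x z = D ∨ ∃ j < T, ∃ k l,
      LinkWalk (σ .lk) (σ .wl) z k l (σ .hub j) ∧ σ₆ .x z = f j + l := by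
    intro z hz
    obtain ⟨k, l, y, hy, hw, he⟩ := r3 z hz
    rcases x5 y hy with h | ⟨j, hj, rfl, h⟩
    · left
      have := (r1 z hz).trans (x5D z hz)
      omega
    · exact .inr ⟨j, hj, k, l, hw, by rw [he, h]⟩
  refine ⟨⟨f, ⟨fun z hz => (r1 z hz).trans (x5D z hz), ?_, hfa, ?_, r3', ?_⟩⟩,
    S35.trans (S6.mono (by decide)), ?_, ?_⟩
  · have h8 := (r1 _ (hhub 0 hT1)).trans (x5' 0 hT1)
    have h9 : f 0 ≤ 0 := by
      rw [hf]; dsimp only; rw [hceil]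
      have := e1 (fun _ => 0) 0 (by omega) (fun _ _ => hT1)
      simp [pathSum] at this
      simp [this]
    omega
  · intro z hz j hj k hk l hw
    exact (r2 z hz k hk l _ hw).trans (Nat.add_le_add_right (x5' j hj) _)
  · intro z hz hlt
    rcases r3' z hz with h | ⟨j, hj, k, l, hw, he⟩
    · omega
    · obtain ⟨k', l', hw', hl'⟩ := hfs j hj (by omega)
      refine ⟨_, _, hw.append hw', ?_⟩
      rw [he]
      have h5 : 4 * l ≤ 8 * lam * l := Nat.mul_le_mul_right _ (by omega)
      have h6 : 8 * lam * (f j + l) = 8 * lam * f j + 8 * lam * l := by ring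
      omega
  · have hlog : Nat.log 2 L + 1 ≤ Λ + 1 := Nat.succ_le_succ (by
      calc Nat.log 2 L ≤ Nat.log 2 (2 ^ Λ) := Nat.log_mono_right (by omega)
        _ = Λ := Nat.log_pow (by omega) _)
    have p1 : Λ + 1 ≤ (Λ + 1) ^ 3 := Nat.le_self_pow (by omega) _
    have p2 : (Λ + 1) ^ 2 ≤ (Λ + 1) ^ 3 := Nat.pow_le_pow_right (by omega) (by omega)
    have p0 : 1 ≤ (Λ + 1) ^ 3 := Nat.one_le_pow _ _ (by omega)
    set M := T * N + T * T * T + L * N with hM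
    have hLN : L ≤ L * N := Nat.le_mul_of_pos_right _ hN1
    have hNL : N ≤ L * N := Nat.le_mul_of_pos_left _ hL1
    have q1 : k1 ≤ 9 * ((Λ + 1) ^ 3 * M) := by
      calc k1 ≤ (Λ + 1) * (3 * N + 6) := hk1
        _ ≤ (Λ + 1) ^ 3 * (9 * M) := Nat.mul_le_mul p1 (by omega)
        _ = _ := by ring
    have q2 : k2 ≤ 200 * ((Λ + 1) ^ 3 * M) := by
      have h5 : 60 * (Λ + 1) * (Nat.log 2 L + 1) * (T * N + L + 1) ≤
          60 * (Λ + 1) * (Λ + 1) * (3 * M) :=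
        Nat.mul_le_mul (Nat.mul_le_mul_left _ hlog) (by omega)
      have h6 : 2 * (T * T) + 10 ≤ (Λ + 1) * (Λ + 1) * (12 * M) :=
        (show 2 * (T * T) + 10 ≤ 12 * M by omega).trans (Nat.le_mul_of_pos_left _ (by positivity))
      calc k2 ≤ _ := hk2
        _ ≤ (Λ + 1) * (60 * (Λ + 1) * (Λ + 1) * (3 * M) + (Λ + 1) * (Λ + 1) * (12 * M)) := by
          refine Nat.mul_le_mul_left _ ?_; omega
        _ = 192 * ((Λ + 1) ^ 3 * M) := by ring
        _ ≤ _ := Nat.mul_le_mul_right _ (by omega)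
    have q3 : k3 ≤ 23 * ((Λ + 1) ^ 3 * M) := by
      calc k3 ≤ (Λ + 1) * ((Λ + 1) * (3 * (T * T * T) + 20)) := hk3
        _ ≤ (Λ + 1) * ((Λ + 1) * (23 * M)) := by
          refine Nat.mul_le_mul_left _ (Nat.mul_le_mul_left _ ?_); omega
        _ = (Λ + 1) ^ 2 * (23 * M) := by ring
        _ ≤ (Λ + 1) ^ 3 * (23 * M) := Nat.mul_le_mul_right _ p2
        _ = _ := by ring
    have q4 : M ≤ (Λ + 1) ^ 3 * M := Nat.le_mul_of_pos_left _ p0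
    have q5 : k6 ≤ 12 * M := by
      have h5 : R * (3 * N + 6) ≤ L * (9 * N) := Nat.mul_le_mul (by omega) (by omega)
      have h6 : L * (9 * N) = 9 * (L * N) := by ring
      omega
    simp only [eval_sc, nn3, tt4]
    have : 300 * (Λ + 1) ^ 3 * M = 300 * ((Λ + 1) ^ 3 * M) := by ring
    omega
  · have hlog : Nat.log 2 L + 1 ≤ Λ + 1 := Nat.succ_le_succ (by
      calc Nat.log 2 L ≤ Nat.log 2 (2 ^ Λ) := Nat.log_mono_right (by omega)
        _ = Λ := Nat.log_pow (by omega) _)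
    have p1 : Λ + 1 ≤ (Λ + 1) ^ 3 := Nat.le_self_pow (by omega) _
    have p2 : (Λ + 1) ^ 2 ≤ (Λ + 1) ^ 3 := Nat.pow_le_pow_right (by omega) (by omega)
    have p0 : 1 ≤ (Λ + 1) ^ 3 := Nat.one_le_pow _ _ (by omega)
    have q0 : L ≤ (Λ + 1) ^ 3 * L := Nat.le_mul_of_pos_left _ p0
    have q1 : (Λ + 1) ^ 3 ≤ (Λ + 1) ^ 3 * L := Nat.le_mul_of_pos_right _ hL1
    have q2 : d2 ≤ 70 * ((Λ + 1) ^ 3 * L) := by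
      have h5 : 30 * (Λ + 1) * (Nat.log 2 L + 1) * (L + 1) ≤ 30 * (Λ + 1) * (Λ + 1) * (2 * L) :=
        Nat.mul_le_mul (Nat.mul_le_mul_left _ hlog) (by omega)
      have h6 : 10 ≤ (Λ + 1) * (Λ + 1) * (10 * L) :=
        (show 10 ≤ 10 * L by omega).trans (Nat.le_mul_of_pos_left _ (by positivity))
      calc d2 ≤ _ := hd2
        _ ≤ (Λ + 1) * (30 * (Λ + 1) * (Λ + 1) * (2 * L) + (Λ + 1) * (Λ + 1) * (10 * L)) := by
          refine Nat.mul_le_mul_left _ ?_; omega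
        _ = _ := by ring
    have q3 : d3 ≤ 20 * (Λ + 1) ^ 3 := by
      calc d3 ≤ (Λ + 1) * ((Λ + 1) * 20) := hd3
        _ = 20 * (Λ + 1) ^ 2 := by ring
        _ ≤ _ := Nat.mul_le_mul_left _ p2
    have : 150 * (Λ + 1) ^ 3 * L = 150 * ((Λ + 1) ^ 3 * L) := by ring
    omega


open AE

/-! ### Search trees over the incoming edges -/

/-- The vertex in whose tree a node lies; node `n + j` stands for edge `j`. -/
def owner (n : ℕ) (head : ℕ → ℕ) (z : ℕ) : ℕ := if z < n then z else head (z - n)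

theorem owner_of_lt {n z : ℕ} {head : ℕ → ℕ} (h : z < n) : owner n head z = z := if_pos h

theorem owner_add {n j : ℕ} {head : ℕ → ℕ} : owner n head (n + j) = head j := by simp [owner]

/-- Invariant of the construction of the search trees after `d` rounds; `loc j` is the link at
which edge `j` is being inserted. -/
structure TreeInv (n m : ℕ) (head : ℕ → ℕ) (d : ℕ) (loc lk : ℕ → ℕ) : Prop where
  mod_eq : ∀ j < m, ∀ j' < m, loc j = loc j' → j % 2 ^ d = j' % 2 ^ d
  alone : ∀ j < m, ∀ e < m, ∀ b < 2, loc j = 3 * (n + e) + b → ∀ j' < m, loc j' = loc e → j' = e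
  depth : ∃ dep : ℕ → ℕ, ∀ j < m, dep j ≤ d ∧ (dep j = 0 ∧ loc j = 3 * head j ∨
    ∃ e < m, ∃ b < 2, loc j = 3 * (n + e) + b ∧ dep j = dep e + 1 ∧ head e = head j)
  own : ∀ r < 3 * (n + m), lk r = r / 3 ∨ r % 3 < 2 ∧ ∃ j < m, lk r = n + j ∧
    owner n head (r / 3) = head j

section
variable {n m d : ℕ} {head loc lk : ℕ → ℕ}

theorem TreeInv.init (hhead : ∀ j < m, head j < n) {loc lk : ℕ → ℕ}
    (hloc : ∀ j < m, loc j = 3 * head j) (hlk : ∀ r < 3 * (n + m), lk r = r / 3) :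
    TreeInv n m head 0 loc lk := by
  refine ⟨fun j _ j' _ _ => by simp [Nat.mod_one], fun j hj e _ b _ he => ?_,
    ⟨fun _ => 0, fun j hj => ⟨le_rfl, .inl ⟨rfl, hloc j hj⟩⟩⟩, fun r hr => .inl (hlk r hr)⟩
  have := hhead j hj
  rw [hloc j hj] at he; omega

theorem TreeInv.own_loc (h : TreeInv n m head d loc lk) (hhead : ∀ j < m, head j < n) {j : ℕ}
    (hj : j < m) : loc j % 3 < 2 ∧ owner n head (loc j / 3) = head j ∧ loc j < 3 * (n + m) := by
  obtain ⟨dep, hd⟩ := h.depth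
  have hh := hhead j hj
  rcases (hd j hj).2 with ⟨-, h1⟩ | ⟨e, he, b, hb, h1, -, h2⟩
  · rw [h1, Nat.mul_div_cancel_left _ (by omega), owner_of_lt hh]
    omega
  · have e1 : loc j / 3 = n + e := by omega
    rw [e1, owner_add]
    exact ⟨by omega, h2, by omega⟩

theorem TreeInv.own_scatter (h : TreeInv n m head d loc lk) (hhead : ∀ j < m, head j < n)
    {g : ℕ → Prop} : ∀ r < 3 * (n + m), scatter m g loc (n + ·) lk r = r / 3 ∨ r % 3 < 2 ∧
      ∃ j < m, scatter m g loc (n + ·) lk r = n + j ∧ owner n head (r / 3) = head j := by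
  intro r hr
  rcases scatter_cases m g loc (n + ·) lk r with h1 | ⟨j, hj, -, rfl, h1⟩
  · rw [h1]; exact h.own r hr
  · obtain ⟨h2, h3, -⟩ := h.own_loc hhead hj
    exact .inr ⟨h2, j, hj, h1, h3⟩

/-- One round of simultaneous insertion. -/
theorem TreeInv.step (h : TreeInv n m head d loc lk) (hhead : ∀ j < m, head j < n)
    {loc' lk' : ℕ → ℕ} (hlk' : lk' = scatter m (fun _ => 1 ≠ 0) loc (n + ·) lk)
    (hloc' : ∀ j < m, loc' j =
      if lk' (loc j) ≠ n + j then 3 * lk' (loc j) + j / 2 ^ d % 2 else loc j) :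
    TreeInv n m head (d + 1) loc' lk' := by
  have win : ∀ j < m, ∃ e < m, lk' (loc j) = n + e ∧ loc e = loc j := by
    intro j hj
    obtain ⟨e, he, -, h1, h2, -⟩ := scatter_spec (N := m) (g := fun _ => 1 ≠ 0) (idx := loc)
      (v := (n + ·)) (old := lk) hj (by simp)
    exact ⟨e, by omega, by rw [hlk', h2], h1⟩
  have cases' : ∀ j < m, (loc' j = loc j ∧ lk' (loc j) = n + j) ∨ ∃ e < m, e ≠ j ∧ loc e = loc j ∧
      lk' (loc j) = n + e ∧ loc' j = 3 * (n + e) + j / 2 ^ d % 2 := by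
    intro j hj
    obtain ⟨e, he, h1, h2⟩ := win j hj
    have h3 := hloc' j hj
    by_cases hej : e = j
    · subst hej
      left; rw [h3, h1]; simp
    · right
      refine ⟨e, he, hej, h2, h1, ?_⟩
      rw [h3, h1, if_pos (by omega)]
  have keep : ∀ j < m, (∀ j' < m, loc j' = loc j → j' = j) → loc' j = loc j := by
    intro j hj hal
    rcases cases' j hj with h1 | ⟨e, he, hej, h1, -⟩
    · exact h1.1
    · exact absurd (hal e he h1) hej
  have keepw : ∀ j < m, ∀ e < m, lk' (loc j) = n + e → loc e = loc j → loc' e = loc e := by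
    intro j hj e he h1 h2
    rw [hloc' e he, h2, h1]; simp
  have hb : ∀ j, j / 2 ^ d % 2 < 2 := fun j => Nat.mod_lt _ (by omega)
  -- Suppose `e` wins at its link against everybody there. An edge that stays at this link would be
  -- another winner. An edge that moves there leaves the link of some `e2` below which `e` already
  -- sits; but `e2` is alone at that link, so there is nobody else to move.
  have noMove : ∀ e < m, ∀ j'' < m, loc' j'' = loc e → j'' ≠ e →
      (∀ j' < m, loc j' = loc e → lk' (loc j') = n + e) → False := by
    intro e he j'' hj'' h1 hne hw
    rcases cases' j'' hj'' with ⟨h2, h3⟩ | ⟨e2, he2, hne2, h2, h3, h4⟩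
    · have := hw j'' hj'' (h2.symm.trans h1)
      omega
    · exact hne2.symm (h.alone e he e2 he2 _ (hb j'') (h1.symm.trans h4) j'' hj'' h2.symm)
  refine ⟨?_, ?_, ?_, ?_⟩
  · intro j hj j' hj' he
    rcases cases' j hj with ⟨h1, h2⟩ | ⟨e, he1, hne, h1, h2, h3⟩ <;>
      rcases cases' j' hj' with ⟨h1', h2'⟩ | ⟨e', he1', hne', h1', h2', h3'⟩
    · have h5 : loc j = loc j' := by rw [← h1, ← h1', he]
      rw [h5] at h2
      have : j = j' := by omega
      rw [this]
    · exact absurd (h.alone j hj e' he1' _ (hb j') (by rw [← h1, he, h3']) j' hj' h1'.symm)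
        (Ne.symm hne')
    · exact absurd (h.alone j' hj' e he1 _ (hb j) (by rw [← h1', ← he, h3]) j hj h1.symm)
        (Ne.symm hne)
    · have hbj := hb j
      have hbj' := hb j'
      have h5 : e = e' := by omega
      have h6 : j / 2 ^ d % 2 = j' / 2 ^ d % 2 := by omega
      subst h5
      have h7 := h.mod_eq j hj j' hj' (by rw [← h1, h1'])
      rw [pow_succ, Nat.mod_mul, Nat.mod_mul, h6, h7]
  · intro j hj e he b hbl h1 j'' hj'' h2
    by_contra hne
    rcases cases' j hj with ⟨h3, -⟩ | ⟨e', he', hne', h3, h4, h5⟩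
    · have hal := h.alone j hj e he b hbl (by rw [← h3, h1])
      rw [keep e he hal] at h2
      refine noMove e he j'' hj'' h2 hne fun j' hj' hl => ?_
      obtain ⟨w, hw, h6, h7⟩ := win j' hj'
      rw [h6, hal w hw (h7.trans hl)]
    · have hbj := hb j
      obtain rfl : e = e' := by omega
      rw [keepw j hj e he h4 h3] at h2
      exact noMove e he j'' hj'' h2 hne fun j' _ hl => by rw [hl, h3, h4]
  · obtain ⟨dep, hd⟩ := h.depth
    refine ⟨fun j => if lk' (loc j) = n + j then dep j else dep (lk' (loc j) - n) + 1,
      fun j hj => ?_⟩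
    beta_reduce
    rcases cases' j hj with ⟨h1, h2⟩ | ⟨e, he, hne, h1, h2, h3⟩
    · rw [if_pos h2, h1]
      obtain ⟨h3, h4⟩ := hd j hj
      refine ⟨by omega, h4.imp_right ?_⟩
      rintro ⟨e, he, b, hbl, h5, h6, h7⟩
      refine ⟨e, he, b, hbl, h5, ?_, h7⟩
      obtain ⟨w, hw, h8, h9⟩ := win e he
      rw [if_pos, h6]
      rw [h8, h.alone j hj e he b hbl h5 w hw h9]
    · have hlt : lk' (loc j) ≠ n + j := by omega
      have hle : lk' (loc e) = n + e := by rw [h1, h2]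
      rw [if_neg hlt, h2, Nat.add_sub_cancel_left]
      refine ⟨by have := (hd e he).1; omega, .inr ⟨e, he, _, hb j, h3, by rw [if_pos hle], ?_⟩⟩
      rw [← (h.own_loc hhead he).2.1, ← (h.own_loc hhead hj).2.1, h1]
  · rw [hlk']; exact h.own_scatter hhead

end

/-- The link structure: search trees over the incoming edges, whose leaves lead to the tails. -/
structure LinkSpec (n m : ℕ) (tail head : ℕ → ℕ) (LG : ℕ) (lk : ℕ → ℕ) : Prop where
  lt : ∀ r < 3 * (n + m), lk r < n + m
  tail_eq : ∀ j < m, lk (3 * (n + j) + 2) = tail j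
  own : ∀ r < 3 * (n + m), (r % 3 < 2 ∨ r / 3 < n) → owner n head (lk r) = owner n head (r / 3)
  reach : ∀ j < m, ∀ wl : ℕ → ℕ, (∀ r, r % 3 < 2 → wl r = 0) →
    ∃ k ≤ LG + 1, LinkWalk lk wl (head j) k 0 (n + j)

/-- Edges that share a link agree modulo `2 ^ d ≥ m`, hence are equal: after `d` rounds every edge
has a link of its own, and the last write puts it there. Induction on the depth then follows the
links from the head down to the edge. Links never written are loops with an unchanged owner, and the
third link of an edge node is redirected to the tail. -/
theorem TreeInv.linkSpec {n m d : ℕ} {tail head loc lk : ℕ → ℕ} (h : TreeInv n m head d loc lk)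
    (hhead : ∀ j < m, head j < n) (htail : ∀ j < m, tail j < n) (hm : m ≤ 2 ^ d) {lk' lk'' : ℕ → ℕ}
    (hlk' : lk' = scatter m (fun _ => 1 ≠ 0) loc (n + ·) lk)
    (hlk'' : lk'' = scatter m (fun _ => 1 ≠ 0) (fun j => 3 * (n + j) + 2) tail lk') :
    LinkSpec n m tail head d lk'' := by
  have hinj : ∀ j < m, ∀ j' < m, loc j = loc j' → j = j' := by
    intro j hj j' hj' he
    have := h.mod_eq j hj j' hj' he
    rwa [Nat.mod_eq_of_lt (by omega), Nat.mod_eq_of_lt (by omega)] at this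
  have hown : ∀ r < 3 * (n + m), (r % 3 < 2 ∨ r / 3 < n) → lk'' r = lk' r := by
    intro r hr hc
    rw [hlk'']
    refine scatter_of_forall fun i hi _ => ?_
    omega
  have htl : ∀ j < m, lk'' (3 * (n + j) + 2) = tail j := by
    intro j hj
    rw [hlk'']
    exact scatter_inj (idx := fun j => 3 * (n + j) + 2) hj (by simp) fun j' _ _ he => by omega
  have hown' := h.own_scatter (g := fun _ => 1 ≠ 0) hhead
  rw [← hlk'] at hown'
  have hplace : ∀ j < m, lk'' (loc j) = n + j := by
    intro j hj
    obtain ⟨h1, -, h3⟩ := h.own_loc hhead hj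
    rw [hown _ h3 (.inl h1), hlk']
    exact scatter_inj hj (by simp) fun j' hj' _ he => hinj j' hj' j hj he
  refine ⟨fun r hr => ?_, htl, fun r hr hc => ?_, ?_⟩
  · by_cases hc : r % 3 < 2 ∨ r / 3 < n
    · rw [hown r hr hc]
      rcases hown' r hr with h1 | ⟨-, j, hj, h1, -⟩ <;> omega
    · have e : r = 3 * (n + (r / 3 - n)) + 2 := by omega
      rw [e, htl _ (by omega)]
      have := htail (r / 3 - n) (by omega)
      omega
  · rw [hown r hr hc]
    rcases hown' r hr with h1 | ⟨-, j, hj, h1, h2⟩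
    · rw [h1]
    · rw [h1, owner_add, h2]
  · intro j hj wl hwl
    obtain ⟨dep, hd⟩ := h.depth
    suffices H : ∀ t, ∀ j < m, dep j = t → LinkWalk lk'' wl (head j) (t + 1) 0 (n + j) from
      ⟨_, Nat.succ_le_succ (hd j hj).1, H _ j hj rfl⟩
    intro t
    induction t with
    | zero =>
      intro j hj hdj
      rcases (hd j hj).2 with ⟨-, h1⟩ | ⟨e, he, b, hb, h1, h2, h3⟩
      · have := (LinkWalk.nil (lk := lk'') (wl := wl) (head j)).snoc 0 (by omega)
        rwa [add_zero (3 * head j), ← h1, hplace j hj, hwl _ (h.own_loc hhead hj).1] at this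
      · omega
    | succ t ih =>
      intro j hj hdj
      rcases (hd j hj).2 with ⟨h0, -⟩ | ⟨e, he, b, hb, h1, h2, h3⟩
      · omega
      · have := (ih e he (by omega)).snoc b (by omega)
        rwa [← h1, hplace j hj, hwl _ (h.own_loc hhead hj).1, h3] at this

/-- Walks along edges: `EdgeWalk tail head m wt u k l v` means that there is a walk of `k` edges
from `u` to `v` of weight `l`. -/
inductive EdgeWalk (tail head : ℕ → ℕ) (m : ℕ) (wt : ℕ → ℕ) (u : ℕ) : ℕ → ℕ → ℕ → Prop
  | nil : EdgeWalk tail head m wt u 0 0 u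
  | snoc {k l : ℕ} (j : ℕ) (hj : j < m) (h : EdgeWalk tail head m wt u k l (tail j)) :
      EdgeWalk tail head m wt u (k + 1) (l + wt j) (head j)

/-- The weights of links that belong to the edge weights `wt`. -/
structure LinkWeights (n m : ℕ) (wt wl : ℕ → ℕ) : Prop where
  zero : ∀ r, r % 3 < 2 ∨ r / 3 < n → wl r = 0
  edge : ∀ j < m, wl (3 * (n + j) + 2) = wt j

section
variable {n m LG : ℕ} {tail head lk wt wl : ℕ → ℕ}

/-- Links run backwards. The last edge of the walk costs at most `LG + 1` tree links of weight `0`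
from its head to its node, and one link that carries its weight to its tail. -/
theorem LinkSpec.linkWalk (hs : LinkSpec n m tail head LG lk) (hw : LinkWeights n m wt wl)
    {u k l v : ℕ} (h : EdgeWalk tail head m wt u k l v) :
    ∃ k' ≤ k * (LG + 2), LinkWalk lk wl v k' l u := by
  induction h with
  | nil => exact ⟨0, by simp, .nil _⟩
  | snoc j hj _ ih =>
    obtain ⟨k', hk', h1⟩ := ih
    obtain ⟨q, hq, h2⟩ := hs.reach j hj wl fun r hr => hw.zero r (.inl hr)
    have h3 := h2.append ((LinkWalk.cons 2 (by omega) (by rwa [hs.tail_eq j hj]) :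
      LinkWalk lk wl (n + j) (k' + 1) _ u))
    rw [hw.edge j hj] at h3
    refine ⟨_, ?_, by rwa [zero_add, add_comm (wt j)] at h3⟩
    rw [add_mul]; omega

/-- The owner changes only along the third link of an edge node, and that link has the weight of its
edge and leads from head to tail. All other links have weight `0` and stay within the tree of one
vertex, so projecting a link walk to owners gives an edge walk of the same weight. -/
theorem LinkSpec.edgeWalk (hs : LinkSpec n m tail head LG lk) (hw : LinkWeights n m wt wl)
    (htail : ∀ j < m, tail j < n) {z k l u : ℕ} (h : LinkWalk lk wl z k l u) (hz : z < n + m)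
    (hu : u < n) : ∃ k', EdgeWalk tail head m wt u k' l (owner n head z) := by
  induction h with
  | nil => rw [owner_of_lt hu]; exact ⟨0, .nil⟩
  | @cons z k l y c hc h ih =>
    obtain ⟨k', h1⟩ := ih (hs.lt _ (by omega)) hu
    by_cases h2 : (3 * z + c) % 3 < 2 ∨ (3 * z + c) / 3 < n
    · rw [hs.own _ (by omega) h2, show (3 * z + c) / 3 = z by omega] at h1
      rw [hw.zero _ h2, zero_add]
      exact ⟨k', h1⟩
    · obtain ⟨j, rfl⟩ : ∃ j, z = n + j := ⟨z - n, by omega⟩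
      obtain rfl : c = 2 := by omega
      rw [hs.tail_eq j (by omega), owner_of_lt (htail j (by omega))] at h1
      rw [hw.edge j (by omega), owner_add, add_comm]
      exact ⟨_, h1.snoc j (by omega)⟩

end

/-- Computation of `lg` and the construction of the search trees. -/
def treeP : AProg :=
  .seq (.set .lg 0) <| .seq (.set .pw 1) <|
  .seq (.loop (lt (sc .pw) (inp 0 + inp 1 + 2))
    (.seq (.set .pw (sc .pw * 2)) (.set .lg (sc .lg + 1)))) <|
  .seq (.set .nn (inp 0 + inp 1)) <|
  .seq (.map (3 * sc .nn) 1 .lk (pid / 3)) <|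
  .seq (.map (inp 1) 1 .loc (3 * inp (5 + 3 * pid))) <|
  .seq (.set .pw 1) <|
  .seq (.loop (lt (sc .pw) (inp 0 + inp 1 + 2)) <|
    .seq (.par (inp 1) 1 .lk (rd .loc pid) (inp 0 + pid)) <|
    .seq (.map (inp 1) (not (eq (rd .lk (rd .loc pid)) (inp 0 + pid))) .loc
      (3 * rd .lk (rd .loc pid) + pid / sc .pw % 2)) <|
    .set .pw (sc .pw * 2)) <|
  .seq (.par (inp 1) 1 .lk (rd .loc pid) (inp 0 + pid)) <|
  .par (inp 1) 1 .lk (3 * (inp 0 + pid) + 2) (inp (4 + 3 * pid))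

theorem treeP_ok {I : ℕ → ℕ} {B n m : ℕ} {σ : St} (hB : 3 * (n + m) + 4 ≤ B) (h0 : I 0 = n)
    (h1 : I 1 = m) (htail : ∀ j < m, I (4 + 3 * j) < n) (hhead : ∀ j < m, I (5 + 3 * j) < n) :
    Ok I B treeP σ fun σ' k d => σ' .lg 0 = Nat.clog 2 (n + m + 2) ∧ σ' .nn 0 = n + m ∧
      LinkSpec n m (fun j => I (4 + 3 * j)) (fun j => I (5 + 3 * j)) (σ' .lg 0) (σ' .lk) ∧
      Same [.lg, .pw, .nn, .lk, .loc] σ σ' ∧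
      k ≤ 30 * (Nat.clog 2 (n + m + 2) + 1) * (n + m + 1) ∧
      d ≤ 30 * (Nat.clog 2 (n + m + 2) + 1) := by
  set LG := Nat.clog 2 (n + m + 2) with hLG
  have hlgB : ∀ i < LG, i + 1 ≤ B ∧ 2 ^ i * 2 ≤ B ∧ 2 ^ i < n + m + 2 := fun i hi => by
    have h2 := Nat.pow_lt_of_lt_clog hi
    have h3 : i < 2 ^ i := Nat.lt_two_pow_self
    omega
  have hle : n + m + 2 ≤ 2 ^ LG := Nat.le_pow_clog one_lt_two _
  have hI : ∀ j < m, owner n (fun j => I (5 + 3 * j)) (I (5 + 3 * j)) = I (5 + 3 * j) :=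
    fun j hj => owner_of_lt (hhead j hj)
  refine Ok.seq (Ok.set (by omega) (by simp) fun σ₁ s1 f1 => ?_)
  refine Ok.seq (Ok.set (by omega) (by simp; omega) fun σ₂ s2 f2 => ?_)
  simp only [eval_ofNat] at s1 s2
  refine Ok.seq (Ok.loop LG 4 2 (fun i σ' => σ' .pw 0 = 2 ^ i ∧ σ' .lg 0 = i ∧
    Same [.lg, .pw, .nn, .lk, .loc] σ σ') ?_ ?_ ?_ ?_)
  · exact ⟨by simpa using s2, by rw [f2 _ (by simp), s1],
      (Same.of_ne f1 (by decide)).trans (Same.of_ne f2 (by decide))⟩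
  · rintro i hi σ₃ ⟨a1, a2, S3⟩
    obtain ⟨b1, b2, b3⟩ := hlgB i hi
    refine ⟨by simp [a1, h0, h1, b3], ?_⟩
    refine Ok.seq (Ok.set (by omega) (by simpa [a1] using b2) fun σ₄ s4 f4 => ?_)
    refine Ok.set (by omega) (by simpa [f4, a2] using b1) fun σ₅ s5 f5 => ?_
    exact ⟨⟨by rw [f5 _ (by simp), s4]; simp [a1, pow_succ], by rw [s5]; simp [f4, a2],
      (S3.trans (Same.of_ne f4 (by decide))).trans (Same.of_ne f5 (by decide))⟩, le_rfl, le_rfl⟩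
  · rintro σ₃ ⟨a1, -, -⟩
    simp [a1, h0, h1, hle]
  rintro σ₃ k3 d3 ⟨-, lg3, S3⟩ hk3 hd3
  refine Ok.seq (Ok.set (by omega) (by simp [h0, h1]; omega) fun σ₄ s4 f4 => ?_)
  have nn4 : σ₄ .nn 0 = n + m := by rw [s4]; simp [h0, h1]
  refine Ok.seq (Ok.map (by simp [nn4]; omega) ?_ fun σ₅ s5 f5 => ?_)
  · intro r hr _
    simp [nn4] at hr ⊢; omega
  refine Ok.seq (Ok.map (by simp [h1]; omega) ?_ fun σ₆ s6 f6 => ?_)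
  · intro j hj _
    simp [h1] at hj ⊢
    have := hhead j hj; omega
  refine Ok.seq (Ok.set (by omega) (by simp; omega) fun σ₇ s7 f7 => ?_)
  simp only [eval_ofNat] at s7
  have lg7 : σ₇ .lg 0 = LG := by
    rw [f7 _ (by simp), f6 _ (by simp), f5 _ (by simp), f4 _ (by simp), lg3]
  have nn7 : σ₇ .nn 0 = n + m := by
    rw [f7 _ (by simp), f6 _ (by simp), f5 _ (by simp), nn4]
  have S7 : Same [.lg, .pw, .nn, .lk, .loc] σ σ₇ :=
    (((S3.trans (Same.of_ne f4 (by decide))).trans (Same.of_ne f5 (by decide))).trans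
      (Same.of_ne f6 (by decide))).trans (Same.of_ne f7 (by decide))
  refine Ok.seq (Ok.loop LG (2 * m + 4) 3 (fun i σ' => σ' .pw 0 = 2 ^ i ∧
    TreeInv n m (fun j => I (5 + 3 * j)) i (σ' .loc) (σ' .lk) ∧ Same [.pw, .lk, .loc] σ₇ σ')
    ?_ ?_ ?_ ?_)
  · refine ⟨by simpa using s7, TreeInv.init hhead ?_ ?_, Same.refl _ _⟩
    · intro j hj
      rw [f7 _ (by simp), s6]; simp [h1, hj]
    · intro r hr
      rw [f7 _ (by simp), f6 _ (by simp), s5]; simp [nn4, hr]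
  · rintro i hi σ₈ ⟨a1, a2, S8⟩
    obtain ⟨b1, b2, b3⟩ := hlgB i hi
    refine ⟨by simp [a1, h0, h1, b3], ?_⟩
    refine Ok.seq (Ok.scat (by simp [h1]; omega) ?_ fun σ₉ s9 f9 => ?_)
    · intro j hj _
      simp [h1] at hj; simp [h0]; omega
    simp only [eval_inp, eval_ofNat, h1, eval_rd, eval_pid, eval_add, h0] at s9
    have loc9 : σ₉ .loc = σ₈ .loc := f9 _ (by simp)
    have pw9 : σ₉ .pw 0 = 2 ^ i := by rw [f9 _ (by simp), a1]
    refine Ok.seq (Ok.map (by simp [h1]; omega) ?_ fun σ₁₀ s10 f10 => ?_)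
    · intro j hj _
      simp only [eval_inp, eval_ofNat, h1] at hj
      obtain ⟨e, he, -, -, h2, -⟩ := scatter_spec (N := m) (g := fun _ => 1 ≠ 0)
        (idx := σ₈ .loc) (v := (n + ·)) (old := σ₈ .lk) hj (by simp)
      have h3 : j / 2 ^ i % 2 < 2 := Nat.mod_lt _ (by omega)
      simp [loc9, pw9, s9]
      simp at h2
      rw [h2]; omega
    have loc10 : ∀ j < m, σ₁₀ .loc j = if σ₉ .lk (σ₈ .loc j) ≠ n + j then
        3 * σ₉ .lk (σ₈ .loc j) + j / 2 ^ i % 2 else σ₈ .loc j := by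
      intro j hj
      rw [s10]
      simp [h1, hj, loc9, h0, pw9]
    refine Ok.set (by omega) (by simpa [f10, pw9] using b2) fun σ₁₁ s11 f11 => ?_
    refine ⟨⟨?_, ?_, ?_⟩, ?_, by omega⟩
    · rw [s11]; simp [f10, pw9, pow_succ]
    · refine a2.step hhead ?_ ?_
      · rw [f11 _ (by simp), f10 _ (by simp), s9]
      · rw [f11 .loc (by simp), f11 .lk (by simp), f10 .lk (by simp)]; exact loc10
    · exact ((S8.trans (Same.of_ne f9 (by decide))).trans (Same.of_ne f10 (by decide))).trans
        (Same.of_ne f11 (by decide))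
    · simp [h1]; omega
  · rintro σ₈ ⟨a1, -, -⟩
    simp [a1, h0, h1, hle]
  rintro σ₈ k8 d8 ⟨-, a2, S8⟩ hk8 hd8
  refine Ok.seq (Ok.scat (by simp [h1]; omega) ?_ fun σ₉ s9 f9 => ?_)
  · intro j hj _
    simp [h1] at hj; simp [h0]; omega
  refine Ok.scat (by simp [h1]; omega) ?_ fun σ₁₀ s10 f10 => ?_
  · intro j hj _
    simp only [eval_inp, eval_ofNat, h1] at hj
    have := htail j hj
    simp; omega
  simp only [eval_inp, eval_ofNat, h1, eval_rd, eval_pid, eval_add, eval_mul, h0] at s9 s10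
  have S79 : Same [.pw, .lk, .loc] σ₇ σ₁₀ :=
    (S8.trans (Same.of_ne f9 (by decide))).trans (Same.of_ne f10 (by decide))
  have lg10 : σ₁₀ .lg 0 = LG := by rw [S79 _ (by decide), lg7]
  refine ⟨lg10, by rw [S79 _ (by decide), nn7], ?_, S7.trans (S79.mono (by decide)), ?_, ?_⟩
  · rw [lg10]
    exact a2.linkSpec hhead htail (by omega) s9 s10
  · simp only [eval_mul, eval_sc, nn4, eval_inp, eval_ofNat, h1]
    have e1 : LG * (2 * m + 4 + 1) ≤ 5 * (LG * (n + m + 1)) := by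
      calc LG * (2 * m + 4 + 1) ≤ LG * (5 * (n + m + 1)) := Nat.mul_le_mul_left _ (by omega)
        _ = _ := by ring
    have e2 : LG ≤ LG * (n + m + 1) := Nat.le_mul_of_pos_right _ (by omega)
    have e3 : 30 * (LG + 1) * (n + m + 1) = 30 * (LG * (n + m + 1)) + 30 * (n + m + 1) := by ring
    omega
  · omega


open AE

section
variable {n m : ℕ} {tail head wt : ℕ → ℕ}

/-! ### Hub chains -/

theorem EdgeWalk.append {u k l v k' l' x : ℕ} (h : EdgeWalk tail head m wt u k l v)
    (h' : EdgeWalk tail head m wt v k' l' x) : EdgeWalk tail head m wt u (k + k') (l + l') x := by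
  induction h' with
  | nil => simpa using h
  | snoc j hj _ ih =>
    have := ih.snoc j hj
    rwa [add_assoc, add_assoc] at this

theorem EdgeWalk.lt {u k l v : ℕ} (h : EdgeWalk tail head m wt u k l v) (hu : u < n)
    (hhead : ∀ j < m, head j < n) : v < n := by
  cases h with
  | nil => exact hu
  | snoc j hj _ => exact hhead j hj

theorem EdgeWalk.source_lt {u k l v : ℕ} (h : EdgeWalk tail head m wt u k l v) (hk : k ≠ 0)
    (htail : ∀ j < m, tail j < n) : u < n := by
  induction h with
  | nil => exact absurd rfl hk
  | @snoc k l j hj h ih =>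
    by_cases h0 : k = 0
    · subst h0; cases h; exact htail j hj
    · exact ih h0

/-- A chain of walks of at most `h` edges each, with hubs in between, of total weight `l`. -/
inductive HubChain (tail head : ℕ → ℕ) (m : ℕ) (wt hub : ℕ → ℕ) (T h u : ℕ) : ℕ → ℕ → Prop
  | base {k l v : ℕ} (hk : k ≤ h) (hw : EdgeWalk tail head m wt u k l v) :
      HubChain tail head m wt hub T h u l v
  | step {l k l' v i : ℕ} (hi : i < T) (hc : HubChain tail head m wt hub T h u l (hub i))
      (hk : k ≤ h) (hw : EdgeWalk tail head m wt (hub i) k l' v) :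
      HubChain tail head m wt hub T h u (l + l') v

/-- Every walk can be replaced by a hub chain. -/
def GoodHubs (tail head : ℕ → ℕ) (m : ℕ) (wt hub : ℕ → ℕ) (T h : ℕ) : Prop :=
  ∀ u k l v, EdgeWalk tail head m wt u k l v → ∃ l' ≤ l, HubChain tail head m wt hub T h u l' v

theorem GoodHubs.congr {hub hub' : ℕ → ℕ} {T h : ℕ} (hg : GoodHubs tail head m wt hub T h)
    (he : ∀ i < T, hub' i = hub i) : GoodHubs tail head m wt hub' T h := by
  intro u k l v hw
  obtain ⟨l', hl, hc⟩ := hg u k l v hw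
  refine ⟨l', hl, ?_⟩
  clear hl hw
  induction hc with
  | base hk hw => exact .base hk hw
  | step hi _ hk hw ih =>
    rw [← he _ hi] at ih hw
    exact .step hi ih hk hw

/-- The vertices of a walk, with the partial weights. -/
theorem EdgeWalk.exists_path {u k l v : ℕ} (h : EdgeWalk tail head m wt u k l v) :
    ∃ p c : ℕ → ℕ, p 0 = u ∧ p k = v ∧ c 0 = 0 ∧ c k = l ∧ ∀ i j, i ≤ j → j ≤ k →
      ∃ l', EdgeWalk tail head m wt (p i) (j - i) l' (p j) ∧ c i + l' = c j := by
  induction h with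
  | nil =>
    refine ⟨fun _ => u, fun _ => 0, rfl, rfl, rfl, rfl, fun i j hij hj => ⟨0, ?_, rfl⟩⟩
    rw [show j - i = 0 by omega]; exact .nil
  | @snoc k l j hj h ih =>
    obtain ⟨p, c, p0, pk, c0, ck, hp⟩ := ih
    refine ⟨fun i => if i = k + 1 then head j else p i, fun i => if i = k + 1 then l + wt j else c i,
      by simp [p0], by simp, by simp [c0], by simp, fun a b hab hb => ?_⟩
    by_cases hb' : b = k + 1
    · subst hb'
      by_cases ha : a = k + 1
      · subst ha; exact ⟨0, by simpa using EdgeWalk.nil, by simp⟩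
      · obtain ⟨l', h1, h2⟩ := hp a k (by omega) le_rfl
        rw [pk] at h1
        refine ⟨l' + wt j, ?_, by simp [ha]; omega⟩
        rw [show k + 1 - a = k - a + 1 by omega]
        simpa [ha] using h1.snoc j hj
    · obtain ⟨l', h1, h2⟩ := hp a b hab (by omega)
      exact ⟨l', by simpa [hb', show a ≠ k + 1 by omega] using h1,
        by simpa [hb', show a ≠ k + 1 by omega] using h2⟩

/-- A lightest walk with fewest edges. -/
structure MinWalk (tail head : ℕ → ℕ) (m : ℕ) (wt : ℕ → ℕ) (u k l v : ℕ) : Prop where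
  walk : EdgeWalk tail head m wt u k l v
  le : ∀ k' l', EdgeWalk tail head m wt u k' l' v → l ≤ l'
  hop : ∀ k', EdgeWalk tail head m wt u k' l v → k ≤ k'

theorem EdgeWalk.exists_minWalk {u k l v : ℕ} (h : EdgeWalk tail head m wt u k l v) :
    ∃ k' l', l' ≤ l ∧ MinWalk tail head m wt u k' l' v := by
  classical
  have h1 : ∃ l, ∃ k, EdgeWalk tail head m wt u k l v := ⟨l, k, h⟩
  have h2 := Nat.find_spec h1
  exact ⟨Nat.find h2, Nat.find h1, Nat.find_min' h1 ⟨k, h⟩, Nat.find_spec h2,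
    fun k' l' h' => Nat.find_min' h1 ⟨k', h'⟩, fun k' h' => Nat.find_min' h2 h'⟩

/-- The vertices of a minimal walk are distinct. -/
theorem MinWalk.injOn {u k l v : ℕ} (h : MinWalk tail head m wt u k l v) {p c : ℕ → ℕ}
    (p0 : p 0 = u) (pk : p k = v) (c0 : c 0 = 0) (ck : c k = l)
    (hp : ∀ i j, i ≤ j → j ≤ k →
      ∃ l', EdgeWalk tail head m wt (p i) (j - i) l' (p j) ∧ c i + l' = c j) :
    ∀ i j, i < j → j ≤ k → p i ≠ p j := by
  intro i j hij hj he
  obtain ⟨l1, h1, e1⟩ := hp 0 i (by omega) (by omega)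
  obtain ⟨l2, h2, e2⟩ := hp j k hj le_rfl
  obtain ⟨l3, -, e3⟩ := hp i j hij.le hj
  rw [← he] at h2
  have h3 := h1.append h2
  rw [p0, pk] at h3
  have h4 := h.le _ _ h3
  have h5 : l1 + l2 = l := by omega
  rw [h5] at h3
  have := h.hop _ h3
  omega

theorem MinWalk.card_le {u k l v : ℕ} (h : MinWalk tail head m wt u k l v) (hu : u < n)
    (hhead : ∀ j < m, head j < n) : k < n := by
  obtain ⟨p, c, p0, pk, c0, ck, hp⟩ := h.walk.exists_path
  have hinj := h.injOn p0 pk c0 ck hp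
  have h1 : ((Finset.range (k + 1)).image p).card = k + 1 := by
    rw [Finset.card_image_of_injOn, Finset.card_range]
    intro i hi j hj he
    simp at hi hj
    by_contra hne
    rcases Nat.lt_or_gt_of_ne hne with hlt | hlt
    · exact hinj i j hlt (by omega) he
    · exact hinj j i hlt (by omega) he.symm
  have h2 : (Finset.range (k + 1)).image p ⊆ Finset.range n := by
    intro x hx
    simp only [Finset.mem_image, Finset.mem_range] at hx ⊢
    obtain ⟨i, hi, rfl⟩ := hx
    obtain ⟨l', h3, -⟩ := hp 0 i (by omega) (by omega)
    exact h3.lt (by rwa [p0]) hhead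
  have := Finset.card_le_card h2
  rw [h1, Finset.card_range] at this
  omega

/-- A long minimal walk has `h` vertices close to its end. -/
theorem MinWalk.exists_finset {u k l v h : ℕ} (hm : MinWalk tail head m wt u k l v) (hu : u < n)
    (hhead : ∀ j < m, head j < n) (hk : h ≤ k) :
    ∃ S : Finset ℕ, S ⊆ Finset.range n ∧ S.card = h ∧ ∀ x ∈ S, ∃ k1 k2 l1 l2, k2 ≤ h ∧ k1 < k ∧
      l1 + l2 = l ∧ EdgeWalk tail head m wt u k1 l1 x ∧ EdgeWalk tail head m wt x k2 l2 v := by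
  obtain ⟨p, c, p0, pk, c0, ck, hp⟩ := hm.walk.exists_path
  have hinj := hm.injOn p0 pk c0 ck hp
  -- The positions `k - h, …, k - 1` leave out the end of the walk, so the part up to a chosen
  -- vertex has strictly fewer edges; this drives the induction over hub chains.
  refine ⟨(Finset.range h).image fun i => p (k - h + i), ?_, ?_, ?_⟩
  · intro x hx
    simp only [Finset.mem_image, Finset.mem_range] at hx ⊢
    obtain ⟨i, hi, rfl⟩ := hx
    obtain ⟨l', h3, -⟩ := hp 0 (k - h + i) (by omega) (by omega)
    exact h3.lt (by rwa [p0]) hhead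
  · rw [Finset.card_image_of_injOn, Finset.card_range]
    intro i hi j hj he
    simp at hi hj
    by_contra hne
    rcases Nat.lt_or_gt_of_ne hne with hlt | hlt
    · exact hinj _ _ (show k - h + i < k - h + j by omega) (by omega) he
    · exact hinj _ _ (show k - h + j < k - h + i by omega) (by omega) he.symm
  · intro x hx
    simp only [Finset.mem_image, Finset.mem_range] at hx
    obtain ⟨i, hi, rfl⟩ := hx
    obtain ⟨l1, h1, e1⟩ := hp 0 (k - h + i) (by omega) (by omega)
    obtain ⟨l2, h2, e2⟩ := hp (k - h + i) k (by omega) le_rfl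
    rw [p0] at h1
    rw [pk] at h2
    exact ⟨_, _, l1, l2, by omega, by omega, by omega, h1, h2⟩

/-- There are `n * n` sets of `h` vertices such that hubs that meet all of them are good. -/
theorem exists_hitting_sets {h : ℕ} (htail : ∀ j < m, tail j < n) (hhead : ∀ j < m, head j < n)
    (hn : h ≤ n) :
    ∃ S : ℕ → ℕ → Finset ℕ, (∀ u v, S u v ⊆ Finset.range n ∧ (S u v).card = h) ∧
      ∀ T hub, (∀ u < n, ∀ v < n, ∃ i < T, hub i ∈ S u v) →
        GoodHubs tail head m wt hub T h := by
  have key : ∀ u v, ∃ S : Finset ℕ, S ⊆ Finset.range n ∧ S.card = h ∧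
      ∀ k l, MinWalk tail head m wt u k l v → u < n → h < k → ∀ x ∈ S, ∃ k1 k2 l1 l2, k2 ≤ h ∧
        k1 < k ∧ l1 + l2 = l ∧ EdgeWalk tail head m wt u k1 l1 x ∧
          EdgeWalk tail head m wt x k2 l2 v := by
    intro u v
    by_cases hex : ∃ k l, MinWalk tail head m wt u k l v ∧ u < n ∧ h < k
    · obtain ⟨k, l, hm, hu, hk⟩ := hex
      obtain ⟨S, h1, h2, h3⟩ := hm.exists_finset hu hhead hk.le
      refine ⟨S, h1, h2, fun k' l' hm' _ _ => ?_⟩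
      -- One set per pair of vertices is enough: all minimal walks between them have the same weight
      -- and number of edges, so a split found on one of them fits the others.
      obtain rfl : l = l' := le_antisymm (hm.le _ _ hm'.walk) (hm'.le _ _ hm.walk)
      obtain rfl : k = k' := le_antisymm (hm.hop _ hm'.walk) (hm'.hop _ hm.walk)
      exact h3
    · exact ⟨Finset.range h, Finset.range_subset_range.2 hn, Finset.card_range h,
        fun k l hm hu hk => absurd ⟨k, l, hm, hu, hk⟩ hex⟩
  choose S hS using key
  refine ⟨S, fun u v => ⟨(hS u v).1, (hS u v).2.1⟩, fun T hub hit u k l v hw => ?_⟩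
  obtain ⟨k', l', hl, hm⟩ := hw.exists_minWalk
  refine ⟨l', hl, ?_⟩
  clear hl hw
  -- Induction on the number of edges: a hub among the last `h` vertices splits off a final piece of
  -- at most `h` edges. The walk up to the hub is replaced by a minimal one, which has the same
  -- weight, for otherwise the whole walk could be made lighter.
  induction k' using Nat.strong_induction_on generalizing v l' with
  | _ k' ih =>
    by_cases hk : k' ≤ h
    · exact .base hk hm.walk
    · have hu := hm.walk.source_lt (by omega) htail
      obtain ⟨i, hi, hx⟩ := hit u hu v (hm.walk.lt hu hhead)
      obtain ⟨k1, k2, l1, l2, hk2, hk1, e, h1, h2⟩ := (hS u v).2.2 k' l' hm hu (by omega) _ hx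
      obtain ⟨q, l3, hl3, hq⟩ := h1.exists_minWalk
      have e3 : l3 = l1 := by
        have := hm.le _ _ (hq.walk.append h2)
        omega
      subst e3
      rw [← e]
      exact .step hi (ih q (by have := hq.hop _ h1; omega) _ _ hq) hk2 h2

/-! ### Potentials -/

/-- Edge weights reduced by a potential (truncated at `0`). -/
def redW (tail head wt pot : ℕ → ℕ) (j : ℕ) : ℕ := wt j + pot (tail j) - pot (head j)

/-- Potentials for which reduced weights are not truncated. -/
def Feasible (tail head : ℕ → ℕ) (m : ℕ) (wt pot : ℕ → ℕ) : Prop :=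
  ∀ j < m, pot (head j) ≤ wt j + pot (tail j)

variable {pot : ℕ → ℕ}

/-- The potential differences telescope. Feasibility is needed so that truncated subtraction is true
subtraction on every edge. -/
theorem EdgeWalk.reduce (hf : Feasible tail head m wt pot) {u k l v : ℕ}
    (h : EdgeWalk tail head m wt u k l v) :
    ∃ l', EdgeWalk tail head m (redW tail head wt pot) u k l' v ∧ l' + pot v = l + pot u := by
  induction h with
  | nil => exact ⟨0, .nil, rfl⟩
  | snoc j hj _ ih =>
    obtain ⟨l', h1, h2⟩ := ih
    refine ⟨_, h1.snoc j hj, ?_⟩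
    have := hf j hj
    unfold redW; omega

theorem EdgeWalk.unreduce (hf : Feasible tail head m wt pot) {u k l v : ℕ}
    (h : EdgeWalk tail head m (redW tail head wt pot) u k l v) :
    ∃ l', EdgeWalk tail head m wt u k l' v ∧ l + pot v = l' + pot u := by
  induction h with
  | nil => exact ⟨0, .nil, rfl⟩
  | snoc j hj _ ih =>
    obtain ⟨l', h1, h2⟩ := ih
    refine ⟨_, h1.snoc j hj, ?_⟩
    have := hf j hj
    unfold redW; omega

/-- Feasibility is not required here: a truncated difference that vanishes still gives `wt + pot
tail ≤ pot head`. This is what makes the final check trustworthy even when the hubs were bad and the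
potential is arbitrary. -/
theorem EdgeWalk.of_reduced_zero {u k l v : ℕ}
    (h : EdgeWalk tail head m (redW tail head wt pot) u k l v) (hl : l = 0) :
    ∃ l', EdgeWalk tail head m wt u k l' v ∧ l' + pot u ≤ pot v := by
  induction h with
  | nil => exact ⟨0, .nil, by simp⟩
  | snoc j hj _ ih =>
    obtain ⟨l', h1, h2⟩ := ih (by omega)
    refine ⟨_, h1.snoc j hj, ?_⟩
    unfold redW at hl; omega

theorem EdgeWalk.pot_le (hf : Feasible tail head m wt pot) {u k l v : ℕ}
    (h : EdgeWalk tail head m wt u k l v) : pot v ≤ l + pot u := by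
  obtain ⟨l', -, h2⟩ := h.reduce hf
  omega

theorem HubChain.reduce (hf : Feasible tail head m wt pot) {hub : ℕ → ℕ} {T h u l v : ℕ}
    (hc : HubChain tail head m wt hub T h u l v) :
    ∃ l', HubChain tail head m (redW tail head wt pot) hub T h u l' v ∧
      l' + pot v = l + pot u := by
  induction hc with
  | base hk hw =>
    obtain ⟨l', h1, h2⟩ := hw.reduce hf
    exact ⟨l', .base hk h1, h2⟩
  | step hi _ hk hw ih =>
    obtain ⟨l1, h1, e1⟩ := ih
    obtain ⟨l2, h2, e2⟩ := hw.reduce hf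
    exact ⟨_, .step hi h1 hk h2, by omega⟩

/-- Reducing the weights changes all walks between two given vertices by the same amount, so
comparisons between a walk and its hub chain are unaffected. Good hubs thus remain good in every
phase. -/
theorem GoodHubs.reduce {hub : ℕ → ℕ} {T h : ℕ} (hg : GoodHubs tail head m wt hub T h)
    (hf : Feasible tail head m wt pot) :
    GoodHubs tail head m (redW tail head wt pot) hub T h := by
  intro u k l v hw
  obtain ⟨l', h1, e1⟩ := hw.unreduce hf
  obtain ⟨l2, hl2, hc⟩ := hg _ _ _ _ h1
  obtain ⟨l3, h3, e3⟩ := hc.reduce hf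
  exact ⟨l3, by omega, h3⟩

/-! ### Phases and potentials -/

variable {LG T h D lam : ℕ} {lk wl hub f X : ℕ → ℕ}

theorem PhaseSpec.sound' (hp : PhaseSpec lk wl hub (n + m) T (h * (LG + 2)) D lam f X)
    (hs : LinkSpec n m tail head LG lk) (hw : LinkWeights n m wt wl)
    (htail : ∀ j < m, tail j < n) (h0 : hub 0 < n) {v : ℕ} (hv : v < n) (hX : X v < D) :
    ∃ k l, EdgeWalk tail head m wt (hub 0) k l v ∧ 4 * l ≤ 8 * lam * X v + D := by
  obtain ⟨k, l, h1, h2⟩ := hp.sound v (by omega) hX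
  obtain ⟨k', h3⟩ := hs.edgeWalk hw htail h1 (by omega) h0
  rw [owner_of_lt hv] at h3
  exact ⟨k', l, h3, h2⟩

/-- The estimate at the tail is either the maximal value `D` or comes from a walk that starts at a
hub `i`. Append the edge and replace the result by a hub chain: along each piece the hub estimates
satisfy the triangle inequality, and the last piece is short enough for relaxation. So the estimate
at the head is at most `f i` plus the weight of the extended walk. -/
theorem PhaseSpec.feasible (hp : PhaseSpec lk wl hub (n + m) T (h * (LG + 2)) D lam f X)
    (hs : LinkSpec n m tail head LG lk) (hw : LinkWeights n m wt wl)
    (htail : ∀ j < m, tail j < n) (hhead : ∀ j < m, head j < n) (hhub : ∀ i < T, hub i < n)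
    (hg : GoodHubs tail head m wt hub T h) : Feasible tail head m wt X := by
  intro j hj
  have htl := htail j hj
  have hhd := hhead j hj
  rcases hp.eq_add (tail j) (by omega) with h1 | ⟨i, hi, k, l, h1, h2⟩
  · have := hp.le (head j) (by omega)
    omega
  · obtain ⟨k', h3⟩ := hs.edgeWalk hw htail h1 (by omega) (hhub i hi)
    rw [owner_of_lt htl] at h3
    obtain ⟨l', hl', hc⟩ := hg _ _ _ _ (h3.snoc j hj)
    have short : ∀ i < T, ∀ k ≤ h, ∀ l v, EdgeWalk tail head m wt (hub i) k l v →
        X v ≤ f i + l ∧ ∀ i' < T, v = hub i' → f i' ≤ f i + l := by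
      intro i hi k hk l v hwk
      obtain ⟨q, hq, hl⟩ := hs.linkWalk hw hwk
      have hqR : q ≤ h * (LG + 2) := hq.trans (Nat.mul_le_mul_right _ hk)
      have hv := hwk.lt (hhub i hi) hhead
      exact ⟨hp.le_add v (by omega) i hi q hqR l hl, fun i' hi' e =>
        hp.hub_le i' hi' i hi q hqR l (by rwa [← e])⟩
    have main : ∀ {l v}, HubChain tail head m wt hub T h (hub i) l v →
        X v ≤ f i + l ∧ ∀ i' < T, v = hub i' → f i' ≤ f i + l := by
      intro l v hc
      induction hc with
      | base hk hwk => exact short i hi _ hk _ _ hwk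
      | @step l1 k l2 v i1 hi1 _ hk hwk ih =>
        have e1 := ih.2 i1 hi1 rfl
        obtain ⟨e2, e3⟩ := short i1 hi1 _ hk _ _ hwk
        exact ⟨by omega, fun i' hi' e => by have := e3 i' hi' e; omega⟩
    have := (main hc).1
    omega

/-- Invariant of the sequence of phases: the potential is feasible, and it is less than the
distance by at most `D`. -/
structure PotInv (tail head : ℕ → ℕ) (m : ℕ) (wt : ℕ → ℕ) (s D : ℕ) (pot : ℕ → ℕ) : Prop where
  feasible : Feasible tail head m wt pot
  close : ∀ v k l, EdgeWalk tail head m wt s k l v →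
    ∃ k' l', EdgeWalk tail head m wt s k' l' v ∧ l' ≤ pot v + D

/-- Let `q` be `D / (8 * lam)` rounded up. If `X v ≥ q`, the increase of the potential pays for the
decrease of `D`. If `X v < q`, then `8 * lam * X v < D`, so soundness gives a reduced walk with `4 *
l < 2 * D`; this is within the new bound since `lam ≥ 4` makes `q - 1` at most `(D - 1) / 32`. -/
theorem PotInv.step {pot' : ℕ → ℕ} (hi : PotInv tail head m wt (hub 0) D pot) (hD : 1 ≤ D)
    (hlam : 4 ≤ lam) (hpot : pot (hub 0) = 0)
    (hp : PhaseSpec lk wl hub (n + m) T (h * (LG + 2)) D lam f X)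
    (hs : LinkSpec n m tail head LG lk) (hw : LinkWeights n m (redW tail head wt pot) wl)
    (htail : ∀ j < m, tail j < n) (hhead : ∀ j < m, head j < n) (hhub : ∀ i < T, hub i < n)
    (hT : 1 ≤ T) (hg : GoodHubs tail head m wt hub T h) (hpot' : ∀ v < n, pot' v = pot v + X v) :
    PotInv tail head m wt (hub 0) (D - (D + 8 * lam - 1) / (8 * lam)) pot' := by
  have hX := hp.feasible hs hw htail hhead hhub (hg.reduce hi.feasible)
  refine ⟨fun j hj => ?_, fun v k l hwk => ?_⟩
  · have h1 := hX j hj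
    have h2 := hi.feasible j hj
    rw [hpot' _ (hhead j hj), hpot' _ (htail j hj)]
    unfold redW at h1; omega
  · have hv := hwk.lt (hhub 0 hT) hhead
    obtain ⟨k1, l1, hw1, hl1⟩ := hi.close v k l hwk
    rw [hpot' v hv]
    set q := (D + 8 * lam - 1) / (8 * lam) with hq
    have q1 : q * (8 * lam) ≤ D + 8 * lam - 1 := Nat.div_mul_le_self _ _
    have q2 : D ≤ q * (8 * lam) := by
      have := Nat.lt_div_mul_add (a := D + 8 * lam - 1) (b := 8 * lam) (by omega)
      rw [← hq] at this; omega
    have q3 : q ≤ D := by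
      have e : D * (8 * lam) = D + D * (8 * lam - 1) := by
        rw [Nat.mul_sub, mul_one]
        have : D ≤ D * (8 * lam) := Nat.le_mul_of_pos_right _ (by omega)
        omega
      have : 8 * lam - 1 ≤ D * (8 * lam - 1) := Nat.le_mul_of_pos_left _ hD
      exact Nat.le_of_mul_le_mul_right (q1.trans (by omega)) (show 0 < 8 * lam by omega)
    by_cases hXD : X v < D
    · by_cases hXq : q ≤ X v
      · exact ⟨k1, l1, hw1, by omega⟩
      · obtain ⟨k2, l2, h2, e2⟩ := hp.sound' hs hw htail (hhub 0 hT) hv hXD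
        obtain ⟨l3, h3, e3⟩ := h2.unreduce hi.feasible
        refine ⟨k2, l3, h3, ?_⟩
        have e4 : (X v + 1) * (8 * lam) ≤ q * (8 * lam) := Nat.mul_le_mul_right _ (by omega)
        have e5 : 8 * lam * X v = X v * (8 * lam) := by ring
        have e6 : (q - 1) * 32 ≤ (q - 1) * (8 * lam) := Nat.mul_le_mul_left _ (by omega)
        have e7 : (q - 1) * (8 * lam) + 8 * lam = q * (8 * lam) := by
          rw [← Nat.succ_mul]; congr 1; omega
        rw [add_mul, one_mul] at e4
        omega
    · have := hp.le v (by omega)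
      exact ⟨k1, l1, hw1, by omega⟩

/-- If the final estimates pass the check, then the potential is the distance. -/
theorem exact_of_check {s : ℕ} (hpot : pot s = 0) (hXs : X s = 0)
    (hz : ∀ v < n, X v = 0 → ∃ k, EdgeWalk tail head m (redW tail head wt pot) s k 0 v)
    (hc : ∀ j < m, X (tail j) = 0 → X (head j) = 0 ∧ pot (head j) ≤ pot (tail j) + wt j) {v : ℕ}
    (hv : v < n) :
    (X v = 0 → (∃ k, EdgeWalk tail head m wt s k (pot v) v) ∧
      ∀ k l, EdgeWalk tail head m wt s k l v → pot v ≤ l) ∧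
    (X v ≠ 0 → ∀ k l, ¬ EdgeWalk tail head m wt s k l v) := by
  have key : ∀ {k l v}, EdgeWalk tail head m wt s k l v → X v = 0 ∧ pot v ≤ l := by
    intro k l v hw
    induction hw with
    | nil => exact ⟨hXs, hpot.le⟩
    | snoc j hj _ ih =>
      obtain ⟨h1, h2⟩ := hc j hj ih.1
      exact ⟨h1, by omega⟩
  refine ⟨fun h0 => ⟨?_, fun k l hw => (key hw).2⟩, fun h0 k l hw => h0 (key hw).1⟩
  obtain ⟨k, hk⟩ := hz v hv h0
  obtain ⟨l, hl, e⟩ := hk.of_reduced_zero rfl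
  have := (key hl).2
  obtain rfl : l = pot v := by omega
  exact ⟨k, hl⟩

/-- With good hubs the final estimates pass the check. -/
theorem PotInv.check (hi : PotInv tail head m wt (hub 0) 0 pot)
    (hp : PhaseSpec lk wl hub (n + m) T (h * (LG + 2)) 1 lam f X)
    (hs : LinkSpec n m tail head LG lk) (hw : LinkWeights n m (redW tail head wt pot) wl)
    (htail : ∀ j < m, tail j < n) (hhead : ∀ j < m, head j < n) (hhub : ∀ i < T, hub i < n)
    (hT : 1 ≤ T) (hpot : pot (hub 0) = 0) (hg : GoodHubs tail head m wt hub T h) {j : ℕ}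
    (hj : j < m) (hX0 : X (tail j) = 0) :
    X (head j) = 0 ∧ pot (head j) ≤ pot (tail j) + wt j := by
  have hX := hp.feasible hs hw htail hhead hhub (hg.reduce hi.feasible)
  have hf := hi.feasible j hj
  refine ⟨?_, by omega⟩
  obtain ⟨k, l, h1, -⟩ := hp.sound' hs hw htail (hhub 0 hT) (htail j hj) (by omega)
  obtain ⟨l', h2, -⟩ := h1.unreduce hi.feasible
  obtain ⟨k3, l3, h3, e3⟩ := hi.close _ _ _ (h2.snoc j hj)
  -- With error bound `0` the walk has weight at most `pot` at its end, so its reduced weight is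
  -- `0`; as `X` is a feasible potential that vanishes at the source, it vanishes at the head as
  -- well.
  obtain ⟨l4, h4, e4⟩ := h3.reduce hi.feasible
  have h5 := h4.pot_le hX
  rw [hp.zero] at h5
  omega

end


open AE

/-! ### The sequence of phases -/

/-- The decrease of the bound on the error from one phase to the next. -/
def nextBound (lam D : ℕ) : ℕ := D - (D + 8 * lam - 1) / (8 * lam)

theorem ceil_div_le {a D : ℕ} (ha : 1 ≤ a) (hD : 1 ≤ D) : (D + 8 * a - 1) / (8 * a) ≤ D := by
  refine Nat.div_le_of_le_mul ?_
  obtain ⟨D, rfl⟩ : ∃ D', D = D' + 1 := ⟨D - 1, by omega⟩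
  have : 8 * a * (D + 1) = 8 * (a * D) + 8 * a := by ring
  have : D ≤ a * D := Nat.le_mul_of_pos_left _ ha
  omega

/-- As long as the bound is at least `2 ^ q`, each step subtracts at least `2 ^ q / (8 * lam)`,
rounded up. Hence `8 * lam` steps take a bound below `2 ^ (q + 1)` to one below `2 ^ q`. Rounding up
is what lets the process reach `0`. -/
theorem nextBound_iterate {lam : ℕ} (hlam : 1 ≤ lam) (q : ℕ) :
    ∀ D < 2 ^ q, (nextBound lam)^[8 * lam * q] D = 0 := by
  have h0 : nextBound lam 0 = 0 := by simp [nextBound]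
  induction q with
  | zero => intro D hD; obtain rfl : D = 0 := by simpa using hD
            simp
  | succ q ih =>
    intro D hD
    have key : ∀ k, (nextBound lam)^[k] D < 2 ^ q ∨
        (nextBound lam)^[k] D + k * ((2 ^ q + 8 * lam - 1) / (8 * lam)) ≤ D := by
      intro k
      induction k with
      | zero => simp
      | succ k ihk =>
        rw [Function.iterate_succ_apply']
        set E := (nextBound lam)^[k] D with hE
        rcases ihk with h1 | h1
        · exact .inl ((Nat.sub_le _ _).trans_lt h1)
        · by_cases h2 : E < 2 ^ q
          · exact .inl ((Nat.sub_le _ _).trans_lt h2)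
          · right
            have h3 : (2 ^ q + 8 * lam - 1) / (8 * lam) ≤ (E + 8 * lam - 1) / (8 * lam) :=
              Nat.div_le_div_right (by omega)
            have h4 : (E + 8 * lam - 1) / (8 * lam) ≤ E := by
              have hE1 : 1 ≤ E := (Nat.one_le_two_pow).trans (not_lt.1 h2)
              exact ceil_div_le hlam hE1
            rw [add_mul, one_mul]
            unfold nextBound; omega
    have h2q : 2 ^ q ≤ 8 * lam * ((2 ^ q + 8 * lam - 1) / (8 * lam)) := by
      have := Nat.lt_div_mul_add (a := 2 ^ q + 8 * lam - 1) (b := 8 * lam) (by omega)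
      rw [mul_comm (8 * lam)]; omega
    rw [Nat.mul_succ, Function.iterate_add_apply]
    refine ih _ ?_
    rcases key (8 * lam) with h | h
    · exact h
    · rw [pow_succ] at hD; omega

theorem exists_iterate_nextBound {lam q D : ℕ} (hlam : 1 ≤ lam) (hD : D < 2 ^ q) :
    ∃ r ≤ 8 * lam * q, (nextBound lam)^[r] D = 0 ∧ ∀ i < r, (nextBound lam)^[i] D ≠ 0 := by
  classical
  have hex : ∃ r, (nextBound lam)^[r] D = 0 := ⟨_, nextBound_iterate hlam q D hD⟩
  exact ⟨Nat.find hex, Nat.find_min' hex (nextBound_iterate hlam q D hD), Nat.find_spec hex,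
    fun i hi => Nat.find_min hex hi⟩

/-- Set the link weights to the reduced edge weights. -/
def weightsP : AProg :=
  .par (inp 1) 1 .wl (3 * (inp 0 + pid) + 2)
    (inp (6 + 3 * pid) + rd .pot (inp (4 + 3 * pid)) - rd .pot (inp (5 + 3 * pid)))

/-- Check that the estimates that are `0` are closed under edges. -/
def checkP : AProg :=
  .seq (.set .bad 0) <|
  .par (inp 1) (eq (rd .x (inp (4 + 3 * pid))) 0 * not (eq (rd .x (inp (5 + 3 * pid))) 0 *
    lt (rd .pot (inp (5 + 3 * pid))) (rd .pot (inp (4 + 3 * pid)) + inp (6 + 3 * pid) + 1)))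
    .bad 0 1

/-- All phases, and the check. -/
def runP : AProg :=
  .seq (.map (inp 0) 1 .pot 0) <| .seq (.set .dd (sc .d0)) <|
  .seq (.set .cap (8 * sc .tt * (sc .lg + 4))) <| .seq (.set .ll (inp 3 * (sc .lg + 4))) <|
  .seq (.loop (sc .dd) <|
    .seq weightsP <| .seq phaseP <| .seq (.map (inp 0) 1 .pot (rd .pot pid + rd .x pid)) <|
    .set .dd (sc .dd - (sc .dd + 8 * (sc .lg + 4) - 1) / (8 * (sc .lg + 4)))) <|
  .seq (.set .dd 1) <| .seq weightsP <| .seq phaseP checkP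

/-- The arrays changed by a run. -/
abbrev runArr : List Arr := [.pot, .dd, .cap, .ll, .wl, .bad] ++ phaseArr

/-- The input seen as an abstract graph. -/
structure InputOk (I : ℕ → ℕ) (n m h : ℕ) : Prop where
  n_eq : I 0 = n
  m_eq : I 1 = m
  h_eq : I 3 = h
  tail_lt : ∀ j < m, I (4 + 3 * j) < n
  head_lt : ∀ j < m, I (5 + 3 * j) < n

/-- Tails, heads and weights of the edges in the input. -/
abbrev tl (I : ℕ → ℕ) (j : ℕ) : ℕ := I (4 + 3 * j)
abbrev hd (I : ℕ → ℕ) (j : ℕ) : ℕ := I (5 + 3 * j)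
abbrev wt (I : ℕ → ℕ) (j : ℕ) : ℕ := I (6 + 3 * j)

section
variable {I : ℕ → ℕ} {B n m h T lam D0 Λ : ℕ} {σ : St}

/-- Only third links of edge nodes are written; the zeros elsewhere persist from the initial memory,
and `h0` is carried along for this purpose. -/
theorem weightsP_ok (hI : InputOk I n m h) (hmB : m ≤ B)
    (hw : ∀ j < m, ∀ v < n, wt I j + σ .pot v ≤ B)
    (h0 : ∀ r, r % 3 < 2 ∨ r / 3 < n → σ .wl r = 0) :
    Ok I B weightsP σ fun σ' k d =>
      LinkWeights n m (redW (tl I) (hd I) (wt I) (σ .pot)) (σ' .wl) ∧ Same [.wl] σ σ' ∧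
      k = m + 1 ∧ d = 1 := by
  refine Ok.scat (by simpa [hI.m_eq] using hmB) ?_ fun σ' h1 f1 => ⟨⟨?_, ?_⟩,
    Same.of_ne f1 (by decide), by simp [hI.m_eq], rfl⟩
  · intro j hj _
    simp [hI.m_eq] at hj
    have := hw j hj _ (hI.tail_lt j hj)
    simp [wt] at this ⊢; omega
  · intro r hr
    rw [h1, scatter_of_forall, h0 r hr]
    intro j _ _
    simp [hI.n_eq]; omega
  · intro j hj
    rw [h1]
    have := scatter_inj (N := m) (g := fun _ => 1 ≠ 0) (idx := fun j => 3 * (n + j) + 2)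
      (v := redW (tl I) (hd I) (wt I) (σ .pot)) (old := σ .wl) hj (by simp)
      fun j' _ _ he => by omega
    simp only [eval_inp, eval_ofNat, hI.m_eq, hI.n_eq, eval_add, eval_mul, eval_pid, eval_sub,
      eval_rd]
    exact this

theorem checkP_ok (hI : InputOk I n m h) (hmB : m + 1 ≤ B) :
    Ok I B checkP σ fun σ' k d => (σ' .bad 0 = 0 ↔ ∀ j < m, σ .x (tl I j) = 0 →
        σ .x (hd I j) = 0 ∧ σ .pot (hd I j) ≤ σ .pot (tl I j) + wt I j) ∧
      Same [.bad] σ σ' ∧ k = m + 3 ∧ d = 2 := by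
  refine Ok.seq (Ok.set (by omega) (by simp) fun σ₁ h1 f1 => ?_)
  simp only [eval_ofNat] at h1
  refine Ok.scat (by simp [hI.m_eq]; omega) (by intro i hi _; simp; omega) fun σ₂ h2 f2 =>
    ⟨?_, (Same.of_ne f1 (by decide)).trans (Same.of_ne f2 (by decide)), by simp [hI.m_eq]; omega,
    rfl⟩
  have key : ∀ j, ((eq (rd .x (inp (4 + 3 * pid))) 0 * not (eq (rd .x (inp (5 + 3 * pid))) 0 *
    lt (rd .pot (inp (5 + 3 * pid)))
      (rd .pot (inp (4 + 3 * pid)) + inp (6 + 3 * pid) + 1))).eval I σ₁ j ≠ 0) ↔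
      ¬ (σ .x (tl I j) = 0 → σ .x (hd I j) = 0 ∧ σ .pot (hd I j) ≤ σ .pot (tl I j) + wt I j) := by
    intro j
    simp [f1]
  constructor
  · intro h3 j hj
    by_contra hne
    have hgj := (key j).2 hne
    obtain ⟨i, -, -, -, h4, -⟩ := scatter_spec (g := fun j => AE.eval I σ₁ j _ ≠ 0)
      (idx := fun _ => 0) (v := fun _ => 1) (old := σ₁ .bad) hj hgj
    rw [h2] at h3
    simp only [eval_inp, eval_ofNat, hI.m_eq] at h3
    rw [h4] at h3; omega
  · intro h3
    rw [h2, scatter_of_forall, h1]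
    intro j hj hg
    simp only [eval_inp, eval_ofNat, hI.m_eq] at hj
    exact absurd (h3 j hj) ((key j).1 hg)

/-- This yields an initial error bound that the program can compute from its input; `W` itself is
not part of the input. -/
theorem EdgeWalk.le_mul_sum {tail head w : ℕ → ℕ} {u k l v : ℕ}
    (hw : EdgeWalk tail head m w u k l v) : l ≤ k * ∑ j ∈ Finset.range m, w j := by
  induction hw with
  | nil => simp
  | snoc j hj _ ih =>
    have : w j ≤ ∑ j ∈ Finset.range m, w j :=
      Finset.single_le_sum (fun _ _ => Nat.zero_le _) (Finset.mem_range.2 hj)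
    rw [add_mul, one_mul]; omega

/-- `pot` holds the distances from `s` to the vertices where `x` is `0`; the others are not
reachable. -/
def ExactAt (I : ℕ → ℕ) (n m s : ℕ) (pot x : ℕ → ℕ) : Prop := ∀ v < n,
  (x v = 0 → (∃ k, EdgeWalk (tl I) (hd I) m (wt I) s k (pot v) v) ∧
    ∀ k l, EdgeWalk (tl I) (hd I) m (wt I) s k l v → pot v ≤ l) ∧
  (x v ≠ 0 → ∀ k l, ¬ EdgeWalk (tl I) (hd I) m (wt I) s k l v)

-- Exactness after a passed check and the bounds on values, work and depth hold for all hubs. Only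
-- the assertion that the check passes needs good hubs, so `PotInv` enters the loop invariant as an
-- implication.
set_option maxHeartbeats 1000000 in
theorem runP_ok {W q : ℕ} (hI : InputOk I n m h)
    (hB : 6 * (T * (n + m)) + 2 * (T * T * T) + 8 * (8 * T * lam) * (h * lam) +
      4 * (8 * T * lam) + 3 * (h * lam) + 3 * (n + m) + 8 * lam * D0 + W + 10 ≤ B)
    (hT : σ .tt 0 = T) (hN : σ .nn 0 = n + m) (hlam : σ .lg 0 + 4 = lam) (hD0 : σ .d0 0 = D0)
    (h1 : 1 ≤ h) (hT1 : 1 ≤ T)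
    (hΛ : 3 * (T * (n + m)) ≤ 2 ^ Λ) (hΛC : 4 * (8 * T * lam) * (h * lam) ≤ 2 ^ Λ)
    (hlk : LinkSpec n m (tl I) (hd I) (σ .lg 0) (σ .lk)) (hhub : ∀ x < T, σ .hub x < n)
    (hW : ∀ j < m, wt I j ≤ W) (hsum : n * ∑ j ∈ Finset.range m, wt I j < D0)
    (hq : D0 < 2 ^ q) (hwl : ∀ r, r % 3 < 2 ∨ r / 3 < n → σ .wl r = 0) :
    Ok I B runP σ fun σ' k d =>
      (σ' .bad 0 = 0 → ExactAt I n m (σ .hub 0) (σ' .pot) (σ' .x)) ∧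
      (GoodHubs (tl I) (hd I) m (wt I) (σ .hub) T h → σ' .bad 0 = 0) ∧
      (∀ v < n, σ' .pot v ≤ 8 * lam * D0) ∧
      (∀ r, r % 3 < 2 ∨ r / 3 < n → σ' .wl r = 0) ∧ Same runArr σ σ' ∧
      k ≤ (8 * lam * q + 2) * (320 * (Λ + 1) ^ 3 *
        (T * (n + m) + T * T * T + h * lam * (n + m))) ∧
      d ≤ (8 * lam * q + 2) * (170 * (Λ + 1) ^ 3 * (h * lam)) := by
  set s := σ .hub 0 with hs
  have hsn : s < n := hhub 0 (by omega)
  have hlam4 : 4 ≤ lam := by omega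
  have hTT : T ≤ T * T * T := by nlinarith [Nat.mul_le_mul hT1 hT1]
  have hTl : 8 * T * lam ≤ B := by omega
  have hlD : D0 ≤ 8 * lam * D0 := Nat.le_mul_of_pos_left _ (by omega)
  set M := T * (n + m) + T * T * T + h * lam * (n + m) with hM
  have hNM : n + m ≤ T * (n + m) := Nat.le_mul_of_pos_left _ hT1
  set P := (Λ + 1) ^ 3 with hP
  have hP1 : 1 ≤ P := Nat.one_le_pow _ _ (by omega)
  have hMP : M ≤ P * M := Nat.le_mul_of_pos_left _ hP1
  have hLP : h * lam ≤ P * (h * lam) := Nat.le_mul_of_pos_left _ hP1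
  have hL1 : 1 ≤ h * lam := Nat.mul_pos h1 (by omega)
  have eM : ∀ c, c * P * M = c * (P * M) := fun c => mul_assoc _ _ _
  have eL : ∀ c, c * P * (h * lam) = c * (P * (h * lam)) := fun c => mul_assoc _ _ _
  refine Ok.seq (Ok.map (by simp [hI.n_eq]; omega) (by simp) fun σ₁ s1 f1 => ?_)
  refine Ok.seq (Ok.set (by omega) (by simp [f1, hD0]; omega) fun σ₂ s2 f2 => ?_)
  refine Ok.seq (Ok.set (by omega) (by simp [f2, f1, hT, hlam]; omega) fun σ₃ s3 f3 => ?_)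
  refine Ok.seq (Ok.set (by omega) (by simp [f3, f2, f1, hI.h_eq, hlam]; omega) fun σ₄ s4 f4 => ?_)
  have S4 : Same runArr σ σ₄ := (((Same.of_ne f1 (by decide)).trans
    (Same.of_ne f2 (by decide))).trans (Same.of_ne f3 (by decide))).trans
      (Same.of_ne f4 (by decide))
  have pot4 : ∀ v < n, σ₄ .pot v = 0 := fun v hv => by
    rw [f4 _ (by simp), f3 _ (by simp), f2 _ (by simp), s1]; simp [hI.n_eq, hv]
  have wl4 : σ₄ .wl = σ .wl := by
    rw [f4 _ (by simp), f3 _ (by simp), f2 _ (by simp), f1 _ (by simp)]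
  have dd4 : σ₄ .dd 0 = D0 := by
    rw [f4 _ (by simp), f3 _ (by simp), s2]; simp [f1, hD0]
  have cap4 : σ₄ .cap 0 = 8 * T * lam := by
    rw [f4 _ (by simp), s3]; simp [f2, f1, hT, hlam]
  have ll4 : σ₄ .ll 0 = h * lam := by
    rw [s4]; simp [f3, f2, f1, hI.h_eq, hlam]
  -- one phase
  have phase : ∀ (σ₅ : St) (D : ℕ), 1 ≤ D → D ≤ D0 → σ₅ .dd 0 = D →
      (∀ v < n, σ₅ .pot v + 8 * lam * D ≤ 8 * lam * D0 ∨ σ₅ .pot v ≤ 8 * lam * D0) →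
      (∀ r, r % 3 < 2 ∨ r / 3 < n → σ₅ .wl r = 0) →
      σ₅ .cap 0 = 8 * T * lam → σ₅ .ll 0 = h * lam → Same runArr σ σ₅ →
      Ok I B (.seq weightsP phaseP) σ₅ fun σ' k d =>
        (∃ wl f, LinkWeights n m (redW (tl I) (hd I) (wt I) (σ₅ .pot)) wl ∧
          PhaseSpec (σ .lk) wl (σ .hub) (n + m) T (h * (σ .lg 0 + 2)) D lam f (σ' .x)) ∧
        (∀ r, r % 3 < 2 ∨ r / 3 < n → σ' .wl r = 0) ∧ Same (.wl :: phaseArr) σ₅ σ' ∧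
        k ≤ 302 * (P * M) ∧ d ≤ 151 * (P * (h * lam)) := by
    intro σ₅ D hD1 hDD hd5 hp5 hw5 hc5 hl5 S5
    refine Ok.seq ((weightsP_ok (B := B) hI (by omega) ?_ hw5).imp ?_)
    · intro j hj v hv
      have e1 := hW j hj
      have e2 := hp5 v hv
      omega
    rintro σ₆ k6 d6 ⟨w6, S6, hk6, hd6⟩
    have S56 : Same runArr σ σ₆ := S5.trans (S6.mono (by decide))
    refine (phaseP_ok (B := B) (T := T) (N := n + m) (h := h) (lam := lam) (D := D) (Λ := Λ)
      (by omega) (by rw [S56 _ (by decide), hT]) (by rw [S56 _ (by decide), hN])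
      (by rw [S56 _ (by decide), hlam]) (by rw [S6 _ (by decide), hl5])
      (by rw [S6 _ (by decide), hc5]) (by rw [S6 _ (by decide), hd5]) hI.h_eq h1 hT1 hD1 hΛ hΛC
      (by rw [S56 _ (by decide)]; exact hlk.lt)
      (by rw [S56 _ (by decide)]; intro x hx; have := hhub x hx; omega)).imp ?_
    rintro σ₇ k7 d7 ⟨⟨f, h7⟩, S7, hk7, hd7⟩
    rw [S56 .lk (by decide), S56 .hub (by decide), S56 .lg (by decide)] at h7
    refine ⟨⟨_, f, w6, h7⟩, ?_, (S6.mono (by simp)).trans (S7.mono (by simp)), ?_, ?_⟩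
    · intro r hr
      rw [S7 _ (by decide)]; exact w6.zero r hr
    · rw [eM] at hk7; omega
    · rw [eL] at hd7; omega
  obtain ⟨r, hr, hr0, hri⟩ := exists_iterate_nextBound (lam := lam) (by omega) hq
  refine Ok.seq (Ok.loop r (306 * (P * M)) (153 * (P * (h * lam))) (fun i σ' =>
    σ' .dd 0 = (nextBound lam)^[i] D0 ∧ σ' .dd 0 ≤ D0 ∧ σ' .pot s = 0 ∧
    (∀ v < n, σ' .pot v + 8 * lam * σ' .dd 0 ≤ 8 * lam * D0) ∧
    (∀ r, r % 3 < 2 ∨ r / 3 < n → σ' .wl r = 0) ∧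
    (GoodHubs (tl I) (hd I) m (wt I) (σ .hub) T h →
      PotInv (tl I) (hd I) m (wt I) s (σ' .dd 0) (σ' .pot)) ∧
    σ' .cap 0 = 8 * T * lam ∧ σ' .ll 0 = h * lam ∧ Same runArr σ σ') ?_ ?_ ?_ ?_)
  · refine ⟨by simpa using dd4, dd4.le, pot4 s hsn, fun v hv => by rw [pot4 v hv, dd4, zero_add],
      by rw [wl4]; exact hwl, fun _ => ⟨fun j hj => ?_, fun v k l hw => ?_⟩, cap4, ll4, S4⟩
    · rw [pot4 _ (hI.head_lt j hj)]; omega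
    · obtain ⟨k', l', -, hm⟩ := hw.exists_minWalk
      refine ⟨k', l', hm.walk, ?_⟩
      have e1 := hm.walk.le_mul_sum
      have e2 := hm.card_le hsn hI.head_lt
      have e3 := Nat.mul_le_mul_right (∑ j ∈ Finset.range m, wt I j) e2.le
      rw [dd4]; omega
  · rintro i hi σ₅ ⟨a1, a2, a3, a4, a5, a6, a7, a8, S5⟩
    have hD1 : σ₅ .dd 0 ≠ 0 := by rw [a1]; exact hri i hi
    set D := σ₅ .dd 0 with hD
    refine ⟨by simpa [← hD] using hD1, ?_⟩
    obtain ⟨σ₆, k6, d6, hr6, ⟨wl, f, w6, p6⟩, wl6, S6, hk6, hd6⟩ :=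
      phase σ₅ D (by omega) a2 rfl (fun v hv => .inl (a4 v hv)) a5 a7 a8 S5
    -- The lemma for one phase speaks of the two statements as a unit, whereas the loop body nests
    -- to the right; the run is taken apart to fit.
    obtain ⟨σa, ka, da, kb, db, hra, hrb, hkab, hdab⟩ : ∃ σa ka da kb db, Run I B weightsP σ₅ σa ka da ∧
        Run I B phaseP σa σ₆ kb db ∧ ka + kb = k6 ∧ da + db = d6 := by
      cases hr6 with
      | seq hp hq => exact ⟨_, _, _, _, _, hp, hq, rfl, rfl⟩
    refine Ok.seq ⟨_, _, _, hra, Ok.seq ⟨_, _, _, hrb, ?_⟩⟩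
    have S56 : Same runArr σ σ₆ := S5.trans (S6.mono (by decide))
    have hx6 : ∀ v < n, σ₆ .x v ≤ D := fun v hv => p6.le v (by omega)
    have pot6 : σ₆ .pot = σ₅ .pot := S6 _ (by decide)
    refine Ok.seq (Ok.map (by simp [hI.n_eq]; omega) ?_ fun σ₇ s7 f7 => ?_)
    · intro v hv _
      simp only [eval_inp, eval_ofNat, hI.n_eq] at hv
      have e1 := hx6 v hv
      have e2 := a4 v hv
      have e3 : D ≤ 8 * lam * D := Nat.le_mul_of_pos_left _ (by omega)
      simp [pot6]; omega
    have pot7 : ∀ v < n, σ₇ .pot v = σ₅ .pot v + σ₆ .x v := fun v hv => by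
      rw [s7]; simp [hI.n_eq, hv, pot6]
    have dd7 : σ₇ .dd 0 = D := by rw [f7 _ (by simp), S6 _ (by decide)]
    have lg7 : σ₇ .lg 0 + 4 = lam := by rw [f7 _ (by simp), S56 _ (by decide), hlam]
    refine Ok.set (by omega) ?_ fun σ₈ s8 f8 => ?_
    · simp only [eval_sub, eval_sc, dd7]
      exact (Nat.sub_le _ _).trans (by omega)
    have dd8 : σ₈ .dd 0 = nextBound lam D := by
      rw [s8]; simp [dd7, lg7, nextBound]
    have pot8 : σ₈ .pot = σ₇ .pot := f8 _ (by simp)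
    refine ⟨⟨?_, ?_, ?_, ?_, ?_, ?_, ?_, ?_, ?_⟩, ?_, ?_⟩
    · rw [dd8, Function.iterate_succ_apply', a1]
    · rw [dd8]; exact (Nat.sub_le _ _).trans a2
    · rw [pot8, pot7 s hsn, a3, p6.zero]
    · intro v hv
      rw [pot8, pot7 v hv, dd8]
      have e1 := hx6 v hv
      have e2 := a4 v hv
      -- The quantity `pot v + 8 * lam * D` never increases: `pot v` grows by `X v ≤ D`, and `D`
      -- drops by at least `D / (8 * lam)`. This keeps potentials below `8 * lam * D0` even with bad
      -- hubs.
      have e3 : D ≤ (D + 8 * lam - 1) / (8 * lam) * (8 * lam) := by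
        have := Nat.lt_div_mul_add (a := D + 8 * lam - 1) (b := 8 * lam) (by omega)
        omega
      unfold nextBound
      set c := (D + 8 * lam - 1) / (8 * lam) with hc
      have e4 : c ≤ D := ceil_div_le (by omega) (by omega)
      have e5 : 8 * lam * (D - c) + c * (8 * lam) = 8 * lam * D := by
        rw [mul_comm c, ← mul_add, Nat.sub_add_cancel e4]
      omega
    · intro r hr
      rw [f8 _ (by simp), f7 _ (by simp)]; exact wl6 r hr
    · intro hg
      rw [dd8, pot8]
      exact (a6 hg).step (by omega) hlam4 a3 p6 hlk w6 hI.tail_lt hI.head_lt hhub hT1 hg pot7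
    · rw [f8 _ (by simp), f7 _ (by simp), S6 _ (by decide), a7]
    · rw [f8 _ (by simp), f7 _ (by simp), S6 _ (by decide), a8]
    · exact (S56.trans (Same.of_ne f7 (by decide))).trans (Same.of_ne f8 (by decide))
    · simp only [eval_inp, eval_ofNat, hI.n_eq]; omega
    · omega
  · rintro σ₅ ⟨a1, -⟩
    simp [a1, hr0]
  rintro σ₅ k5 d5 ⟨a1, a2, a3, a4, a5, a6, a7, a8, S5⟩ hk5 hd5
  rw [hr0] at a1
  refine Ok.seq (Ok.set (by omega) (by simp; omega) fun σ₆ s6 f6 => ?_)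
  simp only [eval_ofNat] at s6
  have pot6 : σ₆ .pot = σ₅ .pot := f6 _ (by simp)
  obtain ⟨σ₇, k7, d7, hr7, ⟨wl, f, w7, p7⟩, wl7, S7, hk7, hd7⟩ :=
    phase σ₆ 1 le_rfl (by omega) s6 (fun v hv => .inr (by rw [pot6]; have := a4 v hv; omega))
      (by rw [f6 _ (by simp)]; exact a5) (by rw [f6 _ (by simp), a7])
      (by rw [f6 _ (by simp), a8]) (S5.trans (Same.of_ne f6 (by decide)))
  obtain ⟨σa, ka, da, kb, db, hra, hrb, hkab, hdab⟩ : ∃ σa ka da kb db, Run I B weightsP σ₆ σa ka da ∧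
      Run I B phaseP σa σ₇ kb db ∧ ka + kb = k7 ∧ da + db = d7 := by
    cases hr7 with
    | seq hp hq => exact ⟨_, _, _, _, _, hp, hq, rfl, rfl⟩
  refine Ok.seq ⟨_, _, _, hra, Ok.seq ⟨_, _, _, hrb, ?_⟩⟩
  have S7' : Same runArr σ σ₇ := (S5.trans (Same.of_ne f6 (by decide))).trans (S7.mono (by decide))
  have pot7 : σ₇ .pot = σ₅ .pot := by rw [S7 _ (by decide), pot6]
  rw [pot6] at w7
  refine (checkP_ok (B := B) (h := h) hI (by omega)).imp ?_
  rintro σ₈ k8 d8 ⟨c8, S8, hk8, hd8⟩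
  have x8 : σ₈ .x = σ₇ .x := S8 _ (by decide)
  have pot8 : σ₈ .pot = σ₅ .pot := by rw [S8 _ (by decide), pot7]
  refine ⟨?_, ?_, ?_, ?_, S7'.trans (S8.mono (by decide)), ?_, ?_⟩
  · intro hb v hv
    rw [x8, pot8]
    have hc := c8.1 hb
    rw [pot7] at hc
    refine exact_of_check a3 p7.zero (fun v hv hx => ?_) hc hv
    -- With `D = 1` and `X v = 0` soundness reads `4 * l ≤ 1`, hence `l = 0`.
    obtain ⟨k, l, e1, e2⟩ := p7.sound' hlk w7 hI.tail_lt hsn hv (by omega)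
    rw [hx] at e2
    obtain rfl : l = 0 := by omega
    exact ⟨k, e1⟩
  · intro hg
    refine c8.2 fun j hj hx => ?_
    have hpi := a6 hg
    rw [a1] at hpi
    rw [pot7]
    exact hpi.check p7 hlk w7 hI.tail_lt hI.head_lt hhub hT1 a3 hg hj hx
  · intro v hv
    rw [pot8]; have := a4 v hv; omega
  · intro r hr
    rw [S8 _ (by decide)]; exact wl7 r hr
  · simp only [eval_inp, eval_ofNat, hI.n_eq]
    have e1 : r * (306 * (P * M) + 1) ≤ 8 * lam * q * (310 * (P * M)) :=
      Nat.mul_le_mul hr (by omega)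
    have e2 : 8 * lam * q * (310 * (P * M)) ≤ 8 * lam * q * (320 * (P * M)) :=
      Nat.mul_le_mul_left _ (by omega)
    rw [eM, add_mul]
    omega
  · have e1 : r * (153 * (P * (h * lam)) + 1) ≤ 8 * lam * q * (170 * (P * (h * lam))) :=
      Nat.mul_le_mul hr (by omega)
    rw [eL, add_mul]
    omega

end


open AE

/-! ### The complete program -/

/-- Search trees, the initial bound on the distances, and the number of hubs. -/
def preP (c : ℕ) : AProg :=
  .seq treeP <| .seq (.set .kk (inp 1 + 1)) <| .seq (.map (sc .kk) 1 .f (inp (6 + 3 * pid))) <|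
  .seq scanP <| .seq (.set .d0 (inp 0 * sc .f + 1)) <|
  .set .tt (lit c * inp 0 * sc .lg / inp 3 + 2)

/-- The scan covers `m + 1` cells, the last of which is read beyond the input and is `0`: so cell
`0` of the scan holds the sum of the weights also when there are no edges. -/
theorem preP_ok {I : ℕ → ℕ} {B n m h c : ℕ} {σ : St} (hI : InputOk I n m h)
    (h0 : I (6 + 3 * m) = 0)
    (hB : 3 * (n + m) + 4 + (n + 1) * (∑ j ∈ Finset.range m, wt I j) +
      c * n * Nat.clog 2 (n + m + 2) ≤ B) :
    Ok I B (preP c) σ fun σ' k d => σ' .lg 0 = Nat.clog 2 (n + m + 2) ∧ σ' .nn 0 = n + m ∧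
      LinkSpec n m (tl I) (hd I) (σ' .lg 0) (σ' .lk) ∧
      σ' .d0 0 = n * ∑ j ∈ Finset.range m, wt I j + 1 ∧
      σ' .tt 0 = c * n * Nat.clog 2 (n + m + 2) / h + 2 ∧
      Same [.lg, .pw, .nn, .lk, .loc, .kk, .f, .j1, .d0, .tt] σ σ' ∧
      k ≤ 60 * (Nat.clog 2 (n + m + 2) + 1) * (n + m + 1) ∧
      d ≤ 60 * (Nat.clog 2 (n + m + 2) + 1) := by
  set LG := Nat.clog 2 (n + m + 2) with hLG
  set A := ∑ j ∈ Finset.range m, wt I j with hA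
  have hle : n + m + 2 ≤ 2 ^ LG := Nat.le_pow_clog one_lt_two _
  have hdiv : c * n * LG / h ≤ c * n * LG := Nat.div_le_self _ _
  have hnA : (n + 1) * A = n * A + A := by ring
  refine Ok.seq ((treeP_ok (B := B) (by omega) hI.n_eq hI.m_eq hI.tail_lt hI.head_lt).imp ?_)
  rintro σ₁ k1 d1 ⟨lg1, nn1, lk1, S1, hk1, hd1⟩
  rw [← hLG] at hk1 hd1
  refine Ok.seq (Ok.set (by omega) (by simp [hI.m_eq]; omega) fun σ₂ s2 f2 => ?_)
  have kk2 : σ₂ .kk 0 = m + 1 := by rw [s2]; simp [hI.m_eq]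
  have hwA : ∀ j < m, wt I j ≤ A := fun j hj =>
    Finset.single_le_sum (fun _ _ => Nat.zero_le _) (Finset.mem_range.2 hj)
  refine Ok.seq (Ok.map (by simp [kk2]; omega) ?_ fun σ₃ s3 f3 => ?_)
  · intro j hj _
    simp only [eval_sc, kk2] at hj
    rcases Nat.lt_succ_iff_lt_or_eq.1 hj with hj | rfl
    · have := hwA j hj
      simp [wt] at this ⊢; omega
    · simp [h0]
  have kk3 : σ₃ .kk 0 = m + 1 := by rw [f3 _ (by simp), kk2]
  have f3' : ∀ j < m + 1, σ₃ .f j = I (6 + 3 * j) := fun j hj => by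
    rw [s3]; simp [kk2, hj]
  have hsum : ∑ j ∈ Finset.range (m + 1), σ₃ .f j = A := by
    rw [Finset.sum_range_succ, f3' m (by omega), h0, add_zero]
    exact Finset.sum_congr rfl fun j hj => f3' j (by simp at hj; omega)
  refine Ok.seq ((scanP_ok (B := B) (K := m + 1) (Λ := LG) (by omega) kk3 (by rw [hsum]; omega)
    (by omega)).imp ?_)
  rintro σ₄ k4 d4 ⟨s4, S4, hk4, hd4⟩
  have f4 : σ₄ .f 0 = A := by
    rw [s4 0 (by omega), ← Finset.range_eq_Ico, hsum]
  refine Ok.seq (Ok.set (by omega) (by simp [hI.n_eq, f4]; omega) fun σ₅ s5 f5 => ?_)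
  have d05 : σ₅ .d0 0 = n * A + 1 := by rw [s5]; simp [hI.n_eq, f4]
  have S25 : Same [.kk, .f, .j1, .d0] σ₁ σ₅ := (((Same.of_ne f2 (by decide)).trans
    (Same.of_ne f3 (by decide))).trans (S4.mono (by decide))).trans (Same.of_ne f5 (by decide))
  have lg5 : σ₅ .lg 0 = LG := by rw [S25 _ (by decide), lg1]
  refine Ok.set (by omega) (by simp [hI.n_eq, hI.h_eq, lg5]; omega) fun σ₆ s6 f6 => ?_
  have S26 : Same [.kk, .f, .j1, .d0, .tt] σ₁ σ₆ := (S25.mono (by decide)).trans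
    (Same.of_ne f6 (by decide))
  refine ⟨by rw [S26 _ (by decide), lg1], by rw [S26 _ (by decide), nn1], ?_,
    by rw [f6 _ (by simp), d05], ?_, (S1.mono (by decide)).trans (S26.mono (by decide)), ?_, ?_⟩
  · rw [S26 .lg (by decide), S26 .lk (by decide)]; exact lk1
  · rw [s6]; simp [hI.n_eq, hI.h_eq, lg5]
  · simp only [eval_sc, kk2]
    have e1 : (m + 1 + 7) * (LG + 1) ≤ 8 * ((LG + 1) * (n + m + 1)) := by
      calc (m + 1 + 7) * (LG + 1) ≤ (8 * (n + m + 1)) * (LG + 1) :=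
            Nat.mul_le_mul_right _ (by omega)
        _ = _ := by ring
    have e2 : n + m + 1 ≤ (LG + 1) * (n + m + 1) := Nat.le_mul_of_pos_left _ (by omega)
    have e3 : 30 * (LG + 1) * (n + m + 1) = 30 * ((LG + 1) * (n + m + 1)) := by ring
    have e4 : 60 * (LG + 1) * (n + m + 1) = 60 * ((LG + 1) * (n + m + 1)) := by ring
    omega
  · omega

/-- The number with the binary digits `x a, x (a + 1), …, x (a + b - 1)`. -/
def bitVal (x : ℕ → ℕ) (a : ℕ) : ℕ → ℕ
  | 0 => 0
  | b + 1 => 2 * bitVal x a b + x (a + b)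

theorem bitVal_lt {x : ℕ → ℕ} (hx : ∀ r, x r ≤ 1) (a b : ℕ) : bitVal x a b < 2 ^ b := by
  induction b with
  | zero => simp [bitVal]
  | succ b ih =>
    have := hx (a + b)
    simp only [bitVal, pow_succ]; omega

/-- The hubs that belong to the random bits `x`: the source, and random vertices. -/
def hubOf (n s LG : ℕ) (x : ℕ → ℕ) (i : ℕ) : ℕ :=
  if i = 0 then s else bitVal x (i * LG) LG % n

/-- Computation of the hubs from random bits. -/
def hubP : AProg :=
  .seq (.set .aa 0) <| .seq (.map (sc .tt) 1 .acc 0) <|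
  .seq (.loop (lt (sc .aa) (sc .lg)) <|
    .seq (.map (sc .tt) 1 .acc (2 * rd .acc pid + rd .bits (pid * sc .lg + sc .aa))) <|
    .set .aa (sc .aa + 1)) <|
  .seq (.map (sc .tt) 1 .hub (rd .acc pid % inp 0)) (.set .hub (inp 2))

theorem hubP_ok {I : ℕ → ℕ} {B n s T LG : ℕ} {σ : St} (hn : I 0 = n) (hs : I 2 = s) (hsn : s < n)
    (hT : σ .tt 0 = T) (hLG : σ .lg 0 = LG) (hbits : ∀ r, σ .bits r ≤ 1)
    (hB : T + LG + 2 ^ LG + n + 1 ≤ B) :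
    Ok I B hubP σ fun σ' k d => (∀ i < T, σ' .hub i = hubOf n s LG (σ .bits) i) ∧ σ' .hub 0 = s ∧
      Same [.aa, .acc, .hub] σ σ' ∧ k ≤ 10 * (LG + 1) * (T + 1) ∧ d ≤ 10 * (LG + 1) := by
  have hp : 1 ≤ 2 ^ LG := Nat.one_le_two_pow
  refine Ok.seq (Ok.set (by omega) (by simp) fun σ₁ s1 f1 => ?_)
  simp only [eval_ofNat] at s1
  refine Ok.seq (Ok.map (by simp [f1, hT]; omega) (by simp) fun σ₂ s2 f2 => ?_)
  refine Ok.seq (Ok.loop LG (T + 3) 2 (fun b σ' => σ' .aa 0 = b ∧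
    (∀ i < T, σ' .acc i = bitVal (σ .bits) (i * LG) b) ∧ Same [.aa, .acc, .hub] σ σ') ?_ ?_ ?_ ?_)
  · refine ⟨by rw [f2 _ (by simp), s1], fun i hi => ?_,
      (Same.of_ne f1 (by decide)).trans (Same.of_ne f2 (by decide))⟩
    rw [s2]; simp [f1, hT, hi, bitVal]
  · rintro b hb σ₃ ⟨a1, a2, S3⟩
    have hlt : ∀ i, bitVal (σ .bits) (i * LG) (b + 1) ≤ B := fun i => by
      have e1 := bitVal_lt hbits (i * LG) (b + 1)
      have e2 : 2 ^ (b + 1) ≤ 2 ^ LG := Nat.pow_le_pow_right (by omega) hb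
      omega
    have tt3 : σ₃ .tt 0 = T := by rw [S3 _ (by decide), hT]
    have lg3 : σ₃ .lg 0 = LG := by rw [S3 _ (by decide), hLG]
    have bits3 : σ₃ .bits = σ .bits := S3 _ (by decide)
    refine ⟨by simp [a1, lg3, hb], Ok.seq (Ok.map (by simp [tt3]; omega) ?_ fun σ₄ s4 f4 => ?_)⟩
    · intro i hi _
      simp only [eval_sc, tt3] at hi
      simpa [a2 i hi, bits3, lg3, a1, bitVal] using hlt i
    · refine Ok.set (by omega) (by simp [f4, a1]; omega) fun σ₅ s5 f5 => ?_
      refine ⟨⟨by rw [s5]; simp [f4, a1], fun i hi => ?_,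
        (S3.trans (Same.of_ne f4 (by decide))).trans (Same.of_ne f5 (by decide))⟩, ?_, by omega⟩
      · rw [f5 _ (by simp), s4]
        simp [tt3, hi, a2 i hi, bits3, lg3, a1, bitVal]
      · simp [tt3]
  · rintro σ₃ ⟨a1, -, S3⟩
    simp [a1, S3 .lg (by decide), hLG]
  rintro σ₃ k3 d3 ⟨a1, a2, S3⟩ hk3 hd3
  have tt3 : σ₃ .tt 0 = T := by rw [S3 _ (by decide), hT]
  refine Ok.seq (Ok.map (by simp [tt3]; omega) ?_ fun σ₄ s4 f4 => ?_)
  · intro i _ _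
    have := Nat.mod_lt (σ₃ .acc i) (show 0 < n by omega)
    simp [hn]; omega
  refine Ok.scat (by simp; omega) (by intro i _ _; simp [hs]; omega) fun σ₅ s5 f5 => ?_
  have h5 : ∀ i, σ₅ .hub i = if i = 0 then s else σ₄ .hub i := by
    intro i
    rw [s5]
    simp [scatter_one, hs, Function.update_apply]
  refine ⟨fun i hi => ?_, by simp [h5], (S3.trans (Same.of_ne f4 (by decide))).trans
    (Same.of_ne f5 (by decide)), ?_, ?_⟩
  · rw [h5, hubOf, s4]
    simp [tt3, hi, a2 i hi, hn]
  · simp only [eval_sc, f1 .tt (by simp), hT, tt3, eval_ofNat]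
    have e1 : LG * (T + 3 + 1) ≤ 4 * (LG * (T + 1)) := by
      calc LG * (T + 3 + 1) ≤ LG * (4 * (T + 1)) := Nat.mul_le_mul_left _ (by omega)
        _ = _ := by ring
    have e2 : 10 * (LG + 1) * (T + 1) = 10 * (LG * (T + 1)) + 10 * (T + 1) := by ring
    omega
  · omega

/-- Work of a run with `T` hubs. -/
def runWork (lam q Λ n m h T : ℕ) : ℕ :=
  (8 * lam * q + 2) * (320 * (Λ + 1) ^ 3 * (T * (n + m) + T * T * T + h * lam * (n + m)))

/-- Depth of a run. -/
def runDepth (lam q Λ h : ℕ) : ℕ := (8 * lam * q + 2) * (170 * (Λ + 1) ^ 3 * (h * lam))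

/-- Bound on the numbers that occur in a run with `T` hubs. -/
def runBound (n m h lam D0 W T : ℕ) : ℕ :=
  6 * (T * (n + m)) + 2 * (T * T * T) + 8 * (8 * T * lam) * (h * lam) +
      4 * (8 * T * lam) + 3 * (h * lam) + 3 * (n + m) + 8 * lam * D0 + W + 10

/-- A run with random hubs, and a second one with all vertices as hubs if the first one fails. -/
def solveP : AProg :=
  .seq hubP <| .seq runP <|
  .ite (sc .bad) (.seq (.set .tt (inp 0 + 1)) (.seq (.par (inp 0) 1 .hub (pid + 1) pid) runP)) .skip

/-- The second run uses the source and all vertices as hubs. These meet every non-empty set of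
vertices, so they are good and the second check cannot fail. Correctness is therefore certain, and
only the work depends on whether the random hubs are good. -/
theorem solveP_ok {I : ℕ → ℕ} {B n m h s T LG lam D0 W q Λ : ℕ} {σ : St} (hI : InputOk I n m h)
    (hs : I 2 = s) (hsn : s < n) (h1 : 1 ≤ h) (hhn : h ≤ n)
    (hT : σ .tt 0 = T) (hT1 : 1 ≤ T) (hN : σ .nn 0 = n + m) (hLG : σ .lg 0 = LG)
    (hlam : LG + 4 = lam) (hD0 : σ .d0 0 = D0)
    (hbits : ∀ r, σ .bits r ≤ 1) (hB1 : T + LG + 2 ^ LG + n + 1 ≤ B)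
    (hB2 : runBound n m h lam D0 W T ≤ B) (hB3 : runBound n m h lam D0 W (n + 1) ≤ B)
    (hΛ1 : 3 * (T * (n + m)) ≤ 2 ^ Λ) (hΛ2 : 4 * (8 * T * lam) * (h * lam) ≤ 2 ^ Λ)
    (hΛ3 : 3 * ((n + 1) * (n + m)) ≤ 2 ^ Λ) (hΛ4 : 4 * (8 * (n + 1) * lam) * (h * lam) ≤ 2 ^ Λ)
    (hlk : LinkSpec n m (tl I) (hd I) LG (σ .lk))
    (hW : ∀ j < m, wt I j ≤ W) (hsum : n * ∑ j ∈ Finset.range m, wt I j < D0)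
    (hq : D0 < 2 ^ q) (hwl : ∀ r, r % 3 < 2 ∨ r / 3 < n → σ .wl r = 0) :
    Ok I B solveP σ fun σ' k d => ExactAt I n m s (σ' .pot) (σ' .x) ∧
      (∀ v < n, σ' .pot v ≤ 8 * lam * D0) ∧
      k ≤ 10 * (LG + 1) * (T + 1) + runWork lam q Λ n m h T + n + 4 +
        runWork lam q Λ n m h (n + 1) ∧
      (GoodHubs (tl I) (hd I) m (wt I) (hubOf n s LG (σ .bits)) T h →
        k ≤ 10 * (LG + 1) * (T + 1) + runWork lam q Λ n m h T + 1) ∧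
      d ≤ 10 * (LG + 1) + 2 * runDepth lam q Λ h + 3 := by
  have hp : 1 ≤ 2 ^ LG := Nat.one_le_two_pow
  refine Ok.seq ((hubP_ok (B := B) hI.n_eq hs hsn hT hLG hbits hB1).imp ?_)
  rintro σ₁ k1 d1 ⟨hub1, hub10, S1, hk1, hd1⟩
  have hlt1 : ∀ i < T, σ₁ .hub i < n := by
    intro i hi
    rw [hub1 i hi, hubOf]
    split_ifs
    · exact hsn
    · exact Nat.mod_lt _ (by omega)
  refine Ok.seq ((runP_ok (B := B) (T := T) (lam := lam) (D0 := D0) (Λ := Λ) (W := W) (q := q) hI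
    hB2 (by rw [S1 _ (by decide), hT]) (by rw [S1 _ (by decide), hN])
    (by rw [S1 _ (by decide), hLG, hlam]) (by rw [S1 _ (by decide), hD0]) h1 hT1 hΛ1 hΛ2
    (by rw [S1 .lg (by decide), S1 .lk (by decide), hLG]; exact hlk) hlt1 hW hsum hq
    (by rw [S1 .wl (by decide)]; exact hwl)).imp ?_)
  rintro σ₂ k2 d2 ⟨ex2, good2, pot2, wl2, S2, hk2, hd2⟩
  rw [hub10] at ex2
  have S12 : Same ([.aa, .acc, .hub] ++ runArr) σ σ₂ := (S1.mono (by simp)).trans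
    (S2.mono (by simp))
  have hgood : GoodHubs (tl I) (hd I) m (wt I) (hubOf n s LG (σ .bits)) T h → σ₂ .bad 0 = 0 := by
    exact fun hg => good2 (hg.congr hub1)
  refine Ok.ite (fun hb => ?_) (fun hb => ?_)
  · have hn1 : n ≤ B := by omega
    have hn2 : n + 1 ≤ B := by omega
    refine Ok.seq (Ok.set (by omega) (by simpa [hI.n_eq] using hn2) fun σ₃ s3 f3 => ?_)
    have tt3 : σ₃ .tt 0 = n + 1 := by rw [s3]; simp [hI.n_eq]
    refine Ok.seq (Ok.scat (by simpa [hI.n_eq] using hn1) ?_ fun σ₄ s4 f4 => ?_)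
    · intro i hi _
      simp [hI.n_eq] at hi; simp; omega
    simp only [eval_inp, eval_ofNat, hI.n_eq, eval_add, eval_pid] at s4
    have S14 : Same ([.aa, .acc, .hub, .tt] ++ runArr) σ σ₄ := ((S12.mono (by decide)).trans
      (Same.of_ne f3 (by decide))).trans (Same.of_ne f4 (by decide))
    have hub4 : ∀ i < n, σ₄ .hub (i + 1) = i := by
      intro i hi
      rw [s4]
      exact scatter_inj (idx := fun i => i + 1) (v := fun i => i) hi (by simp)
        fun j _ _ he => by omega
    have hub40 : σ₄ .hub 0 = s := by
      rw [s4, scatter_of_forall fun i _ _ => by omega, f3 _ (by simp), S2 _ (by decide), hub10]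
    have hlt4 : ∀ i < n + 1, σ₄ .hub i < n := by
      rintro (_ | i) hi
      · rw [hub40]; exact hsn
      · rw [hub4 i (by omega)]; omega
    refine (runP_ok (B := B) (T := n + 1) (lam := lam) (D0 := D0) (Λ := Λ) (W := W) (q := q) hI
      hB3 (by rw [f4 _ (by simp), tt3]) (by rw [S14 _ (by decide), hN])
      (by rw [S14 _ (by decide), hLG, hlam]) (by rw [S14 _ (by decide), hD0]) h1 (by omega) hΛ3 hΛ4
      (by rw [S14 .lg (by decide), S14 .lk (by decide), hLG]; exact hlk) hlt4 hW hsum hq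
      (by rw [f4 .wl (by simp), f3 .wl (by simp)]; exact wl2)).imp ?_
    rintro σ₅ k5 d5 ⟨ex5, good5, pot5, -, -, hk5, hd5⟩
    rw [hub40] at ex5
    refine ⟨ex5 (good5 ?_), pot5, ?_, fun hg => absurd (hgood hg) hb, ?_⟩
    · obtain ⟨S, hS, hgS⟩ := exists_hitting_sets (wt := wt I) hI.tail_lt hI.head_lt hhn
      refine hgS _ _ fun u hu v hv => ?_
      obtain ⟨hsub, hcard⟩ := hS u v
      obtain ⟨x, hx⟩ : (S u v).Nonempty := by
        rw [← Finset.card_pos, hcard]; exact h1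
      have hxn := Finset.mem_range.1 (hsub hx)
      exact ⟨x + 1, by omega, by rw [hub4 x hxn]; exact hx⟩
    · simp only [eval_inp, eval_ofNat, hI.n_eq]
      unfold runWork; omega
    · unfold runDepth; omega
  · refine Ok.skip ⟨ex2 hb, pot2, ?_, fun _ => ?_, ?_⟩
    · unfold runWork; omega
    · unfold runWork; omega
    · unfold runDepth; omega


open AE

/-! ### Sampling -/

instance : IsProbabilityMeasure coinMeasure := by unfold coinMeasure; infer_instance

/-- The probability of prescribed outcomes of finitely many coins. -/
theorem coinMeasure_cylinder {ι : Type*} [Fintype ι] {e : ι → ℕ × ℕ} (he : Function.Injective e)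
    (a : ι → Bool) :
    coinMeasure {ω | ∀ i, ω (e i) = a i} = (2⁻¹ : ENNReal) ^ Fintype.card ι := by
  classical
  have hset : {ω : Coins | ∀ i, ω (e i) = a i} =
      Set.pi (Finset.univ.image e : Finset (ℕ × ℕ)) fun x =>
        {Function.extend e a (fun _ => false) x} := by
    ext ω
    simp [Set.mem_pi, he.extend_apply]
  have hb : ∀ b : Bool, (PMF.uniformOfFintype Bool).toMeasure {b} = 2⁻¹ := by
    intro b
    rw [PMF.toMeasure_apply_singleton _ _ (MeasurableSet.singleton b)]
    simp
  rw [hset, coinMeasure, Measure.infinitePi_pi _ fun _ _ => MeasurableSet.singleton _]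
  simp only [hb, Finset.prod_const]
  rw [Finset.card_image_of_injective _ he, Finset.card_univ]

theorem bitVal_congr {x y : ℕ → ℕ} {a a' b : ℕ} (h : ∀ i < b, x (a + i) = y (a' + i)) :
    bitVal x a b = bitVal y a' b := by
  induction b with
  | zero => rfl
  | succ b ih => rw [bitVal, bitVal, ih fun i hi => h i (by omega), h b (by omega)]

theorem exists_bitVal_eq (b : ℕ) : ∀ y < 2 ^ b,
    ∃ x : ℕ → Bool, bitVal (fun r => (x r).toNat) 0 b = y := by
  induction b with
  | zero => intro y hy; exact ⟨fun _ => false, by simp at hy; simp [bitVal, hy]⟩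
  | succ b ih =>
    intro y hy
    rw [pow_succ] at hy
    obtain ⟨x, hx⟩ := ih (y / 2) (by omega)
    refine ⟨Function.update x b (decide (y % 2 = 1)), ?_⟩
    have e : bitVal (fun r => (Function.update x b (decide (y % 2 = 1)) r).toNat) 0 b =
        bitVal (fun r => (x r).toNat) 0 b := by
      refine bitVal_congr fun i hi => ?_
      rw [Function.update_of_ne (by omega)]
    rw [bitVal, e, hx, zero_add, Function.update_self]
    rcases Nat.mod_two_eq_zero_or_one y with h | h <;> simp [h] <;> omega

/-- The value of a block of random bits. -/
def blockVal {b : ℕ} (x : Fin b → Bool) : ℕ :=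
  bitVal (fun r => if h : r < b then (x ⟨r, h⟩).toNat else 0) 0 b

/-- Each `v` in `S` is the residue of the numbers `v + n * q` with `q < 2 ^ b / n`, all below `2 ^
b` and pairwise different, and every number below `2 ^ b` is the value of a block. -/
theorem card_block_ge {n b : ℕ} {S : Finset ℕ} (hS : S ⊆ Finset.range n) :
    S.card * (2 ^ b / n) ≤
      (Finset.univ.filter fun x : Fin b → Bool => blockVal x % n ∈ S).card := by
  have h1 : S.card * (2 ^ b / n) ≤ ((Finset.range (2 ^ b)).filter fun y => y % n ∈ S).card := by
    rw [← Finset.card_range (2 ^ b / n), ← Finset.card_product]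
    refine Finset.card_le_card_of_injOn (fun p => p.1 + n * p.2) ?_ ?_
    · rintro ⟨v, q⟩ hp
      simp only [Finset.coe_product, Set.mem_prod, Finset.mem_coe, Finset.mem_range] at hp
      have hv := Finset.mem_range.1 (hS hp.1)
      have h2 : n * (q + 1) ≤ 2 ^ b :=
        (Nat.mul_le_mul_left _ hp.2).trans (Nat.mul_div_le _ _)
      rw [mul_add] at h2
      simp only [Finset.coe_filter, Finset.mem_range, Set.mem_ofPred_eq]
      rw [Nat.add_mul_mod_self_left, Nat.mod_eq_of_lt hv]
      exact ⟨by omega, hp.1⟩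
    · rintro ⟨v, q⟩ hp ⟨v', q'⟩ hp' he
      simp only [Finset.coe_product, Set.mem_prod, Finset.mem_coe, Finset.mem_range] at hp hp' he
      have hv := Finset.mem_range.1 (hS hp.1)
      have hv' := Finset.mem_range.1 (hS hp'.1)
      have e1 := congrArg (· % n) he
      have e2 := congrArg (· / n) he
      simp only [Nat.add_mul_mod_self_left, Nat.mod_eq_of_lt hv, Nat.mod_eq_of_lt hv'] at e1
      rw [Nat.add_mul_div_left _ _ (by omega), Nat.add_mul_div_left _ _ (by omega),
        Nat.div_eq_of_lt hv, Nat.div_eq_of_lt hv', zero_add, zero_add] at e2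
      rw [e1, e2]
  refine h1.trans (Finset.card_le_card_of_surjOn blockVal ?_)
  intro y hy
  simp only [Finset.coe_filter, Finset.mem_range, Set.mem_ofPred_eq] at hy
  obtain ⟨x, hx⟩ := exists_bitVal_eq b y hy.1
  have e : blockVal (fun i : Fin b => x i) = y := by
    rw [← hx]
    refine bitVal_congr fun i hi => ?_
    rw [dif_pos (by omega)]
  exact ⟨fun i => x i, by simpa [e] using hy.2, e⟩

/-- The probability that random hubs avoid a set of vertices. -/
theorem coinMeasure_avoid {n s LG T t₀ : ℕ} {S : Finset ℕ} (hS : S ⊆ Finset.range n) (hn : 1 ≤ n)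
    (hLG : n ≤ 2 ^ LG) :
    coinMeasure {ω | ∀ i < T + 1, hubOf n s LG (fun r => (ω (t₀, r)).toNat) i ∉ S} ≤
      ENNReal.ofReal ((1 - S.card / (2 * n)) ^ T) := by
  classical
  set bad : Finset (Fin LG → Bool) := Finset.univ.filter fun x => ¬ blockVal x % n ∈ S with hbad
  have hcard : (bad.card : ℝ) ≤ 2 ^ LG * (1 - S.card / (2 * n)) := by
    have h1 := Finset.card_filter_add_card_filter_not (s := (Finset.univ : Finset (Fin LG → Bool)))
      (fun x => blockVal x % n ∈ S)
    rw [Finset.card_univ, Fintype.card_fun, Fintype.card_bool, Fintype.card_fin] at h1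
    have h2 := card_block_ge (b := LG) hS
    -- As `n ≤ 2 ^ LG`, rounding the quotient down loses at most a factor two; this is the `2` in `1
    -- - S.card / (2 * n)`.
    have h3 : 2 ^ LG ≤ 2 * n * (2 ^ LG / n) := by
      have e1 := Nat.lt_div_mul_add (a := 2 ^ LG) (b := n) (by omega)
      have e2 : 1 ≤ 2 ^ LG / n := (Nat.one_le_div_iff (by omega)).2 hLG
      have e3 : n ≤ n * (2 ^ LG / n) := Nat.le_mul_of_pos_right _ (by omega)
      rw [mul_comm] at e1
      rw [mul_assoc]; omega
    change _ + bad.card = _ at h1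
    have h4 : bad.card + S.card * (2 ^ LG / n) ≤ 2 ^ LG := by omega
    have h4' : (bad.card : ℝ) + S.card * ((2 ^ LG / n : ℕ) : ℝ) ≤ 2 ^ LG := by exact_mod_cast h4
    have h3' : (2 : ℝ) ^ LG ≤ 2 * n * ((2 ^ LG / n : ℕ) : ℝ) := by exact_mod_cast h3
    have hn' : (0 : ℝ) < 2 * n := by positivity
    have h5 : (2 : ℝ) ^ LG * (S.card / (2 * n)) ≤ S.card * ((2 ^ LG / n : ℕ) : ℝ) := by
      rw [mul_div_assoc', div_le_iff₀ hn']
      nlinarith [mul_le_mul_of_nonneg_left h3' (Nat.cast_nonneg (α := ℝ) S.card)]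
    linarith
  -- Hub `0` is the source, so the random hubs use the blocks from index `1` on; these are disjoint
  -- sets of coins.
  set e : Fin T × Fin LG → ℕ × ℕ := fun p => (t₀, (p.1 + 1) * LG + p.2) with he
  have heinj : Function.Injective e := by
    rintro ⟨i, b⟩ ⟨i', b'⟩ h
    simp only [he, Prod.mk.injEq, true_and] at h
    have hb := b.2
    have hb' := b'.2
    have e1 := congrArg (· / LG) h
    have e2 := congrArg (· % LG) h
    simp only [Nat.mul_add_mod', Nat.mod_eq_of_lt hb, Nat.mod_eq_of_lt hb'] at e2
    simp only [mul_comm _ LG] at e1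
    rw [Nat.mul_add_div (by omega), Nat.mul_add_div (by omega), Nat.div_eq_of_lt hb,
      Nat.div_eq_of_lt hb'] at e1
    ext <;> simp <;> omega
  have hsub : {ω : Coins | ∀ i < T + 1, hubOf n s LG (fun r => (ω (t₀, r)).toNat) i ∉ S} ⊆
      ⋃ a ∈ Fintype.piFinset fun _ : Fin T => bad, {ω | ∀ p, ω (e p) = a p.1 p.2} := by
    intro ω hω
    simp only [Set.mem_iUnion, Set.mem_ofPred_eq]
    refine ⟨fun i b => ω (e (i, b)), ?_, fun p => rfl⟩
    rw [Fintype.mem_piFinset]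
    intro i
    have h1 := hω (i + 1) (by omega)
    rw [hubOf, if_neg (by omega)] at h1
    rw [hbad, Finset.mem_filter]
    refine ⟨Finset.mem_univ _, ?_⟩
    convert h1 using 2
    congr 1
    refine bitVal_congr fun b hb => ?_
    rw [zero_add, dif_pos hb]
  refine (measure_mono hsub).trans ((measure_biUnion_finset_le _ _).trans ?_)
  have h6 : ∀ a : Fin T → Fin LG → Bool, coinMeasure {ω | ∀ p, ω (e p) = a p.1 p.2} =
      (2⁻¹ : ENNReal) ^ (T * LG) := by
    intro a
    rw [coinMeasure_cylinder heinj fun p => a p.1 p.2]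
    simp
  simp only [h6, Finset.sum_const, nsmul_eq_mul]
  rw [Fintype.card_piFinset_const]
  have h7 : ((bad.card ^ T : ℕ) : ENNReal) * (2⁻¹ : ENNReal) ^ (T * LG) =
      ENNReal.ofReal (((bad.card : ℝ) / 2 ^ LG) ^ T) := by
    have e1 : (2⁻¹ : ENNReal) = ENNReal.ofReal 2⁻¹ := by
      rw [ENNReal.ofReal_inv_of_pos (by norm_num)]; simp
    rw [e1, ← ENNReal.ofReal_pow (by norm_num), ← ENNReal.ofReal_natCast,
      ← ENNReal.ofReal_mul (by positivity)]
    congr 1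
    push_cast
    rw [div_pow, mul_comm T, pow_mul, inv_pow, inv_pow, div_eq_mul_inv]
  rw [h7]
  refine ENNReal.ofReal_le_ofReal (pow_le_pow_left₀ (by positivity) ?_ _)
  rw [div_le_iff₀ (by positivity), mul_comm]
  exact hcard

/-- Random hubs are good with high probability. -/
theorem coinMeasure_not_goodHubs {n m s h LG T t₀ c : ℕ} {tail head w : ℕ → ℕ}
    (htail : ∀ j < m, tail j < n) (hhead : ∀ j < m, head j < n) (h1 : 1 ≤ h) (hn : h ≤ n)
    (hLG : n ≤ 2 ^ LG) (hT : (2 * c + 4) * n * LG / h + 2 ≤ T) :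
    coinMeasure {ω | ¬ GoodHubs tail head m w (hubOf n s LG fun r => (ω (t₀, r)).toNat) T h} ≤
      ENNReal.ofReal (1 / (n : ℝ) ^ c) := by
  obtain ⟨S, hS, hgood⟩ := exists_hitting_sets (wt := w) htail hhead hn
  have hT2 : 2 ≤ T := (Nat.le_add_left _ _).trans hT
  obtain ⟨T, rfl⟩ : ∃ T', T = T' + 1 := ⟨T - 1, by omega⟩
  have hn1 : 1 ≤ n := by omega
  have hnR : (1 : ℝ) ≤ n := by exact_mod_cast hn1
  have hhR : (1 : ℝ) ≤ h := by exact_mod_cast h1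
  set x : ℝ := (1 - h / (2 * n)) ^ T with hx
  have hsub : {ω : Coins | ¬ GoodHubs tail head m w
      (hubOf n s LG fun r => (ω (t₀, r)).toNat) (T + 1) h} ⊆
      ⋃ p ∈ Finset.range n ×ˢ Finset.range n,
        {ω | ∀ i < T + 1, hubOf n s LG (fun r => (ω (t₀, r)).toNat) i ∉ S p.1 p.2} := by
    intro ω hω
    by_contra hne
    refine hω (hgood _ _ fun u hu v hv => ?_)
    by_contra hno
    refine hne ?_
    simp only [Set.mem_iUnion, Set.mem_ofPred_eq]
    exact ⟨(u, v), by simp [hu, hv], fun i hi hm => hno ⟨i, hi, hm⟩⟩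
  refine (measure_mono hsub).trans ((measure_biUnion_finset_le _ _).trans ?_)
  have h2 : ∀ p ∈ Finset.range n ×ˢ Finset.range n,
      coinMeasure {ω | ∀ i < T + 1, hubOf n s LG (fun r => (ω (t₀, r)).toNat) i ∉ S p.1 p.2} ≤
        ENNReal.ofReal x := by
    intro p _
    obtain ⟨h3, h4⟩ := hS p.1 p.2
    have := coinMeasure_avoid (s := s) (T := T) (t₀ := t₀) h3 hn1 hLG
    rwa [h4] at this
  refine (Finset.sum_le_sum h2).trans ?_
  rw [Finset.sum_const, Finset.card_product, Finset.card_range, nsmul_eq_mul,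
    ← ENNReal.ofReal_natCast, ← ENNReal.ofReal_mul (by positivity)]
  refine ENNReal.ofReal_le_ofReal ?_
  push_cast
  have hq : (h : ℝ) / (2 * n) ≤ 1 := by
    rw [div_le_one (by positivity)]
    have : (h : ℝ) ≤ n := by exact_mod_cast hn
    linarith
  -- By `1 - y ≤ exp (-y)` the probability of missing one set is at most `exp (-T h / (2 n))`. The
  -- coefficient `2 * c + 4` makes this at most `n ^ -(c + 2)`, and the union over `n²` sets leaves
  -- `n ^ -c`. The summand `2` in the number of hubs pays for the source and for rounding down.
  have h5 : x ≤ Real.exp (-((c + 2 : ℕ) * Real.log n)) := by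
    have h6 : x ≤ Real.exp (-(h / (2 * n))) ^ T := by
      refine pow_le_pow_left₀ (by linarith) ?_ _
      have := Real.add_one_le_exp (-((h : ℝ) / (2 * n)))
      linarith
    refine h6.trans ?_
    rw [← Real.exp_nat_mul]
    refine Real.exp_le_exp.2 ?_
    have h7 : ((2 * c + 4) * n * LG : ℝ) ≤ T * h := by
      have e1 := Nat.lt_div_mul_add (a := (2 * c + 4) * n * LG) (b := h) (by omega)
      have e2 : (2 * c + 4) * n * LG ≤ T * h := by
        have e3 : ((2 * c + 4) * n * LG / h + 1) * h ≤ T * h := Nat.mul_le_mul_right _ (by omega)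
        rw [add_mul, one_mul] at e3; omega
      exact_mod_cast e2
    have h8 : Real.log n ≤ LG := by
      have e1 : (n : ℝ) ≤ 2 ^ LG := by exact_mod_cast hLG
      have e2 := Real.log_le_log (by linarith) e1
      rw [Real.log_pow] at e2
      have e3 : Real.log 2 ≤ 1 := by have := Real.log_two_lt_d9; linarith
      nlinarith [Nat.cast_nonneg (α := ℝ) LG]
    have h9 : ((c : ℝ) + 2) * LG ≤ T * (h / (2 * n)) := by
      rw [mul_div_assoc', le_div_iff₀ (by positivity)]
      linarith
    have h10 : ((c : ℝ) + 2) * Real.log n ≤ (c + 2) * LG :=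
      mul_le_mul_of_nonneg_left h8 (by positivity)
    push_cast
    linarith
  have h11 : Real.exp (-((c + 2 : ℕ) * Real.log n)) = 1 / (n : ℝ) ^ (c + 2) := by
    rw [Real.exp_neg, Real.exp_nat_mul, Real.exp_log (by linarith), one_div]
  rw [h11] at h5
  calc (n : ℝ) * n * x ≤ n * n * (1 / (n : ℝ) ^ (c + 2)) :=
        mul_le_mul_of_nonneg_left h5 (by positivity)
    _ = 1 / (n : ℝ) ^ c := by
      rw [pow_add]; field_simp


open AE

/-! ### Execution of the complete program -/

/-- Toss the coins. -/
def coinP : Prog :=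
  .par (sc .tt * sc .lg).compile (.lit 1) (AE.addr .bits .pid) .coin

/-- Write the output. -/
def outP : Prog :=
  .par (inp 0).compile (.lit 1) .pid ((rd .pot pid + 1) * eq (rd .x pid) 0).compile

/-- The complete program; `c` determines the number of hubs. -/
def ssspP (c : ℕ) : Prog :=
  .seq (preP c).compile (.seq coinP (.seq solveP.compile outP))

theorem parWrite_pid {w : ℕ} {ω : Coins} {t N : ℕ} {g a v : Expr} {M : Mem}
    (hg : ∀ i < N, g.eval w ω t i M ≠ 0) (ha : ∀ i < N, a.eval w ω t i M = i) {x : ℕ}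
    (hx : x < N) : parWrite w ω t N g a v M x = v.eval w ω t x M := by
  classical
  have H : ∃ i, i < N ∧ g.eval w ω t i M ≠ 0 ∧ a.eval w ω t i M = x := ⟨x, hx, hg x hx, ha x hx⟩
  rw [parWrite, dif_pos H]
  have hs := Nat.find_spec H
  rw [ha _ hs.1] at hs
  rw [hs.2.2]

/-- Work of the complete program if the first run succeeds. -/
def goodWork (n m h LG T q Λ : ℕ) : ℕ :=
  60 * (LG + 1) * (n + m + 1) + T * LG + 10 * (LG + 1) * (T + 1) +
    runWork (LG + 4) q Λ n m h T + n + 3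

/-- Numerical side conditions. -/
structure Numeric (n m h W D0 T LG q Λ B : ℕ) : Prop where
  hub : T + LG + 2 ^ LG + n + 1 ≤ B
  run : runBound n m h (LG + 4) D0 W T ≤ B
  run' : runBound n m h (LG + 4) D0 W (n + 1) ≤ B
  key : 3 * (T * (n + m)) ≤ 2 ^ Λ
  cap : 4 * (8 * T * (LG + 4)) * (h * (LG + 4)) ≤ 2 ^ Λ
  key' : 3 * ((n + 1) * (n + m)) ≤ 2 ^ Λ
  cap' : 4 * (8 * (n + 1) * (LG + 4)) * (h * (LG + 4)) ≤ 2 ^ Λ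
  bound : D0 < 2 ^ q
  coins : T * LG ≤ B

/-- The time `t₀` of the coin tosses is chosen before the outcome `ω`: everything before the tosses
is deterministic. So the random bits come from a fixed family of coins, as the probability estimate
requires, and the rest of the run treats them as ordinary memory. -/
theorem ssspP_exec {I : ℕ → ℕ} {B n m h s c W T LG q Λ w : ℕ} (hI : InputOk I n m h)
    (hs : I 2 = s) (hsn : s < n) (h1 : 1 ≤ h) (hhn : h ≤ n) (hI0 : ∀ x, 4 + 3 * m ≤ x → I x = 0)
    (hIB : ∀ x, I x ≤ B) (hB2 : 2 ≤ B) (hw : B ^ (ssspP c).deg < 2 ^ w)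
    (hLG : LG = Nat.clog 2 (n + m + 2)) (hT : T = c * n * LG / h + 2)
    (hW : ∀ j < m, wt I j ≤ W)
    (hN : Numeric n m h W (n * (∑ j ∈ Finset.range m, wt I j) + 1) T LG q Λ B)
    (hB : 3 * (n + m) + 4 + (n + 1) * (∑ j ∈ Finset.range m, wt I j) + c * n * LG ≤ B) :
    ∃ t₀, ∀ ω, ∃ M k d, Exec w ω (ssspP c) 0 I M k d ∧
      (∃ pot x, ExactAt I n m s pot x ∧ ∀ v < n, M v = (pot v + 1) * if x v = 0 then 1 else 0) ∧
      k ≤ (ssspP c).cst * (goodWork n m h LG T q Λ + (n + 3 + runWork (LG + 4) q Λ n m h (n + 1))) ∧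
      (GoodHubs (tl I) (hd I) m (wt I) (hubOf n s LG fun r => (ω (t₀, r)).toNat) T h →
        k ≤ (ssspP c).cst * goodWork n m h LG T q Λ) ∧
      d ≤ (ssspP c).cst * (70 * (LG + 1) + 2 * runDepth (LG + 4) q Λ h + 5) := by
  have hI1 : I 1 = m := hI.m_eq
  have hmono : ∀ {a : ℕ}, a ≤ (ssspP c).deg → B ^ a < 2 ^ w :=
    fun h => (Nat.pow_le_pow_right (by omega) h).trans_lt hw
  have hdeg : (ssspP c).deg = max (preP c).compile.deg
    (max coinP.deg (max solveP.compile.deg outP.deg)) := rfl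
  have hcst : (ssspP c).cst = max (preP c).compile.cst
    (max coinP.cst (max solveP.compile.cst outP.cst)) := rfl
  set χ := (ssspP c).cst with hχ
  have hwA : B ^ (preP c).compile.deg < 2 ^ w := hmono (by omega)
  have hwC : ∀ {a : ℕ}, a ≤ coinP.deg → B ^ a < 2 ^ w := fun h => hmono (by omega)
  have hwS : B ^ solveP.compile.deg < 2 ^ w := hmono (by omega)
  have hwO : ∀ {a : ℕ}, a ≤ outP.deg → B ^ a < 2 ^ w := fun h => hmono (by omega)
  set σ₀ : St := fun _ _ => 0 with hσ₀
  have hmem0 : toMem I m σ₀ = I := by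
    funext x
    unfold toMem
    split_ifs with hx
    · rfl
    · rw [hI0 x (by omega)]
  have hnB : n + 1 ≤ B := by omega
  have hT1 : 1 ≤ T := by rw [hT]; exact (show 1 ≤ 2 by omega).trans (Nat.le_add_left _ _)
  have par_le : ∀ {a b c d N : ℕ}, a + (b + c + d + 1) ≤ χ →
      a + N * (b + c + d + 1) ≤ χ * (N + 1) := by
    intro a b c d N h
    calc a + N * (b + c + d + 1) ≤ χ + N * χ :=
          Nat.add_le_add (by omega) (Nat.mul_le_mul_left _ (by omega))
      _ = χ * (N + 1) := by ring
  obtain ⟨σ₁, k1, d1, hr1, lg1, nn1, lk1, d01, tt1, S1, hk1, hd1⟩ :=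
    preP_ok (B := B) (c := c) (σ := σ₀) hI (hI0 _ (by omega)) (by rw [← hLG]; exact hB)
  rw [← hLG] at lg1 tt1 hk1 hd1
  rw [← hT] at tt1
  have b1 := hr1.bounded fun _ _ => Nat.zero_le _
  obtain ⟨k1', d1', hk1', hd1', ex1⟩ := hr1.exec hB2 hI1 hI0 hIB (fun _ _ => Nat.zero_le _) hwA
  rw [hmem0] at ex1
  refine ⟨0 + d1', fun ω => ?_⟩
  -- the coins
  set N := T * LG with hNdef
  have hNB : N ≤ B := hN.coins
  have evN : ∀ (σ : St), (∀ a x, σ a x ≤ B) → ∀ t i, i ≤ B → ∀ e : Expr, B ^ e.deg < 2 ^ w →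
      e.eval w ω t i (toMem I m σ) = e.evalN ω t i (toMem I m σ) :=
    fun σ hσ t i hi e he => (Expr.eval_eq_evalN hB2 (toMem_le σ hIB hσ) hi e he).1
  have ev : ∀ (σ : St), (∀ a x, σ a x ≤ B) → ∀ t i, i ≤ B → ∀ e : AE, B ^ e.compile.deg < 2 ^ w →
      e.compile.eval w ω t i (toMem I m σ) = e.eval I σ i :=
    fun σ hσ t i hi e he => by rw [evN σ hσ t i hi _ he, AE.evalN_compile σ hI1 hI0]
  have cN : ∀ t, (sc .tt * sc .lg).compile.eval w ω t 0 (toMem I m σ₁) = N := by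
    intro t
    rw [ev σ₁ b1 t 0 (by omega) _ (hwC (by simp only [coinP, Prog.deg]; omega))]
    simp [tt1, lg1, hNdef]
  have ex2 := Exec.par (w := w) (ω := ω) (sc .tt * sc .lg).compile (.lit 1)
    (AE.addr .bits .pid) .coin (0 + d1') (toMem I m σ₁)
  rw [cN, parWrite_toMem (arr := .bits) (g' := fun _ => True) (idx := fun i => i)
    (v' := fun i => (ω (0 + d1', i)).toNat)] at ex2
  rotate_left
  · intro i hi
    rw [evN σ₁ b1 _ i (by omega) _ (hwC (by simp only [coinP, Prog.deg]; omega))]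
    simp [Expr.evalN]
  · intro i hi
    rw [evN σ₁ b1 _ i (by omega) _ (hwC (by simp only [coinP, Prog.deg]; omega)),
      AE.evalN_addr σ₁ hI1]
    simp [Expr.evalN]
  · intro i hi
    rw [evN σ₁ b1 _ i (by omega) _ (hwC (by simp only [coinP, Prog.deg]; omega))]
    simp [Expr.evalN]
  set σ₂ : St := Function.update σ₁ .bits (scatter N (fun _ => True) (fun i => i)
    (fun i => (ω (0 + d1', i)).toNat) (σ₁ .bits)) with hσ₂
  have f2 : ∀ b, b ≠ .bits → σ₂ b = σ₁ b := fun b hb => Function.update_of_ne hb _ _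
  have bits2 : ∀ r, σ₂ .bits r = if r < N then (ω (0 + d1', r)).toNat else 0 := by
    intro r
    rw [hσ₂, Function.update_self, scatter_id, S1 .bits (by decide)]
    simp [hσ₀]
  have bits2' : ∀ r, σ₂ .bits r ≤ 1 := by
    intro r
    rw [bits2]
    split_ifs
    · exact Bool.toNat_le _
    · omega
  have b2 : ∀ a x, σ₂ a x ≤ B := by
    intro a x
    by_cases ha : a = .bits
    · subst ha; exact (bits2' x).trans (by omega)
    · rw [f2 a ha]; exact b1 a x
  -- the runs
  obtain ⟨σ₃, k3, d3, hr3, hex, hpot, hk3, hk3', hd3⟩ :=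
    solveP_ok (B := B) (T := T) (LG := LG) (lam := LG + 4) (W := W) (q := q) (Λ := Λ) (σ := σ₂)
      (D0 := n * (∑ j ∈ Finset.range m, wt I j) + 1)
      hI hs hsn h1 hhn (by rw [f2 _ (by simp), tt1]) hT1 (by rw [f2 _ (by simp), nn1])
      (by rw [f2 _ (by simp), lg1]) rfl (by rw [f2 _ (by simp), d01]) bits2' hN.hub hN.run hN.run'
      hN.key hN.cap hN.key' hN.cap' (by rw [f2 _ (by simp), ← lg1]; exact lk1) hW (by omega)
      hN.bound (fun r _ => by rw [f2 _ (by simp), S1 _ (by decide)])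
  have b3 := hr3.bounded b2
  obtain ⟨k3', d3', hk3c, hd3c, ex3⟩ := hr3.exec hB2 hI1 hI0 hIB b2 hwS
  -- the output
  have oN : ∀ t, (inp 0).compile.eval w ω t 0 (toMem I m σ₃) = n := by
    intro t
    rw [ev σ₃ b3 t 0 (by omega) _ (hwO (by simp only [outP, Prog.deg]; omega))]
    simp [hI.n_eq]
  have ex4 := fun t => Exec.par (w := w) (ω := ω) (inp 0).compile (.lit 1) .pid
    ((rd .pot pid + 1) * eq (rd .x pid) 0).compile t (toMem I m σ₃)
  simp only [oN] at ex4
  refine ⟨_, _, _, Exec.seq (ex1 ω 0) (Exec.seq ex2 (Exec.seq (ex3 ω _) (ex4 _))),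
    ⟨σ₃ .pot, σ₃ .x, hex, fun v hv => ?_⟩, ?_, ?_, ?_⟩
  -- Output cells overlap the input, but all reads of a parallel statement refer to the old memory.
  · rw [parWrite_pid _ _ hv,
      ev σ₃ b3 _ v (by omega) _ (hwO (by simp only [outP, Prog.deg]; omega))]
    · by_cases hx : σ₃ .x v = 0 <;> simp [hx]
    · intro i hi
      rw [evN σ₃ b3 _ i (by omega) _ (hwO (by simp only [outP, Prog.deg]; omega))]
      simp [Expr.evalN]
    · intro i hi
      rw [evN σ₃ b3 _ i (by omega) _ (hwO (by simp only [outP, Prog.deg]; omega))]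
      simp [Expr.evalN]
  all_goals
    have c2 : (sc .tt * sc .lg).compile.cost + ((Expr.lit 1).cost + (AE.addr .bits .pid).cost +
        Expr.coin.cost + 1) ≤ χ := by
      have : coinP.cst ≤ χ := by omega
      simp only [coinP, Prog.cst] at this; omega
    have c4 : (inp 0).compile.cost + ((Expr.lit 1).cost + Expr.pid.cost +
        ((rd .pot pid + 1) * eq (rd .x pid) 0).compile.cost + 1) ≤ χ := by
      have : outP.cst ≤ χ := by omega
      simp only [outP, Prog.cst] at this; omega
    have c1 : (preP c).compile.cst ≤ χ := by omega
    have c3 : solveP.compile.cst ≤ χ := by omega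
  · have e1 := hk1'.trans (Nat.mul_le_mul c1 hk1)
    have e3 := hk3c.trans (Nat.mul_le_mul c3 hk3)
    refine (Nat.add_le_add e1 (Nat.add_le_add (par_le (N := N) c2) (Nat.add_le_add e3
      (par_le (N := n) c4)))).trans ?_
    simp only [← mul_add]
    refine Nat.mul_le_mul_left _ ?_
    unfold goodWork
    omega
  · intro hg
    have hg' := hk3' (hg.congr fun i hi => ?_)
    · have e1 := hk1'.trans (Nat.mul_le_mul c1 hk1)
      have e3 := hk3c.trans (Nat.mul_le_mul c3 hg')
      refine (Nat.add_le_add e1 (Nat.add_le_add (par_le (N := N) c2) (Nat.add_le_add e3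
        (par_le (N := n) c4)))).trans ?_
      simp only [← mul_add]
      refine Nat.mul_le_mul_left _ ?_
      unfold goodWork
      omega
    · unfold hubOf
      split_ifs with h0
      · rfl
      · refine congrArg (· % n) (bitVal_congr fun b hb => ?_)
        have : (i + 1) * LG ≤ T * LG := Nat.mul_le_mul_right _ hi
        rw [add_mul] at this
        rw [bits2, if_pos (by omega)]
  · have e1 := hd1'.trans (Nat.mul_le_mul c1 hd1)
    have e3 := hd3c.trans (Nat.mul_le_mul c3 hd3)
    refine (Nat.add_le_add e1 (Nat.add_le_add c2 (Nat.add_le_add e3 c4))).trans ?_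
    have e5 : χ * (60 * (LG + 1)) + (χ + (χ * (10 * (LG + 1) + 2 * runDepth (LG + 4) q Λ h + 3) +
        χ)) = χ * (60 * (LG + 1) + (10 * (LG + 1) + 2 * runDepth (LG + 4) q Λ h + 3) + 2) := by ring
    rw [e5]
    refine Nat.mul_le_mul_left _ ?_
    omega


/-! ### Numerical bounds -/

/-- With `a = 2 ^ LG`, the number `α = a ^ (c + 3)` dominates `T`, `n + 1` and `LG + 4`. All
quantities are then at most of degree four in `α`, and linear in `W + 2` where weights occur. The
spare factors, `a ^ 8` in the bound on values and `a ^ 3` in `2 ^ Λ`, absorb the numerical constants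
since `a ≥ 4`. -/
theorem numeric_of_le {c n m h W S T LG : ℕ} (hLG : n + m + 2 ≤ 2 ^ LG) (h1 : 1 ≤ h) (hhn : h ≤ n)
    (hS : S ≤ m * W) (hT : T = c * n * LG / h + 2) :
    Numeric n m h W (n * S + 1) T LG (2 * LG + Nat.log 2 (W + 2) + 1) ((4 * c + 15) * LG)
        (2 ^ (LG * (4 * c + 20)) * (W + 2)) ∧
      3 * (n + m) + 4 + (n + 1) * S + c * n * LG ≤ 2 ^ (LG * (4 * c + 20)) * (W + 2) := by
  have hLGa : LG < 2 ^ LG := Nat.lt_two_pow_self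
  have ha : 4 ≤ 2 ^ LG := by
    have h3 : 2 ≤ LG := by
      by_contra hlt
      have : 2 ^ LG ≤ 2 ^ 1 := Nat.pow_le_pow_right (by omega) (by omega)
      omega
    exact Nat.pow_le_pow_right (n := 2) (by omega) h3
  have hq : n * S + 1 ≤ 2 ^ (2 * LG) * (W + 2) := by
    have e1 : n * S ≤ 2 ^ LG * (2 ^ LG * W) :=
      Nat.mul_le_mul (by omega) (hS.trans (Nat.mul_le_mul_right _ (by omega)))
    have e2 : 2 ^ LG * (2 ^ LG * W) = 2 ^ (2 * LG) * W := by rw [two_mul, pow_add]; ring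
    have e3 : 1 ≤ 2 ^ (2 * LG) := Nat.one_le_two_pow
    rw [mul_add]; omega
  have hq2 : 2 ^ (2 * LG) * (W + 2) < 2 ^ (2 * LG + Nat.log 2 (W + 2) + 1) := by
    rw [add_assoc, pow_add]
    exact Nat.mul_lt_mul_of_pos_left (Nat.lt_pow_succ_log_self (by omega) _) (by positivity)
  have e1 : 2 ^ (LG * (4 * c + 20)) = ((2 ^ LG) ^ c * (2 ^ LG) ^ 3) ^ 4 * (2 ^ LG) ^ 8 := by
    rw [pow_mul]; ring
  have e2 : 2 ^ ((4 * c + 15) * LG) = ((2 ^ LG) ^ c * (2 ^ LG) ^ 3) ^ 4 * (2 ^ LG) ^ 3 := by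
    rw [mul_comm, pow_mul]; ring
  have e3 : 2 ^ (2 * LG) = (2 ^ LG) ^ 2 := by rw [← pow_mul, mul_comm]
  have hA : c ≤ (2 ^ LG) ^ c := (Nat.lt_two_pow_self.le).trans (Nat.pow_le_pow_left (by omega) _)
  have hA1 : 1 ≤ (2 ^ LG) ^ c := Nat.one_le_pow _ _ (by omega)
  rw [e1]
  rw [e3] at hq
  generalize haeq : 2 ^ LG = a at *
  generalize a ^ c = A at *
  have hcn : c * n * LG ≤ A * a * a := Nat.mul_le_mul (Nat.mul_le_mul hA (by omega)) hLGa.le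
  have ha3 : 4 * (A * a * a) ≤ A * a ^ 3 := by
    calc 4 * (A * a * a) ≤ a * (A * a * a) := Nat.mul_le_mul_right _ ha
      _ = A * a ^ 3 := by ring
  have haA : a * a ≤ A * a * a := by
    rw [mul_assoc]; exact Nat.le_mul_of_pos_left _ hA1
  have ha2 : 4 * a ≤ a * a := Nat.mul_le_mul_right _ ha
  have hTle : T ≤ A * a ^ 3 := by
    have := Nat.div_le_self (c * n * LG) h
    omega
  set α := A * a ^ 3 with hα
  have haα : a ≤ α := by omega
  have hLα : LG + 4 ≤ α := by omega
  have p1 : α ≤ α ^ 4 := Nat.le_self_pow (by omega) _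
  have p2 : α ^ 2 ≤ α ^ 4 := Nat.pow_le_pow_right (by omega) (by omega)
  have p3 : α ^ 3 ≤ α ^ 4 := Nat.pow_le_pow_right (by omega) (by omega)
  have p0 : 1 ≤ α ^ 4 := Nat.one_le_pow _ _ (by omega)
  have q3 : 64 ≤ a ^ 3 := by simpa using Nat.pow_le_pow_left ha 3
  have q8 : 256 ≤ a ^ 8 :=
    (show 256 = 4 ^ 4 by norm_num).le.trans ((Nat.pow_le_pow_left ha 4).trans
      (Nat.pow_le_pow_right (by omega) (by omega)))
  have hΛ : 64 * α ^ 4 ≤ α ^ 4 * a ^ 3 := by rw [mul_comm]; exact Nat.mul_le_mul_left _ q3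
  have hBB : 256 * (α ^ 4 * (W + 2)) ≤ α ^ 4 * a ^ 8 * (W + 2) := by
    calc 256 * (α ^ 4 * (W + 2)) ≤ a ^ 8 * (α ^ 4 * (W + 2)) := Nat.mul_le_mul_right _ q8
      _ = _ := by ring
  have hW2 : α ^ 4 * (W + 2) = α ^ 4 * W + 2 * α ^ 4 := by ring
  have hWα : W ≤ α ^ 4 * W := Nat.le_mul_of_pos_left _ p0
  have hkey : ∀ τ ≤ α, 3 * (τ * (n + m)) ≤ 3 * α ^ 2 := by
    intro τ hτ
    calc 3 * (τ * (n + m)) ≤ 3 * (α * α) :=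
          Nat.mul_le_mul_left _ (Nat.mul_le_mul hτ (by omega))
      _ = _ := by ring
  have hcap : ∀ τ ≤ α, (8 * τ * (LG + 4)) * (h * (LG + 4)) ≤ 8 * α ^ 4 := by
    intro τ hτ
    calc (8 * τ * (LG + 4)) * (h * (LG + 4)) ≤ (8 * α * α) * (α * α) :=
          Nat.mul_le_mul (Nat.mul_le_mul (Nat.mul_le_mul_left _ hτ) hLα)
            (Nat.mul_le_mul (by omega) hLα)
      _ = _ := by ring
  have hrun : ∀ τ ≤ α, runBound n m h (LG + 4) (n * S + 1) W τ ≤ α ^ 4 * a ^ 8 * (W + 2) := by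
    intro τ hτ
    have r1 := hkey τ hτ
    have r2 := hcap τ hτ
    have r3 : τ * τ * τ ≤ α ^ 3 := by
      calc τ * τ * τ = τ ^ 3 := by ring
        _ ≤ _ := Nat.pow_le_pow_left hτ 3
    have r4 : τ * (LG + 4) ≤ α ^ 2 := by
      calc τ * (LG + 4) ≤ α * α := Nat.mul_le_mul hτ hLα
        _ = _ := by ring
    have r5 : h * (LG + 4) ≤ α ^ 2 := by
      calc h * (LG + 4) ≤ α * α := Nat.mul_le_mul (by omega) hLα
        _ = _ := by ring
    have r6 : (LG + 4) * (n * S + 1) ≤ α ^ 4 * (W + 2) := by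
      calc (LG + 4) * (n * S + 1) ≤ α * (a ^ 2 * (W + 2)) := Nat.mul_le_mul hLα hq
        _ ≤ α * (α ^ 2 * (W + 2)) := by gcongr
        _ = α ^ 3 * (W + 2) := by ring
        _ ≤ _ := Nat.mul_le_mul_right _ p3
    have r7 : 8 * (8 * τ * (LG + 4)) * (h * (LG + 4)) =
        8 * ((8 * τ * (LG + 4)) * (h * (LG + 4))) := by ring
    have r8 : 4 * (8 * τ * (LG + 4)) = 32 * (τ * (LG + 4)) := by ring
    have r9 : 8 * (LG + 4) * (n * S + 1) = 8 * ((LG + 4) * (n * S + 1)) := by ring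
    unfold runBound
    rw [r7, r8, r9]
    omega
  have hcap' : ∀ τ ≤ α, 4 * (8 * τ * (LG + 4)) * (h * (LG + 4)) ≤ α ^ 4 * a ^ 3 := by
    intro τ hτ
    have := hcap τ hτ
    rw [mul_assoc 4]; omega
  refine ⟨⟨?_, hrun T hTle, hrun _ (by omega), ?_, ?_, ?_, ?_,
    (hq.trans_lt ?_), ?_⟩, ?_⟩
  · rw [haeq]; omega
  · rw [e2]; exact (hkey T hTle).trans (by omega)
  · rw [e2]; exact hcap' T hTle
  · rw [e2]; exact (hkey (n + 1) (by omega)).trans (by omega)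
  · rw [e2]; exact hcap' _ (by omega)
  · rwa [e3] at hq2
  · have : T * LG ≤ α * α := Nat.mul_le_mul hTle (by omega)
    have : α * α = α ^ 2 := by ring
    omega
  · have : (n + 1) * S ≤ α ^ 4 * W := by
      calc (n + 1) * S ≤ a * (a * W) :=
            Nat.mul_le_mul (by omega) (hS.trans (Nat.mul_le_mul_right _ (by omega)))
        _ ≤ α * (α * W) := by gcongr
        _ = α ^ 2 * W := by ring
        _ ≤ _ := Nat.mul_le_mul_right _ p2
    omega

theorem phases_le (lam q : ℕ) (hl : 1 ≤ lam) : 8 * lam * q + 2 ≤ 10 * lam * (q + 1) := by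
  have : 10 * lam * (q + 1) = 8 * lam * q + (2 * lam * q + 10 * lam) := by ring
  omega

theorem lam_le {c LG : ℕ} : (4 * c + 15) * LG + 1 ≤ (4 * c + 15) * (LG + 4) := by
  rw [mul_add]; omega

theorem depth_le {c LG q h : ℕ} (h1 : 1 ≤ h) :
    70 * (LG + 1) + 2 * runDepth (LG + 4) q ((4 * c + 15) * LG) h + 5 ≤
      (3400 * (4 * c + 15) ^ 3 + 75) * ((LG + 4) ^ 5 * (q + 1) * h) := by
  set u := LG + 4 with hu
  have e1 : runDepth u q ((4 * c + 15) * LG) h ≤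
      1700 * (4 * c + 15) ^ 3 * (u ^ 5 * (q + 1) * h) := by
    calc runDepth u q ((4 * c + 15) * LG) h ≤
        (10 * u * (q + 1)) * (170 * ((4 * c + 15) * u) ^ 3 * (h * u)) := by
          unfold runDepth
          exact Nat.mul_le_mul (phases_le _ _ (by omega)) (Nat.mul_le_mul_right _
            (Nat.mul_le_mul_left _ (Nat.pow_le_pow_left lam_le _)))
      _ = _ := by ring
  have e2 : u ≤ u ^ 5 * (q + 1) * h := by
    calc u ≤ u ^ 5 := Nat.le_self_pow (by omega) _
      _ ≤ u ^ 5 * (q + 1) := Nat.le_mul_of_pos_right _ (by omega)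
      _ ≤ _ := Nat.le_mul_of_pos_right _ h1
  have e3 : (3400 * (4 * c + 15) ^ 3 + 75) * (u ^ 5 * (q + 1) * h) =
      2 * (1700 * (4 * c + 15) ^ 3 * (u ^ 5 * (q + 1) * h)) + 75 * (u ^ 5 * (q + 1) * h) := by ring
  omega

theorem extra_le {c LG q n m h : ℕ} (h1 : 1 ≤ h) (hhn : h ≤ n) (hm : m ≤ n * n) :
    n + 3 + runWork (LG + 4) q ((4 * c + 15) * LG) n m h (n + 1) ≤
      (44800 * (4 * c + 15) ^ 3 + 4) * ((LG + 4) ^ 5 * (q + 1) * n ^ 3) := by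
  set u := LG + 4 with hu
  have hn : n ≤ n * n := Nat.le_mul_of_pos_left _ (by omega)
  have hn3 : n ≤ n ^ 3 := Nat.le_self_pow (by omega) _
  have e0 : (n + 1) * (n + m) + (n + 1) * (n + 1) * (n + 1) + h * u * (n + m) ≤
      14 * u * n ^ 3 := by
    have f1 : (n + 1) * (n + m) ≤ (2 * n) * (2 * (n * n)) := Nat.mul_le_mul (by omega) (by omega)
    have f2 : (n + 1) * (n + 1) * (n + 1) ≤ (2 * n) * (2 * n) * (2 * n) :=
      Nat.mul_le_mul (Nat.mul_le_mul (by omega) (by omega)) (by omega)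
    have f3 : h * u * (n + m) ≤ n * u * (2 * (n * n)) :=
      Nat.mul_le_mul (Nat.mul_le_mul_right _ hhn) (by omega)
    have f4 : (2 * n) * (2 * (n * n)) + (2 * n) * (2 * n) * (2 * n) = 12 * n ^ 3 := by ring
    have f5 : n * u * (2 * (n * n)) = 2 * (u * n ^ 3) := by ring
    have f6 : n ^ 3 ≤ u * n ^ 3 := Nat.le_mul_of_pos_left _ (by omega)
    rw [mul_assoc 14]
    omega
  have e1 : runWork u q ((4 * c + 15) * LG) n m h (n + 1) ≤
      44800 * (4 * c + 15) ^ 3 * (u ^ 5 * (q + 1) * n ^ 3) := by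
    calc runWork u q ((4 * c + 15) * LG) n m h (n + 1) ≤
        (10 * u * (q + 1)) * (320 * ((4 * c + 15) * u) ^ 3 * (14 * u * n ^ 3)) := by
          unfold runWork
          exact Nat.mul_le_mul (phases_le _ _ (by omega)) (Nat.mul_le_mul
            (Nat.mul_le_mul_left _ (Nat.pow_le_pow_left lam_le _)) e0)
      _ = _ := by ring
  have e2 : n ^ 3 ≤ u ^ 5 * (q + 1) * n ^ 3 := Nat.le_mul_of_pos_left _ (by positivity)
  have e3 : (44800 * (4 * c + 15) ^ 3 + 4) * (u ^ 5 * (q + 1) * n ^ 3) =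
      44800 * (4 * c + 15) ^ 3 * (u ^ 5 * (q + 1) * n ^ 3) + 4 * (u ^ 5 * (q + 1) * n ^ 3) := by
    ring
  omega

/-- The main term of the work. -/
noncomputable def mainTerm (n m h : ℕ) : ℝ := (n : ℝ) ^ 3 / (h : ℝ) ^ 3 + m * h + m * n / h

-- With `r = n / h` the main term is `r³ + m h + m r`, and `T` is at most `r` up to a logarithm. So
-- `T³`, `T (n + m)` and `h (n + m)` match its three summands, where `n ≤ m + 1` removes `n` in
-- favour of `m` and the remainders are absorbed by `r ≤ r³`.
set_option maxHeartbeats 1000000 in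
theorem good_le {c LG q n m h T : ℕ} (h1 : 1 ≤ h) (hhn : h ≤ n) (hnm : n ≤ m + 1)
    (hT : T = c * n * LG / h + 2) :
    (goodWork n m h LG T q ((4 * c + 15) * LG) : ℝ) ≤
      (9600 * (4 * c + 15) ^ 3 * (c + 2) ^ 3 + 11 * (c + 3) + 125) *
        ((LG + 4 : ℕ) ^ 7 * (q + 1) * mainTerm n m h) := by
  have hh : (1 : ℝ) ≤ h := by exact_mod_cast h1
  have hhn' : (h : ℝ) ≤ n := by exact_mod_cast hhn
  have hnm' : (n : ℝ) ≤ m + 1 := by exact_mod_cast hnm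
  have hm0 : (0 : ℝ) ≤ m := Nat.cast_nonneg _
  have hc0 : (0 : ℝ) ≤ c := Nat.cast_nonneg _
  set r : ℝ := n / h with hr
  have hr1 : 1 ≤ r := by rw [hr, le_div_iff₀ (by linarith)]; linarith
  have hr3 : r ≤ r ^ 3 := le_self_pow₀ hr1 (by norm_num)
  set Z := mainTerm n m h with hZdef
  have hZ : Z = r ^ 3 + m * h + m * r := by
    rw [hZdef, mainTerm, hr, div_pow, mul_div_assoc]
  have hmh : (m : ℝ) ≤ m * h := le_mul_of_one_le_right hm0 hh
  have hmr : 0 ≤ (m : ℝ) * r := by positivity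
  have hrZ : r ≤ Z := by rw [hZ]; linarith
  have hZ1 : 1 ≤ Z := by linarith
  have hnZ : (n : ℝ) + m + 1 ≤ 2 * Z := by rw [hZ]; linarith
  have hhZ : (h : ℝ) ≤ m * h + r ^ 3 := by
    rcases Nat.eq_zero_or_pos m with rfl | hm
    · have : h ≤ 1 := by omega
      have : (h : ℝ) ≤ 1 := by exact_mod_cast this
      simp; linarith
    · have : (1 : ℝ) ≤ m := by exact_mod_cast hm
      nlinarith
  set u : ℝ := ((LG + 4 : ℕ) : ℝ) with hu
  have hLGu : (LG : ℝ) + 4 = u := by rw [hu]; push_cast; ring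
  have hu4 : 4 ≤ u := by have := Nat.cast_nonneg (α := ℝ) LG; linarith
  have hTr : (T : ℝ) ≤ (c + 2) * u * r := by
    have e1 : ((c * n * LG / h : ℕ) : ℝ) ≤ c * n * LG / h := by
      have := Nat.cast_div_le (α := ℝ) (m := c * n * LG) (n := h)
      push_cast at this; exact this
    have e2 : (c : ℝ) * n * LG / h = c * LG * r := by rw [hr]; ring
    have e3 : (c : ℝ) * LG * r ≤ c * u * r := by gcongr; linarith
    have e4 : (2 : ℝ) ≤ 2 * u * r := by nlinarith
    rw [hT]; push_cast
    linarith
  have hT0 : (0 : ℝ) ≤ T := Nat.cast_nonneg _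
  have hsum : (T : ℝ) * (n + m) + T * T * T + h * u * (n + m) ≤ 3 * (c + 2) ^ 3 * u ^ 3 * Z := by
    have hc2 : 2 * ((c : ℝ) + 2) ≤ (c + 2) ^ 3 := by nlinarith [sq_nonneg (c : ℝ), pow_nonneg hc0 3]
    have hc3 : (3 : ℝ) ≤ (c + 2) ^ 3 := by linarith
    have f0 : u ≤ u ^ 3 := le_self_pow₀ (by linarith) (by norm_num)
    have f1 : (T : ℝ) * (n + m) ≤ (c + 2) ^ 3 * u ^ 3 * Z := by
      calc (T : ℝ) * (n + m) ≤ ((c + 2) * u * r) * (2 * m + 1) := by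
            exact mul_le_mul hTr (by linarith) (by positivity) (by positivity)
        _ = (c + 2) * u * (2 * (m * r) + r) := by ring
        _ ≤ (c + 2) * u * (2 * Z) := by
            gcongr; linarith [mul_nonneg hm0 (show (0 : ℝ) ≤ h by linarith)]
        _ = (2 * (c + 2)) * u * Z := by ring
        _ ≤ (c + 2) ^ 3 * u ^ 3 * Z := by
            exact mul_le_mul_of_nonneg_right (mul_le_mul hc2 f0 (by linarith) (by positivity)) (by linarith)
    have f2 : (T : ℝ) * T * T ≤ (c + 2) ^ 3 * u ^ 3 * Z := by
      calc (T : ℝ) * T * T = T ^ 3 := by ring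
        _ ≤ ((c + 2) * u * r) ^ 3 := by gcongr
        _ = (c + 2) ^ 3 * u ^ 3 * r ^ 3 := by ring
        _ ≤ _ := by
            gcongr; have : 0 ≤ (m : ℝ) * h := by positivity
            linarith
    have f3 : (h : ℝ) * u * (n + m) ≤ (c + 2) ^ 3 * u ^ 3 * Z := by
      calc (h : ℝ) * u * (n + m) ≤ h * u * (2 * m + 1) :=
            mul_le_mul_of_nonneg_left (by linarith) (by positivity)
        _ = u * (2 * (m * h) + h) := by ring
        _ ≤ u * (3 * Z) := by gcongr; linarith [pow_nonneg (show 0 ≤ r by linarith) 3]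
        _ = 3 * u * Z := by ring
        _ ≤ _ := by exact mul_le_mul_of_nonneg_right (mul_le_mul hc3 f0 (by linarith) (by positivity)) (by linarith)
    linarith
  have hrun : (runWork (LG + 4) q ((4 * c + 15) * LG) n m h T : ℝ) ≤
      9600 * (4 * c + 15) ^ 3 * (c + 2) ^ 3 * (u ^ 7 * (q + 1) * Z) := by
    have g1 : ((8 * (LG + 4) * q + 2 : ℕ) : ℝ) ≤ 10 * u * (q + 1) := by
      have := phases_le (LG + 4) q (by omega)
      rw [hu]; exact_mod_cast this
    have g2 : (((4 * c + 15) * LG + 1 : ℕ) : ℝ) ≤ (4 * c + 15) * u := by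
      have := lam_le (c := c) (LG := LG)
      rw [hu]; exact_mod_cast this
    have g3 : (runWork (LG + 4) q ((4 * c + 15) * LG) n m h T : ℝ) =
        ((8 * (LG + 4) * q + 2 : ℕ) : ℝ) * (320 * (((4 * c + 15) * LG + 1 : ℕ) : ℝ) ^ 3 *
          (T * (n + m) + T * T * T + h * u * (n + m))) := by
      rw [runWork, hu]; push_cast; ring
    rw [g3]
    calc _ ≤ (10 * u * (q + 1)) * (320 * ((4 * c + 15) * u) ^ 3 *
          (3 * (c + 2) ^ 3 * u ^ 3 * Z)) := by gcongr
      _ = _ := by ring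
  have hu7 : u ^ 2 ≤ u ^ 7 * (q + 1) := by
    have e1 : u ^ 2 ≤ u ^ 7 := pow_le_pow_right₀ (by linarith) (by norm_num)
    have e2 : u ^ 7 ≤ u ^ 7 * (q + 1) := le_mul_of_one_le_right (by positivity) (by
      have := Nat.cast_nonneg (α := ℝ) q; linarith)
    linarith
  have hsmall : 60 * ((LG : ℝ) + 1) * (n + m + 1) + T * LG + 10 * (LG + 1) * (T + 1) + n + 3 ≤
      (11 * (c + 3) + 125) * (u ^ 2 * Z) := by
    have hLG0 := Nat.cast_nonneg (α := ℝ) LG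
    have huu : u ≤ u ^ 2 := le_self_pow₀ (by linarith) (by norm_num)
    have f1 : 60 * ((LG : ℝ) + 1) * (n + m + 1) ≤ 120 * (u ^ 2 * Z) := by
      calc 60 * ((LG : ℝ) + 1) * (n + m + 1) ≤ 60 * u ^ 2 * (2 * Z) := by gcongr; linarith
        _ = _ := by ring
    have hTZ : (T : ℝ) ≤ (c + 2) * u * Z := hTr.trans (by gcongr)
    have f2 : (T : ℝ) * LG ≤ (c + 2) * (u ^ 2 * Z) := by
      calc (T : ℝ) * LG ≤ ((c + 2) * u * Z) * u := by gcongr; linarith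
        _ = _ := by ring
    have f3 : 10 * ((LG : ℝ) + 1) * (T + 1) ≤ 10 * (c + 3) * (u ^ 2 * Z) := by
      calc 10 * ((LG : ℝ) + 1) * (T + 1) ≤ 10 * u * ((c + 2) * u * Z + u * Z) := by
            gcongr
            · linarith
            · linarith [one_le_mul_of_one_le_of_one_le (show 1 ≤ u by linarith) hZ1]
        _ = _ := by ring
    have f4 : (n : ℝ) + 3 ≤ 5 * (u ^ 2 * Z) := by
      have : Z ≤ u ^ 2 * Z := le_mul_of_one_le_left (by linarith) (by nlinarith)
      linarith
    linarith [mul_nonneg (sq_nonneg u) (show 0 ≤ Z by linarith)]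
  have hgw : (goodWork n m h LG T q ((4 * c + 15) * LG) : ℝ) =
      (60 * ((LG : ℝ) + 1) * (n + m + 1) + T * LG + 10 * (LG + 1) * (T + 1) + n + 3) +
        runWork (LG + 4) q ((4 * c + 15) * LG) n m h T := by
    rw [goodWork]; push_cast; ring
  rw [hgw]
  have hs2 : (11 * ((c : ℝ) + 3) + 125) * (u ^ 2 * Z) ≤
      (11 * (c + 3) + 125) * (u ^ 7 * (q + 1) * Z) := by gcongr
  linarith

/-- Logarithmic bounds. -/
theorem log_bounds {n m W LG : ℕ} (hn : 1 ≤ n) (hm : m ≤ n * n)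
    (hLG : LG = Nat.clog 2 (n + m + 2)) :
    1 ≤ Real.log (n + 2) ∧ ((LG + 4 : ℕ) : ℝ) ≤ 8 * Real.log (n + 2) ∧
      ((2 * LG + Nat.log 2 (W + 2) + 1 : ℕ) : ℝ) + 1 ≤
        22 * (Real.log (n + 2) * Real.log (W + 2)) := by
  have hnR : (1 : ℝ) ≤ n := by exact_mod_cast hn
  set l := Real.log ((n : ℝ) + 2) with hl
  have hl1 : 1 ≤ l := by
    rw [hl, Real.le_log_iff_exp_le (by linarith)]
    have := Real.exp_one_lt_d9
    linarith
  have h2 := Real.log_two_gt_d9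
  have hLGl : (LG : ℝ) ≤ 1 + 3 * l := by
    have e1 : 2 ^ (LG - 1) ≤ (n + 2) ^ 2 := by
      have := Nat.pow_pred_clog_lt_self (b := 2) (by omega) (x := n + m + 2) (by omega)
      rw [← hLG] at this
      calc 2 ^ (LG - 1) ≤ n + m + 2 := this.le
        _ ≤ _ := by nlinarith
    have e2 : ((2 : ℝ)) ^ (LG - 1) ≤ ((n : ℝ) + 2) ^ 2 := by exact_mod_cast e1
    have e3 := Real.log_le_log (by positivity) e2
    rw [Real.log_pow, Real.log_pow, ← hl] at e3
    have e4 : (LG : ℝ) ≤ ((LG - 1 : ℕ) : ℝ) + 1 := by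
      exact_mod_cast (show LG ≤ LG - 1 + 1 by omega)
    push_cast at e3
    have e5 := Nat.cast_nonneg (α := ℝ) (LG - 1)
    nlinarith
  have hw2 : (1 / 2 : ℝ) ≤ Real.log (W + 2) := by
    have : Real.log 2 ≤ Real.log ((W : ℝ) + 2) :=
      Real.log_le_log (by norm_num) (by have := Nat.cast_nonneg (α := ℝ) W; linarith)
    linarith
  have hWl : (Nat.log 2 (W + 2) : ℝ) ≤ 3 / 2 * Real.log (W + 2) := by
    have e1 : 2 ^ Nat.log 2 (W + 2) ≤ W + 2 := Nat.pow_log_le_self 2 (by omega)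
    have e2 : (2 : ℝ) ^ Nat.log 2 (W + 2) ≤ W + 2 := by exact_mod_cast e1
    have e3 := Real.log_le_log (by positivity) e2
    rw [Real.log_pow] at e3
    have e5 := Nat.cast_nonneg (α := ℝ) (Nat.log 2 (W + 2))
    nlinarith
  refine ⟨hl1, by push_cast; linarith, ?_⟩
  -- The left side is at most `10 l + (3/2) l'` with `l = log (n + 2) ≥ 1` and `l' = log (W + 2) ≥
  -- 1/2`, which turns the sum into a product with factor below `22`.
  push_cast
  nlinarith

theorem log_pow_bound {n W a : ℕ} (hn : 1 ≤ n) (hW : W ≤ n ^ a) :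
    Real.log (W + 2) ≤ (a + 1) * Real.log (n + 2) := by
  have h1 : W + 2 ≤ (n + 2) ^ (a + 1) := by
    have e1 : n ^ a ≤ (n + 2) ^ a := Nat.pow_le_pow_left (by omega) _
    have e2 : 1 ≤ (n + 2) ^ a := Nat.one_le_pow _ _ (by omega)
    rw [pow_succ]
    nlinarith
  have h2 : (W : ℝ) + 2 ≤ ((n : ℝ) + 2) ^ (a + 1) := by exact_mod_cast h1
  have h3 := Real.log_le_log (by positivity) h2
  rw [Real.log_pow] at h3
  push_cast at h3
  exact h3


variable {n m : ℕ}

/-! ### The input -/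

theorem inputMem_add_four (G : WDigraph n m) (s : Fin n) (h x : ℕ) :
    inputMem G s h (x + 4) = if hx : x / 3 < m then
      match x % 3 with
      | 0 => (G.edge ⟨x / 3, hx⟩).1
      | 1 => (G.edge ⟨x / 3, hx⟩).2
      | _ => G.weight ⟨x / 3, hx⟩
    else 0 := rfl

theorem tl_inputMem (G : WDigraph n m) (s : Fin n) (h : ℕ) (j : Fin m) :
    tl (inputMem G s h) j = (G.edge j).1 := by
  have e : 4 + 3 * (j : ℕ) = 3 * j + 4 := by omega
  have e1 : 3 * (j : ℕ) / 3 = j := by omega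
  have e2 : 3 * (j : ℕ) % 3 = 0 := by omega
  simp [tl, e, inputMem_add_four, e1, e2]

theorem hd_inputMem (G : WDigraph n m) (s : Fin n) (h : ℕ) (j : Fin m) :
    hd (inputMem G s h) j = (G.edge j).2 := by
  have e : 5 + 3 * (j : ℕ) = 3 * j + 1 + 4 := by omega
  have e1 : (3 * (j : ℕ) + 1) / 3 = j := by omega
  have e2 : (3 * (j : ℕ) + 1) % 3 = 1 := by omega
  simp [hd, e, inputMem_add_four, e1, e2]

theorem wt_inputMem (G : WDigraph n m) (s : Fin n) (h : ℕ) (j : Fin m) :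
    wt (inputMem G s h) j = G.weight j := by
  have e : 6 + 3 * (j : ℕ) = 3 * j + 2 + 4 := by omega
  have e1 : (3 * (j : ℕ) + 2) / 3 = j := by omega
  have e2 : (3 * (j : ℕ) + 2) % 3 = 2 := by omega
  simp [wt, e, inputMem_add_four, e1, e2]

theorem inputOk_inputMem (G : WDigraph n m) (s : Fin n) (h : ℕ) :
    InputOk (inputMem G s h) n m h where
  n_eq := rfl
  m_eq := rfl
  h_eq := rfl
  tail_lt j hj := (tl_inputMem G s h ⟨j, hj⟩).trans_lt (Fin.isLt _)
  head_lt j hj := (hd_inputMem G s h ⟨j, hj⟩).trans_lt (Fin.isLt _)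

theorem inputMem_eq_zero (G : WDigraph n m) (s : Fin n) (h : ℕ) {x : ℕ} (hx : 4 + 3 * m ≤ x) :
    inputMem G s h x = 0 := by
  obtain ⟨y, rfl⟩ : ∃ y, x = y + 4 := ⟨x - 4, by omega⟩
  rw [inputMem_add_four, dif_neg (by omega)]

theorem inputMem_le (G : WDigraph n m) (s : Fin n) {h B : ℕ} (hh : h ≤ n) (hB : n + m ≤ B)
    (hW : ∀ j, G.weight j ≤ B) (x : ℕ) : inputMem G s h x ≤ B := by
  match x with
  | 0 => change n ≤ B; omega
  | 1 => change m ≤ B; omega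
  | 2 => change (s : ℕ) ≤ B; have := s.isLt; omega
  | 3 => change h ≤ B; omega
  | x + 4 =>
    rw [inputMem_add_four]
    split_ifs with hx
    · have h1 := (G.edge ⟨x / 3, hx⟩).1.isLt
      have h2 := (G.edge ⟨x / 3, hx⟩).2.isLt
      have h3 := hW ⟨x / 3, hx⟩
      split <;> omega
    · omega

/-! ### Distances -/

theorem exists_edgeWalk_of_isWalkWeight (G : WDigraph n m) (s : Fin n) (h : ℕ) {u v : Fin n}
    {l : ℕ} (hw : G.IsWalkWeight u v l) :
    ∃ k, EdgeWalk (tl (inputMem G s h)) (hd (inputMem G s h)) m (wt (inputMem G s h)) u k l v := by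
  induction hw with
  | nil u => exact ⟨0, .nil⟩
  | @cons j v l _ ih =>
    obtain ⟨k, hk⟩ := ih
    have e := (EdgeWalk.nil (tail := tl (inputMem G s h)) (head := hd (inputMem G s h)) (m := m)
      (wt := wt (inputMem G s h)) (u := tl (inputMem G s h) j)).snoc j j.isLt
    rw [tl_inputMem, hd_inputMem, wt_inputMem] at e
    have := e.append hk
    rw [zero_add (G.weight j)] at this
    exact ⟨_, this⟩

theorem _root_.WDigraph.IsWalkWeight.snoc {G : WDigraph n m} {u v : Fin n} {l : ℕ}
    (hw : G.IsWalkWeight u v l) (j : Fin m) (hv : v = (G.edge j).1) :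
    G.IsWalkWeight u (G.edge j).2 (l + G.weight j) := by
  induction hw with
  | nil u =>
    subst hv
    have := WDigraph.IsWalkWeight.cons (G := G) j (.nil _)
    rwa [add_comm] at this
  | cons i _ ih =>
    rw [add_assoc]
    exact .cons i (ih hv)

theorem isWalkWeight_of_edgeWalk (G : WDigraph n m) (s : Fin n) (h : ℕ) {u : Fin n} {k l v : ℕ}
    (hw : EdgeWalk (tl (inputMem G s h)) (hd (inputMem G s h)) m (wt (inputMem G s h)) u k l v) :
    ∀ v' : Fin n, (v' : ℕ) = v → G.IsWalkWeight u v' l := by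
  induction hw with
  | nil =>
    intro v' hv
    rw [Fin.ext hv]; exact .nil _
  | snoc j hj _ ih =>
    intro v' hv
    have h1 := hd_inputMem G s h ⟨j, hj⟩
    have h2 := wt_inputMem G s h ⟨j, hj⟩
    have h3 := (ih _ (tl_inputMem G s h ⟨j, hj⟩).symm).snoc ⟨j, hj⟩ rfl
    rw [Fin.ext (hv.trans h1), show wt (inputMem G s h) j = _ from h2]
    exact h3

theorem decodeDist_eq_dist (G : WDigraph n m) (s : Fin n) (h : ℕ) {pot x : ℕ → ℕ}
    (hE : ExactAt (inputMem G s h) n m s pot x) (v : Fin n) :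
    decodeDist ((pot v + 1) * if x v = 0 then 1 else 0) = G.dist s v := by
  obtain ⟨h0, h1⟩ := hE v v.isLt
  by_cases hx : x v = 0
  · obtain ⟨⟨k, hk⟩, hmin⟩ := h0 hx
    rw [if_pos hx, mul_one]
    refine le_antisymm (le_iInf₂ fun l hl => ?_)
      (iInf₂_le (pot v) (isWalkWeight_of_edgeWalk G s h hk v rfl))
    obtain ⟨k', hk'⟩ := exists_edgeWalk_of_isWalkWeight G s h hl
    exact Nat.cast_le.mpr (hmin _ _ hk')
  · rw [if_neg hx, mul_zero]
    refine (top_le_iff.mp (le_iInf₂ fun l hl => ?_)).symm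
    obtain ⟨k', hk'⟩ := exists_edgeWalk_of_isWalkWeight G s h hl
    exact absurd hk' (h1 hx _ _)

theorem _root_.WDigraph.card_edges_le (G : WDigraph n m) : m ≤ n * n := by
  simpa using Fintype.card_le_of_injective _ G.edge_injective

/-! ### Word size and expectation -/

/-- Edges are distinct pairs, so `n + m + 2 ≤ b²` for `b = n + W + 2`, and rounding up to a power of
two stays below `b⁴`. Hence all values are bounded by a fixed power of `b`. -/
theorem word_size {n m W w d e : ℕ} (hm : m ≤ n * n)
    (hw : (((4 * e + 1) * d) + 1) * Nat.clog 2 (n + W + 2) ≤ w) :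
    (2 ^ (Nat.clog 2 (n + m + 2) * e) * (W + 2)) ^ d < 2 ^ w := by
  set b := n + W + 2 with hb
  have h1 : 2 ^ Nat.clog 2 (n + m + 2) ≤ b ^ 4 := by
    have e1 := Nat.pow_pred_clog_lt_self (b := 2) (by omega) (x := n + m + 2) (by omega)
    have e2 : 0 < Nat.clog 2 (n + m + 2) := Nat.clog_pos (by omega) (by omega)
    obtain ⟨L, hL⟩ := Nat.exists_eq_succ_of_ne_zero e2.ne'
    rw [hL, Nat.pred_succ] at e1
    rw [hL, pow_succ]
    have e3 : n + m + 2 ≤ b * b := by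
      calc n + m + 2 ≤ (n + 2) * (n + 2) := by nlinarith
        _ ≤ _ := Nat.mul_le_mul (by omega) (by omega)
    have e4 : 2 ≤ b * b := by nlinarith
    calc 2 ^ L * 2 ≤ (b * b) * (b * b) := Nat.mul_le_mul (e1.le.trans e3) e4
      _ = b ^ 4 := by ring
  have h2 : 2 ^ (Nat.clog 2 (n + m + 2) * e) * (W + 2) ≤ b ^ (4 * e + 1) := by
    rw [pow_mul, pow_succ, pow_mul]
    exact Nat.mul_le_mul (Nat.pow_le_pow_left h1 _) (by omega)
  calc (2 ^ (Nat.clog 2 (n + m + 2) * e) * (W + 2)) ^ d ≤ (b ^ (4 * e + 1)) ^ d :=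
        Nat.pow_le_pow_left h2 _
    _ = b ^ ((4 * e + 1) * d) := (pow_mul ..).symm
    _ < b ^ ((4 * e + 1) * d + 1) := Nat.pow_lt_pow_right (by omega) (by omega)
    _ ≤ (2 ^ Nat.clog 2 b) ^ ((4 * e + 1) * d + 1) :=
        Nat.pow_le_pow_left (Nat.le_pow_clog (by omega) _) _
    _ = 2 ^ (((4 * e + 1) * d + 1) * Nat.clog 2 b) := by rw [← pow_mul, mul_comm]
    _ ≤ 2 ^ w := Nat.pow_le_pow_right (by omega) hw

/-- Neither the work nor the bad set is assumed measurable; only upper bounds for the lower integral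
are used, so no measurability is needed. -/
theorem lintegral_le_of_bad {work : Coins → ℕ} {bad : Set Coins} {a b : ℕ} {p : ℝ} (hp0 : 0 ≤ p)
    (hp : coinMeasure bad ≤ ENNReal.ofReal p) (hab : ∀ ω, work ω ≤ a + b)
    (ha : ∀ ω, ω ∉ bad → work ω ≤ a) :
    ∫⁻ ω, (work ω : ENNReal) ∂coinMeasure ≤ ENNReal.ofReal (a + b * p) := by
  calc ∫⁻ ω, (work ω : ENNReal) ∂coinMeasure
      ≤ ∫⁻ ω, ((a : ENNReal) + bad.indicator (fun _ => (b : ENNReal)) ω) ∂coinMeasure := by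
        refine lintegral_mono fun ω => ?_
        by_cases hω : ω ∈ bad
        · rw [Set.indicator_of_mem hω]; rw [← Nat.cast_add]; exact Nat.cast_le.mpr (hab ω)
        · rw [Set.indicator_of_notMem hω, add_zero]; exact Nat.cast_le.mpr (ha ω hω)
    _ = a + ∫⁻ ω, bad.indicator (fun _ => (b : ENNReal)) ω ∂coinMeasure := by
        rw [lintegral_add_left measurable_const, lintegral_const, measure_univ, mul_one]
    _ ≤ a + b * ENNReal.ofReal p := by
        gcongr
        exact (lintegral_indicator_const_le _ _).trans (by gcongr)
    _ = ENNReal.ofReal (a + b * p) := by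
        rw [ENNReal.ofReal_add (by positivity) (by positivity), ENNReal.ofReal_mul (by positivity),
          ENNReal.ofReal_natCast, ENNReal.ofReal_natCast]

/-- Constants in the bounds on the work and the depth. -/
def goodConst (c : ℕ) : ℕ := 9600 * (4 * c + 15) ^ 3 * (c + 2) ^ 3 + 11 * (c + 3) + 125
def extraConst (c : ℕ) : ℕ := 44800 * (4 * c + 15) ^ 3 + 4
def depthConst (c : ℕ) : ℕ := 3400 * (4 * c + 15) ^ 3 + 75

theorem one_le_mainTerm {n m h : ℕ} (h1 : 1 ≤ h) (hhn : h ≤ n) : 1 ≤ mainTerm n m h := by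
  have hh : (1 : ℝ) ≤ h := by exact_mod_cast h1
  have hhn' : (h : ℝ) ≤ n := by exact_mod_cast hhn
  have e1 : (1 : ℝ) ≤ (n : ℝ) ^ 3 / (h : ℝ) ^ 3 := by
    rw [one_le_div (by positivity)]; gcongr
  have e2 : (0 : ℝ) ≤ m * h := by positivity
  have e3 : (0 : ℝ) ≤ m * n / h := by positivity
  rw [mainTerm]; linarith

/-- The guarantees for a single input, before numerical simplification. -/
theorem exists_run {c n m W w h : ℕ} (G : WDigraph n m) (s : Fin n) (hnm : n ≤ m + 1)
    (hGW : ∀ j, G.weight j ≤ W) (h1 : 1 ≤ h) (hhn : h ≤ n) {cc : ℕ} (hcc : cc = 2 * c + 4)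
    (hw : (((4 * (4 * cc + 20) + 1) * (ssspP cc).deg) + 1) * Nat.clog 2 (n + W + 2) ≤ w)
    {X : ℝ} (hX : X = 8 ^ 7 * 22 * Real.log (n + 2) ^ 8) :
    ∃ (out : Coins → Mem) (work depth : Coins → ℕ) (bad : Set Coins) (a b : ℕ),
      (∀ ω, Exec w ω (ssspP cc) 0 (inputMem G s h) (out ω) (work ω) (depth ω)) ∧
      (∀ ω (v : Fin n), decodeDist (out ω v) = G.dist s v) ∧
      (∀ ω, (depth ω : ℝ) ≤
        (ssspP cc).cst * depthConst cc * (X * Real.log (W + 2) * h)) ∧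
      coinMeasure bad ≤ ENNReal.ofReal (1 / (n : ℝ) ^ c) ∧
      (∀ ω, work ω ≤ a + b) ∧ (∀ ω, ω ∉ bad → work ω ≤ a) ∧
      (a : ℝ) ≤ (ssspP cc).cst * goodConst cc * (X * Real.log (W + 2) * mainTerm n m h) ∧
      (b : ℝ) ≤ (ssspP cc).cst * extraConst cc * (X * Real.log (W + 2) * n ^ 3) := by
  set I := inputMem G s h with hI
  set LG := Nat.clog 2 (n + m + 2) with hLG
  set T := cc * n * LG / h + 2 with hT
  have hm := G.card_edges_le
  have hn1 : 1 ≤ n := h1.trans hhn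
  have hwt : ∀ j < m, wt I j ≤ W := fun j hj => (wt_inputMem G s h ⟨j, hj⟩).trans_le (hGW _)
  have hS : ∑ j ∈ Finset.range m, wt I j ≤ m * W := by
    simpa using Finset.sum_le_card_nsmul (Finset.range m) _ W fun j hj =>
      hwt j (Finset.mem_range.mp hj)
  have hLG2 : n + m + 2 ≤ 2 ^ LG := Nat.le_pow_clog (by omega) _
  obtain ⟨hN, hB⟩ := numeric_of_le (c := cc) hLG2 h1 hhn hS hT
  have hB2 : W + 2 ≤ 2 ^ (LG * (4 * cc + 20)) * (W + 2) :=
    Nat.le_mul_of_pos_left _ (by positivity)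
  have hok := inputOk_inputMem G s h
  have hws : (2 ^ (LG * (4 * cc + 20)) * (W + 2)) ^ (ssspP cc).deg < 2 ^ w := word_size hm hw
  obtain ⟨t₀, ht⟩ := ssspP_exec (c := cc) (I := I) hok rfl s.isLt h1 hhn
    (fun x hx => inputMem_eq_zero G s h hx)
    (inputMem_le G s hhn (by omega) fun j => (hGW j).trans (by omega)) (by omega)
    hws hLG hT hwt hN hB
  choose M k d hexec hdist hk hgood hdep using ht
  obtain ⟨hl1, hu, hq⟩ := log_bounds (W := W) hn1 hm hLG
  set q := 2 * LG + Nat.log 2 (W + 2) + 1 with hqdef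
  set l := Real.log ((n : ℝ) + 2) with hl
  set l' := Real.log ((W : ℝ) + 2) with hl'
  set u : ℝ := ((LG + 4 : ℕ) : ℝ) with hudef
  have hu1 : 1 ≤ u := by
    have : 1 ≤ LG + 4 := by omega
    rw [hudef]; exact_mod_cast this
  -- Seven logarithms come from `lam`, `Λ` and `T`; the eighth from the number of phases, whose
  -- other factor is `log (W + 2)`.
  have hY7 : u ^ 7 * ((q : ℝ) + 1) ≤ X * l' := by
    calc u ^ 7 * ((q : ℝ) + 1) ≤ (8 * l) ^ 7 * (22 * (l * l')) := by gcongr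
      _ = X * l' := by rw [hX]; ring
  have hY5 : u ^ 5 * ((q : ℝ) + 1) ≤ X * l' := by
    refine le_trans ?_ hY7
    gcongr
    norm_num
  have hZ1 := one_le_mainTerm (m := m) h1 hhn
  refine ⟨M, k, d, {ω | ¬ GoodHubs (tl I) (hd I) m (wt I)
    (hubOf n s LG fun r => (ω (t₀, r)).toNat) T h},
    (ssspP cc).cst * goodWork n m h LG T q ((4 * cc + 15) * LG),
    (ssspP cc).cst * (n + 3 + runWork (LG + 4) q ((4 * cc + 15) * LG) n m h (n + 1)),
    hexec, fun ω v => ?_, fun ω => ?_, ?_, fun ω => ?_, fun ω hω => hgood ω (not_not.mp hω), ?_, ?_⟩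
  · obtain ⟨pot, x, hE, hM⟩ := hdist ω
    rw [hM v v.isLt]
    exact decodeDist_eq_dist G s h hE v
  · have e1 : d ω ≤ (ssspP cc).cst * (depthConst cc * ((LG + 4) ^ 5 * (q + 1) * h)) :=
      (hdep ω).trans (Nat.mul_le_mul_left _ (depth_le h1))
    have e2 : (d ω : ℝ) ≤ (ssspP cc).cst * (depthConst cc * (u ^ 5 * (q + 1) * h)) := by
      rw [hudef]; exact_mod_cast e1
    refine e2.trans ?_
    rw [mul_assoc ((ssspP cc).cst : ℝ)]
    have e3 := mul_le_mul_of_nonneg_right hY5 (Nat.cast_nonneg (α := ℝ) h)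
    exact mul_le_mul_of_nonneg_left (mul_le_mul_of_nonneg_left e3 (Nat.cast_nonneg _))
      (Nat.cast_nonneg _)
  · exact coinMeasure_not_goodHubs hok.tail_lt hok.head_lt h1 hhn (by omega) (by rw [hT, hcc])
  · rw [← mul_add]; exact hk ω
  · have e := good_le (c := cc) (q := q) (LG := LG) h1 hhn hnm hT
    have e0 : (9600 * (4 * cc + 15) ^ 3 * (cc + 2) ^ 3 + 11 * (cc + 3) + 125 : ℝ) =
      goodConst cc := by rw [goodConst]; push_cast; ring
    rw [e0] at e
    rw [Nat.cast_mul, mul_assoc]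
    refine mul_le_mul_of_nonneg_left (e.trans ?_) (Nat.cast_nonneg _)
    gcongr
  · have e := extra_le (c := cc) (LG := LG) (q := q) h1 hhn hm
    have e2 : ((n + 3 + runWork (LG + 4) q ((4 * cc + 15) * LG) n m h (n + 1) : ℕ) : ℝ) ≤
        extraConst cc * (u ^ 5 * (q + 1) * n ^ 3) := by
      rw [hudef, extraConst]; exact_mod_cast e
    rw [Nat.cast_mul, mul_assoc]
    refine mul_le_mul_of_nonneg_left (e2.trans ?_) (Nat.cast_nonneg _)
    gcongr

end PRAM

theorem mainTheorem5 (c : ℕ) :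
    ∃ (P : PRAM.Prog) (K k : ℕ) (C : ℝ) (C' : ℕ → ℝ),
      ∀ (n m W w h : ℕ) (G : WDigraph n m) (s : Fin n),
        n ≤ m + 1 → (∀ j, G.weight j ≤ W) → 1 ≤ h → h ≤ n →
        K * Nat.clog 2 (n + W + 2) ≤ w →
        ∃ (out : PRAM.Coins → PRAM.Mem) (work depth : PRAM.Coins → ℕ),
          -- for every outcome of the coins, the program halts with the exact distances
          (∀ ω, PRAM.Exec w ω P 0 (PRAM.inputMem G s h) (out ω) (work ω) (depth ω)) ∧
          (∀ ω (v : Fin n), PRAM.decodeDist (out ω v) = G.dist s v) ∧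
          -- depth: `Õ(h)` if `W` is polynomial in `n`, and `Õ(h log W)` in general
          (∀ a : ℕ, W ≤ n ^ a → ∀ ω, (depth ω : ℝ) ≤ C' a * Real.log (n + 2) ^ k * h) ∧
          (∀ ω, (depth ω : ℝ) ≤ C * Real.log (n + 2) ^ k * h * Real.log (W + 2)) ∧
          -- work, with high probability and in expectation
          PRAM.coinMeasure {ω | C * Real.log (n + 2) ^ k *
              (((n : ℝ) ^ 3 / (h : ℝ) ^ 3 + m * h + m * n / h) * Real.log (W + 2)) < work ω}
            ≤ ENNReal.ofReal (1 / (n : ℝ) ^ c) ∧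
          ∫⁻ ω, (work ω : ENNReal) ∂PRAM.coinMeasure
            ≤ ENNReal.ofReal (C * Real.log (n + 2) ^ k *
              (((n : ℝ) ^ 3 / (h : ℝ) ^ 3 + m * h + m * n / h) * Real.log (W + 2))) := by
  -- Failure probability `n ^ -(c + 3)` rather than `n ^ -c`: the repeated run costs about `n³ log
  -- W`, and the three extra powers make its contribution to the expected work negligible.
  set cc := 2 * (c + 3) + 4 with hcc
  obtain ⟨χ, hχ⟩ : ∃ χ : ℝ, χ = ((PRAM.ssspP cc).cst : ℝ) := ⟨_, rfl⟩
  obtain ⟨g, hg⟩ : ∃ g : ℝ, g = (PRAM.goodConst cc : ℝ) := ⟨_, rfl⟩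
  obtain ⟨e, he⟩ : ∃ e : ℝ, e = (PRAM.extraConst cc : ℝ) := ⟨_, rfl⟩
  obtain ⟨d, hd⟩ : ∃ d : ℝ, d = (PRAM.depthConst cc : ℝ) := ⟨_, rfl⟩
  obtain ⟨D, hD⟩ : ∃ D : ℝ, D = g + e + d := ⟨_, rfl⟩
  obtain ⟨C, hC⟩ : ∃ C : ℝ, C = χ * D * (8 ^ 7 * 22) := ⟨_, rfl⟩
  refine ⟨PRAM.ssspP cc, ((4 * (4 * cc + 20) + 1) * (PRAM.ssspP cc).deg) + 1, 9, C,
    fun a => C * (a + 1), ?_⟩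
  intro n m W w h G s hnm hGW h1 hhn hw
  obtain ⟨out, work, depth, bad, a, b, hexec, hout, hdepth, hbad, hab, ha, haC, hbC⟩ :=
    PRAM.exists_run G s hnm hGW h1 hhn hcc hw rfl
  have hn1 : 1 ≤ n := h1.trans hhn
  have hnR : (1 : ℝ) ≤ n := by exact_mod_cast hn1
  have hl1 := (PRAM.log_bounds (W := W) hn1 G.card_edges_le rfl).1
  have hl' : 0 ≤ Real.log ((W : ℝ) + 2) :=
    Real.log_nonneg (by have := Nat.cast_nonneg (α := ℝ) W; linarith)
  have hZ1 := PRAM.one_le_mainTerm (m := m) h1 hhn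
  rw [← hχ, ← hg] at haC
  rw [← hχ, ← he] at hbC
  simp only [← hχ, ← hd] at hdepth
  have hχ0 : 0 ≤ χ := hχ ▸ Nat.cast_nonneg _
  have hg0 : 0 ≤ g := hg ▸ Nat.cast_nonneg _
  have he0 : 0 ≤ e := he ▸ Nat.cast_nonneg _
  have hd0 : 0 ≤ d := hd ▸ Nat.cast_nonneg _
  have hD0 : 0 ≤ D := by rw [hD]; positivity
  have hC0 : 0 ≤ C := by rw [hC]; positivity
  set l := Real.log ((n : ℝ) + 2)
  set l' := Real.log ((W : ℝ) + 2)
  obtain ⟨X, hX⟩ : ∃ X : ℝ, X = 8 ^ 7 * 22 * l ^ 8 := ⟨_, rfl⟩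
  rw [← hX] at haC hbC
  simp only [← hX] at hdepth
  have hX0 : 0 ≤ X := by rw [hX]; positivity
  have hl89 : l ^ 8 ≤ l ^ 9 := pow_le_pow_right₀ hl1 (by norm_num)
  have hdepth' : ∀ ω, (depth ω : ℝ) ≤ χ * D * (X * l' * h) := fun ω => by
    refine (hdepth ω).trans ?_
    gcongr
    linarith
  have hwork : ∀ Y : ℝ, Y ≤ χ * D * (X * l' * PRAM.mainTerm n m h) →
      Y ≤ C * l ^ 9 * (PRAM.mainTerm n m h * l') := fun Y hY => by
    refine hY.trans ?_
    calc χ * D * (X * l' * PRAM.mainTerm n m h) = C * l ^ 8 * (PRAM.mainTerm n m h * l') := by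
          rw [hX, hC]; ring
      _ ≤ _ := by gcongr
  have hprob : 1 / (n : ℝ) ^ (c + 3) ≤ 1 / (n : ℝ) ^ c :=
    one_div_le_one_div_of_le (by positivity) (pow_le_pow_right₀ hnR (by omega))
  refine ⟨out, work, depth, hexec, hout, fun p hp ω => ?_, fun ω => ?_, ?_, ?_⟩
  · have hlp := PRAM.log_pow_bound hn1 hp
    refine (hdepth' ω).trans ?_
    calc χ * D * (X * l' * h) ≤ χ * D * (X * ((p + 1) * l) * h) := by gcongr
      _ = C * (p + 1) * l ^ 9 * h := by rw [hX, hC]; ring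
  · refine (hdepth' ω).trans ?_
    calc χ * D * (X * l' * h) = C * l ^ 8 * h * l' := by rw [hX, hC]; ring
      _ ≤ _ := by gcongr
  · refine ((measure_mono fun ω hω => ?_).trans hbad).trans (ENNReal.ofReal_le_ofReal hprob)
    by_contra hgood
    refine absurd (hwork (work ω) ?_) (not_le.mpr hω)
    calc (work ω : ℝ) ≤ a := by exact_mod_cast ha ω hgood
      _ ≤ _ := haC
      _ ≤ _ := by gcongr; linarith
  · refine (PRAM.lintegral_le_of_bad (by positivity) hbad hab ha).trans
      (ENNReal.ofReal_le_ofReal (hwork _ ?_))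
    have hb1 : (b : ℝ) * (1 / (n : ℝ) ^ (c + 3)) ≤
        χ * e * (X * l' * PRAM.mainTerm n m h) := by
      rw [mul_one_div, div_le_iff₀ (by positivity)]
      refine hbC.trans ?_
      have e1 : (n : ℝ) ^ 3 ≤ n ^ (c + 3) := pow_le_pow_right₀ hnR (by omega)
      have e2 : (n : ℝ) ^ (c + 3) ≤ PRAM.mainTerm n m h * n ^ (c + 3) :=
        le_mul_of_one_le_left (by positivity) hZ1
      calc χ * e * (X * l' * n ^ 3) ≤
          χ * e * (X * l' * (PRAM.mainTerm n m h * n ^ (c + 3))) := by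
            gcongr; exact e1.trans e2
        _ = _ := by ring
    have hsum : χ * g * (X * l' * PRAM.mainTerm n m h) +
        χ * e * (X * l' * PRAM.mainTerm n m h) ≤
          χ * D * (X * l' * PRAM.mainTerm n m h) := by
      rw [← add_mul, ← mul_add]
      gcongr
      linarith
    linarith
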